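/- **Setting.** Let $\Omega\subset\mathbb R^2$ be open and bounded with Lipschitz boundary, and let $\partial_D\Omega\subseteq\partial\Omega$ be regular in the sense of Gröger, i.e. with $G=\Omega\cup(\partial\Omega\setminus\partial_D\Omega)$, every $y\in\partial\Omega$ has an open neighbourhood $U$ and a bi-Lipschitz map $\Phi$ from $U$ onto an open set such that $\Phi(U\cap G)$ is one of $\{|x|<1,\,x_2<0\}$, $\{|x|<1,\,x_2\le 0\}$, $\{|x|<1,\,x_2\le 0,\ (x_2<0 \text{ or } x_1>0)\}$. Assume that the closure of every connected component of $\Omega$ meets $\partial_D\Omega$ (for connected $\Omega\neq\emptyset$: $\partial_D\Omega\ne\emptyset$). For $u\in H^1(\Omega;\mathbb R^2)$ and $b\in W^{1,p}(\Omega;\mathbb R^2)$, $p\ge2$, "$u=b$ on $\partial_D\Omega$" means that $u-b$ lies in the $H^1$-closure of the restrictions to $\Omega$ of functions in $C_c^\infty(\mathbb R^2;\mathbb R^2)$ whose support is disjoint from $\partial_D\Omega$. Let $\mu,\kappa>0$. Let $h\in C^{1,1}_{loc}(\mathbb R)$ be convex with $h(s)\ge h(0)>0$ for all $s$, and let $f\in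 C^{1,1}_{loc}(\mathbb R)$ be strongly convex with $0\le f(1)\le f(s)$ for all $s$. For a $2\times2$ matrix $\mathbf F$ put $\mathbf F_v=\frac12(\operatorname{tr}\mathbf F)\mathbf I$, $\mathbf F_d=\mathbf F-\mathbf F_v$, $\mathbf F_v^\pm=\frac12(\operatorname{tr}\mathbf F)_\pm\mathbf I$, let $|\cdot|$ be the Frobenius norm, and set $\varepsilon(u)=\frac12(\nabla u+\nabla u^T)$ and $$W(z,\mathbf F)=h(z)\big(\mu|\mathbf F_d|^2+\kappa|\mathbf F_v^+|^2\big)+\kappa|\mathbf F_v^-|^2,\qquad \mathcal F(u,z)=\tfrac12\int_\Omega W(z,\varepsilon(u))\,dx+\tfrac12\int_\Omega|\nabla z|^2+f(z)\,dx\in[0,\infty]$$ for $u\in H^1(\Omega;\mathbb R^2)$ and $z\in H^1(\Omega)$. Let $T>0$, $p\in(2,\infty)$ and $g\in H^1([0,T];W^{1,p}(\Omega;\mathbb R^2))$ (continuous representative). Fix $\delta>0$, $k\in\mathbb N$ with $k\geq 1$, and $i\in\{1,\dots,k\}$; put $\tau_k=T/k$ and $t^k_i=i\tau_k$. Let $u^k_{i-1}\in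 H^1(\Omega;\mathbb R^2)$ and $z^k_{i-1}\in H^1(\Omega;[0,1])$ be given, let $u^k_{i,0}=u^k_{i-1}$, $z^k_{i,0}=z^k_{i-1}$, and for every $j\ge1$ let $$u^k_{i,j}\in\operatorname{argmin}\{\mathcal F(u,z^k_{i,j-1}):u\in H^1(\Omega;\mathbb R^2),\ u=g(t^k_i)\text{ on }\partial_D\Omega\},$$ $$z^k_{i,j}\in\operatorname{argmin}\Big\{\mathcal F(u^k_{i,j},z)+\tfrac{\delta}{2\tau_k}\|z-z^k_{i-1}\|_{L^2}^2:z\in H^1(\Omega),\ z\le z^k_{i-1}\text{ a.e. in }\Omega\Big\}.$$ **Proposition.** There exist $\bar u\in H^1(\Omega;\mathbb R^2)$, $\bar z\in H^1(\Omega;[0,1])$ and a strictly increasing sequence $(j_l)$ such that $u^k_{i,j_l}\to\bar u$ strongly in $H^1(\Omega;\mathbb R^2)$ and $z^k_{i,j_l}\rightharpoonup\bar z$ weakly in $H^1(\Omega)$ as $l\to\infty$, $\bar u=g(t^k_i)$ on $\partial_D\Omega$, and $\bar u$ and $\bar z$ are the unique solutions of the two partial minimization problems: $$\operatorname{argmin}\{\mathcal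 F(u,\bar z):u\in H^1(\Omega;\mathbb R^2),\ u=g(t^k_i)\text{ on }\partial_D\Omega\}=\{\bar u\},$$ $$\operatorname{argmin}\Big\{\mathcal F(\bar u,z)+\tfrac{\delta}{2\tau_k}\|z-z^k_{i-1}\|_{L^2}^2:z\in H^1(\Omega),\ z\le z^k_{i-1}\text{ a.e. in }\Omega\Big\}=\{\bar z\}.$$ -/

import Mathlib

open MeasureTheory Filter Topology
open scoped ENNReal NNReal ContDiff

noncomputable section

namespace PhaseField

/-- The Euclidean plane. -/
abbrev R2 : Type := EuclideanSpace ℝ (Fin 2)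

/-! ### Lipschitz domains and Dirichlet parts regular in the sense of Gröger -/

/-- `Ω` has Lipschitz boundary: near each boundary point, after a linear isometry of the plane,
`Ω` is the region strictly above the graph of a Lipschitz function. -/
def HasLipschitzBoundary (Ω : Set R2) : Prop :=
  ∀ y ∈ frontier Ω, ∃ (A : R2 ≃ₗᵢ[ℝ] R2) (γ : ℝ → ℝ) (K : ℝ≥0) (r : ℝ), 0 < r ∧
    LipschitzWith K γ ∧ ∀ x ∈ Metric.ball y r, (x ∈ Ω ↔ γ (A x 0) < A x 1)

/-- The open half disc. -/
def halfDisc₁ : Set R2 := {x | ‖x‖ < 1 ∧ x 1 < 0}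

/-- The half disc together with its flat side. -/
def halfDisc₂ : Set R2 := {x | ‖x‖ < 1 ∧ x 1 ≤ 0}

/-- The half disc together with one half of its flat side. -/
def halfDisc₃ : Set R2 := {x | x ∈ halfDisc₂ ∧ (x 1 < 0 ∨ 0 < x 0)}

/-- `D ⊆ ∂Ω` is regular in the sense of Gröger: with `G = Ω ∪ (∂Ω \ D)`, every boundary point
has an open neighbourhood `U` and a bi-Lipschitz map `Φ` from `U` onto an open set
that carries `U ∩ G` onto one of the three model half discs. -/
def IsGroegerRegular (Ω D : Set R2) : Prop :=
  ∀ y ∈ frontier Ω, ∃ (U : Set R2) (Φ : R2 → R2) (K K' : ℝ≥0), IsOpen U ∧ y ∈ U ∧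
    LipschitzOnWith K Φ U ∧ AntilipschitzWith K' (U.domRestrict Φ) ∧ IsOpen (Φ '' U) ∧
    (Φ '' (U ∩ (Ω ∪ (frontier Ω \ D))) = halfDisc₁ ∨
      Φ '' (U ∩ (Ω ∪ (frontier Ω \ D))) = halfDisc₂ ∨
      Φ '' (U ∩ (Ω ∪ (frontier Ω \ D))) = halfDisc₃)

/-! ### Sobolev spaces -/

/-- `φ ∈ C_c^∞(Ω)`. -/
def IsTest (Ω : Set R2) (φ : R2 → ℝ) : Prop :=
  ContDiff ℝ ∞ φ ∧ HasCompactSupport φ ∧ tsupport φ ⊆ Ω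

section Sobolev

variable {E : Type*} [NormedAddCommGroup E] [NormedSpace ℝ E]

/-- `G` is the weak partial derivative of `v` in direction `j` on `Ω`. -/
def IsWeakPartial (Ω : Set R2) (j : Fin 2) (v G : R2 → E) : Prop :=
  ∀ φ : R2 → ℝ, IsTest Ω φ →
    ∫ x in Ω, (fderiv ℝ φ x (EuclideanSpace.single j 1)) • v x = - ∫ x in Ω, φ x • G x

theorem integrable_smul_of_memLp {Ω : Set R2} {p : ℝ≥0∞} [hp : Fact (1 ≤ p)] {φ : R2 → ℝ}
    (hφ : Continuous φ) (hc : HasCompactSupport φ) (v : Lp E p (volume.restrict Ω)) :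
    Integrable (fun x => φ x • v x) (volume.restrict Ω) :=
  ((Lp.memLp v).locallyIntegrable hp.out).integrable_smul_left_of_hasCompactSupport hφ hc

variable (E) in
/-- The Sobolev space `W^{1,p}(Ω; E)` with norm `(‖v‖_p^p + ∑ⱼ ‖∂ⱼ v‖_p^p)^{1/p}`. An element is
a function `v` (component `none`) together with its weak partial derivatives `∂ⱼ v`
(components `some j`), all of class `L^p`. -/
def Sobolev (Ω : Set R2) (p : ℝ≥0∞) [Fact (1 ≤ p)] :
    Submodule ℝ (PiLp p fun _ : Option (Fin 2) => Lp E p (volume.restrict Ω)) where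
  carrier := {w | ∀ j, IsWeakPartial Ω j (w none) (w (some j))}
  zero_mem' := by
    intro j φ _
    have h0 : ∀ᵐ x ∂(volume.restrict Ω), (0 : Lp E p (volume.restrict Ω)) x = 0 :=
      Lp.coeFn_zero E p _
    rw [PiLp.zero_apply, PiLp.zero_apply,
      integral_congr_ae (g := fun _ => (0 : E)) (by filter_upwards [h0] with x hx; simp only [hx, smul_zero]),
      integral_congr_ae (f := fun x => φ x • _) (g := fun _ => (0 : E))
        (by filter_upwards [h0] with x hx; simp only [hx, smul_zero])]
    simp
  add_mem' := by
    intro a b ha hb j φ hφ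
    have hφ' : Continuous fun x => fderiv ℝ φ x (EuclideanSpace.single j 1) :=
      (hφ.1.continuous_fderiv (by simp)).clm_apply continuous_const
    have hc' : HasCompactSupport fun x => fderiv ℝ φ x (EuclideanSpace.single j 1) :=
      hφ.2.1.fderiv_apply ℝ _
    have h1 := Lp.coeFn_add (a none) (b none)
    have h2 := Lp.coeFn_add (a (some j)) (b (some j))
    rw [PiLp.add_apply, PiLp.add_apply,
      integral_congr_ae (g := fun x => fderiv ℝ φ x (EuclideanSpace.single j 1) • a none x +
        fderiv ℝ φ x (EuclideanSpace.single j 1) • b none x)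
        (by filter_upwards [h1] with x hx; simp only [hx, Pi.add_apply, smul_add]),
      integral_congr_ae (f := fun x => φ x • _)
        (g := fun x => φ x • a (some j) x + φ x • b (some j) x)
        (by filter_upwards [h2] with x hx; simp only [hx, Pi.add_apply, smul_add]),
      integral_add (integrable_smul_of_memLp hφ' hc' _) (integrable_smul_of_memLp hφ' hc' _),
      integral_add (integrable_smul_of_memLp hφ.1.continuous hφ.2.1 _)
        (integrable_smul_of_memLp hφ.1.continuous hφ.2.1 _),
      ha j φ hφ, hb j φ hφ]
    abel
  smul_mem' := by
    intro c a ha j φ hφ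
    have h1 := Lp.coeFn_smul c (a none)
    have h2 := Lp.coeFn_smul c (a (some j))
    rw [PiLp.smul_apply, PiLp.smul_apply,
      integral_congr_ae
        (g := fun x => c • (fderiv ℝ φ x (EuclideanSpace.single j 1) • a none x))
        (by filter_upwards [h1] with x hx; simp only [hx, Pi.smul_apply, smul_comm c]),
      integral_congr_ae (f := fun x => φ x • _) (g := fun x => c • (φ x • a (some j) x))
        (by filter_upwards [h2] with x hx; simp only [hx, Pi.smul_apply, smul_comm c]),
      integral_smul, integral_smul, ha j φ hφ, smul_neg]

variable {Ω : Set R2} {p : ℝ≥0∞} [Fact (1 ≤ p)]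

/-- The underlying `L^p` function of a Sobolev function. -/
def toLp (w : Sobolev E Ω p) : Lp E p (volume.restrict Ω) := w.1 none

/-- The `j`-th weak partial derivative of a Sobolev function. -/
def pd (j : Fin 2) (w : Sobolev E Ω p) : Lp E p (volume.restrict Ω) := w.1 (some j)

end Sobolev

/-- `H¹(Ω)`. -/
abbrev H1 (Ω : Set R2) := Sobolev ℝ Ω 2

/-- `H¹(Ω; ℝ²)`. -/
abbrev H1v (Ω : Set R2) := Sobolev R2 Ω 2

/-- The functions in `H¹(Ω; ℝ²)` that vanish on `D`: the closure in `H¹` of the restrictions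
to `Ω` of the functions in `C_c^∞(ℝ²; ℝ²)` whose support does not meet `D`. -/
def H1vZero (Ω D : Set R2) : Set (H1v Ω) :=
  closure {w | ∃ φ : R2 → R2, ContDiff ℝ ∞ φ ∧ HasCompactSupport φ ∧ Disjoint (tsupport φ) D ∧
    ∀ᵐ x ∂(volume.restrict Ω), toLp w x = φ x}

/-- `u = b` on `D`, for `u ∈ H¹(Ω; ℝ²)` and `b ∈ W^{1,p}(Ω; ℝ²)`: the difference `u - b`
belongs to the space of `H¹` functions vanishing on `D`. -/
def EqOnBdry {Ω : Set R2} {p : ℝ≥0∞} [Fact (1 ≤ p)] (D : Set R2) (u : H1v Ω)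
    (b : Sobolev R2 Ω p) : Prop :=
  ∃ w ∈ H1vZero Ω D, ∀ᵐ x ∂(volume.restrict Ω), toLp u x - toLp b x = toLp w x

/-- `g ∈ H¹([0,T]; X)`, through the continuous representative: `g` is the primitive of a
function in `L²(0,T; X)`. -/
def IsH1InTime {X : Type*} [NormedAddCommGroup X] [NormedSpace ℝ X] (T : ℝ) (g : ℝ → X) : Prop :=
  ∃ g' : ℝ → X, MemLp g' 2 (volume.restrict (Set.Ioo 0 T)) ∧
    ∀ t ∈ Set.Icc 0 T, g t = g 0 + ∫ s in (0 : ℝ)..t, g' s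

/-! ### The energy -/

/-- `f ∈ C^{1,1}_loc(ℝ)`. -/
def IsC11Loc (f : ℝ → ℝ) : Prop := ContDiff ℝ 1 f ∧ LocallyLipschitz (deriv f)

/-- Squared Frobenius norm. -/
def frobSq (F : Matrix (Fin 2) (Fin 2) ℝ) : ℝ := ∑ a, ∑ b, F a b ^ 2

/-- Volumetric part `½ (tr F) I`. -/
def volPart (F : Matrix (Fin 2) (Fin 2) ℝ) : Matrix (Fin 2) (Fin 2) ℝ := (F.trace / 2) • 1

/-- Deviatoric part `F - F_v`. -/
def devPart (F : Matrix (Fin 2) (Fin 2) ℝ) : Matrix (Fin 2) (Fin 2) ℝ := F - volPart F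

/-- `½ (tr F)₊ I`. -/
def volPos (F : Matrix (Fin 2) (Fin 2) ℝ) : Matrix (Fin 2) (Fin 2) ℝ := (max F.trace 0 / 2) • 1

/-- `½ (tr F)₋ I`. -/
def volNeg (F : Matrix (Fin 2) (Fin 2) ℝ) : Matrix (Fin 2) (Fin 2) ℝ := (max (-F.trace) 0 / 2) • 1

/-- The elastic energy density
`W(z, F) = h(z) (μ |F_d|² + κ |F_v⁺|²) + κ |F_v⁻|²`. -/
def density (h : ℝ → ℝ) (μ κ : ℝ) (z : ℝ) (F : Matrix (Fin 2) (Fin 2) ℝ) : ℝ :=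
  h z * (μ * frobSq (devPart F) + κ * frobSq (volPos F)) + κ * frobSq (volNeg F)

/-- The strain `½ (∇u + ∇uᵀ)`, where `(∇u)_{ab} = ∂_b u_a`. -/
def strain {Ω : Set R2} (u : H1v Ω) (x : R2) : Matrix (Fin 2) (Fin 2) ℝ :=
  Matrix.of fun a b => (pd b u x a + pd a u x b) / 2

/-- Elastic energy `½ ∫_Ω W(z, ε(u))`. The integrand is nonnegative, so that the energy is
defined, with values in `[0, ∞]`, for every `z ∈ H¹(Ω)`. -/
def elastic {Ω : Set R2} (h : ℝ → ℝ) (μ κ : ℝ) (u : H1v Ω) (z : H1 Ω) : ℝ≥0∞ :=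
  (1 / 2) * ∫⁻ x in Ω, ENNReal.ofReal (density h μ κ (toLp z x) (strain u x))

/-- Dissipation potential `½ ∫_Ω |∇z|² + f(z)`, with values in `[0, ∞]`. -/
def dissipation {Ω : Set R2} (f : ℝ → ℝ) (z : H1 Ω) : ℝ≥0∞ :=
  (1 / 2) * ∫⁻ x in Ω, ENNReal.ofReal ((∑ j, pd j z x ^ 2) + f (toLp z x))

/-- Total energy `F(u, z)`. -/
def energy {Ω : Set R2} (h f : ℝ → ℝ) (μ κ : ℝ) (u : H1v Ω) (z : H1 Ω) : ℝ≥0∞ :=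
  elastic h μ κ u z + dissipation f z

/-- The set of minimizers of `J` over `S`. -/
def argmin {X : Type*} (J : X → ℝ≥0∞) (S : Set X) : Set X := {x | x ∈ S ∧ ∀ y ∈ S, J x ≤ J y}

/-- The solutions of the displacement step: minimizers of `F(·, z)` among the `u ∈ H¹(Ω; ℝ²)`
with `u = b` on `D`. -/
def argminU {Ω : Set R2} {p : ℝ≥0∞} [Fact (1 ≤ p)] (D : Set R2) (h f : ℝ → ℝ) (μ κ : ℝ)
    (b : Sobolev R2 Ω p) (z : H1 Ω) : Set (H1v Ω) :=
  argmin (fun u => energy h f μ κ u z) {u | EqOnBdry D u b}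

/-- The solutions of the phase-field step: minimizers of `F(u, ·) + δ/(2τ) ‖· - z₀‖₂²` among the
`z ∈ H¹(Ω)` with `z ≤ z₀` a.e. in `Ω`. -/
def argminZ {Ω : Set R2} (h f : ℝ → ℝ) (μ κ δ τ : ℝ) (z₀ : H1 Ω) (u : H1v Ω) : Set (H1 Ω) :=
  argmin (fun z => energy h f μ κ u z + ENNReal.ofReal (δ / (2 * τ) * ‖toLp z - toLp z₀‖ ^ 2))
    {z | ∀ᵐ x ∂(volume.restrict Ω), toLp z x ≤ toLp z₀ x}

end PhaseField

end

namespace PhaseField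

open Metric ContinuousLinearMap

/-! ### Mollification -/

/-! The energy is not jointly convex, but it is strongly convex in each variable separately, and the
two convexities cooperate.

In the displacement, `h z ≥ h 0 > 0` makes the density uniformly convex in the strain
(`dens_lower`), and Korn's inequality on the fields vanishing on `D` (`exists_korn`) converts strain
into the full `H¹` norm. In the phase field, convexity of `h` and `f` together with the Dirichlet
energy and the viscous `L²` term gives strong convexity in `H¹` (`quadR_mid_le`).

The abstract scheme is `exists_limit_of_alternate_minimization`. The functional decreases along the
iteration and each phase step pays a multiple of the squared increment, so the increments of `z`
vanish. Bounds give weak limits along a subsequence. Since `z j` converges a.e. along a further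
subsequence, the weak limit of the displacements is a good competitor, and uniform convexity makes
the displacements converge strongly. Comparing two phase steps with each other then shows that the
phase fields are Cauchy, so they too converge strongly, which is more than the weak convergence
asked for. Both minimality properties pass to the limit, and strong convexity gives uniqueness.

Three analytic ingredients feed the scheme. Compactness: mollification gives a Rellich theorem on
compact subsets only, which already yields a.e. convergence on `Ω`
(`exists_subseq_ae_of_weakly_convergent`). Bounds on the phase field: a `C¹` truncation from below
does not increase the energy and strictly decreases the viscous term wherever `z < 0`
(`mem_Icc_of_mem_argminZ`), so one may work with values in `[-1, 1]`, where all energies are finite.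

Korn's inequality is the longest part. For a smooth planar field the only combination of first
derivatives not seen by the strain is the curl. A null Lagrangian identity shows that (div, curl)
differs from a weak solution `(a, b)` of the Cauchy-Riemann system by no more than the shear
(`exists_weakCR_approx`). As `(a + ib)²` is again holomorphic, testing with vector fields
transversal to the Lipschitz boundary bounds `b` by `a` and by `b` on a compact set
(`WeakCR.integral_sq_le`); there the curl is bounded by a cutoff argument. This is Korn's second
inequality with a compact remainder. The remainder is removed by contradiction, because a
strain-free field vanishing on `D` is zero (`eq_zero_of_strain_zero`): near a suitable point of `D`
its extension by zero is a rigid displacement that vanishes outside `Ω`, and this propagates through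
the component. -/

/-- A bump function at the origin supported in the closed ball of radius `1/(n+1)`. -/
noncomputable def bump (n : ℕ) : ContDiffBump (0 : R2) where
  rIn := 1 / (2 * (n + 1 : ℝ))
  rOut := 1 / (n + 1 : ℝ)
  rIn_pos := by positivity
  rIn_lt_rOut := by
    rw [div_lt_div_iff₀ (by positivity) (by positivity)]
    nlinarith [(Nat.cast_nonneg n : (0 : ℝ) ≤ n)]

/-- The mollification kernel. -/
noncomputable def kern (n : ℕ) : R2 → ℝ := (bump n).normed volume

theorem kern_contDiff (n : ℕ) : ContDiff ℝ ∞ (kern n) := (bump n).contDiff_normed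

theorem kern_hasCompactSupport (n : ℕ) : HasCompactSupport (kern n) :=
  (bump n).hasCompactSupport_normed

theorem kern_nonneg (n : ℕ) (x : R2) : 0 ≤ kern n x := (bump n).nonneg_normed x

theorem tsupport_kern (n : ℕ) : tsupport (kern n) = closedBall 0 (1 / (n + 1 : ℝ)) :=
  (bump n).tsupport_normed_eq

theorem kern_eq_zero {n : ℕ} {x : R2} (h : 1 / (n + 1 : ℝ) < ‖x‖) : kern n x = 0 := by
  apply image_eq_zero_of_notMem_tsupport
  rw [tsupport_kern, mem_closedBall_zero_iff]
  exact not_le.2 h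

theorem integral_kern (n : ℕ) : ∫ x, kern n x = 1 := (bump n).integral_normed

theorem kern_continuous (n : ℕ) : Continuous (kern n) := (kern_contDiff n).continuous

theorem kern_integrable (n : ℕ) : Integrable (kern n) :=
  (kern_continuous n).integrable_of_hasCompactSupport (kern_hasCompactSupport n)

/-- The probability measure with the mollification kernel as density. -/
noncomputable def kernMeas (n : ℕ) : Measure R2 :=
  volume.withDensity fun y => ENNReal.ofReal (kern n y)

instance (n : ℕ) : IsProbabilityMeasure (kernMeas n) := by
  refine ⟨?_⟩
  rw [kernMeas, withDensity_apply _ MeasurableSet.univ, Measure.restrict_univ, ← ofReal_integral_eq_lintegral_ofReal (kern_integrable n)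
    (Eventually.of_forall (kern_nonneg n)), integral_kern, ENNReal.ofReal_one]

theorem kernMeas_ae (n : ℕ) : ∀ᵐ y ∂(kernMeas n), ‖y‖ ≤ 1 / (n + 1 : ℝ) := by
  rw [kernMeas, ae_withDensity_iff (kern_continuous n).measurable.ennreal_ofReal]
  refine Eventually.of_forall fun y hy => ?_
  by_contra h
  exact hy (by rw [kern_eq_zero (not_le.1 h), ENNReal.ofReal_zero])

theorem kernMeas_absolutelyContinuous (n : ℕ) : kernMeas n ≪ volume :=
  withDensity_absolutelyContinuous _ _

/-- The mollification of `v`. -/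
noncomputable def moll (n : ℕ) (v : R2 → ℝ) : R2 → ℝ :=
  convolution v (kern n) (ContinuousLinearMap.mul ℝ ℝ) volume

theorem moll_eq (n : ℕ) (v : R2 → ℝ) (x : R2) : moll n v x = ∫ y, v y * kern n (x - y) := rfl

/-- Reading the convolution as an average against a probability measure makes Jensen's inequality
and modulus-of-continuity estimates available. -/
theorem moll_eq_kernMeas (n : ℕ) (v : R2 → ℝ) (x : R2) :
    moll n v x = ∫ y, v (x - y) ∂(kernMeas n) := by
  rw [kernMeas, integral_withDensity_eq_integral_toReal_smul
    (kern_continuous n).measurable.ennreal_ofReal (Eventually.of_forall fun _ => ENNReal.ofReal_lt_top)]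
  rw [moll, convolution_eq_swap]
  refine integral_congr_ae (Eventually.of_forall fun y => ?_)
  simp [ENNReal.toReal_ofReal (kern_nonneg n y), mul_comm]

theorem moll_contDiff {v : R2 → ℝ} (hv : LocallyIntegrable v) (n : ℕ) :
    ContDiff ℝ ∞ (moll n v) :=
  (kern_hasCompactSupport n).contDiff_convolution_right (n := ⊤) _ hv (kern_contDiff n)

theorem moll_sub {v w : R2 → ℝ} (hv : LocallyIntegrable v) (hw : LocallyIntegrable w) (n : ℕ)
    (x : R2) : moll n (fun y => v y - w y) x = moll n v x - moll n w x := by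
  simp only [moll_eq]
  rw [← integral_sub]
  · simp only [sub_mul]
  · exact ((kern_hasCompactSupport n).convolutionExists_right (ContinuousLinearMap.mul ℝ ℝ) hv
      (kern_continuous n)) x
  · exact ((kern_hasCompactSupport n).convolutionExists_right (ContinuousLinearMap.mul ℝ ℝ) hw
      (kern_continuous n)) x

/-- The reflected and translated mollification kernel as a function of its centre. -/
noncomputable def kernAt (n : ℕ) (x : R2) : R2 → ℝ := fun y => kern n (x - y)

/-- Testing a weak equation with this function turns it into a pointwise equation for the mollified
functions, valid wherever the ball of the kernel's radius stays inside `Ω`. -/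
theorem kernAt_isTest {Ω : Set R2} {n : ℕ} {x : R2} (h : closedBall x (1 / (n + 1 : ℝ)) ⊆ Ω) :
    IsTest Ω (kernAt n x) := by
  have hs : tsupport (kernAt n x) ⊆ closedBall x (1 / (n + 1 : ℝ)) := by
    refine closure_minimal (fun y hy => ?_) isClosed_closedBall
    by_contra hc
    refine hy (kern_eq_zero ?_)
    rw [mem_closedBall, not_le, dist_comm, dist_eq_norm] at hc
    exact hc
  exact ⟨(kern_contDiff n).comp (contDiff_const.sub contDiff_id),
    HasCompactSupport.intro (isCompact_closedBall x _)
      fun y hy => image_eq_zero_of_notMem_tsupport fun h' => hy (hs h'), hs.trans h⟩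

theorem fderiv_kernAt (n : ℕ) (x y e : R2) :
    fderiv ℝ (kernAt n x) y e = - fderiv ℝ (kern n) (x - y) e := by
  have h1 : HasFDerivAt (fun y : R2 => x - y) (-(ContinuousLinearMap.id ℝ R2)) y := by
    simpa using (hasFDerivAt_id y).const_sub x
  have h2 := (((kern_contDiff n).differentiable (by simp)) (x - y)).hasFDerivAt.comp y h1
  have h3 : kernAt n x = kern n ∘ fun y => x - y := rfl
  rw [h3, h2.fderiv]
  simp

theorem fderiv_moll {v : R2 → ℝ} (hv : LocallyIntegrable v) (n : ℕ) (x e : R2) :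
    fderiv ℝ (moll n v) x e = - ∫ y, fderiv ℝ (kernAt n x) y e * v y := by
  have h1 := (kern_hasCompactSupport n).hasFDerivAt_convolution_right
    (ContinuousLinearMap.mul ℝ ℝ) hv ((kern_contDiff n).of_le (by simp)) x
  have h2 : fderiv ℝ (moll n v) x = _ := h1.fderiv
  rw [h2, convolution_precompR_apply _ hv ((kern_hasCompactSupport n).fderiv ℝ)
    ((kern_contDiff n).continuous_fderiv (by simp)), ← integral_neg]
  refine integral_congr_ae (Eventually.of_forall fun y => ?_)
  simp only [fderiv_kernAt, ContinuousLinearMap.mul_apply']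
  ring

/-- Jensen for the square: Hölder against the constant 1, which has norm 1 for a probability
measure. -/
theorem sq_lintegral_le {α : Type*} [MeasurableSpace α] (ν : Measure α) [IsProbabilityMeasure ν]
    {F : α → ℝ≥0∞} (hF : AEMeasurable F ν) : (∫⁻ y, F y ∂ν) ^ 2 ≤ ∫⁻ y, F y ^ 2 ∂ν := by
  have h := ENNReal.lintegral_mul_le_Lp_mul_Lq ν (Real.HolderConjugate.two_two) hF
    (aemeasurable_const (b := (1 : ℝ≥0∞)))
  simp only [Pi.mul_apply, mul_one, ENNReal.one_rpow, lintegral_const, measure_univ,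
    ENNReal.rpow_ofNat, one_pow, ENNReal.one_rpow] at h
  calc (∫⁻ y, F y ∂ν) ^ 2 ≤ ((∫⁻ y, F y ^ 2 ∂ν) ^ (1 / 2 : ℝ)) ^ 2 := by gcongr
    _ = _ := by
      rw [← ENNReal.rpow_natCast, ← ENNReal.rpow_mul]
      norm_num

theorem enorm_integral_sq_le {α : Type*} [MeasurableSpace α] (ν : Measure α)
    [IsProbabilityMeasure ν] {F : α → ℝ} (hF : AEStronglyMeasurable F ν) :
    ‖∫ y, F y ∂ν‖ₑ ^ 2 ≤ ∫⁻ y, ‖F y‖ₑ ^ 2 ∂ν :=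
  (pow_le_pow_left' (enorm_integral_le_lintegral_enorm _) 2).trans
    (sq_lintegral_le ν hF.enorm)

theorem aestronglyMeasurable_sub_kernMeas {v : R2 → ℝ} (hv : AEStronglyMeasurable v) (n : ℕ)
    (x : R2) : AEStronglyMeasurable (fun y => v (x - y)) (kernMeas n) :=
  (hv.comp_quasiMeasurePreserving
    (quasiMeasurePreserving_sub_left_of_right_invariant volume x)).mono_ac
    (kernMeas_absolutelyContinuous n)

/-- Jensen at each point, then Tonelli and translation invariance of Lebesgue measure. -/
theorem lintegral_moll_sq_le {v : R2 → ℝ} (hv : AEStronglyMeasurable v) (n : ℕ) :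
    ∫⁻ x, ‖moll n v x‖ₑ ^ 2 ≤ ∫⁻ x, ‖v x‖ₑ ^ 2 := by
  calc ∫⁻ x, ‖moll n v x‖ₑ ^ 2 ≤ ∫⁻ x, ∫⁻ y, ‖v (x - y)‖ₑ ^ 2 ∂(kernMeas n) := by
        refine lintegral_mono fun x => ?_
        rw [moll_eq_kernMeas]
        exact enorm_integral_sq_le _ (aestronglyMeasurable_sub_kernMeas hv n x)
    _ = ∫⁻ y, (∫⁻ x, ‖v (x - y)‖ₑ ^ 2) ∂(kernMeas n) := by
        refine lintegral_lintegral_swap ?_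
        exact ((hv.comp_quasiMeasurePreserving
          (quasiMeasurePreserving_sub_of_right_invariant volume (kernMeas n))).enorm).pow_const 2
    _ = ∫⁻ y, (∫⁻ x, ‖v x‖ₑ ^ 2) ∂(kernMeas n) := by
        refine lintegral_congr fun y => ?_
        exact lintegral_sub_right_eq_self (fun x => ‖v x‖ₑ ^ 2) y
    _ = _ := by simp

theorem eLpNorm_two_sq {α : Type*} [MeasurableSpace α] {E : Type*} [NormedAddCommGroup E]
    (f : α → E) (ν : Measure α) : eLpNorm f 2 ν ^ 2 = ∫⁻ x, ‖f x‖ₑ ^ 2 ∂ν := by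
  rw [eLpNorm_eq_lintegral_rpow_enorm_toReal (by simp) (by simp)]
  rw [← ENNReal.rpow_natCast, ← ENNReal.rpow_mul]
  simp

theorem eLpNorm_moll_le {v : R2 → ℝ} (hv : AEStronglyMeasurable v) (n : ℕ) :
    eLpNorm (moll n v) 2 volume ≤ eLpNorm v 2 volume := by
  have h := lintegral_moll_sq_le hv n
  rw [← eLpNorm_two_sq, ← eLpNorm_two_sq] at h
  exact (ENNReal.pow_le_pow_left_iff (by norm_num)).1 h

theorem tendsto_one_div_nat : Tendsto (fun n : ℕ => 1 / (n + 1 : ℝ)) atTop (𝓝 0) :=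
  tendsto_one_div_add_atTop_nhds_zero_nat

theorem moll_sub_eq {v : R2 → ℝ} (hv : Continuous v) (n : ℕ) (x : R2) :
    moll n v x - v x = ∫ y, (v (x - y) - v x) ∂(kernMeas n) := by
  have hi : Integrable (fun y => v (x - y)) (kernMeas n) := by
    obtain ⟨C, hC⟩ := (isCompact_closedBall (0 : R2) (1 / (n + 1 : ℝ))).exists_bound_of_continuousOn
      (f := fun y => v (x - y)) (by fun_prop)
    refine Integrable.of_bound (by fun_prop) C ?_
    filter_upwards [kernMeas_ae n] with y hy
    exact hC y (by simpa using hy)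
  rw [integral_sub hi (integrable_const _), moll_eq_kernMeas]
  simp

theorem tendsto_eLpNorm_moll_sub_of_continuous {v : R2 → ℝ} (hv : Continuous v)
    (hc : HasCompactSupport v) :
    Tendsto (fun n => eLpNorm (fun x => moll n v x - v x) 2 volume) atTop (𝓝 0) := by
  have huc := hc.uniformContinuous_of_continuous hv
  rw [Metric.uniformContinuous_iff] at huc
  have key : ∀ ε > 0, ∀ᶠ n : ℕ in atTop, ∀ x, ‖moll n v x - v x‖ ≤ ε := by
    intro ε hε
    obtain ⟨d, hd, h⟩ := huc ε hε
    filter_upwards [tendsto_one_div_nat.eventually (gt_mem_nhds hd)] with n hn x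
    rw [moll_sub_eq hv]
    refine (norm_integral_le_of_norm_le_const (C := ε) ?_).trans (by simp)
    filter_upwards [kernMeas_ae n] with y hy
    rw [← dist_eq_norm]
    refine (h ?_).le
    simpa [dist_eq_norm] using hy.trans_lt hn
  -- All kernels have radius at most 1, so every error is supported in this compact set; uniform
  -- smallness on a set of finite measure then gives `L²` convergence.
  set S := cthickening 1 (tsupport v) with hS
  have hSc : IsCompact S := IsCompact.cthickening hc
  have hz : ∀ n x, x ∉ S → moll n v x - v x = 0 := by
    intro n x hx
    rw [moll_sub_eq hv]
    refine integral_eq_zero_of_ae ?_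
    filter_upwards [kernMeas_ae n] with y hy
    have h1 : ∀ w, dist x w ≤ 1 → v w = 0 := by
      intro w hw
      by_contra hne
      exact hx (mem_cthickening_of_dist_le x w 1 _ (subset_tsupport v hne) hw)
    have h2 : (1 : ℝ) / (n + 1) ≤ 1 := by
      rw [div_le_one (by positivity)]
      linarith [(Nat.cast_nonneg n : (0 : ℝ) ≤ n)]
    simp [h1 x (by simp), h1 (x - y) (by simpa [dist_eq_norm] using hy.trans h2)]
  have hsq : Tendsto (fun n => ∫⁻ x, ‖moll n v x - v x‖ₑ ^ 2) atTop (𝓝 (∫⁻ _ : R2, 0)) := by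
    refine tendsto_lintegral_filter_of_dominated_convergence (S.indicator fun _ => 1) ?_ ?_ ?_ ?_
    · refine Eventually.of_forall fun n => ?_
      have := (moll_contDiff hv.locallyIntegrable n).continuous
      fun_prop
    · filter_upwards [key 1 one_pos] with n hn
      refine Eventually.of_forall fun x => ?_
      by_cases hx : x ∈ S
      · rw [Set.indicator_of_mem hx, ← ofReal_norm]
        refine pow_le_one₀ (by simp) ?_
        simpa using ENNReal.ofReal_le_ofReal (hn x)
      · simp [hz n x hx]
    · rw [lintegral_indicator hSc.measurableSet]
      simpa using hSc.measure_lt_top.ne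
    · refine Eventually.of_forall fun x => ?_
      have h1 : Tendsto (fun n => moll n v x - v x) atTop (𝓝 0) := by
        rw [Metric.tendsto_nhds]
        intro ε hε
        filter_upwards [key (ε / 2) (by positivity)] with n hn
        rw [dist_zero_right]
        linarith [hn x]
      have h2 := (ENNReal.continuous_pow 2).tendsto _ |>.comp ((continuous_enorm.tendsto _).comp h1)
      simpa [Function.comp_def] using h2
  rw [lintegral_zero] at hsq
  have h3 := (ENNReal.continuous_rpow_const (y := (1 / 2 : ℝ))).tendsto _ |>.comp hsq
  refine (h3.congr fun n => ?_).trans_eq (by simp)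
  simp only [Function.comp_apply]
  rw [← eLpNorm_two_sq, ← ENNReal.rpow_natCast, ← ENNReal.rpow_mul]
  norm_num

/-- Density of continuous compactly supported functions combined with the contraction property
`eLpNorm_moll_le`. -/
theorem tendsto_eLpNorm_moll_sub {v : R2 → ℝ} (hv : MemLp v 2 volume) :
    Tendsto (fun n => eLpNorm (fun x => moll n v x - v x) 2 volume) atTop (𝓝 0) := by
  rw [ENNReal.tendsto_nhds_zero]
  intro ε hε
  have hε3 : ε / 3 ≠ 0 := by simp [hε.ne']
  obtain ⟨g, hgc, hg, hgcont, hgm⟩ := hv.exists_hasCompactSupport_eLpNorm_sub_le (by simp) hε3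
  have hvl : LocallyIntegrable v := hv.locallyIntegrable (by norm_num)
  filter_upwards [(ENNReal.tendsto_nhds_zero.1
    (tendsto_eLpNorm_moll_sub_of_continuous hgcont hgc)) (ε / 3) (pos_iff_ne_zero.2 hε3)] with n hn
  have e : (fun x => moll n v x - v x) = (fun x => moll n (fun y => v y - g y) x) +
      ((fun x => moll n g x - g x) + fun x => g x - v x) := by
    ext x
    simp [moll_sub hvl hgcont.locallyIntegrable n x]
  have hd : LocallyIntegrable fun y => v y - g y := hvl.sub hgcont.locallyIntegrable
  have m1 := (moll_contDiff hd n).continuous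
  have m2 := (moll_contDiff hgcont.locallyIntegrable n).continuous
  rw [e]
  calc _ ≤ eLpNorm (fun x => moll n (fun y => v y - g y) x) 2 volume +
        (eLpNorm (fun x => moll n g x - g x) 2 volume + eLpNorm (fun x => g x - v x) 2 volume) :=
        (eLpNorm_add_le (by fun_prop) ((by fun_prop : Continuous fun x =>
          moll n g x - g x).aestronglyMeasurable.add (hgm.1.sub hv.1)) (by norm_num)).trans
          (by gcongr; exact eLpNorm_add_le (by fun_prop) (hgm.1.sub hv.1) (by norm_num))
    _ ≤ ε / 3 + (ε / 3 + ε / 3) := by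
        gcongr
        · exact (eLpNorm_moll_le (hv.1.sub hgm.1) n).trans hg
        · rw [← eLpNorm_neg]
          refine le_trans (le_of_eq (congrArg (fun f => eLpNorm f 2 volume) ?_)) hg
          ext x; simp
    _ = ε := by rw [← add_assoc]; exact ENNReal.add_thirds ε

/-- The fundamental theorem of calculus along the segment from `x` to `x - y`, followed by Jensen on
the unit interval. -/
theorem sub_enorm_sq_le {s : R2 → ℝ} (hs : ContDiff ℝ 1 s) (x y : R2) :
    ‖s (x - y) - s x‖ₑ ^ 2 ≤
      ∫⁻ τ in Set.Ioc (0 : ℝ) 1, ‖y‖ₑ ^ 2 * ‖fderiv ℝ s (x - τ • y)‖ₑ ^ 2 := by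
  have hc := hs.continuous_fderiv (by simp)
  have hd : ∀ τ ∈ Set.uIcc (0 : ℝ) 1, HasDerivAt (fun τ : ℝ => s (x - τ • y))
      (fderiv ℝ s (x - τ • y) (-y)) τ := by
    intro τ _
    have h1 : HasDerivAt (fun τ : ℝ => x - τ • y) (-y) τ := by
      simpa using ((hasDerivAt_id τ).smul_const y).const_sub x
    exact ((hs.differentiable (by simp)) _).hasFDerivAt.comp_hasDerivAt τ h1
  have hint : Continuous fun τ : ℝ => fderiv ℝ s (x - τ • y) (-y) := by fun_prop
  have h1 := intervalIntegral.integral_eq_sub_of_hasDerivAt hd (hint.intervalIntegrable 0 1)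
  rw [intervalIntegral.integral_of_le zero_le_one] at h1
  simp only [one_smul, zero_smul, sub_zero] at h1
  have : IsProbabilityMeasure (volume.restrict (Set.Ioc (0 : ℝ) 1)) := ⟨by simp⟩
  rw [← h1]
  refine (enorm_integral_sq_le _ hint.aestronglyMeasurable).trans (lintegral_mono fun τ => ?_)
  rw [← mul_pow]
  refine pow_le_pow_left' ?_ 2
  rw [mul_comm, ← enorm_neg y]
  exact (fderiv ℝ s (x - τ • y)).le_opENorm (-y)

/-- Averaging `sub_enorm_sq_le` over the kernel gains a factor equal to its radius. The gradient is
evaluated at translates of points of `K` by at most that radius, hence the thickening on the right.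
-/
theorem lintegral_moll_sub_sq_le {s : R2 → ℝ} (hs : ContDiff ℝ 1 s) (n : ℕ) {K : Set R2}
    (hK : MeasurableSet K) :
    ∫⁻ x in K, ‖moll n s x - s x‖ₑ ^ 2 ≤ ENNReal.ofReal (1 / (n + 1 : ℝ)) ^ 2 *
      ∫⁻ x in cthickening (1 / (n + 1 : ℝ)) K, ‖fderiv ℝ s x‖ₑ ^ 2 := by
  have hc := hs.continuous_fderiv (by simp)
  set C := cthickening (1 / (n + 1 : ℝ)) K
  have hCm : MeasurableSet C := isClosed_cthickening.measurableSet
  set F : R2 → R2 → ℝ → ℝ≥0∞ := fun x y τ => ‖y‖ₑ ^ 2 * ‖fderiv ℝ s (x - τ • y)‖ₑ ^ 2 with hF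
  have hFm : Measurable fun p : (R2 × R2) × ℝ => F p.1.1 p.1.2 p.2 := by
    have : Continuous fun p : (R2 × R2) × ℝ => fderiv ℝ s (p.1.1 - p.2 • p.1.2) := by fun_prop
    have h1 : Measurable fun p : (R2 × R2) × ℝ => ‖fderiv ℝ s (p.1.1 - p.2 • p.1.2)‖ₑ :=
      (continuous_enorm.comp this).measurable
    have h2 : Measurable fun p : (R2 × R2) × ℝ => ‖p.1.2‖ₑ := by fun_prop
    exact (h2.pow_const 2).mul (h1.pow_const 2)
  calc ∫⁻ x in K, ‖moll n s x - s x‖ₑ ^ 2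
      ≤ ∫⁻ x in K, (∫⁻ y, (∫⁻ τ in Set.Ioc (0 : ℝ) 1, F x y τ) ∂(kernMeas n)) := by
        refine lintegral_mono fun x => ?_
        rw [moll_sub_eq hs.continuous]
        have := hs.continuous
        refine (enorm_integral_sq_le _ (by fun_prop)).trans ?_
        exact lintegral_mono fun y => sub_enorm_sq_le hs x y
    _ = ∫⁻ y, (∫⁻ x in K, (∫⁻ τ in Set.Ioc (0 : ℝ) 1, F x y τ)) ∂(kernMeas n) :=
        lintegral_lintegral_swap (hFm.lintegral_prod_right').aemeasurable
    _ ≤ ∫⁻ y, (ENNReal.ofReal (1 / (n + 1 : ℝ)) ^ 2 *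
          ∫⁻ x in C, ‖fderiv ℝ s x‖ₑ ^ 2) ∂(kernMeas n) := by
        refine lintegral_mono_ae ?_
        filter_upwards [kernMeas_ae n] with y hy
        rw [lintegral_lintegral_swap]
        swap
        · exact (hFm.comp (by fun_prop : Measurable fun p : R2 × ℝ => ((p.1, y), p.2))).aemeasurable
        have : ∀ τ ∈ Set.Ioc (0 : ℝ) 1, (∫⁻ x in K, F x y τ) ≤
            ENNReal.ofReal (1 / (n + 1 : ℝ)) ^ 2 * ∫⁻ x in C, ‖fderiv ℝ s x‖ₑ ^ 2 := by
          intro τ hτ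
          simp only [hF]
          rw [lintegral_const_mul _ (by fun_prop)]
          refine mul_le_mul' (pow_le_pow_left' ?_ 2) ?_
          · rw [← ofReal_norm]
            exact ENNReal.ofReal_le_ofReal hy
          · rw [← lintegral_indicator hK, ← lintegral_indicator hCm,
              ← lintegral_sub_right_eq_self (C.indicator fun x => ‖fderiv ℝ s x‖ₑ ^ 2) (τ • y)]
            refine lintegral_mono fun x => ?_
            by_cases hx : x ∈ K
            · rw [Set.indicator_of_mem hx, Set.indicator_of_mem]
              refine mem_cthickening_of_dist_le _ x _ _ hx ?_
              rw [dist_eq_norm]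
              simp only [sub_sub_cancel_left, norm_neg, norm_smul, Real.norm_eq_abs,
                abs_of_pos hτ.1]
              nlinarith [norm_nonneg y, hτ.1, hτ.2]
            · simp [Set.indicator_of_notMem hx]
        refine (setLIntegral_mono measurable_const this).trans ?_
        simp
    _ = _ := by simp

/-! ### Convergence in `L²` -/

section L2

variable {α : Type*} [MeasurableSpace α] {ν : Measure α}

theorem tendsto_eLpNorm_two_iff {E : Type*} [NormedAddCommGroup E] {f : ℕ → α → E} :
    Tendsto (fun n => eLpNorm (f n) 2 ν) atTop (𝓝 0) ↔
      Tendsto (fun n => ∫⁻ x, ‖f n x‖ₑ ^ 2 ∂ν) atTop (𝓝 0) := by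
  constructor
  · intro h
    have := (ENNReal.continuous_pow 2).tendsto _ |>.comp h
    simpa [Function.comp_def, eLpNorm_two_sq] using this
  · intro h
    have h3 := (ENNReal.continuous_rpow_const (y := (1 / 2 : ℝ))).tendsto _ |>.comp h
    refine (h3.congr fun n => ?_).trans_eq (by simp)
    simp only [Function.comp_apply]
    rw [← eLpNorm_two_sq, ← ENNReal.rpow_natCast, ← ENNReal.rpow_mul]
    norm_num

theorem tendsto_eLpNorm_zero_of_dominated {f : ℕ → α → ℝ} {g : α → ℝ}
    (hf : ∀ n, AEStronglyMeasurable (f n) ν) (hg : MemLp g 2 ν)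
    (hb : ∀ n, ∀ᵐ x ∂ν, |f n x| ≤ g x)
    (h : ∀ᵐ x ∂ν, Tendsto (fun n => f n x) atTop (𝓝 0)) :
    Tendsto (fun n => eLpNorm (f n) 2 ν) atTop (𝓝 0) := by
  rw [tendsto_eLpNorm_two_iff, ← lintegral_zero (μ := ν)]
  refine tendsto_lintegral_of_dominated_convergence' (fun x => ‖g x‖ₑ ^ 2)
    (fun n => (hf n).enorm.pow_const 2) ?_ ?_ ?_
  · intro n
    filter_upwards [hb n] with x hx
    refine pow_le_pow_left' ?_ 2
    rw [enorm_le_iff_norm_le]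
    exact hx.trans (le_abs_self _)
  · rw [← eLpNorm_two_sq]
    exact ENNReal.pow_ne_top hg.eLpNorm_lt_top.ne
  · filter_upwards [h] with x hx
    have h2 := (ENNReal.continuous_pow 2).tendsto _ |>.comp ((continuous_enorm.tendsto _).comp hx)
    simpa [Function.comp_def] using h2

theorem tendsto_integral_mul {f g : ℕ → α → ℝ} {f₀ g₀ : α → ℝ} (hf : ∀ n, MemLp (f n) 2 ν)
    (hg : ∀ n, MemLp (g n) 2 ν) (hf₀ : MemLp f₀ 2 ν) (hg₀ : MemLp g₀ 2 ν)
    (hfc : Tendsto (fun n => eLpNorm (f n - f₀) 2 ν) atTop (𝓝 0))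
    (hgc : Tendsto (fun n => eLpNorm (g n - g₀) 2 ν) atTop (𝓝 0)) :
    Tendsto (fun n => ∫ x, f n x * g n x ∂ν) atTop (𝓝 (∫ x, f₀ x * g₀ x ∂ν)) := by
  have key : ∀ {a b : α → ℝ} (ha : MemLp a 2 ν) (hb : MemLp b 2 ν),
      inner ℝ (hb.toLp b) (ha.toLp a) = ∫ x, a x * b x ∂ν := by
    intro a b ha hb
    rw [L2.inner_def]
    refine integral_congr_ae ?_
    filter_upwards [ha.coeFn_toLp, hb.coeFn_toLp] with x h1 h2
    simp [h1, h2]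
  have h1 := (Lp.tendsto_Lp_iff_tendsto_eLpNorm'' f hf f₀ hf₀).2 hfc
  have h2 := (Lp.tendsto_Lp_iff_tendsto_eLpNorm'' g hg g₀ hg₀).2 hgc
  have h3 := h2.inner (𝕜 := ℝ) h1
  simpa only [key] using h3

theorem exists_subseq_ae_tendsto {E : Type*} [NormedAddCommGroup E] {f : ℕ → α → E} {g : α → E}
    (hf : ∀ n, AEStronglyMeasurable (f n) ν) (hg : AEStronglyMeasurable g ν)
    (h : Tendsto (fun n => eLpNorm (f n - g) 2 ν) atTop (𝓝 0)) :
    ∃ ns : ℕ → ℕ, StrictMono ns ∧ ∀ᵐ x ∂ν, Tendsto (fun i => f (ns i) x) atTop (𝓝 (g x)) :=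
  (tendstoInMeasure_of_tendsto_eLpNorm (by norm_num) hf hg h).exists_seq_tendsto_ae

theorem tendsto_eLpNorm_mono {f g : ℕ → α → ℝ} {ν' : Measure α} {C : ℝ≥0∞} (hC : C ≠ ⊤)
    (h : ∀ᶠ n in atTop, eLpNorm (f n) 2 ν ≤ C * eLpNorm (g n) 2 ν')
    (hg : Tendsto (fun n => eLpNorm (g n) 2 ν') atTop (𝓝 0)) :
    Tendsto (fun n => eLpNorm (f n) 2 ν) atTop (𝓝 0) := by
  have h1 := ENNReal.Tendsto.const_mul hg (Or.inr hC)
  rw [mul_zero] at h1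
  exact tendsto_of_tendsto_of_tendsto_of_le_of_le' tendsto_const_nhds h1
    (Eventually.of_forall fun _ => zero_le) h

end L2

/-! ### Integration by parts -/

theorem integral_mul_fderiv_eq {f g : R2 → ℝ} (hf : ContDiff ℝ 1 f) (hg : ContDiff ℝ 1 g)
    (hc : HasCompactSupport f) (v : R2) :
    ∫ x, f x * fderiv ℝ g x v = - ∫ x, fderiv ℝ f x v * g x := by
  have hf' := hf.continuous_fderiv (by simp)
  have hg' := hg.continuous_fderiv (by simp)
  have h1 := hf.continuous
  have h2 := hg.continuous
  refine integral_mul_fderiv_eq_neg_fderiv_mul_of_integrable ?_ ?_ ?_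
    (fun x _ => hf.differentiable (by simp) x) (fun x _ => hg.differentiable (by simp) x)
  · exact Continuous.integrable_of_hasCompactSupport (by fun_prop)
      ((hc.fderiv_apply ℝ v).mul_right)
  · exact Continuous.integrable_of_hasCompactSupport (by fun_prop) hc.mul_right
  · exact Continuous.integrable_of_hasCompactSupport (by fun_prop) hc.mul_right

/-- The coordinate vectors of the plane. -/
noncomputable abbrev ee (j : Fin 2) : R2 := EuclideanSpace.single j (1 : ℝ)

theorem IsTest.continuous {Ω : Set R2} {φ : R2 → ℝ} (h : IsTest Ω φ) : Continuous φ :=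
  h.1.continuous

theorem IsTest.partialDeriv {Ω : Set R2} {φ : R2 → ℝ} (h : IsTest Ω φ) (e : R2) :
    IsTest Ω fun x => fderiv ℝ φ x e := by
  refine ⟨(h.1.fderiv_right (m := ∞) (by simp)).clm_apply contDiff_const,
    h.2.1.fderiv_apply ℝ e, (tsupport_fderiv_apply_subset ℝ e).trans h.2.2⟩

theorem IsTest.fderiv_continuous {Ω : Set R2} {φ : R2 → ℝ} (h : IsTest Ω φ) :
    Continuous (fderiv ℝ φ) := h.1.continuous_fderiv (by simp)

theorem IsTest.mono {Ω Ω' : Set R2} {φ : R2 → ℝ} (h : IsTest Ω φ) (hs : Ω ⊆ Ω') : IsTest Ω' φ :=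
  ⟨h.1, h.2.1, h.2.2.trans hs⟩

theorem IsTest.mul_left {Ω : Set R2} {φ χ : R2 → ℝ} (h : IsTest Ω φ) (hχ : ContDiff ℝ ∞ χ) :
    IsTest Ω fun x => χ x * φ x :=
  ⟨hχ.mul h.1, h.2.1.mul_left, (tsupport_mul_subset_right).trans h.2.2⟩

theorem IsTest.add {Ω : Set R2} {φ χ : R2 → ℝ} (h : IsTest Ω φ) (h' : IsTest Ω χ) :
    IsTest Ω fun x => φ x + χ x := by
  refine ⟨h.1.add h'.1, h.2.1.add h'.2.1, (tsupport_add φ χ).trans ?_⟩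
  exact Set.union_subset h.2.2 h'.2.2

theorem IsTest.memLp {Ω : Set R2} {φ : R2 → ℝ} (h : IsTest Ω φ) (ν : Measure R2)
    [IsFiniteMeasureOnCompacts ν] : MemLp φ 2 ν := h.continuous.memLp_of_hasCompactSupport h.2.1

theorem setIntegral_of_tsupport {Ω : Set R2} {f : R2 → ℝ} (h : tsupport f ⊆ Ω) :
    ∫ x in Ω, f x = ∫ x, f x :=
  setIntegral_eq_integral_of_forall_compl_eq_zero fun _ hx =>
    image_eq_zero_of_notMem_tsupport fun h' => hx (h h')

theorem setIntegral_mul_of_tsupport {Ω : Set R2} {f : R2 → ℝ} (h : tsupport f ⊆ Ω) (g : R2 → ℝ) :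
    ∫ x in Ω, f x * g x = ∫ x, f x * g x :=
  setIntegral_of_tsupport (tsupport_mul_subset_left.trans h)

/-! ### Mollification of functions on a domain -/

section Domain

variable {Ω : Set R2}

theorem memLp_ind (hΩ : IsOpen Ω) {v : R2 → ℝ} (hv : MemLp v 2 (volume.restrict Ω)) :
    MemLp (Ω.indicator v) 2 volume := (memLp_indicator_iff_restrict hΩ.measurableSet).2 hv

theorem locInt_ind (hΩ : IsOpen Ω) {v : R2 → ℝ} (hv : MemLp v 2 (volume.restrict Ω)) :
    LocallyIntegrable (Ω.indicator v) := (memLp_ind hΩ hv).locallyIntegrable (by norm_num)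

theorem eLpNorm_ind (hΩ : IsOpen Ω) (v : R2 → ℝ) :
    eLpNorm (Ω.indicator v) 2 volume = eLpNorm v 2 (volume.restrict Ω) :=
  eLpNorm_indicator_eq_eLpNorm_restrict hΩ.measurableSet

theorem integral_mul_ind (hΩ : IsOpen Ω) (f v : R2 → ℝ) :
    ∫ y, f y * Ω.indicator v y = ∫ y in Ω, f y * v y := by
  rw [← integral_indicator hΩ.measurableSet]
  refine integral_congr_ae (Eventually.of_forall fun y => ?_)
  by_cases hy : y ∈ Ω <;> simp [hy]

theorem moll_ind (hΩ : IsOpen Ω) (v : R2 → ℝ) (n : ℕ) (x : R2) :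
    moll n (Ω.indicator v) x = ∫ y in Ω, kernAt n x y * v y := by
  rw [← integral_mul_ind hΩ, moll_eq]
  simp only [kernAt, mul_comm]

theorem fderiv_moll_ind (hΩ : IsOpen Ω) {v : R2 → ℝ} (hv : MemLp v 2 (volume.restrict Ω)) (n : ℕ)
    (x e : R2) : fderiv ℝ (moll n (Ω.indicator v)) x e =
      - ∫ y in Ω, fderiv ℝ (kernAt n x) y e * v y := by
  rw [← integral_mul_ind hΩ, fderiv_moll (locInt_ind hΩ hv)]

/-- Differentiation commutes with mollification only away from the boundary, since extension by zero
may create a jump there. The proof tests the weak derivative with the kernel centred at `x`. -/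
theorem IsWeakPartial.fderiv_moll (hΩ : IsOpen Ω) {v G : R2 → ℝ} {j : Fin 2}
    (h : IsWeakPartial Ω j v G) (hv : MemLp v 2 (volume.restrict Ω)) {n : ℕ} {x : R2}
    (hx : closedBall x (1 / (n + 1 : ℝ)) ⊆ Ω) :
    fderiv ℝ (moll n (Ω.indicator v)) x (ee j) = moll n (Ω.indicator G) x := by
  rw [fderiv_moll_ind hΩ hv, moll_ind hΩ]
  have := h _ (kernAt_isTest hx)
  simp only [smul_eq_mul] at this
  rw [this, neg_neg]

end Domain

theorem norm_fderiv_le {s : R2 → ℝ} (x : R2) :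
    ‖fderiv ℝ s x‖ ≤ |fderiv ℝ s x (ee 0)| + |fderiv ℝ s x (ee 1)| := by
  refine ContinuousLinearMap.opNorm_le_bound _ (by positivity) fun y => ?_
  have hy : y = y 0 • ee 0 + y 1 • ee 1 := by
    ext i; fin_cases i <;> simp
  have h0 : |y 0| ≤ ‖y‖ := by simpa using PiLp.norm_apply_le y 0
  have h1 : |y 1| ≤ ‖y‖ := by simpa using PiLp.norm_apply_le y 1
  conv_lhs => rw [hy]
  rw [map_add, map_smul, map_smul, add_mul]
  refine (norm_add_le _ _).trans ?_
  rw [norm_smul, norm_smul, Real.norm_eq_abs, Real.norm_eq_abs, Real.norm_eq_abs,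
    Real.norm_eq_abs, mul_comm |y 0|, mul_comm |y 1|]
  gcongr

/-! ### Weak sequential compactness in Hilbert spaces -/

/-- Sequential Banach-Alaoglu needs separability, so the argument takes place in the closed span of
the sequence, identified with its dual by Riesz. A functional on `H` enters only through its
restriction to that span. -/
theorem exists_weakly_convergent_subseq {H : Type*} [NormedAddCommGroup H] [InnerProductSpace ℝ H]
    [CompleteSpace H] {w : ℕ → H} {C : ℝ} (hC : ∀ n, ‖w n‖ ≤ C) :
    ∃ (x : H) (ns : ℕ → ℕ), StrictMono ns ∧
      ∀ ψ : H →L[ℝ] ℝ, Tendsto (fun n => ψ (w (ns n))) atTop (𝓝 (ψ x)) := by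
  set S : Submodule ℝ H := (Submodule.span ℝ (Set.range w)).topologicalClosure with hS
  have hsep : TopologicalSpace.IsSeparable (S : Set H) := by
    rw [hS, Submodule.topologicalClosure_coe]
    exact ((Set.countable_range w).isSeparable.span (R := ℝ)).closure
  have : TopologicalSpace.SeparableSpace S := hsep.separableSpace
  have hcl : IsClosed (S : Set H) := Submodule.isClosed_topologicalClosure _
  have : CompleteSpace S := hcl.completeSpace_coe
  have hw : ∀ n, w n ∈ S := fun n =>
    Submodule.le_topologicalClosure _ (Submodule.subset_span (Set.mem_range_self n))
  let v : ℕ → S := fun n => ⟨w n, hw n⟩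
  let F : ℕ → WeakDual ℝ S := fun n =>
    StrongDual.toWeakDual (InnerProductSpace.toDual ℝ S (v n))
  obtain ⟨a, _, ns, hns, ha⟩ := WeakDual.isSeqCompact_closedBall ℝ S (0 : StrongDual ℝ S) C
    (x := F) (fun n => by
      have : ‖v n‖ ≤ C := hC n
      simpa [F] using this)
  let x : S := (InnerProductSpace.toDual ℝ S).symm (WeakDual.toStrongDual a)
  refine ⟨x, ns, hns, fun ψ => ?_⟩
  let y : S := (InnerProductSpace.toDual ℝ S).symm (ψ ∘L S.subtypeL)
  have hy : ∀ s : S, ψ s = inner ℝ y s := by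
    intro s
    simp [y]
  have h1 : Tendsto (fun n => F (ns n) y) atTop (𝓝 (a y)) :=
    (WeakDual.eval_continuous y).tendsto a |>.comp ha
  have h2 : a y = ψ x := by
    rw [hy, real_inner_comm]
    simp [x]
  rw [← h2]
  refine h1.congr fun n => ?_
  rw [show w (ns n) = (v (ns n) : H) from rfl, hy, real_inner_comm]
  simp [F]

/-! ### Sobolev functions: coordinates -/

section Coord

variable {E : Type*} [NormedAddCommGroup E] [NormedSpace ℝ E] {Ω : Set R2} {p : ℝ≥0∞}
  [Fact (1 ≤ p)]

/-- The continuous linear map taking a Sobolev function to one of its components: the function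
itself (`none`) or a partial derivative. -/
noncomputable def coord (o : Option (Fin 2)) :
    Sobolev E Ω p →L[ℝ] Lp E p (volume.restrict Ω) :=
  (PiLp.proj (𝕜 := ℝ) p (fun _ : Option (Fin 2) => Lp E p (volume.restrict Ω)) o) ∘L
    (Sobolev E Ω p).subtypeL

theorem coord_none (w : Sobolev E Ω p) : coord none w = toLp w := rfl

theorem toLp_add (w w' : Sobolev E Ω p) : toLp (w + w') = toLp w + toLp w' := rfl

theorem toLp_sub (w w' : Sobolev E Ω p) : toLp (w - w') = toLp w - toLp w' := rfl

theorem toLp_smul (c : ℝ) (w : Sobolev E Ω p) : toLp (c • w) = c • toLp w := rfl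

theorem pd_add (j : Fin 2) (w w' : Sobolev E Ω p) : pd j (w + w') = pd j w + pd j w' := rfl

theorem pd_smul (j : Fin 2) (c : ℝ) (w : Sobolev E Ω p) : pd j (c • w) = c • pd j w := rfl

theorem sobolev_norm_sq (w : Sobolev E Ω 2) :
    ‖w‖ ^ 2 = ‖toLp w‖ ^ 2 + ‖pd 0 w‖ ^ 2 + ‖pd 1 w‖ ^ 2 := by
  have h := PiLp.norm_sq_eq_of_L2 (fun _ : Option (Fin 2) => Lp E 2 (volume.restrict Ω)) w.1
  rw [Fintype.sum_option, Fin.sum_univ_two] at h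
  rw [← Submodule.coe_norm, add_assoc] at *
  exact h

theorem norm_toLp_le (w : Sobolev E Ω p) : ‖toLp w‖ ≤ ‖w‖ := PiLp.norm_apply_le w.1 none

theorem norm_pd_le (j : Fin 2) (w : Sobolev E Ω p) : ‖pd j w‖ ≤ ‖w‖ :=
  PiLp.norm_apply_le w.1 (some j)

theorem isWeakPartial_pd (w : Sobolev E Ω p) (j : Fin 2) : IsWeakPartial Ω j (toLp w) (pd j w) :=
  w.2 j

theorem isWeakPartial_congr {j : Fin 2} {v v' G G' : R2 → E}
    (h : IsWeakPartial Ω j v G) (hv : v =ᵐ[volume.restrict Ω] v')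
    (hG : G =ᵐ[volume.restrict Ω] G') : IsWeakPartial Ω j v' G' := by
  intro φ hφ
  have := h φ hφ
  rw [integral_congr_ae (g := fun x => fderiv ℝ φ x (EuclideanSpace.single j 1) • v' x)
    (by filter_upwards [hv] with x hx; rw [hx]),
    integral_congr_ae (f := fun x => φ x • G x) (g := fun x => φ x • G' x)
    (by filter_upwards [hG] with x hx; rw [hx])] at this
  exact this

/-- A Sobolev function from `L^p` functions with weak partial derivatives of class `L^p`. -/
noncomputable def mkSob (v : R2 → E) (G : Fin 2 → R2 → E) (hv : MemLp v p (volume.restrict Ω))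
    (hG : ∀ j, MemLp (G j) p (volume.restrict Ω)) (h : ∀ j, IsWeakPartial Ω j v (G j)) :
    Sobolev E Ω p :=
  ⟨WithLp.toLp p fun o => Option.casesOn o (hv.toLp v) fun j => (hG j).toLp (G j),
    fun j => isWeakPartial_congr (h j) hv.coeFn_toLp.symm (hG j).coeFn_toLp.symm⟩

theorem toLp_mkSob {v : R2 → E} {G : Fin 2 → R2 → E} (hv : MemLp v p (volume.restrict Ω))
    (hG : ∀ j, MemLp (G j) p (volume.restrict Ω)) (h : ∀ j, IsWeakPartial Ω j v (G j)) :
    toLp (mkSob v G hv hG h) =ᵐ[volume.restrict Ω] v := hv.coeFn_toLp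

theorem pd_mkSob {v : R2 → E} {G : Fin 2 → R2 → E} (hv : MemLp v p (volume.restrict Ω))
    (hG : ∀ j, MemLp (G j) p (volume.restrict Ω)) (h : ∀ j, IsWeakPartial Ω j v (G j)) (j : Fin 2) :
    pd j (mkSob v G hv hG h) =ᵐ[volume.restrict Ω] G j := (hG j).coeFn_toLp

end Coord

/-! ### Completeness of the Sobolev space -/

section Complete

variable {E : Type*} [NormedAddCommGroup E] [NormedSpace ℝ E] [CompleteSpace E] {Ω : Set R2}

/-- Test functions and their derivatives are in `L²`, so each defining identity of a weak derivative
equates two continuous functionals. -/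
theorem isClosed_sobolev :
    IsClosed (Sobolev E Ω 2 : Set (PiLp 2 fun _ : Option (Fin 2) => Lp E 2 (volume.restrict Ω))) := by
  have key : ∀ (χ : R2 → ℝ) (_ : MemLp χ 2 (volume.restrict Ω)) (o : Option (Fin 2)),
      Continuous fun w : PiLp 2 (fun _ : Option (Fin 2) => Lp E 2 (volume.restrict Ω)) =>
        ∫ x in Ω, χ x • w o x := by
    intro χ hχ o
    have h1 : ∀ f : Lp E 2 (volume.restrict Ω), (ContinuousLinearMap.lpPairing
        (volume.restrict Ω) 2 2 (ContinuousLinearMap.lsmul ℝ ℝ)) (hχ.toLp χ) f =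
        ∫ x in Ω, χ x • f x := by
      intro f
      rw [ContinuousLinearMap.lpPairing_eq_integral]
      refine integral_congr_ae ?_
      filter_upwards [hχ.coeFn_toLp] with x hx
      simp [hx]
    have h2 : Continuous fun w : PiLp 2 (fun _ : Option (Fin 2) => Lp E 2 (volume.restrict Ω)) =>
      (ContinuousLinearMap.lpPairing
        (volume.restrict Ω) 2 2 (ContinuousLinearMap.lsmul ℝ ℝ)) (hχ.toLp χ) (w o) :=
      (ContinuousLinearMap.continuous _).comp
        (PiLp.proj (𝕜 := ℝ) 2 (fun _ : Option (Fin 2) => Lp E 2 (volume.restrict Ω)) o).continuous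
    simpa only [h1] using h2
  have : (Sobolev E Ω 2 : Set (PiLp 2 fun _ : Option (Fin 2) => Lp E 2 (volume.restrict Ω))) =
      ⋂ (j : Fin 2) (φ : {φ // IsTest Ω φ}), {w |
        ∫ x in Ω, (fderiv ℝ φ.1 x (EuclideanSpace.single j 1)) • w none x =
          - ∫ x in Ω, φ.1 x • w (some j) x} := by
    ext w
    simp only [Set.mem_iInter, Set.mem_ofPred_eq, Subtype.forall]
    rfl
  rw [this]
  refine isClosed_iInter fun j => isClosed_iInter fun φ => ?_
  exact isClosed_eq (key _ ((φ.2.partialDeriv _).memLp _) none) (key _ (φ.2.memLp _) (some j)).neg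

instance : CompleteSpace (Sobolev E Ω 2) := isClosed_sobolev.completeSpace_coe

end Complete

/-! ### Components of vector-valued Sobolev functions -/

section Comp

variable {Ω : Set R2}

/-- The `a`-th coordinate of an `L²` vector field. -/
noncomputable def compLp (a : Fin 2) :
    Lp R2 2 (volume.restrict Ω) →L[ℝ] Lp ℝ 2 (volume.restrict Ω) :=
  (EuclideanSpace.proj a : R2 →L[ℝ] ℝ).compLpL 2 (volume.restrict Ω)

theorem compLp_ae (a : Fin 2) (f : Lp R2 2 (volume.restrict Ω)) :
    ∀ᵐ x ∂(volume.restrict Ω), compLp a f x = f x a := by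
  filter_upwards [(EuclideanSpace.proj a : R2 →L[ℝ] ℝ).coeFn_compLpL f] with x hx
  exact hx

theorem norm_sq_compLp (f : Lp R2 2 (volume.restrict Ω)) :
    ‖f‖ ^ 2 = ‖compLp 0 f‖ ^ 2 + ‖compLp 1 f‖ ^ 2 := by
  have key : ∀ g : Lp ℝ 2 (volume.restrict Ω), ‖g‖ ^ 2 = ∫ x in Ω, g x ^ 2 := by
    intro g
    rw [← real_inner_self_eq_norm_sq, L2.inner_def]
    simp [pow_two]
  rw [key, key, ← integral_add (Lp.memLp _).integrable_sq (Lp.memLp _).integrable_sq,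
    ← real_inner_self_eq_norm_sq, L2.inner_def]
  refine integral_congr_ae ?_
  filter_upwards [compLp_ae 0 f, compLp_ae 1 f] with x h0 h1
  rw [h0, h1, real_inner_self_eq_norm_sq, EuclideanSpace.norm_sq_eq, Fin.sum_univ_two]
  simp

theorem isWeakPartial_comp {j : Fin 2} {v G : R2 → R2} (h : IsWeakPartial Ω j v G)
    (hv : MemLp v 2 (volume.restrict Ω)) (hG : MemLp G 2 (volume.restrict Ω)) (a : Fin 2) :
    IsWeakPartial Ω j (fun x => v x a) (fun x => G x a) := by
  intro φ hφ
  have key : ∀ (χ : R2 → ℝ) (_ : IsTest Ω χ) (f : R2 → R2) (_ : MemLp f 2 (volume.restrict Ω)),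
      ∫ x in Ω, χ x • f x a = (∫ x in Ω, χ x • f x) a := by
    intro χ hχ f hf
    have := (EuclideanSpace.proj a : R2 →L[ℝ] ℝ).integral_comp_comm
      (φ := fun x => χ x • f x) (μ := volume.restrict Ω)
      ((hf.locallyIntegrable (by norm_num)).integrable_smul_left_of_hasCompactSupport
        hχ.continuous hχ.2.1)
    simpa using this
  rw [key _ (hφ.partialDeriv _) v hv, key φ hφ G hG, h φ hφ]
  rfl

/-- The components of a vector-valued Sobolev function. -/
noncomputable def cmp (a : Fin 2) (w : H1v Ω) : H1 Ω :=
  ⟨WithLp.toLp 2 fun o => compLp a (w.1 o), fun j =>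
    isWeakPartial_congr
      (isWeakPartial_comp (isWeakPartial_pd w j) (Lp.memLp _) (Lp.memLp _) a)
      (by filter_upwards [compLp_ae a (toLp w)] with x hx using hx.symm)
      (by filter_upwards [compLp_ae a (pd j w)] with x hx using hx.symm)⟩

theorem toLp_cmp (a : Fin 2) (w : H1v Ω) : toLp (cmp a w) = compLp a (toLp w) := rfl

theorem pd_cmp (a j : Fin 2) (w : H1v Ω) : pd j (cmp a w) = compLp a (pd j w) := rfl

theorem norm_sq_cmp (w : H1v Ω) : ‖w‖ ^ 2 = ‖cmp 0 w‖ ^ 2 + ‖cmp 1 w‖ ^ 2 := by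
  rw [sobolev_norm_sq, sobolev_norm_sq, sobolev_norm_sq]
  simp only [toLp_cmp, pd_cmp]
  rw [norm_sq_compLp, norm_sq_compLp (pd 0 w), norm_sq_compLp (pd 1 w)]
  ring

theorem norm_cmp_le (a : Fin 2) (w : H1v Ω) : ‖cmp a w‖ ≤ ‖w‖ := by
  rw [← sq_le_sq₀ (norm_nonneg _) (norm_nonneg _), norm_sq_cmp w]
  fin_cases a
  · exact le_add_of_nonneg_right (sq_nonneg _)
  · exact le_add_of_nonneg_left (sq_nonneg _)

theorem sobolev_ext {E : Type*} [NormedAddCommGroup E] [NormedSpace ℝ E] {p : ℝ≥0∞}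
    [Fact (1 ≤ p)] {w w' : Sobolev E Ω p} (h : toLp w = toLp w') (h' : ∀ j, pd j w = pd j w') :
    w = w' := by
  apply Subtype.ext
  ext1 o
  cases o with
  | none => exact h
  | some j => exact h' j

theorem cmp_add (a : Fin 2) (w w' : H1v Ω) : cmp a (w + w') = cmp a w + cmp a w' :=
  sobolev_ext (by rw [toLp_cmp, toLp_add, map_add]; rfl)
    fun j => by rw [pd_cmp, pd_add, map_add]; rfl

theorem cmp_smul (a : Fin 2) (c : ℝ) (w : H1v Ω) : cmp a (c • w) = c • cmp a w :=
  sobolev_ext (by rw [toLp_cmp, toLp_smul, map_smul]; rfl)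
    fun j => by rw [pd_cmp, pd_smul, map_smul]; rfl

/-- The components of a vector-valued Sobolev function, as a continuous linear map. -/
noncomputable def cmpL (a : Fin 2) : H1v Ω →L[ℝ] H1 Ω :=
  LinearMap.mkContinuous
    { toFun := cmp a
      map_add' := cmp_add a
      map_smul' := cmp_smul a } 1
    (fun w => by rw [one_mul]; exact norm_cmp_le a w)

theorem cmpL_apply (a : Fin 2) (w : H1v Ω) : cmpL a w = cmp a w := rfl

end Comp

/-! ### Local compactness -/

section Rellich

variable {Ω : Set R2}

theorem integral_mul_eq_inner {α : Type*} [MeasurableSpace α] {ν : Measure α} {a : α → ℝ}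
    (ha : MemLp a 2 ν) (f : Lp ℝ 2 ν) :
    ∫ x, a x * f x ∂ν = inner ℝ (ha.toLp a) f := by
  rw [L2.inner_def]
  refine integral_congr_ae ?_
  filter_upwards [ha.coeFn_toLp] with x h1
  simp [h1, mul_comm]

/-- The pairing with a component of a Sobolev function. -/
noncomputable def pairL (κ : Lp ℝ 2 (volume.restrict Ω)) (o : Option (Fin 2)) : H1 Ω →L[ℝ] ℝ :=
  innerSL ℝ κ ∘L coord o

theorem pairL_apply (κ : Lp ℝ 2 (volume.restrict Ω)) (o : Option (Fin 2)) (w : H1 Ω) :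
    pairL κ o w = inner ℝ κ (coord o w) := by
  rw [pairL, ContinuousLinearMap.comp_apply, innerSL_apply_apply]

theorem eventually_one_div_lt {d : ℝ} (hd : 0 < d) : ∀ᶠ n : ℕ in atTop, 1 / (n + 1 : ℝ) < d :=
  tendsto_one_div_nat.eventually (gt_mem_nhds hd)

theorem tendsto_moll_ind (hΩ : IsOpen Ω) {v : R2 → ℝ} (hv : MemLp v 2 (volume.restrict Ω)) :
    Tendsto (fun n => eLpNorm (moll n (Ω.indicator v) - Ω.indicator v) 2 volume) atTop (𝓝 0) :=
  tendsto_eLpNorm_moll_sub (memLp_ind hΩ hv)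

theorem eLpNorm_fderiv_moll_le (hΩ : IsOpen Ω) {v : R2 → ℝ} {G : Fin 2 → R2 → ℝ}
    (hv : MemLp v 2 (volume.restrict Ω)) (hG : ∀ j, MemLp (G j) 2 (volume.restrict Ω))
    (h : ∀ j, IsWeakPartial Ω j v (G j)) {C : Set R2} (hC : MeasurableSet C) {m : ℕ}
    (hm : ∀ x ∈ C, closedBall x (1 / (m + 1 : ℝ)) ⊆ Ω) :
    eLpNorm (fderiv ℝ (moll m (Ω.indicator v))) 2 (volume.restrict C) ≤
      eLpNorm (G 0) 2 (volume.restrict Ω) + eLpNorm (G 1) 2 (volume.restrict Ω) := by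
  set g : Fin 2 → R2 → ℝ := fun j x => ‖moll m (Ω.indicator (G j)) x‖ with hg
  have hgc : ∀ j, Continuous (g j) := fun j =>
    (moll_contDiff (locInt_ind hΩ (hG j)) m).continuous.norm
  have hge : ∀ j, eLpNorm (g j) 2 volume ≤ eLpNorm (G j) 2 (volume.restrict Ω) := fun j => by
    rw [← eLpNorm_ind hΩ, hg]
    simp only
    rw [eLpNorm_norm]
    exact eLpNorm_moll_le (memLp_ind hΩ (hG j)).1 m
  have h1 : eLpNorm (fderiv ℝ (moll m (Ω.indicator v))) 2 (volume.restrict C) ≤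
      eLpNorm (g 0 + g 1) 2 (volume.restrict C) := by
    refine eLpNorm_mono_ae ((ae_restrict_iff' hC).2 (Eventually.of_forall fun x hx => ?_))
    refine (norm_fderiv_le x).trans ?_
    rw [(h 0).fderiv_moll hΩ hv (hm x hx), (h 1).fderiv_moll hΩ hv (hm x hx)]
    exact le_abs_self _
  exact h1.trans ((eLpNorm_mono_measure _ Measure.restrict_le_self).trans
    ((eLpNorm_add_le (hgc 0).aestronglyMeasurable (hgc 1).aestronglyMeasurable
      (by norm_num)).trans (add_le_add (hge 0) (hge 1))))

/-- The rate depends on `v` only through its gradient norm, which makes it uniform along bounded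
sequences in `H¹`. It holds for smooth functions by `lintegral_moll_sub_sq_le`; here it is applied
to a finer mollification of `v`, whose scale tends to zero. The scales `n` and `m` each use up half
of the distance `d`. -/
theorem eLpNorm_moll_sub_le (hΩ : IsOpen Ω) {v : R2 → ℝ} {G : Fin 2 → R2 → ℝ}
    (hv : MemLp v 2 (volume.restrict Ω)) (hG : ∀ j, MemLp (G j) 2 (volume.restrict Ω))
    (h : ∀ j, IsWeakPartial Ω j v (G j)) {K : Set R2} (hK : MeasurableSet K) {d : ℝ} (hd0 : 0 < d)
    (hd : cthickening d K ⊆ Ω) {n : ℕ} (hn : 1 / (n + 1 : ℝ) ≤ d / 2) :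
    eLpNorm (moll n (Ω.indicator v) - Ω.indicator v) 2 (volume.restrict K) ≤
      ENNReal.ofReal (1 / (n + 1 : ℝ)) *
        (eLpNorm (G 0) 2 (volume.restrict Ω) + eLpNorm (G 1) 2 (volume.restrict Ω)) := by
  set V := Ω.indicator v with hV
  have hVm : MemLp V 2 volume := memLp_ind hΩ hv
  have hVl : LocallyIntegrable V := locInt_ind hΩ hv
  set B := ENNReal.ofReal (1 / (n + 1 : ℝ)) *
        (eLpNorm (G 0) 2 (volume.restrict Ω) + eLpNorm (G 1) 2 (volume.restrict Ω)) with hB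
  set C := cthickening (1 / (n + 1 : ℝ)) K with hC
  -- The error of `V` at scale `n` is that of the smooth `moll m V` plus two copies of the distance
  -- from `moll m V` to `V`: the distance itself and its mollification.
  have step : ∀ᶠ m : ℕ in atTop, eLpNorm (moll n V - V) 2 (volume.restrict K) ≤
      2 * eLpNorm (moll m V - V) 2 volume + B := by
    filter_upwards [eventually_one_div_lt (half_pos hd0)] with m hm
    set s := moll m V with hs
    have hsd : ContDiff ℝ ∞ s := moll_contDiff hVl m
    have hsl : LocallyIntegrable s := hsd.continuous.locallyIntegrable
    have h1 : eLpNorm (moll n s - s) 2 (volume.restrict K) ≤ B := by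
      have e1 : eLpNorm (moll n s - s) 2 (volume.restrict K) ≤
          ENNReal.ofReal (1 / (n + 1 : ℝ)) * eLpNorm (fderiv ℝ s) 2 (volume.restrict C) := by
        rw [← ENNReal.pow_le_pow_left_iff (n := 2) (by norm_num), mul_pow, eLpNorm_two_sq,
          eLpNorm_two_sq]
        exact lintegral_moll_sub_sq_le (hsd.of_le (by simp)) n hK
      refine e1.trans ?_
      rw [hB]
      gcongr
      refine eLpNorm_fderiv_moll_le hΩ hv hG h isClosed_cthickening.measurableSet fun x hx => ?_
      exact (closedBall_subset_cthickening hx _).trans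
        ((cthickening_cthickening_subset (by positivity) (by positivity) K).trans
          ((cthickening_mono (by linarith) K).trans hd))
    have e : moll n V - V = (moll n (fun y => V y - s y)) + ((moll n s - s) + (s - V)) := by
      ext x
      simp [moll_sub hVl hsl n x]
    have c1 := (moll_contDiff (hVl.sub hsl) n).continuous
    have c2 := (moll_contDiff hsl n).continuous
    have c3 := hsd.continuous
    have m1 : AEStronglyMeasurable (moll n (fun y => V y - s y)) (volume.restrict K) :=
      c1.aestronglyMeasurable
    have m2 : AEStronglyMeasurable (moll n s - s) (volume.restrict K) :=
      (c2.sub c3).aestronglyMeasurable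
    have m3' : AEStronglyMeasurable (s - V) volume := c3.aestronglyMeasurable.sub hVm.1
    have m3 : AEStronglyMeasurable (s - V) (volume.restrict K) := m3'.restrict
    have b3 : eLpNorm (s - V) 2 (volume.restrict K) ≤ eLpNorm (s - V) 2 volume :=
      eLpNorm_mono_measure _ Measure.restrict_le_self
    have b1 : eLpNorm (moll n (fun y => V y - s y)) 2 (volume.restrict K) ≤
        eLpNorm (s - V) 2 volume := by
      refine (eLpNorm_mono_measure _ Measure.restrict_le_self).trans
        ((eLpNorm_moll_le (hVm.1.sub c3.aestronglyMeasurable) n).trans ?_)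
      rw [← eLpNorm_neg, neg_sub]
    rw [e]
    calc _ ≤ _ := eLpNorm_add_le m1 (m2.add m3) (by norm_num)
      _ ≤ _ := add_le_add b1 ((eLpNorm_add_le m2 m3 (by norm_num)).trans (add_le_add h1 b3))
      _ = _ := by ring
  have hlim : Tendsto (fun m => 2 * eLpNorm (moll m V - V) 2 volume + B) atTop (𝓝 (2 * 0 + B)) :=
    (ENNReal.Tendsto.const_mul (tendsto_moll_ind hΩ hv) (Or.inr (by simp))).add_const B
  rw [mul_zero, zero_add] at hlim
  exact ge_of_tendsto hlim step

theorem eLpNorm_kernAt_le (m : ℕ) (x : R2) (ν : Measure R2) (hν : ν ≤ volume) :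
    eLpNorm (kernAt m x) 2 ν ≤ eLpNorm (kern m) 2 volume := by
  refine (eLpNorm_mono_measure _ hν).trans (le_of_eq ?_)
  exact eLpNorm_comp_measurePreserving (kern_continuous m).aestronglyMeasurable
    (Measure.measurePreserving_sub_left volume x)

theorem memLp_kernAt (m : ℕ) (x : R2) (ν : Measure R2) (hν : ν ≤ volume) :
    MemLp (kernAt m x) 2 ν := by
  refine ⟨((kern_continuous m).comp (by fun_prop)).aestronglyMeasurable, ?_⟩
  exact (eLpNorm_kernAt_le m x ν hν).trans_lt
    ((kern_continuous m).memLp_of_hasCompactSupport (kern_hasCompactSupport m)).2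

/-- A weakly null sequence in `H¹(Ω)` is strongly null in `L²` on compact subsets. -/
theorem tendsto_eLpNorm_of_weakly_null (hΩ : IsOpen Ω) {w : ℕ → H1 Ω} {C : ℝ}
    (hC : ∀ n, ‖w n‖ ≤ C) (hw : ∀ ψ : H1 Ω →L[ℝ] ℝ, Tendsto (fun n => ψ (w n)) atTop (𝓝 0))
    {K : Set R2} (hK : IsCompact K) (hKΩ : K ⊆ Ω) :
    Tendsto (fun n => eLpNorm (toLp (w n)) 2 (volume.restrict K)) atTop (𝓝 0) := by
  obtain ⟨d, hd0, hd⟩ := hK.exists_cthickening_subset_open hΩ hKΩ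
  set V : ℕ → R2 → ℝ := fun k => Ω.indicator (toLp (w k)) with hV
  have hvm : ∀ k, MemLp (toLp (w k)) 2 (volume.restrict Ω) := fun k => Lp.memLp _
  have hC0 : 0 ≤ C := (norm_nonneg _).trans (hC 0)
  have hpd : ∀ k j, eLpNorm (pd j (w k)) 2 (volume.restrict Ω) ≤ ENNReal.ofReal C := by
    intro k j
    rw [← Lp.enorm_def, ← ofReal_norm]
    exact ENNReal.ofReal_le_ofReal ((norm_pd_le j (w k)).trans (hC k))
  -- At a fixed scale the value at `x` is a continuous functional of `w k`, so it tends to zero; the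
  -- `L²` norm of the kernel bounds it uniformly in `x` and `k`.
  have hsm : ∀ m : ℕ, Tendsto (fun k => eLpNorm (moll m (V k)) 2 (volume.restrict K)) atTop
      (𝓝 0) := by
    intro m
    have hval : ∀ k x, moll m (V k) x =
        inner ℝ ((memLp_kernAt m x (volume.restrict Ω) Measure.restrict_le_self).toLp _)
          (toLp (w k)) := by
      intro k x
      rw [hV, moll_ind hΩ, integral_mul_eq_inner]
    have hfin : eLpNorm (kern m) 2 volume < ⊤ :=
      ((kern_continuous m).memLp_of_hasCompactSupport (kern_hasCompactSupport m)).2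
    have : IsFiniteMeasure (volume.restrict K) := ⟨by simpa using hK.measure_lt_top⟩
    refine tendsto_eLpNorm_zero_of_dominated (g := fun _ => (eLpNorm (kern m) 2 volume).toReal * C)
      (fun k => (moll_contDiff (locInt_ind hΩ (hvm k)) m).continuous.aestronglyMeasurable)
      (memLp_const _) ?_ ?_
    · refine fun k => Eventually.of_forall fun x => ?_
      rw [hval, ← Real.norm_eq_abs]
      refine (norm_inner_le_norm _ _).trans ?_
      gcongr
      · rw [Lp.norm_toLp]
        exact ENNReal.toReal_mono hfin.ne (eLpNorm_kernAt_le m x _ Measure.restrict_le_self)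
      · exact (norm_toLp_le _).trans (hC k)
    · refine Eventually.of_forall fun x => ?_
      have := hw (pairL ((memLp_kernAt m x (volume.restrict Ω)
        Measure.restrict_le_self).toLp _) none)
      simpa only [hval, pairL_apply, coord_none] using this
  rw [ENNReal.tendsto_nhds_zero]
  intro ε hε
  have hlim : Tendsto (fun m : ℕ => ENNReal.ofReal (1 / (m + 1 : ℝ)) *
      (ENNReal.ofReal C + ENNReal.ofReal C)) atTop (𝓝 0) := by
    have h1 : Tendsto (fun m : ℕ => ENNReal.ofReal (1 / (m + 1 : ℝ))) atTop (𝓝 0) := by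
      simpa using ENNReal.tendsto_ofReal tendsto_one_div_nat
    simpa using ENNReal.Tendsto.mul_const h1
      (Or.inr (ENNReal.add_ne_top.2 ⟨ENNReal.ofReal_ne_top, ENNReal.ofReal_ne_top⟩))
  have hε2 : 0 < ε / 2 := ENNReal.half_pos hε.ne'
  -- The scale is fixed first, the mollification error being uniform in `k`; only then does `k` go
  -- to infinity.
  obtain ⟨m, hm1, hm2⟩ := ((eventually_one_div_lt (half_pos hd0)).and
    (ENNReal.tendsto_nhds_zero.1 hlim (ε / 2) hε2)).exists
  filter_upwards [ENNReal.tendsto_nhds_zero.1 (hsm m) (ε / 2) hε2] with k hk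
  have e1 : eLpNorm (toLp (w k)) 2 (volume.restrict K) = eLpNorm (V k) 2 (volume.restrict K) := by
    refine eLpNorm_congr_ae ((ae_restrict_iff' hK.measurableSet).2 (Eventually.of_forall fun x hx => ?_))
    simp [hV, hKΩ hx]
  have hcont := (moll_contDiff (locInt_ind hΩ (hvm k)) m).continuous
  have e2 : V k = moll m (V k) - (moll m (V k) - V k) := by simp
  rw [e1, e2]
  calc _ ≤ eLpNorm (moll m (V k)) 2 (volume.restrict K) +
        eLpNorm (moll m (V k) - V k) 2 (volume.restrict K) :=
        eLpNorm_sub_le hcont.aestronglyMeasurable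
          (hcont.aestronglyMeasurable.sub (memLp_ind hΩ (hvm k)).1.restrict) (by norm_num)
    _ ≤ ε / 2 + ε / 2 := by
        refine add_le_add hk ?_
        refine (eLpNorm_moll_sub_le hΩ (hvm k) (fun j => Lp.memLp (pd j (w k)))
          (isWeakPartial_pd (w k)) hK.measurableSet hd0 hd hm1.le).trans (le_trans ?_ hm2)
        gcongr <;> exact hpd k _
    _ = ε := ENNReal.add_halves ε

end Rellich

/-! ### Almost everywhere convergence and the chain rule -/

section Chain

variable {Ω : Set R2}

/-- A bounded sequence that converges weakly in `H¹(Ω)` has a subsequence converging a.e. -/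
theorem exists_subseq_ae_of_weakly_convergent (hΩ : IsOpen Ω) (hb : Bornology.IsBounded Ω)
    {w : ℕ → H1 Ω} {w₀ : H1 Ω} {C : ℝ} (hC : ∀ n, ‖w n‖ ≤ C)
    (hw : ∀ ψ : H1 Ω →L[ℝ] ℝ, Tendsto (fun n => ψ (w n)) atTop (𝓝 (ψ w₀))) :
    ∃ ns : ℕ → ℕ, StrictMono ns ∧ ∀ᵐ x ∂(volume.restrict Ω),
      Tendsto (fun k => toLp (w (ns k)) x) atTop (𝓝 (toLp w₀ x)) := by
  have hfin : volume Ω < ⊤ := hb.measure_lt_top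
  have hK : ∀ K, IsCompact K → K ⊆ Ω →
      Tendsto (fun n => eLpNorm (toLp (w n - w₀)) 2 (volume.restrict K)) atTop (𝓝 0) := by
    intro K hK hKΩ
    refine tendsto_eLpNorm_of_weakly_null hΩ (C := C + ‖w₀‖) (fun n => ?_) (fun ψ => ?_) hK hKΩ
    · exact (norm_sub_le _ _).trans (by gcongr; exact hC n)
    · have := (hw ψ).sub_const (ψ w₀)
      simpa using this
  have hm : TendstoInMeasure (volume.restrict Ω) (fun n => (toLp (w n) : R2 → ℝ)) atTop
      (toLp w₀) := by
    intro ε hε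
    rw [ENNReal.tendsto_nhds_zero]
    intro η hη
    -- Convergence in measure needs no estimate near the boundary: the layer outside a compact
    -- subset is simply small in measure.
    obtain ⟨K, hKΩ, hKc, hKd⟩ := hΩ.measurableSet.exists_isCompact_sdiff_lt hfin.ne
      (ENNReal.half_pos hη.ne').ne'
    have h1 : TendstoInMeasure (volume.restrict K) (fun n => (toLp (w n - w₀) : R2 → ℝ)) atTop
        (fun _ => 0) := by
      refine tendstoInMeasure_of_tendsto_eLpNorm (p := 2) (by norm_num)
        (fun n => (Lp.aestronglyMeasurable _).mono_measure
          (Measure.restrict_mono hKΩ le_rfl)) aestronglyMeasurable_const ?_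
      refine (hK K hKc hKΩ).congr fun n => ?_
      congr 1
      ext x; simp
    filter_upwards [ENNReal.tendsto_nhds_zero.1 (h1 ε hε) (η / 2) (ENNReal.half_pos hη.ne')]
      with n hn
    have h2 : (volume.restrict Ω) {x | ε ≤ edist (toLp (w n) x) (toLp w₀ x)} ≤
        (volume.restrict Ω) {x | ε ≤ edist (toLp (w n - w₀) x) 0} := by
      refine measure_mono_ae ?_
      filter_upwards [Lp.coeFn_sub (toLp (w n)) (toLp w₀)] with x hx hx'
      change ε ≤ edist (toLp (w n - w₀) x) 0
      rw [toLp_sub, hx, Pi.sub_apply, edist_zero_right, ← edist_eq_enorm_sub]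
      exact hx'
    refine h2.trans ?_
    have h3 : (volume.restrict Ω) ≤ volume.restrict K + volume.restrict (Ω \ K) := by
      exact (Measure.restrict_mono (by simp) le_rfl).trans (Measure.restrict_union_le K (Ω \ K))
    refine (h3 _).trans ?_
    rw [Measure.add_apply, ← ENNReal.add_halves η]
    refine add_le_add hn ?_
    refine (measure_mono (Set.subset_univ _)).trans ?_
    simpa using hKd.le
  exact hm.exists_seq_tendsto_ae

/-- The chain rule in `H¹(Ω)`. -/
theorem exists_comp (hΩ : IsOpen Ω) (z : H1 Ω) {β : ℝ → ℝ} (hβ : ContDiff ℝ 1 β) (hβ0 : β 0 = 0)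
    {M : ℝ≥0} (hM : ∀ s, |deriv β s| ≤ M) :
    ∃ w : H1 Ω, (∀ᵐ x ∂(volume.restrict Ω), toLp w x = β (toLp z x)) ∧
      ∀ j, ∀ᵐ x ∂(volume.restrict Ω), pd j w x = deriv β (toLp z x) * pd j z x := by
  have hβd : Differentiable ℝ β := hβ.differentiable (by simp)
  have hβ' : Continuous (deriv β) := hβ.continuous_deriv (by simp)
  have hLip : LipschitzWith M β := lipschitzWith_of_nnnorm_deriv_le hβd fun s => by
    rw [← NNReal.coe_le_coe]; exact hM s
  have hz : MemLp (toLp z) 2 (volume.restrict Ω) := Lp.memLp _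
  have hzG : ∀ j, MemLp (pd j z) 2 (volume.restrict Ω) := fun j => Lp.memLp _
  have hv : MemLp (fun x => β (toLp z x)) 2 (volume.restrict Ω) := hLip.comp_memLp hβ0 hz
  have hG : ∀ j, MemLp (fun x => deriv β (toLp z x) * pd j z x) 2 (volume.restrict Ω) := by
    intro j
    refine MemLp.of_le_mul (c := M) (hzG j)
      ((hβ'.comp_aestronglyMeasurable hz.1).mul (hzG j).1) (Eventually.of_forall fun x => ?_)
    rw [norm_mul]
    gcongr
    exact hM _
  have hw : ∀ j, IsWeakPartial Ω j (fun x => β (toLp z x))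
      (fun x => deriv β (toLp z x) * pd j z x) := by
    intro j φ hφ
    set V := Ω.indicator (toLp z) with hV
    set G := Ω.indicator (pd j z) with hGdef
    have hVm : MemLp V 2 volume := memLp_ind hΩ hz
    have hGm : MemLp G 2 volume := memLp_ind hΩ (hzG j)
    have hsd : ∀ n, ContDiff ℝ ∞ (moll n V) := fun n => moll_contDiff (locInt_ind hΩ hz) n
    have hgd : ∀ n, ContDiff ℝ ∞ (moll n G) := fun n => moll_contDiff (locInt_ind hΩ (hzG j)) n
    have hsm : ∀ n, MemLp (moll n V) 2 volume := fun n =>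
      ⟨(hsd n).continuous.aestronglyMeasurable, (eLpNorm_moll_le hVm.1 n).trans_lt hVm.2⟩
    have hgm : ∀ n, MemLp (moll n G) 2 volume := fun n =>
      ⟨(hgd n).continuous.aestronglyMeasurable, (eLpNorm_moll_le hGm.1 n).trans_lt hGm.2⟩
    have hVc := tendsto_moll_ind hΩ hz
    have hGc := tendsto_moll_ind hΩ (hzG j)
    -- As `deriv β` is merely continuous, the factor `deriv β (moll n V)` converges only where `moll
    -- n V` does, hence the a.e. convergent subsequence.
    obtain ⟨ns, hns, hae⟩ := exists_subseq_ae_tendsto (fun n => (hsm n).1) hVm.1 hVc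
    have hφ' := hφ.partialDeriv (ee j)
    have lim1 : Tendsto (fun n => ∫ x, fderiv ℝ φ x (ee j) * β (moll n V x)) atTop
        (𝓝 (∫ x, fderiv ℝ φ x (ee j) * β (V x))) := by
      refine tendsto_integral_mul (fun _ => hφ'.memLp _) (fun n => hLip.comp_memLp hβ0 (hsm n))
        (hφ'.memLp _) (hLip.comp_memLp hβ0 hVm) (by simp) ?_
      refine tendsto_eLpNorm_mono (C := M) (by simp) (Eventually.of_forall fun n => ?_) hVc
      refine eLpNorm_le_nnreal_smul_eLpNorm_of_ae_le_mul (Eventually.of_forall fun x => ?_) 2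
      exact hLip.dist_le_mul (moll n V x) (V x)
    have lim2 : Tendsto (fun i => ∫ x, (φ x * deriv β (moll (ns i) V x)) * moll (ns i) G x) atTop
        (𝓝 (∫ x, (φ x * deriv β (V x)) * G x)) := by
      have hb : ∀ f : R2 → ℝ, AEStronglyMeasurable f volume →
          MemLp (fun x => φ x * deriv β (f x)) 2 volume := fun f hf =>
        MemLp.of_le_mul (c := M) (hφ.memLp _)
          (hφ.continuous.aestronglyMeasurable.mul (hβ'.comp_aestronglyMeasurable hf))
          (Eventually.of_forall fun x => by
            rw [norm_mul, mul_comm]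
            gcongr
            exact hM _)
      refine tendsto_integral_mul (fun n => hb _ (hsm _).1) (fun n => hgm _) (hb _ hVm.1) hGm ?_
        (hGc.comp hns.tendsto_atTop)
      refine tendsto_eLpNorm_zero_of_dominated (g := fun x => (2 * M) * |φ x|)
        (fun n => ((hb _ (hsm _).1).sub (hb _ hVm.1)).1)
        ((hφ.memLp volume).norm.const_mul _) ?_ ?_
      · refine fun n => Eventually.of_forall fun x => ?_
        simp only [Pi.sub_apply, ← mul_sub, abs_mul]
        rw [mul_comm]
        gcongr
        refine (abs_sub _ _).trans ?_
        linarith [hM (moll (ns n) V x), hM (V x)]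
      · filter_upwards [hae] with x hx
        have h1 := ((hβ'.tendsto _).comp hx).const_mul (φ x)
        have h2 := h1.sub_const (φ x * deriv β (V x))
        simpa using h2
    obtain ⟨d, hd0, hd⟩ := hφ.2.1.isCompact.exists_cthickening_subset_open hΩ hφ.2.2
    -- On the support of `φ` the mollification is smooth and its derivative is the mollified weak
    -- derivative, so the classical chain rule and integration by parts apply.
    have heq : ∀ᶠ n : ℕ in atTop, ∫ x, fderiv ℝ φ x (ee j) * β (moll n V x) =
        - ∫ x, (φ x * deriv β (moll n V x)) * moll n G x := by
      filter_upwards [eventually_one_div_lt hd0] with n hn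
      have h1 := integral_mul_fderiv_eq (hφ.1.of_le (by simp)) (hβ.comp ((hsd n).of_le (by simp)))
        hφ.2.1 (ee j)
      refine (neg_eq_iff_eq_neg.2 h1).symm.trans (congrArg Neg.neg ?_)
      refine integral_congr_ae (Eventually.of_forall fun x => ?_)
      simp only
      by_cases hx : x ∈ tsupport φ
      · have h2 := (isWeakPartial_pd z j).fderiv_moll hΩ hz
          ((closedBall_subset_cthickening hx _).trans ((cthickening_mono hn.le _).trans hd))
        have h3 : HasFDerivAt (β ∘ moll n V) (deriv β (moll n V x) • fderiv ℝ (moll n V) x) x :=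
          (hβd (moll n V x)).hasDerivAt.comp_hasFDerivAt x
            ((hsd n).differentiable (by simp) x).hasFDerivAt
        rw [h3.fderiv, _root_.smul_apply, h2, smul_eq_mul, mul_assoc]
      · simp [image_eq_zero_of_notMem_tsupport hx]
    have hfinal := tendsto_nhds_unique ((lim1.congr' heq).comp hns.tendsto_atTop)
      (lim2.neg)
    have e1 : ∫ x, fderiv ℝ φ x (ee j) * β (V x) = ∫ x in Ω, fderiv ℝ φ x (ee j) * β (toLp z x) := by
      rw [← integral_mul_ind hΩ]
      refine integral_congr_ae (Eventually.of_forall fun x => ?_)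
      by_cases hx : x ∈ Ω <;> simp [hV, hx, hβ0]
    have e2 : ∫ x, (φ x * deriv β (V x)) * G x =
        ∫ x in Ω, φ x * (deriv β (toLp z x) * pd j z x) := by
      rw [← integral_mul_ind hΩ]
      refine integral_congr_ae (Eventually.of_forall fun x => ?_)
      by_cases hx : x ∈ Ω <;> simp [hV, hGdef, hx, mul_assoc]
    rw [e1, e2] at hfinal
    exact hfinal
  exact ⟨mkSob _ _ hv hG hw, toLp_mkSob hv hG hw, pd_mkSob hv hG hw⟩

end Chain

/-! ### Rigid displacements -/

/-- The mollifications have zero gradient on slightly smaller concentric balls, hence are constant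
there, and they converge a.e. along a subsequence. -/
theorem ae_eq_const_of_weak_gradient_zero {c : R2} {r : ℝ} (hr : 0 < r) {v : R2 → ℝ}
    (hv : MemLp v 2 (volume.restrict (ball c r)))
    (h : ∀ j, IsWeakPartial (ball c r) j v (fun _ => 0)) :
    ∃ a, ∀ᵐ x ∂(volume.restrict (ball c r)), v x = a := by
  have hB : IsOpen (ball c r) := isOpen_ball
  set V := (ball c r).indicator v with hV
  have hVm : MemLp V 2 volume := memLp_ind hB hv
  have hsd : ∀ n, ContDiff ℝ ∞ (moll n V) := fun n => moll_contDiff (locInt_ind hB hv) n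
  have hconst : ∀ (n : ℕ) (x y : R2), dist x c < r - 1 / (n + 1 : ℝ) →
      dist y c < r - 1 / (n + 1 : ℝ) → moll n V x = moll n V y := by
    intro n x y hx hy
    refine isOpen_ball.is_const_of_fderiv_eq_zero (𝕜 := ℝ) (s := ball c (r - 1 / (n + 1 : ℝ)))
      (convex_ball _ _).isPreconnected ((hsd n).differentiable (by simp)).differentiableOn
      (fun w hw => ?_) hx hy
    have hw' : closedBall w (1 / (n + 1 : ℝ)) ⊆ ball c r := by
      refine closedBall_subset_ball' ?_
      have := mem_ball.1 hw
      linarith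
    have h0 : ∀ j, fderiv ℝ (moll n V) w (ee j) = 0 := fun j => by
      rw [(h j).fderiv_moll hB hv hw', moll_ind hB]
      simp
    have := norm_fderiv_le (s := moll n V) w
    rw [h0, h0, abs_zero, add_zero] at this
    simpa using this
  obtain ⟨ns, hns, hae⟩ := exists_subseq_ae_tendsto
    (fun n => (hsd n).continuous.aestronglyMeasurable) hVm.1 (tendsto_moll_ind hB hv)
  have hpos : 0 < volume (ball c (r / 2)) := measure_ball_pos _ _ (by positivity)
  -- A reference point of convergence; the limit at any other point of convergence in the ball must
  -- agree with the value here.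
  obtain ⟨x₀, hx₀, hx₀c⟩ : ∃ x₀ ∈ ball c (r / 2),
      Tendsto (fun i => moll (ns i) V x₀) atTop (𝓝 (V x₀)) := by
    have hne : (ae (volume.restrict (ball c (r / 2)))).NeBot := by
      rw [ae_neBot, Ne, Measure.restrict_eq_zero]
      exact hpos.ne'
    obtain ⟨x, hx⟩ := ((ae_restrict_mem isOpen_ball.measurableSet).and
      (ae_restrict_of_ae (s := ball c (r / 2)) hae)).exists
    exact ⟨x, hx.1, hx.2⟩
  refine ⟨V x₀, (ae_restrict_iff' hB.measurableSet).2 ?_⟩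
  filter_upwards [hae] with x hx hxB
  have e : V x = v x := by simp [hV, Set.indicator_of_mem hxB]
  rw [← e]
  refine tendsto_nhds_unique hx (hx₀c.congr' ?_)
  have h1 : ∀ w ∈ ball c r, ∀ᶠ i in atTop, dist w c < r - 1 / ((ns i : ℕ) + 1 : ℝ) := by
    intro w hw
    have := hns.tendsto_atTop.eventually (eventually_one_div_lt (sub_pos.2 (mem_ball.1 hw)))
    filter_upwards [this] with i hi
    linarith
  filter_upwards [h1 x hxB, h1 x₀ (ball_subset_ball (by linarith) hx₀)] with i hi hi'
  exact hconst _ _ _ hi' hi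

/-! ### Calculus of scalar weak derivatives -/

section WeakCalculus

variable {Ω : Set R2}

theorem integrable_test_mul {φ v : R2 → ℝ} (hφ : IsTest Ω φ) (hv : MemLp v 2 (volume.restrict Ω)) :
    IntegrableOn (fun x => φ x * v x) Ω := (hφ.memLp _).integrable_mul hv

theorem isWeakPartial_iff {j : Fin 2} {v G : R2 → ℝ} : IsWeakPartial Ω j v G ↔
    ∀ φ, IsTest Ω φ → ∫ x in Ω, fderiv ℝ φ x (ee j) * v x = - ∫ x in Ω, φ x * G x := Iff.rfl

theorem IsWeakPartial.add {j : Fin 2} {v G v' G' : R2 → ℝ} (h : IsWeakPartial Ω j v G)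
    (h' : IsWeakPartial Ω j v' G') (hv : MemLp v 2 (volume.restrict Ω))
    (hG : MemLp G 2 (volume.restrict Ω)) (hv' : MemLp v' 2 (volume.restrict Ω))
    (hG' : MemLp G' 2 (volume.restrict Ω)) :
    IsWeakPartial Ω j (fun x => v x + v' x) (fun x => G x + G' x) := by
  rw [isWeakPartial_iff] at *
  intro φ hφ
  simp only [mul_add]
  rw [integral_add (integrable_test_mul (hφ.partialDeriv _) hv)
    (integrable_test_mul (hφ.partialDeriv _) hv'), h φ hφ, h' φ hφ,
    integral_add (integrable_test_mul hφ hG) (integrable_test_mul hφ hG')]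
  ring

theorem isWeakPartial_of_contDiff {f : R2 → ℝ} (hf : ContDiff ℝ 1 f) (j : Fin 2) :
    IsWeakPartial Ω j f (fun x => fderiv ℝ f x (ee j)) := by
  rw [isWeakPartial_iff]
  intro φ hφ
  have := integral_mul_fderiv_eq (hφ.1.of_le (by simp)) hf hφ.2.1 (ee j)
  rw [setIntegral_mul_of_tsupport hφ.2.2, setIntegral_mul_of_tsupport (hφ.partialDeriv _).2.2, this,
    neg_neg]

theorem fderiv_fderiv_comm {φ : R2 → ℝ} (hφ : ContDiff ℝ ∞ φ) (x a b : R2) :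
    fderiv ℝ (fun y => fderiv ℝ φ y a) x b = fderiv ℝ (fun y => fderiv ℝ φ y b) x a := by
  have hd : DifferentiableAt ℝ (fderiv ℝ φ) x :=
    (hφ.fderiv_right (m := ∞) (by simp)).differentiable (by simp) x
  have key : ∀ a b : R2, fderiv ℝ (fun y => fderiv ℝ φ y a) x b =
      fderiv ℝ (fderiv ℝ φ) x b a := by
    intro a b
    rw [fderiv_clm_apply hd (differentiableAt_const a)]
    simp
  rw [key, key]
  exact (hφ.contDiffAt.isSymmSndFDerivAt (by simp; exact WithTop.coe_le_coe.2 le_top)) b a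

end WeakCalculus

/-- A displacement on a disc whose weak strain vanishes is a rigid displacement. -/
theorem ae_rigid_of_strain_zero {c : R2} {r : ℝ} (hr : 0 < r) {v : Fin 2 → R2 → ℝ}
    {G : Fin 2 → Fin 2 → R2 → ℝ} (hv : ∀ a, MemLp (v a) 2 (volume.restrict (ball c r)))
    (hG : ∀ j a, MemLp (G j a) 2 (volume.restrict (ball c r)))
    (h : ∀ j a, IsWeakPartial (ball c r) j (v a) (G j a))
    (h00 : ∀ᵐ x ∂(volume.restrict (ball c r)), G 0 0 x = 0)
    (h11 : ∀ᵐ x ∂(volume.restrict (ball c r)), G 1 1 x = 0)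
    (h01 : ∀ᵐ x ∂(volume.restrict (ball c r)), G 1 0 x = - G 0 1 x) :
    ∃ α β γ : ℝ, ∀ᵐ x ∂(volume.restrict (ball c r)),
      v 0 x = α - γ * x 1 ∧ v 1 x = β + γ * x 0 := by
  set B := ball c r with hBdef
  have hB : IsOpen B := isOpen_ball
  have hfinB : IsFiniteMeasure (volume.restrict B) := ⟨by simpa using measure_ball_lt_top⟩
  have hcongr : ∀ (φ f g : R2 → ℝ), f =ᵐ[volume.restrict B] g →
      ∫ x in B, φ x * f x = ∫ x in B, φ x * g x := fun φ f g hfg =>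
    integral_congr_ae (by filter_upwards [hfg] with x hx; rw [hx])
  -- The rotation has zero weak gradient: every derivative of `∂₀v₁` can be written through
  -- derivatives of strain components, by exchanging the order of two derivatives on the test
  -- function.
  have key : ∀ j, IsWeakPartial B j (G 0 1) (fun _ => 0) := by
    intro j
    rw [isWeakPartial_iff]
    intro φ hφ
    simp only [mul_zero, integral_zero, neg_zero]
    fin_cases j
    · have e1 : ∫ x in B, fderiv ℝ φ x (ee 0) * G 1 0 x = 0 := by
        have a1 := isWeakPartial_iff.1 (h 1 0) _ (hφ.partialDeriv (ee 0))
        have a2 := isWeakPartial_iff.1 (h 0 0) _ (hφ.partialDeriv (ee 1))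
        rw [hcongr _ _ _ h00] at a2
        simp only [mul_zero, integral_zero, neg_zero] at a2
        simp only [fun x => fderiv_fderiv_comm hφ.1 x (ee 1) (ee 0)] at a2
        rw [a2] at a1
        linarith
      rw [hcongr _ _ _ h01] at e1
      simp only [mul_neg, integral_neg, neg_eq_zero] at e1
      exact e1
    · have a1 := isWeakPartial_iff.1 (h 0 1) _ (hφ.partialDeriv (ee 1))
      have a2 := isWeakPartial_iff.1 (h 1 1) _ (hφ.partialDeriv (ee 0))
      rw [hcongr _ _ _ h11] at a2
      simp only [mul_zero, integral_zero, neg_zero] at a2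
      simp only [fun x => fderiv_fderiv_comm hφ.1 x (ee 0) (ee 1)] at a2
      rw [a2] at a1
      exact neg_eq_zero.1 a1.symm
  obtain ⟨γ, hγ⟩ := ae_eq_const_of_weak_gradient_zero hr (hG 0 1) key
  have hlin : ∀ (κ : ℝ) (i : Fin 2), ContDiff ℝ ∞ fun x : R2 => κ * x i := fun κ i =>
    contDiff_const.mul (EuclideanSpace.proj i : R2 →L[ℝ] ℝ).contDiff
  have hdlin : ∀ (κ : ℝ) (i j : Fin 2) (x : R2), fderiv ℝ (fun x : R2 => κ * x i) x (ee j) =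
      κ * (if i = j then 1 else 0) := by
    intro κ i j x
    have : HasFDerivAt (fun x : R2 => κ * x i) (κ • (EuclideanSpace.proj i : R2 →L[ℝ] ℝ)) x :=
      (EuclideanSpace.proj i : R2 →L[ℝ] ℝ).hasFDerivAt.const_mul κ
    rw [this.fderiv]
    simp
  have hlm : ∀ (κ : ℝ) (i : Fin 2), MemLp (fun x : R2 => κ * x i) 2 (volume.restrict B) := by
    intro κ i
    obtain ⟨M, hM⟩ := (isCompact_closedBall c r).exists_bound_of_continuousOn
      (hlin κ i).continuous.continuousOn
    refine MemLp.of_bound (hlin κ i).continuous.aestronglyMeasurable M ?_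
    exact (ae_restrict_iff' hB.measurableSet).2
      (Eventually.of_forall fun x hx => hM x (ball_subset_closedBall hx))
  have hdm : ∀ (κ : ℝ) (i j : Fin 2), MemLp (fun x : R2 =>
      fderiv ℝ (fun x : R2 => κ * x i) x (ee j)) 2 (volume.restrict B) := by
    intro κ i j
    simp only [hdlin]
    exact memLp_const _
  -- With the rotation constant, adding the right multiple of a coordinate to each component cancels
  -- its whole gradient.
  have fin : ∀ (a i : Fin 2) (κ : ℝ),
      (∀ j, ∀ᵐ x ∂(volume.restrict B), G j a x + κ * (if i = j then 1 else 0) = 0) →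
      ∃ α, ∀ᵐ x ∂(volume.restrict B), v a x + κ * x i = α := by
    intro a i κ hz
    refine ae_eq_const_of_weak_gradient_zero hr ((hv a).add (hlm κ i)) fun j => ?_
    refine isWeakPartial_congr ((h j a).add (isWeakPartial_of_contDiff
      ((hlin κ i).of_le (by simp)) j) (hv a) (hG j a) (hlm κ i) (hdm κ i j)) EventuallyEq.rfl ?_
    filter_upwards [hz j] with x hx
    rw [hdlin]
    exact hx
  obtain ⟨α, hα⟩ := fin 0 1 γ (fun j => by
    fin_cases j
    · filter_upwards [h00] with x hx
      simp [hx]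
    · filter_upwards [h01, hγ] with x hx hx'
      simp [hx, hx'])
  obtain ⟨β, hβ⟩ := fin 1 0 (-γ) (fun j => by
    fin_cases j
    · filter_upwards [hγ] with x hx
      simp [hx]
    · filter_upwards [h11] with x hx
      simp [hx])
  refine ⟨α, β, γ, ?_⟩
  filter_upwards [hα, hβ] with x h1 h2
  constructor <;> linarith

/-- A rigid displacement that vanishes a.e. on a nonempty open set is zero. -/
theorem rigid_eq_zero {O : Set R2} (hO : IsOpen O) (hne : O.Nonempty) {α β γ : ℝ}
    (h : ∀ᵐ x ∂(volume.restrict O), α - γ * x 1 = 0 ∧ β + γ * x 0 = 0) :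
    α = 0 ∧ β = 0 ∧ γ = 0 := by
  have hp : ∀ i : Fin 2, Continuous fun x : R2 => x i := fun i =>
    (EuclideanSpace.proj i : R2 →L[ℝ] ℝ).continuous
  have c0 := hp 0
  have c1 := hp 1
  have h1 : Set.EqOn (fun x : R2 => α - γ * x 1) (fun _ => 0) O :=
    Measure.eqOn_open_of_ae_eq (by filter_upwards [h] with x hx using hx.1) hO (by fun_prop)
      (by fun_prop)
  have h2 : Set.EqOn (fun x : R2 => β + γ * x 0) (fun _ => 0) O :=
    Measure.eqOn_open_of_ae_eq (by filter_upwards [h] with x hx using hx.2) hO (by fun_prop)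
      (by fun_prop)
  obtain ⟨x, hx⟩ := hne
  obtain ⟨ε, hε, hb⟩ := Metric.isOpen_iff.1 hO x hx
  -- Two points of `O` that differ only in the first coordinate isolate `γ` in the second equation.
  have hy : x + (ε / 2) • ee 0 ∈ O := by
    refine hb ?_
    rw [mem_ball, dist_eq_norm]
    simp [norm_smul, abs_of_pos hε]
    linarith
  have e1 := h1 hx
  have e2 := h2 hx
  have e3 := h2 hy
  simp at e1 e2 e3
  have hγ : γ = 0 := by
    have : γ * (ε / 2) = 0 := by linarith
    rcases mul_eq_zero.1 this with h | h
    · exact h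
    · linarith
  subst hγ
  simp at e1 e2
  exact ⟨e1, e2, rfl⟩

/-! ### Transversal vector fields on Lipschitz domains -/

/-- Convolution with a probability density keeps the Lipschitz constant. A kernel of radius `η / (3
(K + 1))` moves `γ` by at most `η / 3`, and adding `η / 2` lifts the result strictly above. Lying
above the graph keeps the supports of the fields built from it inside `Ω`. -/
theorem exists_smooth_lipschitz_above {γ : ℝ → ℝ} {K : ℝ≥0} (hγ : LipschitzWith K γ) {η : ℝ}
    (hη : 0 < η) : ∃ g : ℝ → ℝ, ContDiff ℝ ∞ g ∧ (∀ s, |deriv g s| ≤ K) ∧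
      ∀ s, γ s < g s ∧ g s ≤ γ s + η := by
  have hr : 0 < η / (3 * (K + 1)) := by positivity
  let b : ContDiffBump (0 : ℝ) := ⟨η / (3 * (K + 1)) / 2, η / (3 * (K + 1)), by positivity,
    by linarith⟩
  set f : ℝ → ℝ := convolution (b.normed volume) γ (ContinuousLinearMap.lsmul ℝ ℝ) volume with hf
  have hfd : ContDiff ℝ ∞ f := b.hasCompactSupport_normed.contDiff_convolution_left (n := ⊤)
    (ContinuousLinearMap.lsmul ℝ ℝ) b.contDiff_normed hγ.continuous.locallyIntegrable
  have hclose : ∀ s, |f s - γ s| ≤ η / 3 := by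
    intro s
    rw [← Real.dist_eq]
    refine b.dist_normed_convolution_le hγ.continuous.aestronglyMeasurable fun x hx => ?_
    refine (hγ.dist_le_mul x s).trans ?_
    have h1 : dist x s < η / (3 * (K + 1)) := mem_ball.1 hx
    have h2 : (K : ℝ) * (η / (3 * (K + 1))) ≤ η / 3 := by
      rw [mul_div_assoc', div_le_div_iff₀ (by positivity) (by positivity)]
      nlinarith [K.2]
    exact (mul_le_mul_of_nonneg_left h1.le K.2).trans h2
  have hint : ∀ s, Integrable fun t => b.normed volume t * γ (s - t) := by
    intro s
    have := hγ.continuous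
    have := (b.contDiff_normed (μ := volume) (n := 0)).continuous
    exact Continuous.integrable_of_hasCompactSupport (by fun_prop)
      b.hasCompactSupport_normed.mul_right
  have hLip : LipschitzWith K f := by
    refine LipschitzWith.of_dist_le_mul fun x y => ?_
    rw [hf, Real.dist_eq]
    simp only [convolution_def, ContinuousLinearMap.lsmul_apply, smul_eq_mul]
    rw [← integral_sub (hint x) (hint y)]
    have h1 : ∀ t, ‖b.normed volume t * γ (x - t) - b.normed volume t * γ (y - t)‖ ≤
        b.normed volume t * (K * dist x y) := by
      intro t
      rw [← mul_sub, norm_mul, Real.norm_of_nonneg (b.nonneg_normed t)]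
      refine mul_le_mul_of_nonneg_left ?_ (b.nonneg_normed t)
      rw [← dist_eq_norm]
      refine (hγ.dist_le_mul _ _).trans (by simp)
    refine (norm_integral_le_of_norm_le (b.integrable_normed.mul_const _)
      (Eventually.of_forall h1)).trans ?_
    rw [integral_mul_const, b.integral_normed, one_mul]
  refine ⟨fun s => f s + η / 2, hfd.add contDiff_const, fun s => ?_, fun s => ?_⟩
  · rw [deriv_add_const]
    exact norm_deriv_le_of_lipschitz hLip
  · have := abs_le.1 (hclose s)
    constructor <;> linarith [this.1, this.2]

/-- A smooth function that vanishes on `(-∞, 0]` and is the identity on `[1, ∞)`. -/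
noncomputable def ramp (s : ℝ) : ℝ := s * Real.smoothTransition s

theorem ramp_contDiff : ContDiff ℝ ∞ ramp := contDiff_id.mul Real.smoothTransition.contDiff

theorem ramp_nonpos {s : ℝ} (h : s ≤ 0) : ramp s = 0 := by
  rw [ramp, Real.smoothTransition.zero_of_nonpos h, mul_zero]

theorem ramp_one_le {s : ℝ} (h : 1 ≤ s) : ramp s = s := by
  rw [ramp, Real.smoothTransition.one_of_one_le h, mul_one]

theorem abs_ramp_le (s : ℝ) : |ramp s| ≤ |s| := by
  rw [ramp, abs_mul, abs_of_nonneg (Real.smoothTransition.nonneg s)]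
  exact mul_le_of_le_one_right (abs_nonneg s) (Real.smoothTransition.le_one s)

theorem deriv_ramp_of_one_lt {s : ℝ} (h : 1 < s) : deriv ramp s = 1 := by
  have : ramp =ᶠ[𝓝 s] id := by
    filter_upwards [lt_mem_nhds h] with t ht using ramp_one_le ht.le
  rw [this.deriv_eq]
  exact deriv_id s

theorem deriv_ramp_of_neg {s : ℝ} (h : s < 0) : deriv ramp s = 0 := by
  have : ramp =ᶠ[𝓝 s] fun _ => 0 := by
    filter_upwards [gt_mem_nhds h] with t ht using ramp_nonpos ht.le
  rw [this.deriv_eq]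
  exact deriv_const s 0

theorem exists_bound_deriv_ramp : ∃ C : ℝ, 0 ≤ C ∧ ∀ s, |deriv ramp s| ≤ C := by
  obtain ⟨C, hC⟩ := (isCompact_Icc (a := (0 : ℝ)) (b := 1)).exists_bound_of_continuousOn
    (ramp_contDiff.continuous_deriv (by simp)).continuousOn
  refine ⟨max C 1, by positivity, fun s => ?_⟩
  rcases lt_or_ge s 0 with h | h
  · rw [deriv_ramp_of_neg h, abs_zero]; positivity
  rcases lt_or_ge 1 s with h' | h'
  · rw [deriv_ramp_of_one_lt h', abs_one]; exact le_max_right _ _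
  · exact (hC s ⟨h, h'⟩).trans (le_max_left _ _)

/-- The rescaled ramp. -/
noncomputable def rampN (m : ℕ) (s : ℝ) : ℝ := ramp ((m + 1) * s) / (m + 1)

theorem rampN_contDiff (m : ℕ) : ContDiff ℝ ∞ (rampN m) :=
  (ramp_contDiff.comp (contDiff_const.mul contDiff_id)).div_const _

theorem rampN_nonpos {m : ℕ} {s : ℝ} (h : s ≤ 0) : rampN m s = 0 := by
  rw [rampN, ramp_nonpos (mul_nonpos_of_nonneg_of_nonpos (by positivity) h), zero_div]

theorem abs_rampN_le (m : ℕ) (s : ℝ) : |rampN m s| ≤ |s| := by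
  have hm : (0 : ℝ) < m + 1 := by positivity
  rw [rampN, abs_div, abs_of_pos hm, div_le_iff₀ hm]
  refine (abs_ramp_le _).trans ?_
  rw [abs_mul, abs_of_pos hm, mul_comm]

theorem deriv_rampN (m : ℕ) (s : ℝ) : deriv (rampN m) s = deriv ramp ((m + 1) * s) := by
  have hm : (m + 1 : ℝ) ≠ 0 := by positivity
  have h1 : HasDerivAt ramp (deriv ramp ((m + 1) * s)) ((m + 1) * s) :=
    (ramp_contDiff.differentiable (by simp) _).hasDerivAt
  have h2 : HasDerivAt (fun s : ℝ => (m + 1 : ℝ) * s) (m + 1) s := by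
    simpa using (hasDerivAt_id s).const_mul (m + 1 : ℝ)
  have h3 := (h1.comp s h2).div_const (m + 1 : ℝ)
  rw [mul_div_cancel_right₀ _ hm] at h3
  exact h3.deriv

theorem eventually_rampN {s : ℝ} {t : ℕ → ℝ} (hs : 0 < s) (ht : Tendsto t atTop (𝓝 s)) :
    ∀ᶠ m in atTop, rampN m (t m) = t m ∧ deriv (rampN m) (t m) = 1 := by
  have h1 : ∀ᶠ m : ℕ in atTop, 1 / (m + 1 : ℝ) < s / 2 := eventually_one_div_lt (half_pos hs)
  filter_upwards [h1, ht.eventually (lt_mem_nhds (half_lt_self hs))] with m hm htm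
  have hm0 : (0 : ℝ) < m + 1 := by positivity
  have h2 : 1 < (m + 1 : ℝ) * t m := by
    rw [div_lt_iff₀ hm0] at hm
    nlinarith
  rw [deriv_rampN, deriv_ramp_of_one_lt h2, rampN, ramp_one_le h2.le]
  exact ⟨by field_simp, rfl⟩

theorem vec_eq_sum (v : R2) : v = v 0 • ee 0 + v 1 • ee 1 := by
  ext i; fin_cases i <;> simp

/-- A vector field that is transversal to a Lipschitz boundary near one point. -/
theorem exists_local_fields {Ω : Set R2} (hΩ : IsOpen Ω) {y : R2} (A : R2 ≃ₗᵢ[ℝ] R2)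
    {γ : ℝ → ℝ} {K : ℝ≥0} {r : ℝ} (hr : 0 < r) (hγ : LipschitzWith K γ)
    (hΩA : ∀ x ∈ ball y r, (x ∈ Ω ↔ γ (A x 0) < A x 1)) :
    ∃ (ρ M : ℝ) (X : ℕ → Fin 2 → R2 → ℝ) (d : R2 → ℝ), 0 < ρ ∧ 0 ≤ M ∧
      (∀ m i, IsTest Ω (X m i)) ∧ (∀ m i x, |X m i x| ≤ M) ∧
      (∀ m i j x, |fderiv ℝ (X m i) x (ee j)| ≤ M) ∧
      (∀ x ∈ Ω, Tendsto (fun m => fderiv ℝ (X m 0) x (ee 0) + fderiv ℝ (X m 1) x (ee 1)) atTop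
        (𝓝 (d x))) ∧
      Continuous d ∧ (∀ x ∈ frontier Ω, 0 ≤ d x) ∧ ∀ x ∈ frontier Ω, x ∈ ball y ρ → 1 ≤ d x := by
  choose g hgs hgd hg using fun m : ℕ =>
    exists_smooth_lipschitz_above hγ (η := 1 / (m + 1 : ℝ)) (by positivity)
  obtain ⟨C, hC0, hC⟩ := exists_bound_deriv_ramp
  let θ : ContDiffBump y := ⟨r / 4, r / 2, by positivity, by linarith⟩
  have hθs : ContDiff ℝ ∞ θ := θ.contDiff
  have hθt : tsupport θ = closedBall y (r / 2) := θ.tsupport_eq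
  have hθc : HasCompactSupport θ := θ.hasCompactSupport
  let L : Fin 2 → R2 →L[ℝ] ℝ := fun i =>
    (EuclideanSpace.proj i : R2 →L[ℝ] ℝ) ∘L (A.toContinuousLinearEquiv : R2 →L[ℝ] R2)
  have hL : ∀ i x, L i x = A x i := fun i x => rfl
  have hLn : ∀ i v, |L i v| ≤ ‖v‖ := fun i v => by
    rw [hL, ← Real.norm_eq_abs, ← A.norm_map v]
    exact PiLp.norm_apply_le (A v) i
  let e : R2 := A.symm (ee 1)
  have hLe0 : L 0 e = 0 := by simp [hL, e]
  have hLe1 : L 1 e = 1 := by simp [hL, e]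
  have he : ∀ i, |e i| ≤ 1 := fun i => by
    have h1 := PiLp.norm_apply_le e i
    have h2 : ‖e‖ = 1 := by simp [e]
    rwa [h2] at h1
  let s : R2 → ℝ := fun x => L 1 x - γ (L 0 x)
  let sm : ℕ → R2 → ℝ := fun m x => L 1 x - g m (L 0 x)
  -- `s` is the height above the graph, `sm m` a smooth height slightly smaller than it, and `χ m` a
  -- smooth version of its positive part. The field is `χ m * θ` times `e`, the direction pointing
  -- into `Ω`.
  let χ : ℕ → R2 → ℝ := fun m x => rampN m (sm m x)
  have hsc : Continuous s := by
    have := hγ.continuous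
    fun_prop
  have hsms : ∀ m, ContDiff ℝ ∞ (sm m) := fun m =>
    (L 1).contDiff.sub ((hgs m).comp (L 0).contDiff)
  have hχs : ∀ m, ContDiff ℝ ∞ (χ m) := fun m => (rampN_contDiff m).comp (hsms m)
  have hsmlt : ∀ m x, sm m x < s x ∧ s x - 1 / (m + 1 : ℝ) ≤ sm m x := fun m x => by
    have := hg m (L 0 x)
    constructor <;> simp only [s, sm] <;> linarith [this.1, this.2]
  have hχd : ∀ m x v, fderiv ℝ (χ m) x v =
      deriv (rampN m) (sm m x) * (L 1 v - deriv (g m) (L 0 x) * L 0 v) := by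
    intro m x v
    have h1 : HasFDerivAt (sm m) (L 1 - deriv (g m) (L 0 x) • L 0) x :=
      (L 1).hasFDerivAt.sub
        (((hgs m).differentiable (by simp) _).hasDerivAt.comp_hasFDerivAt x (L 0).hasFDerivAt)
    have h2 : HasFDerivAt (χ m) _ x :=
      ((rampN_contDiff m).differentiable (by simp) (sm m x)).hasDerivAt.comp_hasFDerivAt x h1
    rw [h2.fderiv]
    simp
  have hprod : ∀ m x v, fderiv ℝ (fun x => χ m x * θ x) x v =
      χ m x * fderiv ℝ θ x v + θ x * fderiv ℝ (χ m) x v := by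
    intro m x v
    rw [fderiv_fun_mul ((hχs m).differentiable (by simp) x) (hθs.differentiable (by simp) x)]
    simp
  have hX : ∀ m (i : Fin 2) x v, fderiv ℝ (fun x => e i * (χ m x * θ x)) x v =
      e i * fderiv ℝ (fun x => χ m x * θ x) x v := by
    intro m i x v
    rw [fderiv_const_mul (((hχs m).mul hθs).differentiable (by simp) x)]
    simp
  have hout : ∀ x, x ∉ tsupport θ → θ x = 0 ∧ ∀ v, fderiv ℝ θ x v = 0 := fun x hx => by
    refine ⟨image_eq_zero_of_notMem_tsupport hx, fun v => ?_⟩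
    have : fderiv ℝ θ x = 0 :=
      image_eq_zero_of_notMem_tsupport fun h => hx (tsupport_fderiv_subset ℝ h)
    rw [this]; rfl
  obtain ⟨S, hS⟩ := (isCompact_closedBall y (r / 2)).exists_bound_of_continuousOn hsc.continuousOn
  obtain ⟨N, hN⟩ := (isCompact_closedBall y (r / 2)).exists_bound_of_continuousOn
    (hθs.continuous_fderiv (by simp)).continuousOn
  have hS0 : 0 ≤ S := (norm_nonneg _).trans (hS y (mem_closedBall_self (by positivity)))
  have hN0 : 0 ≤ N := (norm_nonneg _).trans (hN y (mem_closedBall_self (by positivity)))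
  have hχb : ∀ m, ∀ x ∈ closedBall y (r / 2), |χ m x| ≤ S + 1 := by
    intro m x hx
    refine (abs_rampN_le _ _).trans ?_
    have h1 := abs_le.1 (hS x hx)
    have h2 := hsmlt m x
    have h3 : 1 / (m + 1 : ℝ) ≤ 1 := by
      rw [div_le_one (by positivity)]
      linarith [(Nat.cast_nonneg m : (0 : ℝ) ≤ m)]
    rw [abs_le]
    constructor <;> linarith [h1.1, h1.2, h2.1, h2.2]
  -- Uniform in `m`: rescaling the ramp in value and argument leaves its slope unchanged, and the
  -- smooth graphs keep the Lipschitz constant `K`.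
  have hχdb : ∀ m x j, |fderiv ℝ (χ m) x (ee j)| ≤ C * (1 + K) := by
    intro m x j
    rw [hχd, abs_mul, deriv_rampN]
    gcongr
    · exact hC _
    · refine (abs_sub _ _).trans ?_
      rw [abs_mul]
      have h1 := hLn 1 (ee j)
      have h0 := hLn 0 (ee j)
      simp only [PiLp.norm_single, norm_one] at h0 h1
      have h2 := mul_le_mul (hgd m (L 0 x)) h0 (abs_nonneg _) K.2
      linarith
  set M := (S + 1) * N + C * (1 + K) + (S + 1) with hM
  have hM0 : 0 ≤ M := by positivity
  refine ⟨r / 4, M, fun m i x => e i * (χ m x * θ x),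
    fun x => θ x + s x * fderiv ℝ θ x e, by positivity, hM0, ?_, ?_, ?_, ?_, ?_, ?_, ?_⟩
  · intro m i
    have ht : tsupport (fun x => e i * (χ m x * θ x)) ⊆
        closedBall y (r / 2) ∩ {x | g m (L 0 x) ≤ L 1 x} := by
      have hcl : IsClosed {x | g m (L 0 x) ≤ L 1 x} :=
        isClosed_le ((hgs m).continuous.comp (L 0).continuous) (L 1).continuous
      refine closure_minimal (fun x hx => ?_) (isClosed_closedBall.inter hcl)
      refine ⟨?_, ?_⟩
      · by_contra h
        rw [← hθt] at h
        exact hx (by simp [(hout x h).1])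
      · by_contra h
        refine hx ?_
        have : χ m x = 0 := rampN_nonpos (by
          have : L 1 x < g m (L 0 x) := not_le.1 h
          simp only [sm]; linarith)
        simp [this]
    refine ⟨contDiff_const.mul ((hχs m).mul hθs), hθc.mul_left.mul_left, fun x hx => ?_⟩
    have := ht hx
    refine (hΩA x (closedBall_subset_ball (by linarith) this.1)).2 ?_
    exact (hg m _).1.trans_le this.2
  · intro m i x
    by_cases hx : x ∈ closedBall y (r / 2)
    · rw [abs_mul, abs_mul, abs_of_nonneg (θ.nonneg' x)]
      have h1 : |χ m x| * θ x ≤ (S + 1) * 1 :=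
        mul_le_mul (hχb m x hx) θ.le_one (θ.nonneg' x) (by positivity)
      have h2 : |e i| * (|χ m x| * θ x) ≤ 1 * ((S + 1) * 1) :=
        mul_le_mul (he i) h1 (mul_nonneg (abs_nonneg _) (θ.nonneg' x)) zero_le_one
      have h3 : 0 ≤ (S + 1) * N + C * (1 + K) := by positivity
      linarith
    · rw [← hθt] at hx
      simp [(hout x hx).1, hM0]
  · intro m i j x
    rw [hX, hprod, abs_mul]
    by_cases hx : x ∈ closedBall y (r / 2)
    · have h1 : |χ m x * fderiv ℝ θ x (ee j)| ≤ (S + 1) * N := by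
        rw [abs_mul]
        refine mul_le_mul (hχb m x hx) ?_ (abs_nonneg _) (by positivity)
        refine ((fderiv ℝ θ x).le_opNorm _).trans ?_
        simpa using hN x hx
      have h2 : |θ x * fderiv ℝ (χ m) x (ee j)| ≤ 1 * (C * (1 + K)) := by
        rw [abs_mul, abs_of_nonneg (θ.nonneg' x)]
        exact mul_le_mul θ.le_one (hχdb m x j) (abs_nonneg _) zero_le_one
      have h3 := mul_le_mul (he i) ((abs_add_le _ _).trans (add_le_add h1 h2)) (abs_nonneg _)
        zero_le_one
      linarith
    · rw [← hθt] at hx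
      simp [(hout x hx).1, (hout x hx).2, hM0]
  · intro x hxΩ
    -- The divergence of a scalar times a constant vector is the derivative along that vector, and
    -- the height grows at unit speed along `e`, where the first rotated coordinate does not move.
    have hsum : ∀ m, fderiv ℝ (fun x => e 0 * (χ m x * θ x)) x (ee 0) +
        fderiv ℝ (fun x => e 1 * (χ m x * θ x)) x (ee 1) =
        χ m x * fderiv ℝ θ x e + θ x * deriv (rampN m) (sm m x) := by
      intro m
      rw [hX, hX]
      have h1 : fderiv ℝ (fun x => χ m x * θ x) x e = e 0 * fderiv ℝ (fun x => χ m x * θ x) x (ee 0)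
          + e 1 * fderiv ℝ (fun x => χ m x * θ x) x (ee 1) := by
        conv_lhs => rw [vec_eq_sum e]
        rw [map_add, map_smul, map_smul, smul_eq_mul, smul_eq_mul]
      rw [← h1, hprod, hχd, hLe0, hLe1]
      ring
    simp only [hsum]
    by_cases hx : x ∈ tsupport θ
    · have hsx : 0 < s x := by
        rw [hθt] at hx
        have := (hΩA x (closedBall_subset_ball (by linarith) hx)).1 hxΩ
        simp only [s, hL]
        linarith
      have hlim : Tendsto (fun m => sm m x) atTop (𝓝 (s x)) := by
        have h1 : Tendsto (fun m : ℕ => s x - 1 / (m + 1 : ℝ)) atTop (𝓝 (s x)) := by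
          simpa using tendsto_one_div_nat.const_sub (s x)
        exact tendsto_of_tendsto_of_tendsto_of_le_of_le h1 tendsto_const_nhds
          (fun m => (hsmlt m x).2) (fun m => (hsmlt m x).1.le)
      have h2 : Tendsto (fun m => θ x + sm m x * fderiv ℝ θ x e) atTop
          (𝓝 (θ x + s x * fderiv ℝ θ x e)) := (hlim.mul_const _).const_add _
      refine h2.congr' ?_
      filter_upwards [eventually_rampN hsx hlim] with m hm
      simp only [χ]
      rw [hm.1, hm.2]
      ring
    · simp [(hout x hx).1, (hout x hx).2]
  · have h1 := hθs.continuous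
    have h2 := hθs.continuous_fderiv (by simp)
    fun_prop
  all_goals
    -- On the boundary inside the chart the height vanishes, nonpositive because the point is not in
    -- the open set `Ω` and nonnegative as a limit from `Ω`; only the cutoff survives in the limit
    -- divergence.
    have hfr : ∀ x ∈ frontier Ω, θ x + s x * fderiv ℝ θ x e = θ x := by
      intro x hx
      by_cases hxt : x ∈ tsupport θ
      · rw [hθt] at hxt
        have hxb : x ∈ ball y r := closedBall_subset_ball (by linarith) hxt
        have h1 : s x ≤ 0 := by
          have : x ∉ Ω := by
            rw [hΩ.frontier_eq] at hx
            exact hx.2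
          rw [hΩA x hxb, not_lt] at this
          simp only [s, hL]
          linarith
        have h2 : 0 ≤ s x := by
          have hcl : x ∈ closure (Ω ∩ ball y r) :=
            isOpen_ball.closure_inter ⟨frontier_subset_closure hx, hxb⟩
          refine closure_minimal (t := {x | 0 ≤ s x}) (fun w hw => ?_)
            (isClosed_le continuous_const hsc) hcl
          have := (hΩA w hw.2).1 hw.1
          simp only [s, hL, Set.mem_ofPred_eq]
          linarith
        rw [le_antisymm h1 h2]
        ring
      · rw [(hout x hxt).2]
        ring
  · intro x hx
    simp only [hfr x hx]
    exact θ.nonneg' x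
  · intro x hx hxb
    simp only [hfr x hx]
    rw [θ.one_of_mem_closedBall (ball_subset_closedBall hxb)]

/-- The divergence of a vector field. -/
noncomputable def divg (X : Fin 2 → R2 → ℝ) (x : R2) : ℝ :=
  fderiv ℝ (X 0) x (ee 0) + fderiv ℝ (X 1) x (ee 1)

/-- There are uniformly Lipschitz test vector fields on `Ω` whose divergence converges to a
continuous function that is nonnegative on `∂Ω` and at least one on `S ∩ ∂Ω`. -/
def HasFields (Ω S : Set R2) : Prop :=
  ∃ (M : ℝ) (X : ℕ → Fin 2 → R2 → ℝ) (d : R2 → ℝ), 0 ≤ M ∧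
    (∀ m i, IsTest Ω (X m i)) ∧ (∀ m i x, |X m i x| ≤ M) ∧
    (∀ m i j x, |fderiv ℝ (X m i) x (ee j)| ≤ M) ∧
    (∀ x ∈ Ω, Tendsto (fun m => divg (X m) x) atTop (𝓝 (d x))) ∧
    Continuous d ∧ (∀ x ∈ frontier Ω, 0 ≤ d x) ∧ ∀ x ∈ frontier Ω, x ∈ S → 1 ≤ d x

theorem isTest_zero (Ω : Set R2) : IsTest Ω (fun _ => 0) :=
  ⟨contDiff_const, HasCompactSupport.zero, by simp [tsupport, Function.support_fun_zero]⟩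

theorem HasFields.union {Ω S S' : Set R2} (h : HasFields Ω S) (h' : HasFields Ω S') :
    HasFields Ω (S ∪ S') := by
  obtain ⟨M, X, d, hM, hX, hXb, hXd, hl, hd, hd0, hd1⟩ := h
  obtain ⟨M', X', d', hM', hX', hXb', hXd', hl', hd', hd0', hd1'⟩ := h'
  have hf : ∀ m i x v, fderiv ℝ (fun x => X m i x + X' m i x) x v =
      fderiv ℝ (X m i) x v + fderiv ℝ (X' m i) x v := by
    intro m i x v
    rw [fderiv_fun_add ((hX m i).1.differentiable (by simp) x)
      ((hX' m i).1.differentiable (by simp) x)]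
    rfl
  refine ⟨M + M', fun m i x => X m i x + X' m i x, fun x => d x + d' x, by positivity,
    fun m i => (hX m i).add (hX' m i), fun m i x => ?_, fun m i j x => ?_, fun x hx => ?_,
    hd.add hd', fun x hx => add_nonneg (hd0 x hx) (hd0' x hx), fun x hx hxS => ?_⟩
  · exact (abs_add_le _ _).trans (add_le_add (hXb m i x) (hXb' m i x))
  · rw [hf]
    exact (abs_add_le _ _).trans (add_le_add (hXd m i j x) (hXd' m i j x))
  · refine ((hl x hx).add (hl' x hx)).congr fun m => ?_
    simp only [divg, hf]
    ring
  · rcases hxS with hxS | hxS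
    · linarith [hd1 x hx hxS, hd0' x hx]
    · linarith [hd0 x hx, hd1' x hx hxS]

/-- The local fields are simply added along a finite cover of the compact boundary. No partition of
unity is needed, since the limit divergences are nonnegative on the boundary and only a lower bound
is wanted. -/
theorem hasFields_frontier {Ω : Set R2} (hΩ : IsOpen Ω) (hb : Bornology.IsBounded Ω)
    (hL : HasLipschitzBoundary Ω) : HasFields Ω (frontier Ω) := by
  have hc : IsCompact (frontier Ω) :=
    hb.isCompact_closure.of_isClosed_subset isClosed_frontier frontier_subset_closure
  refine hc.induction_on (p := HasFields Ω) ?_ ?_ (fun _ _ => HasFields.union) ?_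
  · refine ⟨0, fun _ _ _ => 0, fun _ => 0, le_rfl, fun _ _ => isTest_zero Ω, by simp, by simp,
      fun x _ => ?_, continuous_const, by simp, by simp⟩
    simp [divg]
  · rintro s t hst ⟨M, X, d, h1, h2, h3, h4, h5, h6, h7, h8⟩
    exact ⟨M, X, d, h1, h2, h3, h4, h5, h6, h7, fun x hx hs => h8 x hx (hst hs)⟩
  · intro y hy
    obtain ⟨A, γ, K, r, hr, hγ, hA⟩ := hL y hy
    obtain ⟨ρ, M, X, d, hρ, h1, h2, h3, h4, h5, h6, h7, h8⟩ := exists_local_fields hΩ A hr hγ hA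
    exact ⟨ball y ρ, mem_nhdsWithin_of_mem_nhds (ball_mem_nhds y hρ),
      M, X, d, h1, h2, h3, h4, h5, h6, h7, h8⟩

/-- Absorption of the mass near a Lipschitz boundary: if the moments of `v²` against the divergence
of the test vector fields `X m` are bounded, then the mass of `v²` is controlled by this bound and
its mass on a compact subset. -/
theorem exists_absorbing_fields {Ω : Set R2} (hΩ : IsOpen Ω) (hb : Bornology.IsBounded Ω)
    (hL : HasLipschitzBoundary Ω) :
    ∃ (K : Set R2) (M : ℝ) (X : ℕ → Fin 2 → R2 → ℝ), IsCompact K ∧ K ⊆ Ω ∧ 0 ≤ M ∧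
      (∀ m i, IsTest Ω (X m i)) ∧ (∀ m i x, |X m i x| ≤ M) ∧
      (∀ m i j x, |fderiv ℝ (X m i) x (ee j)| ≤ M) ∧
      ∀ v : R2 → ℝ, MemLp v 2 (volume.restrict Ω) → ∀ B : ℝ,
        (∀ m, |∫ x in Ω, v x ^ 2 * divg (X m) x| ≤ B) →
        ∫ x in Ω, v x ^ 2 ≤ 2 * B + (4 * M + 1) * ∫ x in K, v x ^ 2 := by
  obtain ⟨M, X, d, hM, hX, hXb, hXd, hl, hd, hd0, hd1⟩ := hasFields_frontier hΩ hb hL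
  -- The limit divergence is at least 1 on the boundary, so this compact set stays inside `Ω`, and
  -- off it the divergence exceeds one half.
  set K := closure Ω ∩ {x | d x ≤ 1 / 2} with hK
  have hKc : IsCompact K := hb.isCompact_closure.inter_right (isClosed_le hd continuous_const)
  have hKΩ : K ⊆ Ω := by
    rintro x ⟨hx, hx'⟩
    by_contra hn
    have : x ∈ frontier Ω := by rw [hΩ.frontier_eq]; exact ⟨hx, hn⟩
    have h1 := hd1 x this this
    have h2 : d x ≤ 1 / 2 := hx'
    linarith
  refine ⟨K, M, X, hKc, hKΩ, hM, hX, hXb, hXd, fun v hv B hB => ?_⟩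
  have hdivb : ∀ m x, |divg (X m) x| ≤ 2 * M := fun m x => by
    refine (abs_add_le _ _).trans ?_
    linarith [hXd m 0 0 x, hXd m 1 1 x]
  have hdb : ∀ x ∈ Ω, |d x| ≤ 2 * M := fun x hx =>
    le_of_tendsto (hl x hx).abs (Eventually.of_forall fun m => hdivb m x)
  have hdivm : ∀ m, AEStronglyMeasurable (divg (X m)) (volume.restrict Ω) := fun m =>
    (((hX m 0).partialDeriv _).continuous.add
      ((hX m 1).partialDeriv _).continuous).aestronglyMeasurable
  have hv2 := hv.integrable_sq
  have hlim : Tendsto (fun m => ∫ x in Ω, v x ^ 2 * divg (X m) x) atTop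
      (𝓝 (∫ x in Ω, v x ^ 2 * d x)) := by
    refine tendsto_integral_of_dominated_convergence (fun x => v x ^ 2 * (2 * M))
      (fun m => hv2.1.mul (hdivm m)) (hv2.mul_const _) (fun m => ?_) ?_
    · refine Eventually.of_forall fun x => ?_
      rw [norm_mul, Real.norm_of_nonneg (sq_nonneg _)]
      exact mul_le_mul_of_nonneg_left (hdivb m x) (sq_nonneg _)
    · refine (ae_restrict_iff' hΩ.measurableSet).2 (Eventually.of_forall fun x hx => ?_)
      exact (hl x hx).const_mul _
  have hle : ∫ x in Ω, v x ^ 2 * d x ≤ B :=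
    le_of_tendsto hlim (Eventually.of_forall fun m => (le_abs_self _).trans (hB m))
  have hvd : IntegrableOn (fun x => v x ^ 2 * d x) Ω := by
    refine hv2.mul_bdd hd.aestronglyMeasurable (c := 2 * M) ?_
    exact (ae_restrict_iff' hΩ.measurableSet).2 (Eventually.of_forall hdb)
  have s1 := integral_inter_add_sdiff (f := fun x => v x ^ 2 * d x) hKc.measurableSet hvd
  have s2 := integral_inter_add_sdiff (f := fun x => v x ^ 2) hKc.measurableSet hv2
  rw [Set.inter_eq_right.2 hKΩ] at s1 s2
  have hv2K : IntegrableOn (fun x => v x ^ 2) K := IntegrableOn.mono_set hv2 hKΩ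
  have hv2D : IntegrableOn (fun x => v x ^ 2) (Ω \ K) := IntegrableOn.mono_set hv2 Set.sdiff_subset
  -- Using `d ≥ -2M` on `K` and `d ≥ 1/2` off `K`, half of the mass off `K` is at most `B + 2M ∫_K
  -- v²`; doubling and adding the mass on `K` gives the factor `4M + 1`.
  have e1 : -(2 * M) * ∫ x in K, v x ^ 2 ≤ ∫ x in K, v x ^ 2 * d x := by
    rw [← integral_const_mul]
    refine setIntegral_mono_on (hv2K.const_mul _) (IntegrableOn.mono_set hvd hKΩ)
      hKc.measurableSet fun x hx => ?_
    have := (abs_le.1 (hdb x (hKΩ hx))).1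
    nlinarith [sq_nonneg (v x)]
  have e2 : (1 / 2) * ∫ x in Ω \ K, v x ^ 2 ≤ ∫ x in Ω \ K, v x ^ 2 * d x := by
    rw [← integral_const_mul]
    refine setIntegral_mono_on (hv2D.const_mul _) (IntegrableOn.mono_set hvd Set.sdiff_subset)
      (hΩ.measurableSet.inter hKc.measurableSet.compl) fun x hx => ?_
    have : 1 / 2 < d x := by
      by_contra h
      exact hx.2 ⟨subset_closure hx.1, not_lt.1 h⟩
    nlinarith [sq_nonneg (v x)]
  linarith

/-- The Poincaré-type inequality on Lipschitz domains for smooth functions. -/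
theorem integral_sq_le_of_contDiff {Ω K : Set R2} {M : ℝ} {X : ℕ → Fin 2 → R2 → ℝ}
    (hX : ∀ m i, IsTest Ω (X m i)) (hXb : ∀ m i x, |X m i x| ≤ M)
    (habs : ∀ v : R2 → ℝ, MemLp v 2 (volume.restrict Ω) → ∀ B : ℝ,
        (∀ m, |∫ x in Ω, v x ^ 2 * divg (X m) x| ≤ B) →
        ∫ x in Ω, v x ^ 2 ≤ 2 * B + (4 * M + 1) * ∫ x in K, v x ^ 2)
    {φ : R2 → ℝ} (hφ : ContDiff ℝ ∞ φ) (hc : HasCompactSupport φ) :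
    ∫ x in Ω, φ x ^ 2 ≤ 32 * M ^ 2 * ((∫ x in Ω, fderiv ℝ φ x (ee 0) ^ 2) +
      ∫ x in Ω, fderiv ℝ φ x (ee 1) ^ 2) + (8 * M + 2) * ∫ x in K, φ x ^ 2 := by
  have hφt : IsTest Set.univ φ := ⟨hφ, hc, Set.subset_univ _⟩
  have hm : MemLp φ 2 (volume.restrict Ω) := hφt.memLp _
  have hdm : ∀ i, MemLp (fun x => fderiv ℝ φ x (ee i)) 2 (volume.restrict Ω) := fun i =>
    (hφt.partialDeriv _).memLp _
  have hφ2 : ContDiff ℝ 1 fun x => φ x ^ 2 := (hφ.pow 2).of_le (by simp)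
  -- Integration by parts and Young's inequality, weighted so that each direction costs an eighth of
  -- the mass. Two directions and the factor 2 of `habs` leave one half, which is absorbed on the
  -- left.
  have hstep : ∀ m i, |∫ x in Ω, fderiv ℝ (X m i) x (ee i) * φ x ^ 2| ≤
      (1 / 8) * (∫ x in Ω, φ x ^ 2) + 8 * M ^ 2 * ∫ x in Ω, fderiv ℝ φ x (ee i) ^ 2 := by
    intro m i
    have h1 := integral_mul_fderiv_eq ((hX m i).1.of_le (by simp)) hφ2 (hX m i).2.1 (ee i)
    have h2 : ∀ x, fderiv ℝ (fun x => φ x ^ 2) x (ee i) = 2 * φ x * fderiv ℝ φ x (ee i) := by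
      intro x
      rw [((hφ.differentiable (by simp) x).hasFDerivAt.pow 2).fderiv]
      simp
    rw [setIntegral_mul_of_tsupport ((hX m i).partialDeriv _).2.2, ← neg_neg (∫ x, _), ← h1, abs_neg,
      ← setIntegral_mul_of_tsupport (hX m i).2.2, ← integral_const_mul, ← integral_const_mul,
      ← integral_add (hm.integrable_sq.const_mul _) ((hdm i).integrable_sq.const_mul _)]
    refine (norm_integral_le_of_norm_le (G := ℝ) ((hm.integrable_sq.const_mul _).add
      ((hdm i).integrable_sq.const_mul _)) (Eventually.of_forall fun x => ?_))
    rw [h2, Real.norm_eq_abs, abs_mul, abs_mul, abs_mul, abs_two]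
    rw [← sq_abs (φ x), ← sq_abs (fderiv ℝ φ x (ee i))]
    have h3 := hXb m i x
    have h4 : |X m i x| * (2 * |φ x| * |fderiv ℝ φ x (ee i)|) ≤
        M * (2 * |φ x| * |fderiv ℝ φ x (ee i)|) := by gcongr
    nlinarith [sq_nonneg (|φ x| - 8 * M * |fderiv ℝ φ x (ee i)|)]
  have hB := habs φ hm _ (fun m => by
    have e : ∫ x in Ω, φ x ^ 2 * divg (X m) x = (∫ x in Ω, fderiv ℝ (X m 0) x (ee 0) * φ x ^ 2) +
        ∫ x in Ω, fderiv ℝ (X m 1) x (ee 1) * φ x ^ 2 := by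
      rw [← integral_add]
      · refine integral_congr_ae (Eventually.of_forall fun x => ?_)
        simp only [divg]
        ring
      all_goals
        have c1 := hφ.continuous
        refine (Continuous.integrable_of_hasCompactSupport (((hX m _).partialDeriv _).continuous.mul
          (c1.pow 2)) ((hX m _).partialDeriv _).2.1.mul_right).restrict
    rw [e]
    exact (abs_add_le _ _).trans (add_le_add (hstep m 0) (hstep m 1)))
  linarith

/-! ### Weak solutions of the Cauchy-Riemann system -/

/-- `(a, b)` is a weak solution of `∂₀a = ∂₁b`, `∂₁a = -∂₀b` on `Ω`. -/
def WeakCR (Ω : Set R2) (a b : R2 → ℝ) : Prop :=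
  ∀ φ, IsTest Ω φ →
    ∫ x in Ω, fderiv ℝ φ x (ee 0) * a x = ∫ x in Ω, fderiv ℝ φ x (ee 1) * b x ∧
    ∫ x in Ω, fderiv ℝ φ x (ee 1) * a x = - ∫ x in Ω, fderiv ℝ φ x (ee 0) * b x

/-- Under the Cauchy-Riemann equations `a + ib` is holomorphic, hence so is its square `p + iq` with
`p = a² - b²` and `q = 2ab`. Integrating by parts and exchanging derivatives of `p` for those of `q`
turns the divergence of `X` into its curl. -/
theorem integral_cr_of_contDiff {X : Fin 2 → R2 → ℝ} (hX : ∀ i, ContDiff ℝ ∞ (X i))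
    (hXc : ∀ i, HasCompactSupport (X i)) {a b : R2 → ℝ} (ha : ContDiff ℝ ∞ a)
    (hb : ContDiff ℝ ∞ b)
    (h : ∀ i, ∀ x ∈ tsupport (X i), fderiv ℝ a x (ee 0) = fderiv ℝ b x (ee 1) ∧
      fderiv ℝ a x (ee 1) = - fderiv ℝ b x (ee 0)) :
    ∫ x, (a x ^ 2 - b x ^ 2) * divg X x =
      ∫ x, 2 * a x * b x * (fderiv ℝ (X 0) x (ee 1) - fderiv ℝ (X 1) x (ee 0)) := by
  set p : R2 → ℝ := fun x => a x ^ 2 - b x ^ 2 with hp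
  set q : R2 → ℝ := fun x => 2 * a x * b x with hq
  have hps : ContDiff ℝ ∞ p := (ha.pow 2).sub (hb.pow 2)
  have hqs : ContDiff ℝ ∞ q := (contDiff_const.mul ha).mul hb
  have hpd : ∀ x v, fderiv ℝ p x v = 2 * a x * fderiv ℝ a x v - 2 * b x * fderiv ℝ b x v := by
    intro x v
    have := (((ha.differentiable (by simp) x).hasFDerivAt.pow 2).fun_sub
      ((hb.differentiable (by simp) x).hasFDerivAt.pow 2))
    rw [HasFDerivAt.fderiv (f := p) this]
    simp
  have hqd : ∀ x v, fderiv ℝ q x v = 2 * (a x * fderiv ℝ b x v + b x * fderiv ℝ a x v) := by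
    intro x v
    have := ((ha.differentiable (by simp) x).hasFDerivAt.const_mul 2).fun_mul
      ((hb.differentiable (by simp) x).hasFDerivAt)
    rw [HasFDerivAt.fderiv (f := q) this]
    simp
    ring
  have ibp : ∀ (i j : Fin 2) (f : R2 → ℝ), ContDiff ℝ ∞ f →
      ∫ x, fderiv ℝ (X i) x (ee j) * f x = - ∫ x, X i x * fderiv ℝ f x (ee j) := by
    intro i j f hf
    rw [integral_mul_fderiv_eq ((hX i).of_le (by simp)) (hf.of_le (by simp)) (hXc i), neg_neg]
  have hint : ∀ (i j : Fin 2) (f : R2 → ℝ), ContDiff ℝ ∞ f →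
      Integrable fun x => fderiv ℝ (X i) x (ee j) * f x := by
    intro i j f hf
    have c1 := (hX i).continuous_fderiv (by simp)
    have c2 := hf.continuous
    exact Continuous.integrable_of_hasCompactSupport (by fun_prop)
      ((hXc i).fderiv_apply ℝ _).mul_right
  have e0 : ∫ x, fderiv ℝ (X 0) x (ee 0) * p x = ∫ x, fderiv ℝ (X 0) x (ee 1) * q x := by
    rw [ibp 0 0 p hps, ibp 0 1 q hqs]
    congr 1
    refine integral_congr_ae (Eventually.of_forall fun x => ?_)
    simp only
    by_cases hx : x ∈ tsupport (X 0)
    · rw [hpd, hqd, (h 0 x hx).1, (h 0 x hx).2]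
      ring
    · simp [image_eq_zero_of_notMem_tsupport hx]
  have e1 : ∫ x, fderiv ℝ (X 1) x (ee 1) * p x = - ∫ x, fderiv ℝ (X 1) x (ee 0) * q x := by
    rw [ibp 1 1 p hps, ibp 1 0 q hqs, ← integral_neg, ← integral_neg, ← integral_neg]
    refine integral_congr_ae (Eventually.of_forall fun x => ?_)
    simp only
    by_cases hx : x ∈ tsupport (X 1)
    · rw [hpd, hqd, (h 1 x hx).1, (h 1 x hx).2]
      ring
    · simp [image_eq_zero_of_notMem_tsupport hx]
  calc ∫ x, p x * divg X x = (∫ x, fderiv ℝ (X 0) x (ee 0) * p x) +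
        ∫ x, fderiv ℝ (X 1) x (ee 1) * p x := by
        rw [← integral_add (hint 0 0 p hps) (hint 1 1 p hps)]
        refine integral_congr_ae (Eventually.of_forall fun x => ?_)
        simp only [divg]
        ring
    _ = (∫ x, fderiv ℝ (X 0) x (ee 1) * q x) - ∫ x, fderiv ℝ (X 1) x (ee 0) * q x := by
        rw [e0, e1]
        ring
    _ = _ := by
        rw [← integral_sub (hint 0 1 q hqs) (hint 1 0 q hqs)]
        refine integral_congr_ae (Eventually.of_forall fun x => ?_)
        simp only
        ring

theorem memLp_mul_of_test {Ω : Set R2} {D v : R2 → ℝ} (hD : IsTest Ω D) (hv : MemLp v 2 volume) :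
    MemLp (fun x => D x * v x) 2 volume := by
  obtain ⟨C, hC⟩ := hD.2.1.exists_bound_of_continuous hD.continuous
  refine MemLp.of_le_mul (c := C) hv (hD.continuous.aestronglyMeasurable.mul hv.1)
    (Eventually.of_forall fun x => ?_)
  rw [norm_mul]
  gcongr
  exact hC x

theorem tendsto_integral_test_mul {Ω : Set R2} {D : R2 → ℝ} (hD : IsTest Ω D)
    {f g : ℕ → R2 → ℝ} {f₀ g₀ : R2 → ℝ} (hf : ∀ n, MemLp (f n) 2 volume)
    (hg : ∀ n, MemLp (g n) 2 volume) (hf₀ : MemLp f₀ 2 volume) (hg₀ : MemLp g₀ 2 volume)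
    (hfc : Tendsto (fun n => eLpNorm (f n - f₀) 2 volume) atTop (𝓝 0))
    (hgc : Tendsto (fun n => eLpNorm (g n - g₀) 2 volume) atTop (𝓝 0)) :
    Tendsto (fun n => ∫ x, D x * (f n x * g n x)) atTop (𝓝 (∫ x, D x * (f₀ x * g₀ x))) := by
  obtain ⟨C, hC⟩ := hD.2.1.exists_bound_of_continuous hD.continuous
  have h1 : Tendsto (fun n => eLpNorm ((fun x => D x * f n x) - fun x => D x * f₀ x) 2 volume)
      atTop (𝓝 0) := by
    refine tendsto_eLpNorm_mono (C := ENNReal.ofReal C) (by simp)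
      (Eventually.of_forall fun n => ?_) hfc
    refine eLpNorm_le_mul_eLpNorm_of_ae_le_mul (Eventually.of_forall fun x => ?_) 2
    simp only [Pi.sub_apply, ← mul_sub, norm_mul]
    gcongr
    exact hC x
  have h2 := tendsto_integral_mul (fun n => memLp_mul_of_test hD (hf n)) hg
    (memLp_mul_of_test hD hf₀) hg₀ h1 hgc
  simpa only [mul_assoc] using h2

/-- Mollification preserves the system pointwise near the supports of `X`, where
`integral_cr_of_contDiff` applies; both sides are quadratic and pass to the limit by strong `L²`
convergence. -/
theorem WeakCR.integral_eq {Ω : Set R2} (hΩ : IsOpen Ω) {a b : R2 → ℝ} (h : WeakCR Ω a b)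
    (ha : MemLp a 2 (volume.restrict Ω)) (hb : MemLp b 2 (volume.restrict Ω))
    {X : Fin 2 → R2 → ℝ} (hX : ∀ i, IsTest Ω (X i)) :
    ∫ x in Ω, (a x ^ 2 - b x ^ 2) * divg X x =
      ∫ x in Ω, 2 * a x * b x * (fderiv ℝ (X 0) x (ee 1) - fderiv ℝ (X 1) x (ee 0)) := by
  set A := Ω.indicator a with hA
  set B := Ω.indicator b with hB
  have hAm : MemLp A 2 volume := memLp_ind hΩ ha
  have hBm : MemLp B 2 volume := memLp_ind hΩ hb
  have hAs : ∀ n, ContDiff ℝ ∞ (moll n A) := moll_contDiff (locInt_ind hΩ ha)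
  have hBs : ∀ n, ContDiff ℝ ∞ (moll n B) := moll_contDiff (locInt_ind hΩ hb)
  have hAl : ∀ n, MemLp (moll n A) 2 volume := fun n =>
    ⟨(hAs n).continuous.aestronglyMeasurable, (eLpNorm_moll_le hAm.1 n).trans_lt hAm.2⟩
  have hBl : ∀ n, MemLp (moll n B) 2 volume := fun n =>
    ⟨(hBs n).continuous.aestronglyMeasurable, (eLpNorm_moll_le hBm.1 n).trans_lt hBm.2⟩
  have hAc := tendsto_moll_ind hΩ ha
  have hBc := tendsto_moll_ind hΩ hb
  have hdiv : IsTest Ω (divg X) := ((hX 0).partialDeriv _).add ((hX 1).partialDeriv _)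
  have hcurl : IsTest Ω fun x => fderiv ℝ (X 0) x (ee 1) + (-1) * fderiv ℝ (X 1) x (ee 0) :=
    ((hX 0).partialDeriv _).add (((hX 1).partialDeriv _).mul_left contDiff_const)
  have hK : IsCompact (tsupport (X 0) ∪ tsupport (X 1)) := (hX 0).2.1.isCompact.union (hX 1).2.1
  obtain ⟨d, hd0, hd⟩ := hK.exists_cthickening_subset_open hΩ
    (Set.union_subset (hX 0).2.2 (hX 1).2.2)
  have hev : ∀ᶠ n : ℕ in atTop,
      (∫ x, divg X x * (moll n A x * moll n A x)) - (∫ x, divg X x * (moll n B x * moll n B x)) =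
      2 * ∫ x, (fderiv ℝ (X 0) x (ee 1) + (-1) * fderiv ℝ (X 1) x (ee 0)) *
        (moll n A x * moll n B x) := by
    filter_upwards [eventually_one_div_lt hd0] with n hn
    have hcr := integral_cr_of_contDiff (fun i => (hX i).1) (fun i => (hX i).2.1) (hAs n) (hBs n)
      (fun i x hx => by
        have hx' : x ∈ tsupport (X 0) ∪ tsupport (X 1) := by
          fin_cases i
          · exact Or.inl hx
          · exact Or.inr hx
        have hb' : closedBall x (1 / (n + 1 : ℝ)) ⊆ Ω :=
          (closedBall_subset_cthickening hx' _).trans ((cthickening_mono hn.le _).trans hd)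
        have := h _ (kernAt_isTest hb')
        rw [fderiv_moll_ind hΩ ha, fderiv_moll_ind hΩ hb, fderiv_moll_ind hΩ ha,
          fderiv_moll_ind hΩ hb, this.1, this.2]
        simp)
    have hcA := (hAs n).continuous
    have hcB := (hBs n).continuous
    have hcd := hdiv.continuous
    rw [← integral_sub, ← integral_const_mul]
    · refine Eq.trans ?_ (hcr.trans ?_)
      · refine integral_congr_ae (Eventually.of_forall fun x => ?_)
        simp only
        ring
      · refine integral_congr_ae (Eventually.of_forall fun x => ?_)
        simp only
        ring
    · exact Continuous.integrable_of_hasCompactSupport (by fun_prop) hdiv.2.1.mul_right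
    · exact Continuous.integrable_of_hasCompactSupport (by fun_prop) hdiv.2.1.mul_right
  have l1 := (tendsto_integral_test_mul hdiv hAl hAl hAm hAm hAc hAc).sub
    (tendsto_integral_test_mul hdiv hBl hBl hBm hBm hBc hBc)
  have l2 := (tendsto_integral_test_mul hcurl hAl hBl hAm hBm hAc hBc).const_mul 2
  have := tendsto_nhds_unique (l1.congr' hev) l2
  rw [← integral_sub ((memLp_mul_of_test hdiv hAm).integrable_mul hAm |>.congr
      (Eventually.of_forall fun x => by simp [mul_assoc]))
    ((memLp_mul_of_test hdiv hBm).integrable_mul hBm |>.congr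
      (Eventually.of_forall fun x => by simp [mul_assoc])), ← integral_const_mul] at this
  rw [← integral_indicator hΩ.measurableSet, ← integral_indicator hΩ.measurableSet]
  refine Eq.trans ?_ (this.trans ?_)
  all_goals
    refine integral_congr_ae (Eventually.of_forall fun x => ?_)
    by_cases hx : x ∈ Ω
    · simp [hA, hB, hx]
      ring
    · simp [hA, hB, hx]

/-- Control of a conjugate harmonic function on a Lipschitz domain. -/
theorem WeakCR.integral_sq_le {Ω K : Set R2} (hΩ : IsOpen Ω) {M : ℝ} {X : ℕ → Fin 2 → R2 → ℝ}
    (hX : ∀ m i, IsTest Ω (X m i))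
    (hXd : ∀ m i j x, |fderiv ℝ (X m i) x (ee j)| ≤ M)
    (habs : ∀ v : R2 → ℝ, MemLp v 2 (volume.restrict Ω) → ∀ B : ℝ,
        (∀ m, |∫ x in Ω, v x ^ 2 * divg (X m) x| ≤ B) →
        ∫ x in Ω, v x ^ 2 ≤ 2 * B + (4 * M + 1) * ∫ x in K, v x ^ 2)
    {a b : R2 → ℝ} (h : WeakCR Ω a b)
    (ha : MemLp a 2 (volume.restrict Ω)) (hb : MemLp b 2 (volume.restrict Ω)) :
    ∫ x in Ω, b x ^ 2 ≤ (8 * M + 64 * M ^ 2) * (∫ x in Ω, a x ^ 2) +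
      (8 * M + 2) * ∫ x in K, b x ^ 2 := by
  -- The identity replaces `b² div X` by `a² div X - 2ab (∂₁X₀ - ∂₀X₁)`. Both derivative factors are
  -- at most `2M`, and Young's inequality leaves a quarter of the mass of `b`; doubled by `habs`, it
  -- is absorbed.
  have hB := habs b hb ((2 * M + 16 * M ^ 2) * (∫ x in Ω, a x ^ 2) + (1 / 4) * ∫ x in Ω, b x ^ 2)
    (fun m => by
      have hdc : Continuous (divg (X m)) := ((hX m 0).partialDeriv _).continuous.add
        ((hX m 1).partialDeriv _).continuous
      have hcc : Continuous fun x => fderiv ℝ (X m 0) x (ee 1) - fderiv ℝ (X m 1) x (ee 0) :=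
        ((hX m 0).partialDeriv _).continuous.sub ((hX m 1).partialDeriv _).continuous
      have hdb : ∀ x, |divg (X m) x| ≤ 2 * M := fun x => by
        refine (abs_add_le _ _).trans ?_
        linarith [hXd m 0 0 x, hXd m 1 1 x]
      have hcb : ∀ x, |fderiv ℝ (X m 0) x (ee 1) - fderiv ℝ (X m 1) x (ee 0)| ≤ 2 * M := fun x => by
        refine (abs_sub _ _).trans ?_
        linarith [hXd m 0 1 x, hXd m 1 0 x]
      have i1 : IntegrableOn (fun x => a x ^ 2 * divg (X m) x) Ω :=
        ha.integrable_sq.mul_bdd hdc.aestronglyMeasurable (Eventually.of_forall hdb)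
      have i2 : IntegrableOn (fun x => b x ^ 2 * divg (X m) x) Ω :=
        hb.integrable_sq.mul_bdd hdc.aestronglyMeasurable (Eventually.of_forall hdb)
      have i3 : IntegrableOn (fun x => 2 * a x * b x *
          (fderiv ℝ (X m 0) x (ee 1) - fderiv ℝ (X m 1) x (ee 0))) Ω :=
        ((ha.const_mul 2).integrable_mul hb).mul_bdd hcc.aestronglyMeasurable
          (Eventually.of_forall hcb)
      have e : ∫ x in Ω, b x ^ 2 * divg (X m) x = ∫ x in Ω, (a x ^ 2 * divg (X m) x -
          2 * a x * b x * (fderiv ℝ (X m 0) x (ee 1) - fderiv ℝ (X m 1) x (ee 0))) := by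
        have := h.integral_eq hΩ ha hb (hX m)
        simp only [sub_mul] at this
        rw [integral_sub i1 i2] at this
        rw [integral_sub i1 i3, ← this]
        ring
      rw [e, ← integral_const_mul, ← integral_const_mul,
        ← integral_add (ha.integrable_sq.const_mul _) (hb.integrable_sq.const_mul _)]
      refine norm_integral_le_of_norm_le (G := ℝ) ((ha.integrable_sq.const_mul _).add
        (hb.integrable_sq.const_mul _)) (Eventually.of_forall fun x => ?_)
      rw [Real.norm_eq_abs]
      refine (abs_sub _ _).trans ?_
      rw [abs_mul, abs_mul, abs_mul, abs_mul, abs_two, abs_of_nonneg (sq_nonneg (a x)),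
        ← sq_abs (a x), ← sq_abs (b x)]
      have h1 : |a x| ^ 2 * |divg (X m) x| ≤ |a x| ^ 2 * (2 * M) := by
        gcongr; exact hdb x
      have h2 : 2 * |a x| * |b x| *
          |fderiv ℝ (X m 0) x (ee 1) - fderiv ℝ (X m 1) x (ee 0)| ≤
          2 * |a x| * |b x| * (2 * M) := by
        gcongr; exact hcb x
      nlinarith [sq_nonneg (|b x| - 8 * M * |a x|)])
  linarith

/-! ### The four combinations of first derivatives of a planar vector field -/

/-- The combinations `∂₀ψ₀ - ∂₁ψ₁`, `∂₁ψ₀ + ∂₀ψ₁` of first derivatives. -/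
noncomputable def shearD (ψ : Fin 2 → R2 → ℝ) (x : R2) : ℝ :=
  fderiv ℝ (ψ 0) x (ee 0) - fderiv ℝ (ψ 1) x (ee 1)

/-- The off-diagonal part of twice the deviatoric strain. -/
noncomputable def shearO (ψ : Fin 2 → R2 → ℝ) (x : R2) : ℝ :=
  fderiv ℝ (ψ 0) x (ee 1) + fderiv ℝ (ψ 1) x (ee 0)

/-- The scalar curl of a planar vector field. -/
noncomputable def curl (ψ : Fin 2 → R2 → ℝ) (x : R2) : ℝ :=
  fderiv ℝ (ψ 1) x (ee 0) - fderiv ℝ (ψ 0) x (ee 1)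

theorem norm_sq_lp {α : Type*} [MeasurableSpace α] {ν : Measure α} (g : Lp ℝ 2 ν) :
    ‖g‖ ^ 2 = ∫ x, g x ^ 2 ∂ν := by
  rw [← real_inner_self_eq_norm_sq, L2.inner_def]
  simp [pow_two]

theorem IsTest.sub {Ω : Set R2} {φ χ : R2 → ℝ} (h : IsTest Ω φ) (h' : IsTest Ω χ) :
    IsTest Ω fun x => φ x - χ x := by
  simpa [sub_eq_add_neg] using h.add (h'.mul_left (χ := fun _ => -1) contDiff_const)

section Tests

variable {Ω : Set R2} {ψ : Fin 2 → R2 → ℝ}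

theorem isTest_divg (h : ∀ i, IsTest Ω (ψ i)) : IsTest Ω (divg ψ) :=
  ((h 0).partialDeriv _).add ((h 1).partialDeriv _)

theorem isTest_shearD (h : ∀ i, IsTest Ω (ψ i)) : IsTest Ω (shearD ψ) :=
  ((h 0).partialDeriv _).sub ((h 1).partialDeriv _)

theorem isTest_shearO (h : ∀ i, IsTest Ω (ψ i)) : IsTest Ω (shearO ψ) :=
  ((h 0).partialDeriv _).add ((h 1).partialDeriv _)

theorem isTest_curl (h : ∀ i, IsTest Ω (ψ i)) : IsTest Ω (curl ψ) :=
  ((h 1).partialDeriv _).sub ((h 0).partialDeriv _)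

/-- Moving the derivative off `ψ` produces a second derivative of `φ`, which is symmetric in the two
directions. -/
theorem integral_fderiv_mul_fderiv_comm {φ ψ : R2 → ℝ} (hφ : ContDiff ℝ ∞ φ) (hψ : ContDiff ℝ ∞ ψ)
    (hc : HasCompactSupport ψ) (u v : R2) :
    ∫ x, fderiv ℝ φ x u * fderiv ℝ ψ x v = ∫ x, fderiv ℝ φ x v * fderiv ℝ ψ x u := by
  have key : ∀ u v : R2, ∫ x, fderiv ℝ φ x u * fderiv ℝ ψ x v =
      - ∫ x, ψ x * fderiv ℝ (fun y => fderiv ℝ φ y u) x v := by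
    intro u v
    have h1 : ContDiff ℝ 1 fun y => fderiv ℝ φ y u :=
      (hφ.fderiv_right (m := 1) (by norm_cast)).clm_apply contDiff_const
    rw [integral_mul_fderiv_eq (hψ.of_le (by simp)) h1 hc, neg_neg]
    exact integral_congr_ae (Eventually.of_forall fun x => mul_comm _ _)
  rw [key, key]
  simp only [fderiv_fderiv_comm hφ _ u v]

/-- The null Lagrangian identity. -/
theorem integral_divg_mul_add_curl_mul {φ : Fin 2 → R2 → ℝ} (hφ : ∀ i, ContDiff ℝ ∞ (φ i))
    (hφc : ∀ i, HasCompactSupport (φ i)) (hψ : ∀ i, IsTest Ω (ψ i)) :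
    (∫ x in Ω, divg φ x * divg ψ x) + ∫ x in Ω, curl φ x * curl ψ x =
      (∫ x in Ω, shearD φ x * shearD ψ x) + ∫ x in Ω, shearO φ x * shearO ψ x := by
  have hφt : ∀ i, IsTest Set.univ (φ i) := fun i => ⟨hφ i, hφc i, Set.subset_univ _⟩
  have e : ∀ (f g : R2 → ℝ), IsTest Ω g → ∫ x in Ω, f x * g x = ∫ x, f x * g x := fun f g hg =>
    setIntegral_of_tsupport (tsupport_mul_subset_right.trans hg.2.2)
  have i : ∀ {f g : R2 → ℝ}, IsTest Set.univ f → IsTest Ω g → Integrable fun x => f x * g x :=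
    fun hf hg => (hf.continuous.mul hg.continuous).integrable_of_hasCompactSupport hg.2.1.mul_left
  have i' : ∀ i j k l, Integrable fun x => fderiv ℝ (φ i) x (ee j) * fderiv ℝ (ψ k) x (ee l) :=
    fun i' j k l => i ((hφt i').partialDeriv _) ((hψ k).partialDeriv _)
  rw [e _ _ (isTest_divg hψ), e _ _ (isTest_curl hψ), e _ _ (isTest_shearD hψ),
    e _ _ (isTest_shearO hψ), ← integral_add (i (isTest_divg hφt) (isTest_divg hψ))
      (i (isTest_curl hφt) (isTest_curl hψ)), ← integral_add
      (i (isTest_shearD hφt) (isTest_shearD hψ)) (i (isTest_shearO hφt) (isTest_shearO hψ)),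
    ← sub_eq_zero, ← integral_sub]
  -- The difference of the integrands is twice `∂₀φ₀ ∂₁ψ₁ - ∂₁φ₀ ∂₀ψ₁` plus twice `∂₁φ₁ ∂₀ψ₀ - ∂₀φ₁
  -- ∂₁ψ₀`, and each bracket has zero integral.
  · have c0 := integral_fderiv_mul_fderiv_comm (hφ 0) (hψ 1).1 (hψ 1).2.1 (ee 0) (ee 1)
    have c1 := integral_fderiv_mul_fderiv_comm (hφ 1) (hψ 0).1 (hψ 0).2.1 (ee 1) (ee 0)
    rw [← sub_eq_zero, ← integral_sub (i' _ _ _ _) (i' _ _ _ _)] at c0 c1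
    have := congrArg₂ (fun s t => 2 * s + 2 * t) c0 c1
    simp only [mul_zero, add_zero] at this
    rw [← integral_const_mul, ← integral_const_mul, ← integral_add] at this
    · rw [← this]
      refine integral_congr_ae (Eventually.of_forall fun x => ?_)
      simp only [divg, curl, shearD, shearO]
      ring
    · exact ((i' _ _ _ _).sub (i' _ _ _ _)).const_mul _
    · exact ((i' _ _ _ _).sub (i' _ _ _ _)).const_mul _
  · exact (i (isTest_divg hφt) (isTest_divg hψ)).add (i (isTest_curl hφt) (isTest_curl hψ))
  · exact (i (isTest_shearD hφt) (isTest_shearD hψ)).add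
      (i (isTest_shearO hφt) (isTest_shearO hψ))

theorem differentiable_test (hψ : ∀ i, IsTest Ω (ψ i)) (i : Fin 2) (x : R2) :
    DifferentiableAt ℝ (ψ i) x := (hψ i).1.differentiable (by simp) x

variable (Ω) in
/-- The pairs (divergence, curl) of test fields, as a subspace of `L² × L²`. -/
noncomputable def divCurl :
    Submodule ℝ (WithLp 2 (Lp ℝ 2 (volume.restrict Ω) × Lp ℝ 2 (volume.restrict Ω))) where
  carrier := {v | ∃ ψ : Fin 2 → R2 → ℝ, (∀ i, IsTest Ω (ψ i)) ∧
    v.fst =ᵐ[volume.restrict Ω] divg ψ ∧ v.snd =ᵐ[volume.restrict Ω] curl ψ}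
  zero_mem' := by
    refine ⟨fun _ _ => 0, fun _ => isTest_zero Ω, ?_, ?_⟩
    · filter_upwards [Lp.coeFn_zero ℝ 2 (volume.restrict Ω)] with x hx
      rw [WithLp.zero_fst, hx]
      simp [divg]
    · filter_upwards [Lp.coeFn_zero ℝ 2 (volume.restrict Ω)] with x hx
      rw [WithLp.zero_snd, hx]
      simp [curl]
  add_mem' := by
    rintro v w ⟨ψ, hψ, h1, h2⟩ ⟨χ, hχ, h3, h4⟩
    refine ⟨fun i x => ψ i x + χ i x, fun i => (hψ i).add (hχ i), ?_, ?_⟩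
    · filter_upwards [Lp.coeFn_add v.fst w.fst, h1, h3] with x hx h1 h3
      rw [WithLp.add_fst, hx, Pi.add_apply, h1, h3]
      simp only [divg]
      rw [fderiv_fun_add (differentiable_test hψ _ x) (differentiable_test hχ _ x),
        fderiv_fun_add (differentiable_test hψ _ x) (differentiable_test hχ _ x)]
      simp only [add_apply]
      ring
    · filter_upwards [Lp.coeFn_add v.snd w.snd, h2, h4] with x hx h1 h3
      rw [WithLp.add_snd, hx, Pi.add_apply, h1, h3]
      simp only [curl]
      rw [fderiv_fun_add (differentiable_test hψ _ x) (differentiable_test hχ _ x),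
        fderiv_fun_add (differentiable_test hψ _ x) (differentiable_test hχ _ x)]
      simp only [add_apply]
      ring
  smul_mem' := by
    rintro c v ⟨ψ, hψ, h1, h2⟩
    refine ⟨fun i x => c * ψ i x, fun i => (hψ i).mul_left contDiff_const, ?_, ?_⟩
    · filter_upwards [Lp.coeFn_smul c v.fst, h1] with x hx h1
      rw [WithLp.smul_fst, hx, Pi.smul_apply, h1]
      simp only [divg]
      rw [fderiv_const_mul (differentiable_test hψ _ x), fderiv_const_mul (differentiable_test hψ _ x)]
      simp only [smul_apply, smul_eq_mul]
      ring
    · filter_upwards [Lp.coeFn_smul c v.snd, h2] with x hx h1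
      rw [WithLp.smul_snd, hx, Pi.smul_apply, h1]
      simp only [curl]
      rw [fderiv_const_mul (differentiable_test hψ _ x), fderiv_const_mul (differentiable_test hψ _ x)]
      simp only [smul_apply, smul_eq_mul]
      ring

theorem integral_mul_eq_inner_toLp {α : Type*} [MeasurableSpace α] {ν : Measure α} {a b : α → ℝ}
    (ha : MemLp a 2 ν) (hb : MemLp b 2 ν) :
    ∫ x, a x * b x ∂ν = inner ℝ (ha.toLp a) (hb.toLp b) := by
  rw [← integral_mul_eq_inner]
  refine integral_congr_ae ?_
  filter_upwards [hb.coeFn_toLp] with x h1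
  rw [h1]

/-- `(a, b)` is what remains of (div φ, curl φ) after orthogonal projection onto the closure of
`divCurl Ω`. The projection is no larger than the shear: by the null Lagrangian identity, pairing
(div φ, curl φ) with (div ψ, curl ψ) equals pairing the shears, and on test fields the two pairs
have equal norm. -/
theorem exists_weakCR_approx {φ : Fin 2 → R2 → ℝ} (hφ : ∀ i, ContDiff ℝ ∞ (φ i))
    (hφc : ∀ i, HasCompactSupport (φ i)) :
    ∃ a b : R2 → ℝ, MemLp a 2 (volume.restrict Ω) ∧ MemLp b 2 (volume.restrict Ω) ∧
      WeakCR Ω a b ∧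
      (∫ x in Ω, (divg φ x - a x) ^ 2) + ∫ x in Ω, (curl φ x - b x) ^ 2 ≤
        (∫ x in Ω, shearD φ x ^ 2) + ∫ x in Ω, shearO φ x ^ 2 := by
  have hφt : ∀ i, IsTest Set.univ (φ i) := fun i => ⟨hφ i, hφc i, Set.subset_univ _⟩
  have mt : MemLp (divg φ) 2 (volume.restrict Ω) := (isTest_divg hφt).memLp _
  have mr : MemLp (curl φ) 2 (volume.restrict Ω) := (isTest_curl hφt).memLp _
  have mp : MemLp (shearD φ) 2 (volume.restrict Ω) := (isTest_shearD hφt).memLp _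
  have mq : MemLp (shearO φ) 2 (volume.restrict Ω) := (isTest_shearO hφt).memLp _
  let H := WithLp 2 (Lp ℝ 2 (volume.restrict Ω) × Lp ℝ 2 (volume.restrict Ω))
  let V : Submodule ℝ H := (divCurl Ω).topologicalClosure
  have hVcl : IsClosed (V : Set H) := Submodule.isClosed_topologicalClosure _
  have : CompleteSpace V := hVcl.completeSpace_coe
  let F : H := WithLp.toLp 2 (mt.toLp _, mr.toLp _)
  let G : H := WithLp.toLp 2 (mp.toLp _, mq.toLp _)
  have hb0 : ∀ v ∈ divCurl Ω, inner ℝ F v ≤ ‖G‖ * ‖v‖ := by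
    rintro v ⟨ψ, hψ, h1, h2⟩
    have nt : MemLp (divg ψ) 2 (volume.restrict Ω) := (isTest_divg hψ).memLp _
    have nr : MemLp (curl ψ) 2 (volume.restrict Ω) := (isTest_curl hψ).memLp _
    have np : MemLp (shearD ψ) 2 (volume.restrict Ω) := (isTest_shearD hψ).memLp _
    have nq : MemLp (shearO ψ) 2 (volume.restrict Ω) := (isTest_shearO hψ).memLp _
    have hv : v = WithLp.toLp 2 (nt.toLp _, nr.toLp _) := by
      have e1 : v.fst = nt.toLp _ := Lp.ext (h1.trans nt.coeFn_toLp.symm)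
      have e2 : v.snd = nr.toLp _ := Lp.ext (h2.trans nr.coeFn_toLp.symm)
      rw [← e1, ← e2]
      rfl
    set w : H := WithLp.toLp 2 (np.toLp _, nq.toLp _) with hw
    have hin : inner ℝ F v = inner ℝ G w := by
      have := integral_divg_mul_add_curl_mul hφ hφc hψ
      rw [integral_mul_eq_inner_toLp mt nt, integral_mul_eq_inner_toLp mr nr,
        integral_mul_eq_inner_toLp mp np, integral_mul_eq_inner_toLp mq nq] at this
      rw [hv, WithLp.prod_inner_apply, WithLp.prod_inner_apply]
      exact this
    have hnorm : ‖v‖ = ‖w‖ := by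
      have := integral_divg_mul_add_curl_mul (fun i => (hψ i).1) (fun i => (hψ i).2.1) hψ
      rw [integral_mul_eq_inner_toLp nt nt, integral_mul_eq_inner_toLp nr nr,
        integral_mul_eq_inner_toLp np np, integral_mul_eq_inner_toLp nq nq] at this
      have h2 : inner ℝ v v = inner ℝ w w := by
        rw [hv, WithLp.prod_inner_apply, WithLp.prod_inner_apply]
        exact this
      rw [real_inner_self_eq_norm_sq, real_inner_self_eq_norm_sq] at h2
      exact (sq_eq_sq₀ (norm_nonneg _) (norm_nonneg _)).1 h2
    rw [hin, hnorm]
    exact real_inner_le_norm _ _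
  have hb : ∀ v ∈ V, inner ℝ F v ≤ ‖G‖ * ‖v‖ := by
    have hc : IsClosed {v : H | inner ℝ F v ≤ ‖G‖ * ‖v‖} :=
      isClosed_le (by fun_prop) (by fun_prop)
    exact fun v hv => closure_minimal hb0 hc hv
  let P : H := V.starProjection F
  have hPV : P ∈ V := V.starProjection_apply_mem F
  have hort : ∀ v ∈ V, inner ℝ v (F - P) = 0 := fun v hv =>
    (Submodule.mem_orthogonal _ _).1 (V.sub_starProjection_mem_orthogonal F) v hv
  have hPG : ‖P‖ ^ 2 ≤ ‖G‖ ^ 2 := by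
    have h1 : inner ℝ F P = ‖P‖ ^ 2 := by
      have := hort P hPV
      rw [inner_sub_right, sub_eq_zero, real_inner_self_eq_norm_sq, real_inner_comm] at this
      exact this
    have h2 := hb P hPV
    rw [h1] at h2
    have : ‖P‖ ≤ ‖G‖ := by
      by_contra hlt
      push Not at hlt
      nlinarith [norm_nonneg G]
    gcongr
  set Q : H := F - P with hQ
  refine ⟨Q.fst, Q.snd, Lp.memLp _, Lp.memLp _, ?_, ?_⟩
  · intro φ hφ
    have key : ∀ ψ : Fin 2 → R2 → ℝ, (∀ i, IsTest Ω (ψ i)) →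
        (∫ x in Ω, divg ψ x * Q.fst x) + ∫ x in Ω, curl ψ x * Q.snd x = 0 := by
      intro ψ hψ
      have nt : MemLp (divg ψ) 2 (volume.restrict Ω) := (isTest_divg hψ).memLp _
      have nr : MemLp (curl ψ) 2 (volume.restrict Ω) := (isTest_curl hψ).memLp _
      have := hort (WithLp.toLp 2 (nt.toLp _, nr.toLp _)) (Submodule.le_topologicalClosure _
        ⟨ψ, hψ, nt.coeFn_toLp, nr.coeFn_toLp⟩)
      rw [WithLp.prod_inner_apply] at this
      rw [integral_mul_eq_inner nt, integral_mul_eq_inner nr]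
      exact this
    -- Orthogonality against fields with a single nonzero component is exactly the pair of weak
    -- Cauchy-Riemann equations.
    have k0 := key ![φ, fun _ => 0] (by
      intro i; fin_cases i
      · exact hφ
      · exact isTest_zero Ω)
    have k1 := key ![fun _ => 0, φ] (by
      intro i; fin_cases i
      · exact isTest_zero Ω
      · exact hφ)
    simp [divg, curl] at k0 k1
    simp only [integral_neg] at k0
    constructor <;> linarith
  · have hn : ∀ w : H, ‖w‖ ^ 2 = ‖w.fst‖ ^ 2 + ‖w.snd‖ ^ 2 := fun w => WithLp.prod_norm_sq_eq_of_L2 w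
    rw [hn P, hn G, norm_sq_lp, norm_sq_lp, norm_sq_lp, norm_sq_lp] at hPG
    have hPF : P = F - Q := by rw [hQ]; abel
    have e1 : P.fst =ᵐ[volume.restrict Ω] fun x => divg φ x - Q.fst x := by
      rw [hPF, WithLp.sub_fst]
      filter_upwards [Lp.coeFn_sub F.fst Q.fst, mt.coeFn_toLp] with x hx h1
      rw [hx, Pi.sub_apply]
      exact congrArg (· - _) h1
    have e2 : P.snd =ᵐ[volume.restrict Ω] fun x => curl φ x - Q.snd x := by
      rw [hPF, WithLp.sub_snd]
      filter_upwards [Lp.coeFn_sub F.snd Q.snd, mr.coeFn_toLp] with x hx h1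
      rw [hx, Pi.sub_apply]
      exact congrArg (· - _) h1
    have cg : ∀ {f g : R2 → ℝ}, f =ᵐ[volume.restrict Ω] g →
        ∫ x in Ω, f x ^ 2 = ∫ x in Ω, g x ^ 2 := fun hfg =>
      integral_congr_ae (hfg.mono fun x hx => by simp only [hx])
    have e3 : G.fst =ᵐ[volume.restrict Ω] shearD φ := mp.coeFn_toLp
    have e4 : G.snd =ᵐ[volume.restrict Ω] shearO φ := mq.coeFn_toLp
    rw [cg e1, cg e2, cg e3, cg e4] at hPG
    exact hPG

end Tests

/-! ### Second Korn inequality for smooth fields -/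

theorem exists_cutoff {Ω K : Set R2} (hΩ : IsOpen Ω) (hK : IsCompact K) (hKΩ : K ⊆ Ω) :
    ∃ θ : R2 → ℝ, IsTest Ω θ ∧ (∀ x, θ x ∈ Set.Icc (0 : ℝ) 1) ∧ ∀ x ∈ K, θ x = 1 := by
  obtain ⟨d, hd0, hd⟩ := hK.exists_cthickening_subset_open hΩ hKΩ
  obtain ⟨f, hf0, hf1, hf⟩ := exists_contMDiffMap_zero_one_of_isClosed (modelWithCornersSelf ℝ R2) (n := (⊤ : ℕ∞))
    (s := (thickening d K)ᶜ) (t := K) isOpen_thickening.isClosed_compl hK.isClosed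
    (Set.disjoint_compl_left_iff_subset.2 (self_subset_thickening hd0 K))
  have hts : tsupport f ⊆ cthickening d K := by
    refine closure_minimal (fun x hx => ?_) isClosed_cthickening
    by_contra h
    exact hx (hf0 fun h' => h (thickening_subset_cthickening _ _ h'))
  refine ⟨f, ⟨f.contMDiff.contDiff, ?_, hts.trans hd⟩, hf, fun x hx => hf1 hx⟩
  exact (hK.cthickening (r := d)).of_isClosed_subset (isClosed_tsupport _) hts

theorem fderiv_cutoff_mul {θ φ : R2 → ℝ} (hθ : ContDiff ℝ ∞ θ) (hφ : ContDiff ℝ ∞ φ) (x e : R2) :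
    fderiv ℝ (fun y => φ y * θ y) x e = θ x * fderiv ℝ φ x e + φ x * fderiv ℝ θ x e := by
  rw [fderiv_fun_mul (hφ.differentiable (by simp) x) (hθ.differentiable (by simp) x)]
  simp
  ring

theorem setIntegral_indicator_of_subset {Ω K : Set R2} (hK : MeasurableSet K) (hKΩ : K ⊆ Ω)
    (f : R2 → ℝ) : ∫ x in Ω, K.indicator f x = ∫ x in K, f x := by
  rw [setIntegral_indicator hK, Set.inter_eq_right.2 hKΩ]

/-- For a compactly supported field the null Lagrangian identity, paired with the field itself,
bounds the curl by the shear after dropping the square of the divergence. Cutting off `φ` costs only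
zero-order terms on the support of the cutoff. -/
theorem exists_interior_curl_bound {Ω K : Set R2} (hΩ : IsOpen Ω) (hK : IsCompact K)
    (hKΩ : K ⊆ Ω) :
    ∃ (K' : Set R2) (C : ℝ), IsCompact K' ∧ K' ⊆ Ω ∧ K ⊆ K' ∧ 0 ≤ C ∧
      ∀ φ : Fin 2 → R2 → ℝ, (∀ i, ContDiff ℝ ∞ (φ i)) → (∀ i, HasCompactSupport (φ i)) →
        ∫ x in K, curl φ x ^ 2 ≤ 4 * ((∫ x in Ω, shearD φ x ^ 2) + ∫ x in Ω, shearO φ x ^ 2) +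
          C * ∫ x in K', (φ 0 x ^ 2 + φ 1 x ^ 2) := by
  obtain ⟨θ, hθ, hθ01, hθ1⟩ := exists_cutoff hΩ hK hKΩ
  set K' := tsupport θ with hK'
  have hK'c : IsCompact K' := hθ.2.1.isCompact
  have hKK' : K ⊆ K' := fun x hx => subset_tsupport _ (by simp [hθ1 x hx])
  obtain ⟨N, hN⟩ := hθ.fderiv_continuous.bounded_above_of_compact_support (hθ.2.1.fderiv ℝ)
  have hNj : ∀ j x, |fderiv ℝ θ x (ee j)| ≤ N := fun j x => by
    refine ((fderiv ℝ θ x).le_opNorm _).trans ?_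
    simpa using hN x
  have hzero : ∀ x, x ∉ K' → ∀ e, fderiv ℝ θ x e = 0 := fun x hx e => by
    rw [fderiv_of_notMem_tsupport (𝕜 := ℝ) hx]; rfl
  -- Squaring a sum costs a factor 2 when passing from `φ` to the cut-off field and again when
  -- passing back: 4 on the shear, and `2 (4N² + 4N²) + 4N² = 20N²` on the zero-order terms.
  refine ⟨K', 20 * N ^ 2, hK'c, hθ.2.2, hKK', by positivity, fun φ hφ hφc => ?_⟩
  have hφt : ∀ i, IsTest Set.univ (φ i) := fun i => ⟨hφ i, hφc i, Set.subset_univ _⟩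
  set ψ : Fin 2 → R2 → ℝ := fun i x => φ i x * θ x with hψ
  have hψt : ∀ i, IsTest Ω (ψ i) := fun i => hθ.mul_left (hφ i)
  have hψd : ∀ i j x, fderiv ℝ (ψ i) x (ee j) =
      θ x * fderiv ℝ (φ i) x (ee j) + φ i x * fderiv ℝ θ x (ee j) := fun i j x =>
    fderiv_cutoff_mul hθ.1 (hφ i) x _
  have cφ : ∀ i, Continuous (φ i) := fun i => (hφ i).continuous
  set Φ : R2 → ℝ := fun x => φ 0 x ^ 2 + φ 1 x ^ 2 with hΦ
  have hΦc : Continuous Φ := by fun_prop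
  have iK : ∀ {f : R2 → ℝ} {S : Set R2}, IsCompact S → Continuous f → IntegrableOn f S := fun hS hf =>
    hf.continuousOn.integrableOn_compact hS
  have iΩ : ∀ {f : R2 → ℝ}, IsTest Set.univ f → IntegrableOn (fun x => f x ^ 2) Ω := fun hf =>
    (hf.memLp (volume.restrict Ω)).integrable_sq
  have hnull := integral_divg_mul_add_curl_mul (fun i => (hψt i).1) (fun i => (hψt i).2.1) hψt
  simp only [← pow_two] at hnull
  have hdiv0 : 0 ≤ ∫ x in Ω, divg ψ x ^ 2 := integral_nonneg fun x => sq_nonneg _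
  have key : ∀ (α β s N u v a b : ℝ), |u| ≤ N → |v| ≤ N → s ∈ Set.Icc (0 : ℝ) 1 →
      (s * α + (a * u + b * v)) ^ 2 ≤ 2 * α ^ 2 + 4 * N ^ 2 * (a ^ 2 + b ^ 2) := by
    intro α β s N u v a b hu hv hs
    have h1 : u ^ 2 ≤ N ^ 2 := sq_le_sq' (by linarith [(abs_le.1 hu).1]) (abs_le.1 hu).2
    have h2 : v ^ 2 ≤ N ^ 2 := sq_le_sq' (by linarith [(abs_le.1 hv).1]) (abs_le.1 hv).2
    have h3 : s ^ 2 ≤ 1 := by nlinarith [hs.1, hs.2]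
    have h4 := mul_le_mul_of_nonneg_right h1 (sq_nonneg a)
    have h5 := mul_le_mul_of_nonneg_right h2 (sq_nonneg b)
    have h6 := mul_le_mul_of_nonneg_right h3 (sq_nonneg α)
    nlinarith [sq_nonneg (s * α - (a * u + b * v)), sq_nonneg (a * u - b * v)]
  have key' : ∀ (α s N u v a b : ℝ), |u| ≤ N → |v| ≤ N → s = 1 →
      α ^ 2 ≤ 2 * (s * α + (a * u + b * v)) ^ 2 + 4 * N ^ 2 * (a ^ 2 + b ^ 2) := by
    intro α s N u v a b hu hv hs
    have := key (α + (a * u + b * v)) 0 1 N (-u) (-v) a b (by rwa [abs_neg]) (by rwa [abs_neg])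
      (by simp)
    rw [hs]
    ring_nf at this ⊢
    linarith
  have step : ∀ f g : R2 → ℝ, IsTest Set.univ f → IsTest Set.univ g →
      (∀ x, f x ^ 2 ≤ 2 * g x ^ 2 + K'.indicator (fun x => 4 * N ^ 2 * Φ x) x) →
      ∫ x in Ω, f x ^ 2 ≤ 2 * (∫ x in Ω, g x ^ 2) + 4 * N ^ 2 * ∫ x in K', Φ x := by
    intro f g hf hg hfg
    have i1 : IntegrableOn (K'.indicator fun x => 4 * N ^ 2 * Φ x) Ω :=
      ((iK hK'c (by fun_prop)).integrable_indicator hK'c.measurableSet).integrableOn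
    have := integral_mono (μ := volume.restrict Ω) (iΩ hf) (((iΩ hg).const_mul 2).add i1)
      (fun x => by simpa using hfg x)
    simp only [Pi.add_apply] at this
    rw [integral_add ((iΩ hg).const_mul 2) i1, integral_const_mul,
      setIntegral_indicator_of_subset hK'c.measurableSet hθ.2.2, integral_const_mul] at this
    exact this
  have hψu : ∀ i, IsTest Set.univ (ψ i) := fun i => (hψt i).mono (Set.subset_univ _)
  have s1 := step (shearD ψ) (shearD φ) (isTest_shearD hψu) (isTest_shearD hφt) (fun x => by
    have e : shearD ψ x = θ x * shearD φ x +
        (φ 0 x * fderiv ℝ θ x (ee 0) + φ 1 x * (-fderiv ℝ θ x (ee 1))) := by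
      simp only [shearD, hψd]; ring
    by_cases hx : x ∈ K'
    · rw [e, Set.indicator_of_mem hx]
      exact key _ 0 _ N _ _ _ _ (hNj _ _) (by rw [abs_neg]; exact hNj _ _) (hθ01 x)
    · rw [e, Set.indicator_of_notMem hx, hzero x hx, hzero x hx]
      simpa using key (shearD φ x) 0 (θ x) 0 0 0 0 0 (by simp) (by simp) (hθ01 x))
  have s2 := step (shearO ψ) (shearO φ) (isTest_shearO hψu) (isTest_shearO hφt) (fun x => by
    have e : shearO ψ x = θ x * shearO φ x +
        (φ 0 x * fderiv ℝ θ x (ee 1) + φ 1 x * (fderiv ℝ θ x (ee 0))) := by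
      simp only [shearO, hψd]; ring
    by_cases hx : x ∈ K'
    · rw [e, Set.indicator_of_mem hx]
      exact key _ 0 _ N _ _ _ _ (hNj _ _) (hNj _ _) (hθ01 x)
    · rw [e, Set.indicator_of_notMem hx, hzero x hx, hzero x hx]
      simpa using key (shearO φ x) 0 (θ x) 0 0 0 0 0 (by simp) (by simp) (hθ01 x))
  have s3 : ∫ x in K, curl φ x ^ 2 ≤ 2 * (∫ x in K, curl ψ x ^ 2) + 4 * N ^ 2 * ∫ x in K, Φ x := by
    rw [← integral_const_mul, ← integral_const_mul, ← integral_add]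
    · refine setIntegral_mono_on (iK hK ((isTest_curl hφt).continuous.pow 2)) ?_ hK.measurableSet
        fun x hx => ?_
      · exact (iK hK (((isTest_curl hψt).continuous.pow 2).const_mul _)).add
          (iK hK (hΦc.const_mul _))
      · have e : curl ψ x = θ x * curl φ x +
            (φ 0 x * (-fderiv ℝ θ x (ee 1)) + φ 1 x * fderiv ℝ θ x (ee 0)) := by
          simp only [curl, hψd]; ring
        rw [e]
        exact key' _ _ N _ _ _ _ (by rw [abs_neg]; exact hNj _ _) (hNj _ _) (hθ1 x hx)
    · exact iK hK (((isTest_curl hψt).continuous.pow 2).const_mul _)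
    · exact iK hK (hΦc.const_mul _)
  have s4 : ∫ x in K, curl ψ x ^ 2 ≤ ∫ x in Ω, curl ψ x ^ 2 :=
    setIntegral_mono_set (iΩ (isTest_curl hψu)) (Eventually.of_forall fun x => sq_nonneg _)
      (LE.le.eventuallyLE hKΩ)
  have s5 : ∫ x in K, Φ x ≤ ∫ x in K', Φ x :=
    setIntegral_mono_set (iK hK'c hΦc)
      (Eventually.of_forall fun x => by simp only [hΦ]; positivity)
      (LE.le.eventuallyLE hKK')
  have s6 := mul_le_mul_of_nonneg_left s5 (show 0 ≤ 4 * N ^ 2 by positivity)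
  linarith

/-- Shear, divergence and curl determine the gradient, so only the curl has to be bounded. By
`exists_weakCR_approx` it is close to `b` and the divergence is close to `a`, up to the shear.
`WeakCR.integral_sq_le` bounds `b` by `a` and by `b` on `K`; there `b` is compared with the curl
again, for which `exists_interior_curl_bound` is available. The zero-order term follows from
`integral_sq_le_of_contDiff`. -/
theorem exists_korn_of_contDiff {Ω : Set R2} (hΩ : IsOpen Ω) (hb : Bornology.IsBounded Ω)
    (hL : HasLipschitzBoundary Ω) :
    ∃ (K : Set R2) (C : ℝ), IsCompact K ∧ K ⊆ Ω ∧ 0 ≤ C ∧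
      ∀ φ : Fin 2 → R2 → ℝ, (∀ i, ContDiff ℝ ∞ (φ i)) → (∀ i, HasCompactSupport (φ i)) →
        ∀ i, (∫ x in Ω, φ i x ^ 2) + (∫ x in Ω, fderiv ℝ (φ i) x (ee 0) ^ 2) +
          (∫ x in Ω, fderiv ℝ (φ i) x (ee 1) ^ 2) ≤
        C * ((∫ x in Ω, shearD φ x ^ 2) + (∫ x in Ω, shearO φ x ^ 2) + (∫ x in Ω, divg φ x ^ 2) +
          ((∫ x in K, φ 0 x ^ 2) + ∫ x in K, φ 1 x ^ 2)) := by
  obtain ⟨K, M, X, hK, hKΩ, hM, hX, hXb, hXd, habs⟩ := exists_absorbing_fields hΩ hb hL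
  obtain ⟨K', C, hK', hK'Ω, hKK', hC, hcurl⟩ := exists_interior_curl_bound hΩ hK hKΩ
  set c₁ := 8 * M + 64 * M ^ 2
  set c₂ := 8 * M + 2
  -- With `S` the bracket on the right: `a` costs 2, the curl on `K` costs `4 + C`, `b` on `K` costs
  -- `2 (4 + C) + 2`, and the curl on `Ω` twice the cost of `b` plus 2.
  set D := 2 * (c₁ * 2 + c₂ * (2 * (4 + C) + 2)) + 2 with hD
  have hc1 : 0 ≤ c₁ := by positivity
  have hc2 : 0 ≤ c₂ := by positivity
  have hD0 : 0 ≤ D := by positivity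
  refine ⟨K', 32 * M ^ 2 * (D + 2) + c₂ + (D + 2), hK', hK'Ω, by positivity, fun φ hφ hφc i => ?_⟩
  have hφt : ∀ i, IsTest Set.univ (φ i) := fun i => ⟨hφ i, hφc i, Set.subset_univ _⟩
  obtain ⟨a, b, ha, hb, hab, hE⟩ := exists_weakCR_approx (Ω := Ω) hφ hφc
  have iK : ∀ {f : R2 → ℝ} {S : Set R2}, IsCompact S → Continuous f → IntegrableOn f S := fun hS hf =>
    hf.continuousOn.integrableOn_compact hS
  have mt : MemLp (divg φ) 2 (volume.restrict Ω) := (isTest_divg hφt).memLp _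
  have mr : MemLp (curl φ) 2 (volume.restrict Ω) := (isTest_curl hφt).memLp _
  have mp : MemLp (shearD φ) 2 (volume.restrict Ω) := (isTest_shearD hφt).memLp _
  have mq : MemLp (shearO φ) 2 (volume.restrict Ω) := (isTest_shearO hφt).memLp _
  have md : ∀ i j, MemLp (fun x => fderiv ℝ (φ i) x (ee j)) 2 (volume.restrict Ω) := fun i j =>
    ((hφt i).partialDeriv _).memLp _
  have tri : ∀ {f g h : R2 → ℝ} (S : Set R2), S ⊆ Ω → MemLp g 2 (volume.restrict Ω) →
      MemLp h 2 (volume.restrict Ω) → (∀ x, f x ^ 2 ≤ 2 * g x ^ 2 + 2 * h x ^ 2) →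
      ∫ x in S, f x ^ 2 ≤ 2 * (∫ x in S, g x ^ 2) + 2 * ∫ x in Ω, h x ^ 2 := by
    intro f g h S hS hg hh hfg
    have hg' := (hg.mono_measure (Measure.restrict_mono hS le_rfl)).integrable_sq
    have hh' := (hh.mono_measure (Measure.restrict_mono hS le_rfl)).integrable_sq
    have h1 := integral_mono_of_nonneg (μ := volume.restrict S) (f := fun x => f x ^ 2)
      (Eventually.of_forall fun x => sq_nonneg _)
      ((hg'.const_mul 2).add (hh'.const_mul 2)) (Eventually.of_forall fun x => hfg x)
    simp only [Pi.add_apply] at h1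
    rw [integral_add (hg'.const_mul 2) (hh'.const_mul 2), integral_const_mul,
      integral_const_mul] at h1
    have h2 : ∫ x in S, h x ^ 2 ≤ ∫ x in Ω, h x ^ 2 :=
      setIntegral_mono_set hh.integrable_sq (Eventually.of_forall fun x => sq_nonneg _)
        (LE.le.eventuallyLE hS)
    linarith
  have t1 := tri Ω subset_rfl mt (mt.sub ha) (f := a) (fun x => by
    simp only [Pi.sub_apply]; nlinarith [sq_nonneg (2 * divg φ x - a x)])
  have t2 := tri K hKΩ mr (mr.sub hb) (f := b) (fun x => by
    simp only [Pi.sub_apply]; nlinarith [sq_nonneg (2 * curl φ x - b x)])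
  have t3 := tri Ω subset_rfl hb (mr.sub hb) (f := curl φ) (fun x => by
    simp only [Pi.sub_apply]; nlinarith [sq_nonneg (2 * b x - curl φ x)])
  have t4 := hab.integral_sq_le hΩ hX hXd habs ha hb
  have t5 := hcurl φ hφ hφc
  rw [integral_add (iK hK' ((hφ 0).pow 2).continuous) (iK hK' ((hφ 1).pow 2).continuous)] at t5
  simp only [Pi.sub_apply] at t1 t2 t3
  have nn : ∀ (f : R2 → ℝ) (S : Set R2), 0 ≤ ∫ x in S, f x ^ 2 := fun f S =>
    integral_nonneg fun x => sq_nonneg _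
  have eq1 : (∫ x in Ω, fderiv ℝ (φ 0) x (ee 0) ^ 2) + ∫ x in Ω, fderiv ℝ (φ 1) x (ee 1) ^ 2 =
      ((∫ x in Ω, shearD φ x ^ 2) + ∫ x in Ω, divg φ x ^ 2) / 2 := by
    rw [← integral_add (md _ _).integrable_sq (md _ _).integrable_sq,
      ← integral_add mp.integrable_sq mt.integrable_sq, ← integral_div]
    refine integral_congr_ae (Eventually.of_forall fun x => ?_)
    simp only [shearD, divg]
    ring
  have eq2 : (∫ x in Ω, fderiv ℝ (φ 0) x (ee 1) ^ 2) + ∫ x in Ω, fderiv ℝ (φ 1) x (ee 0) ^ 2 =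
      ((∫ x in Ω, shearO φ x ^ 2) + ∫ x in Ω, curl φ x ^ 2) / 2 := by
    rw [← integral_add (md _ _).integrable_sq (md _ _).integrable_sq,
      ← integral_add mq.integrable_sq mr.integrable_sq, ← integral_div]
    refine integral_congr_ae (Eventually.of_forall fun x => ?_)
    simp only [shearO, curl]
    ring
  have t6 := integral_sq_le_of_contDiff hX hXb habs (hφ i) (hφc i)
  have t7 : ∀ i, ∫ x in K, φ i x ^ 2 ≤ ∫ x in K', φ i x ^ 2 := fun i =>
    setIntegral_mono_set (iK hK' ((hφ i).continuous.pow 2))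
      (Eventually.of_forall fun x => sq_nonneg _) (LE.le.eventuallyLE hKK')
  have n0 := nn (shearD φ) Ω
  have n1 := nn (shearO φ) Ω
  have n2 := nn (divg φ) Ω
  have n3 := nn (φ 0) K'
  have n4 := nn (φ 1) K'
  have m0 := nn (fun x => fderiv ℝ (φ 0) x (ee 0)) Ω
  have m1 := nn (fun x => fderiv ℝ (φ 0) x (ee 1)) Ω
  have m2 := nn (fun x => fderiv ℝ (φ 1) x (ee 0)) Ω
  have m3 := nn (fun x => fderiv ℝ (φ 1) x (ee 1)) Ω
  have m4 := nn (fun x => divg φ x - a x) Ω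
  have m5 := nn (fun x => curl φ x - b x) Ω
  set S := (∫ x in Ω, shearD φ x ^ 2) + (∫ x in Ω, shearO φ x ^ 2) + (∫ x in Ω, divg φ x ^ 2) +
          ((∫ x in K', φ 0 x ^ 2) + ∫ x in K', φ 1 x ^ 2) with hS
  have hS0 : 0 ≤ S := by positivity
  have u1 : ∫ x in Ω, a x ^ 2 ≤ 2 * S := by linarith
  have u2 : ∫ x in K, curl φ x ^ 2 ≤ (4 + C) * S := by
    have : C * ((∫ x in K', φ 0 x ^ 2) + ∫ x in K', φ 1 x ^ 2) ≤ C * S :=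
      mul_le_mul_of_nonneg_left (by linarith) hC
    linarith
  have u3 : ∫ x in K, b x ^ 2 ≤ (2 * (4 + C) + 2) * S := by linarith
  have u4 : ∫ x in Ω, b x ^ 2 ≤ (c₁ * 2 + c₂ * (2 * (4 + C) + 2)) * S := by
    have h1 := mul_le_mul_of_nonneg_left u1 hc1
    have h2 := mul_le_mul_of_nonneg_left u3 hc2
    linarith
  have u5 : ∫ x in Ω, curl φ x ^ 2 ≤ D * S := by
    rw [hD]; linarith
  have u6 : (∫ x in Ω, fderiv ℝ (φ i) x (ee 0) ^ 2) + (∫ x in Ω, fderiv ℝ (φ i) x (ee 1) ^ 2) ≤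
      (D + 2) * S := by
    have hDS : 0 ≤ D * S := by positivity
    fin_cases i <;> simp <;> linarith
  have u7 := mul_le_mul_of_nonneg_left u6 (show 0 ≤ 32 * M ^ 2 by positivity)
  have u8 : c₂ * ∫ x in K, φ i x ^ 2 ≤ c₂ * S := by
    refine mul_le_mul_of_nonneg_left ?_ hc2
    have := t7 i
    fin_cases i <;> simp at this ⊢ <;> linarith
  linarith

/-! ### The closed subspace of fields vanishing on the Dirichlet part -/

theorem IsWeakPartial.ae_eq {Ω : Set R2} (hΩ : IsOpen Ω) {j : Fin 2} {v G G' : R2 → ℝ}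
    (h : IsWeakPartial Ω j v G) (h' : IsWeakPartial Ω j v G')
    (hG : MemLp G 2 (volume.restrict Ω)) (hG' : MemLp G' 2 (volume.restrict Ω)) :
    G =ᵐ[volume.restrict Ω] G' := by
  have hm : MemLp (fun x => G x - G' x) 2 (volume.restrict Ω) := hG.sub hG'
  have h1 : LocallyIntegrableOn (fun x => G x - G' x) Ω :=
    (locallyIntegrableOn_of_locallyIntegrable_restrict (hm.locallyIntegrable (by norm_num)))
  have h2 := hΩ.ae_eq_zero_of_integral_contDiff_smul_eq_zero h1 (fun φ hφ hc hs => by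
    have ht : IsTest Ω φ := ⟨hφ, hc, hs⟩
    have e := (h φ ht).symm.trans (h' φ ht)
    simp only [smul_eq_mul] at e ⊢
    rw [← setIntegral_mul_of_tsupport hs]
    simp only [mul_sub]
    rw [integral_sub (integrable_test_mul ht hG) (integrable_test_mul ht hG')]
    linarith)
  rw [Filter.EventuallyEq, ae_restrict_iff' hΩ.measurableSet]
  filter_upwards [h2] with x hx hxΩ
  linarith [hx hxΩ]

/-- A closed subspace is its own double orthogonal complement, so it is cut out by continuous linear
equations, which survive weak limits. -/
theorem mem_of_weak_limit {H : Type*} [NormedAddCommGroup H] [InnerProductSpace ℝ H]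
    [CompleteSpace H] {V : Submodule ℝ H} (hcl : IsClosed (V : Set H)) {w : ℕ → H} {w₀ : H}
    (hw : ∀ n, w n ∈ V) (hlim : ∀ ψ : H →L[ℝ] ℝ, Tendsto (fun n => ψ (w n)) atTop (𝓝 (ψ w₀))) :
    w₀ ∈ V := by
  have : CompleteSpace V := hcl.completeSpace_coe
  have h : w₀ ∈ Vᗮᗮ := by
    rw [Submodule.mem_orthogonal]
    intro v hv
    refine tendsto_nhds_unique (hlim (innerSL ℝ v)) ?_
    refine tendsto_const_nhds.congr fun n => ?_
    exact ((Submodule.mem_orthogonal' _ _).1 hv _ (hw n)).symm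
  rwa [Submodule.orthogonal_orthogonal] at h

section H1vZero

variable {Ω D : Set R2}

/-- The partial derivatives of the components of a vector field. -/
noncomputable def dL (Ω : Set R2) (j a : Fin 2) : H1v Ω →L[ℝ] Lp ℝ 2 (volume.restrict Ω) :=
  compLp a ∘L coord (some j)

theorem dL_apply (j a : Fin 2) (w : H1v Ω) : dL Ω j a w = compLp a (pd j w) := rfl

theorem dL_ae (j a : Fin 2) (w : H1v Ω) :
    dL Ω j a w =ᵐ[volume.restrict Ω] fun x => pd j w x a := compLp_ae a (pd j w)

/-- The components of a vector field. -/
noncomputable def vL (Ω : Set R2) (a : Fin 2) : H1v Ω →L[ℝ] Lp ℝ 2 (volume.restrict Ω) :=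
  compLp a ∘L coord none

theorem vL_ae (a : Fin 2) (w : H1v Ω) :
    vL Ω a w =ᵐ[volume.restrict Ω] fun x => toLp w x a := compLp_ae a (toLp w)

/-- `∂₀w₀ - ∂₁w₁`. -/
noncomputable def shDL (Ω : Set R2) : H1v Ω →L[ℝ] Lp ℝ 2 (volume.restrict Ω) :=
  dL Ω 0 0 - dL Ω 1 1

/-- `∂₁w₀ + ∂₀w₁`. -/
noncomputable def shOL (Ω : Set R2) : H1v Ω →L[ℝ] Lp ℝ 2 (volume.restrict Ω) :=
  dL Ω 1 0 + dL Ω 0 1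

/-- The divergence. -/
noncomputable def dvL (Ω : Set R2) : H1v Ω →L[ℝ] Lp ℝ 2 (volume.restrict Ω) :=
  dL Ω 0 0 + dL Ω 1 1

theorem shDL_ae (w : H1v Ω) :
    shDL Ω w =ᵐ[volume.restrict Ω] fun x => pd 0 w x 0 - pd 1 w x 1 := by
  filter_upwards [Lp.coeFn_sub (dL Ω 0 0 w) (dL Ω 1 1 w), dL_ae 0 0 w, dL_ae 1 1 w] with x h h1 h2
  exact h.trans (by rw [Pi.sub_apply, h1, h2])

theorem shOL_ae (w : H1v Ω) :
    shOL Ω w =ᵐ[volume.restrict Ω] fun x => pd 1 w x 0 + pd 0 w x 1 := by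
  filter_upwards [Lp.coeFn_add (dL Ω 1 0 w) (dL Ω 0 1 w), dL_ae 1 0 w, dL_ae 0 1 w] with x h h1 h2
  exact h.trans (by rw [Pi.add_apply, h1, h2])

theorem dvL_ae (w : H1v Ω) :
    dvL Ω w =ᵐ[volume.restrict Ω] fun x => pd 0 w x 0 + pd 1 w x 1 := by
  filter_upwards [Lp.coeFn_add (dL Ω 0 0 w) (dL Ω 1 1 w), dL_ae 0 0 w, dL_ae 1 1 w] with x h h1 h2
  exact h.trans (by rw [Pi.add_apply, h1, h2])

/-- `w` is the restriction to `Ω` of a smooth field with compact support away from `D`. -/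
def IsSmoothVanishing (D : Set R2) (w : H1v Ω) : Prop :=
  ∃ φ : R2 → R2, ContDiff ℝ ∞ φ ∧ HasCompactSupport φ ∧ Disjoint (tsupport φ) D ∧
    ∀ᵐ x ∂(volume.restrict Ω), toLp w x = φ x

variable (Ω D) in
/-- The fields that vanish on `D`, as a subspace. -/
noncomputable def smoothVanishing : Submodule ℝ (H1v Ω) where
  carrier := {w | IsSmoothVanishing D w}
  zero_mem' := ⟨fun _ => 0, contDiff_const, HasCompactSupport.zero,
    by simp [tsupport, Function.support_fun_zero], Lp.coeFn_zero R2 2 (volume.restrict Ω)⟩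
  add_mem' := by
    rintro w w' ⟨φ, h1, h2, h3, h4⟩ ⟨φ', h1', h2', h3', h4'⟩
    refine ⟨fun x => φ x + φ' x, h1.add h1', h2.add h2',
      (Disjoint.union_left h3 h3').mono_left (tsupport_add φ φ'), ?_⟩
    filter_upwards [h4, h4', Lp.coeFn_add (toLp w) (toLp w')] with x h h' h''
    rw [toLp_add, h'', Pi.add_apply, h, h']
  smul_mem' := by
    rintro c w ⟨φ, h1, h2, h3, h4⟩
    refine ⟨fun x => c • φ x, h1.const_smul c, h2.smul_left (f := fun _ => c),
      h3.mono_left (tsupport_smul_subset_right (fun _ => c) φ), ?_⟩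
    filter_upwards [h4, Lp.coeFn_smul c (toLp w)] with x h h''
    rw [toLp_smul, h'', Pi.smul_apply, h]

/-- The route by which integration by parts and Korn's second inequality pass from smooth fields to
their closure. -/
theorem H1vZero_induction {P : H1v Ω → Prop} (hP : IsClosed {w | P w})
    (h : ∀ w, IsSmoothVanishing D w → P w) {w : H1v Ω} (hw : w ∈ H1vZero Ω D) : P w :=
  closure_minimal (t := {w | P w}) h hP hw

theorem dL_of_contDiff (hΩ : IsOpen Ω) {w : H1v Ω} {φ : R2 → R2} (h1 : ContDiff ℝ ∞ φ)
    (h2 : HasCompactSupport φ) (h4 : ∀ᵐ x ∂(volume.restrict Ω), toLp w x = φ x) (j a : Fin 2) :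
    dL Ω j a w =ᵐ[volume.restrict Ω] fun x => fderiv ℝ (fun y => φ y a) x (ee j) := by
  have hφa : ContDiff ℝ ∞ fun y => φ y a :=
    (EuclideanSpace.proj a : R2 →L[ℝ] ℝ).contDiff.comp h1
  have hφt : IsTest Set.univ fun y => φ y a :=
    ⟨hφa, h2.comp_left (g := fun y : R2 => y a) rfl, Set.subset_univ _⟩
  refine IsWeakPartial.ae_eq hΩ (v := fun y => φ y a) ?_
    (isWeakPartial_of_contDiff (hφa.of_le (by simp)) j) (Lp.memLp _)
    ((hφt.partialDeriv _).memLp _)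
  refine isWeakPartial_congr (isWeakPartial_pd (cmp a w) j) ?_ EventuallyEq.rfl
  filter_upwards [compLp_ae a (toLp w), h4] with x h h'
  rw [toLp_cmp, h, h']

theorem shDL_of_contDiff (hΩ : IsOpen Ω) {w : H1v Ω} {φ : R2 → R2} (h1 : ContDiff ℝ ∞ φ)
    (h2 : HasCompactSupport φ) (h4 : ∀ᵐ x ∂(volume.restrict Ω), toLp w x = φ x) :
    shDL Ω w =ᵐ[volume.restrict Ω] shearD fun a y => φ y a := by
  filter_upwards [shDL_ae w, dL_of_contDiff hΩ h1 h2 h4 0 0, dL_of_contDiff hΩ h1 h2 h4 1 1,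
    dL_ae 0 0 w, dL_ae 1 1 w] with x h h1 h2 h3 h4
  rw [h, ← h3, ← h4, h1, h2]
  rfl

theorem shOL_of_contDiff (hΩ : IsOpen Ω) {w : H1v Ω} {φ : R2 → R2} (h1 : ContDiff ℝ ∞ φ)
    (h2 : HasCompactSupport φ) (h4 : ∀ᵐ x ∂(volume.restrict Ω), toLp w x = φ x) :
    shOL Ω w =ᵐ[volume.restrict Ω] shearO fun a y => φ y a := by
  filter_upwards [shOL_ae w, dL_of_contDiff hΩ h1 h2 h4 1 0, dL_of_contDiff hΩ h1 h2 h4 0 1,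
    dL_ae 1 0 w, dL_ae 0 1 w] with x h h1 h2 h3 h4
  rw [h, ← h3, ← h4, h1, h2]
  rfl

theorem dvL_of_contDiff (hΩ : IsOpen Ω) {w : H1v Ω} {φ : R2 → R2} (h1 : ContDiff ℝ ∞ φ)
    (h2 : HasCompactSupport φ) (h4 : ∀ᵐ x ∂(volume.restrict Ω), toLp w x = φ x) :
    dvL Ω w =ᵐ[volume.restrict Ω] divg fun a y => φ y a := by
  filter_upwards [dvL_ae w, dL_of_contDiff hΩ h1 h2 h4 0 0, dL_of_contDiff hΩ h1 h2 h4 1 1,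
    dL_ae 0 0 w, dL_ae 1 1 w] with x h h1 h2 h3 h4
  rw [h, ← h3, ← h4, h1, h2]
  rfl

/-- Restriction of an `L²` function to a subset. -/
noncomputable def resL (Ω K : Set R2) :
    Lp ℝ 2 (volume.restrict Ω) →L[ℝ] Lp ℝ 2 ((volume.restrict Ω).restrict K) :=
  LpToLpRestrictCLM R2 ℝ ℝ (volume.restrict Ω) 2 K

theorem norm_sq_resL {K : Set R2} (hK : MeasurableSet K) (hKΩ : K ⊆ Ω)
    (f : Lp ℝ 2 (volume.restrict Ω)) : ‖resL Ω K f‖ ^ 2 = ∫ x in K, f x ^ 2 := by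
  rw [norm_sq_lp]
  have h := LpToLpRestrictCLM_coeFn ℝ K f
  have e : (volume.restrict Ω).restrict K = volume.restrict K := by
    rw [Measure.restrict_restrict hK, Set.inter_eq_left.2 hKΩ]
  rw [← e]
  exact integral_congr_ae (h.mono fun x hx => by simp only [resL, hx])

theorem norm_sq_eq_of_H1v (w : H1v Ω) : ‖w‖ ^ 2 =
    (‖vL Ω 0 w‖ ^ 2 + ‖dL Ω 0 0 w‖ ^ 2 + ‖dL Ω 1 0 w‖ ^ 2) +
    (‖vL Ω 1 w‖ ^ 2 + ‖dL Ω 0 1 w‖ ^ 2 + ‖dL Ω 1 1 w‖ ^ 2) := by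
  exact (norm_sq_cmp w).trans (congrArg₂ (· + ·) (sobolev_norm_sq (cmp 0 w))
    (sobolev_norm_sq (cmp 1 w)))

/-- Korn's second inequality on the closure of the smooth fields. -/
theorem exists_korn_second (hΩ : IsOpen Ω) (hb : Bornology.IsBounded Ω)
    (hL : HasLipschitzBoundary Ω) :
    ∃ (K : Set R2) (C : ℝ), IsCompact K ∧ K ⊆ Ω ∧ 0 ≤ C ∧ ∀ w ∈ H1vZero Ω D,
      ‖w‖ ^ 2 ≤ C * (‖shDL Ω w‖ ^ 2 + ‖shOL Ω w‖ ^ 2 + ‖dvL Ω w‖ ^ 2 +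
        (‖resL Ω K (vL Ω 0 w)‖ ^ 2 + ‖resL Ω K (vL Ω 1 w)‖ ^ 2)) := by
  obtain ⟨K, C, hK, hKΩ, hC, hk⟩ := exists_korn_of_contDiff hΩ hb hL
  -- The smooth estimate is used once for each of the two components, hence the doubling.
  refine ⟨K, 2 * C, hK, hKΩ, by positivity, fun w hw => ?_⟩
  refine H1vZero_induction (P := fun w => ‖w‖ ^ 2 ≤ 2 * C * (‖shDL Ω w‖ ^ 2 + ‖shOL Ω w‖ ^ 2 +
    ‖dvL Ω w‖ ^ 2 + (‖resL Ω K (vL Ω 0 w)‖ ^ 2 + ‖resL Ω K (vL Ω 1 w)‖ ^ 2))) ?_ ?_ hw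
  · have hc : ∀ {F : Type} [NormedAddCommGroup F] [NormedSpace ℝ F] (T : H1v Ω →L[ℝ] F),
        Continuous fun w => ‖T w‖ ^ 2 := fun T => T.continuous.norm.pow 2
    exact isClosed_le (continuous_norm.pow 2) (continuous_const.mul
      ((((hc _).add (hc _)).add (hc _)).add ((hc (resL Ω K ∘L vL Ω 0)).add
        (hc (resL Ω K ∘L vL Ω 1)))))
  · rintro w ⟨φ, h1, h2, -, h4⟩
    have hd := dL_of_contDiff hΩ h1 h2 h4
    let ψ : Fin 2 → R2 → ℝ := fun a y => φ y a
    have hv : ∀ a, vL Ω a w =ᵐ[volume.restrict Ω] ψ a := fun a => by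
      filter_upwards [vL_ae a w, h4] with x h h'
      rw [h, h']
    have hsD := shDL_of_contDiff hΩ h1 h2 h4
    have hsO := shOL_of_contDiff hΩ h1 h2 h4
    have hdv := dvL_of_contDiff hΩ h1 h2 h4
    have cg : ∀ {f g : R2 → ℝ} {S : Set R2}, S ⊆ Ω → f =ᵐ[volume.restrict Ω] g →
        ∫ x in S, f x ^ 2 = ∫ x in S, g x ^ 2 := fun hS hfg =>
      integral_congr_ae (Filter.Eventually.mono (ae_mono (Measure.restrict_mono hS le_rfl) hfg)
        fun x hx => by simp only [hx])
    have hΩΩ : Ω ⊆ Ω := subset_rfl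
    have hφs : ∀ i, ContDiff ℝ ∞ (ψ i) := fun i =>
      (EuclideanSpace.proj i : R2 →L[ℝ] ℝ).contDiff.comp h1
    have hφc : ∀ i, HasCompactSupport (ψ i) := fun i =>
      h2.comp_left (g := fun y : R2 => y i) rfl
    have k0 := hk ψ hφs hφc 0
    have k1 := hk ψ hφs hφc 1
    have eL : ∀ {f : Lp ℝ 2 (volume.restrict Ω)} {g : R2 → ℝ}, f =ᵐ[volume.restrict Ω] g →
        ∫ x in Ω, g x ^ 2 = ‖f‖ ^ 2 := fun hfg => ((norm_sq_lp _).trans (cg hΩΩ hfg)).symm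
    have eK : ∀ {f : Lp ℝ 2 (volume.restrict Ω)} {g : R2 → ℝ}, f =ᵐ[volume.restrict Ω] g →
        ∫ x in K, g x ^ 2 = ‖resL Ω K f‖ ^ 2 := fun hfg =>
      ((norm_sq_resL hK.measurableSet hKΩ _).trans (cg hKΩ hfg)).symm
    have e0 := norm_sq_eq_of_H1v w
    have a1 : ∫ x in Ω, shearD ψ x ^ 2 = ‖shDL Ω w‖ ^ 2 := eL hsD
    have a2 : ∫ x in Ω, shearO ψ x ^ 2 = ‖shOL Ω w‖ ^ 2 := eL hsO
    have a3 : ∫ x in Ω, divg ψ x ^ 2 = ‖dvL Ω w‖ ^ 2 := eL hdv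
    have a4 : ∀ a, ∫ x in K, ψ a x ^ 2 = ‖resL Ω K (vL Ω a w)‖ ^ 2 := fun a => eK (hv a)
    have a5 : ∀ a, ∫ x in Ω, ψ a x ^ 2 = ‖vL Ω a w‖ ^ 2 := fun a => eL (hv a)
    have a6 : ∀ j a, ∫ x in Ω, fderiv ℝ (ψ a) x (ee j) ^ 2 = ‖dL Ω j a w‖ ^ 2 := fun j a =>
      eL (hd j a)
    clear_value ψ
    simp only [a1, a2, a3, a4, a5, a6] at k0 k1
    linarith

end H1vZero

/-! ### Geometry of Lipschitz boundaries -/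

theorem isOpen_coord_lt (i : Fin 2) (c : ℝ) : IsOpen {x : R2 | x i < c} :=
  isOpen_lt (EuclideanSpace.proj i : R2 →L[ℝ] ℝ).continuous continuous_const

theorem exists_open_disjoint_near_frontier {Ω : Set R2} (hΩ : IsOpen Ω)
    (hL : HasLipschitzBoundary Ω) {y : R2} (hy : y ∈ frontier Ω) {ε : ℝ} (hε : 0 < ε) :
    ∃ O : Set R2, IsOpen O ∧ O.Nonempty ∧ O ⊆ ball y ε ∧ Disjoint O Ω := by
  obtain ⟨A, γ, K, r, hr, hγ, hA⟩ := hL y hy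
  have hyΩ : y ∉ Ω := by
    rw [hΩ.frontier_eq] at hy
    exact hy.2
  have hy1 : A y 1 ≤ γ (A y 0) := by
    have := hA y (mem_ball_self hr)
    exact not_lt.1 fun h => hyΩ (this.2 h)
  have hc : ∀ i, Continuous fun x => A x i := fun i =>
    (EuclideanSpace.proj i : R2 →L[ℝ] ℝ).continuous.comp A.continuous
  refine ⟨ball y (min r ε) ∩ {x | A x 1 < γ (A x 0)}, isOpen_ball.inter
    (isOpen_lt (hc 1) (hγ.continuous.comp (hc 0))), ?_,
    Set.inter_subset_left.trans (ball_subset_ball (min_le_right _ _)), ?_⟩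
  · have hm : 0 < min r ε := lt_min hr hε
    refine ⟨y - (min r ε / 2) • A.symm (ee 1), ?_, ?_⟩
    · rw [mem_ball, dist_eq_norm, sub_sub_cancel_left, norm_neg, norm_smul,
        LinearIsometryEquiv.norm_map]
      simp only [Real.norm_eq_abs, PiLp.norm_single, norm_one, mul_one]
      rw [abs_of_pos (by positivity)]
      linarith
    · simp only [Set.mem_ofPred_eq, map_sub, map_smul, LinearIsometryEquiv.apply_symm_apply]
      simp
      linarith
  · rw [Set.disjoint_left]
    rintro x ⟨hx, hx'⟩ hxΩ
    have := (hA x (ball_subset_ball (min_le_left _ _) hx)).1 hxΩ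
    exact lt_asymm hx' this

/-- Two points of `Ω` near `y` are joined by going up from each along the graph direction and
crossing at the raised height. Thus near `y` all of `Ω` belongs to the single component that
accumulates there. -/
theorem exists_ball_inter_subset_component {Ω : Set R2}
    (hL : HasLipschitzBoundary Ω) {y x₀ : R2} (hy : y ∈ frontier Ω)
    (hyc : y ∈ closure (connectedComponentIn Ω x₀)) :
    ∃ r > 0, Ω ∩ ball y r ⊆ connectedComponentIn Ω x₀ := by
  obtain ⟨A, γ, K, r, hr, hγ, hA⟩ := hL y hy
  -- Chosen so that a point of the `ρ`-ball raised by `2Kρ` is still in the chart of radius `r`.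
  set ρ := r / (1 + 2 * K) with hρ
  have hK : (0 : ℝ) ≤ K := K.2
  have hρ0 : 0 < ρ := by positivity
  have hρr : ρ + 2 * K * ρ = r := by rw [hρ]; field_simp
  obtain ⟨x₁, hx₁c, hx₁⟩ := Metric.mem_closure_iff.1 hyc ρ hρ0
  have hx₁Ω := connectedComponentIn_subset _ _ hx₁c
  refine ⟨ρ, hρ0, ?_⟩
  rw [connectedComponentIn_eq hx₁c]
  rintro x₂ ⟨hx₂Ω, hx₂⟩
  set e : R2 := A.symm (ee 1) with he
  -- Within the ball `γ` varies by at most `K` times the diameter `2ρ`, so at this height the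
  -- crossing segment clears the graph.
  set s : ℝ := 2 * K * ρ with hs
  have hs0 : 0 ≤ s := by positivity
  have hAe0 : A e 0 = 0 := by simp [he]
  have hAe1 : A e 1 = 1 := by simp [he]
  have hne : ‖e‖ = 1 := by simp [he]
  have hbr : ball y ρ ⊆ ball y r := ball_subset_ball (by linarith)
  have hxb : x₁ ∈ ball y ρ := by rwa [mem_ball']
  have hup : ∀ x ∈ ball y ρ, x ∈ Ω → ∀ t ∈ Set.Icc 0 s, x + t • e ∈ Ω := by
    intro x hx hxΩ t ht
    refine (hA _ ?_).2 ?_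
    · rw [mem_ball, dist_eq_norm, add_sub_right_comm]
      rw [mem_ball, dist_eq_norm] at hx
      refine (norm_add_le _ _).trans_lt ?_
      rw [norm_smul, hne, Real.norm_of_nonneg ht.1]
      linarith [ht.2]
    · have := (hA x (hbr hx)).1 hxΩ
      simp only [map_add, map_smul, PiLp.add_apply, PiLp.smul_apply, hAe0, hAe1, smul_eq_mul,
        mul_zero, add_zero, mul_one]
      linarith [ht.1]
  have hseg : ∀ x ∈ ball y ρ, x ∈ Ω → segment ℝ x (x + s • e) ⊆ Ω := by
    intro x hx hxΩ z hz
    rw [segment_eq_image'] at hz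
    obtain ⟨θ, hθ, rfl⟩ := hz
    simp only [add_sub_cancel_left, smul_smul]
    exact hup x hx hxΩ _ ⟨by have := hθ.1; positivity, by nlinarith [hθ.2]⟩
  have hacross : segment ℝ (x₁ + s • e) (x₂ + s • e) ⊆ Ω := by
    rintro z ⟨a, b, ha, hb, hab, rfl⟩
    have hz : a • (x₁ + s • e) + b • (x₂ + s • e) = (a • x₁ + b • x₂) + s • e := by
      rw [smul_add, smul_add, add_add_add_comm, ← add_smul, hab, one_smul]
    rw [hz]
    have hm : a • x₁ + b • x₂ ∈ ball y ρ := (convex_ball y ρ) hxb hx₂ ha hb hab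
    refine (hA _ ?_).2 ?_
    · rw [mem_ball, dist_eq_norm, add_sub_right_comm]
      rw [mem_ball, dist_eq_norm] at hm
      refine (norm_add_le _ _).trans_lt ?_
      rw [norm_smul, hne, Real.norm_of_nonneg hs0]
      linarith
    · have h1 := (hA x₁ (hbr hxb)).1 hx₁Ω
      have h2 := (hA x₂ (hbr hx₂)).1 hx₂Ω
      simp only [map_add, map_smul, PiLp.add_apply, PiLp.smul_apply, hAe0, hAe1, smul_eq_mul,
        mul_zero, add_zero, mul_one]
      have hd : ∀ x ∈ ball y ρ, γ (a * A x₁ 0 + b * A x₂ 0) ≤ γ (A x 0) + K * (2 * ρ) := by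
        intro x hx
        have h3 := hγ.dist_le_mul (a * A x₁ 0 + b * A x₂ 0) (A x 0)
        have h4 : dist (a * A x₁ 0 + b * A x₂ 0) (A x 0) ≤ 2 * ρ := by
          have e1 : a * A x₁ 0 + b * A x₂ 0 - A x 0 = (A ((a • x₁ + b • x₂) - x)) 0 := by simp
          rw [Real.dist_eq, e1]
          have h5 := PiLp.norm_apply_le (A ((a • x₁ + b • x₂) - x)) 0
          rw [LinearIsometryEquiv.norm_map, ← dist_eq_norm] at h5
          refine (Real.norm_eq_abs _ ▸ h5).trans ?_
          have := dist_triangle_right (a • x₁ + b • x₂) x y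
          rw [mem_ball] at hm hx
          linarith
        have h6 := mul_le_mul_of_nonneg_left h4 hK
        rw [Real.dist_eq] at h3
        linarith [le_abs_self (γ (a * A x₁ 0 + b * A x₂ 0) - γ (A x 0))]
      have g1 := hd x₁ hxb
      have g2 := hd x₂ hx₂
      have hb' : b = 1 - a := by linarith
      rcases eq_or_lt_of_le ha with ha0 | ha0
      · have hb1 : b = 1 := by linarith
        rw [← ha0, hb1] at g2 ⊢
        linarith
      · have := mul_lt_mul_of_pos_left (h1.trans_le' (by linarith : γ (a * A x₁ 0 + b * A x₂ 0) -
          K * (2 * ρ) ≤ _)) ha0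
        have := mul_le_mul_of_nonneg_left (h2.le.trans' (by linarith : γ (a * A x₁ 0 + b * A x₂ 0) -
          K * (2 * ρ) ≤ _)) hb
        have e3 : a * (γ (a * A x₁ 0 + b * A x₂ 0) - K * (2 * ρ)) +
            b * (γ (a * A x₁ 0 + b * A x₂ 0) - K * (2 * ρ)) =
            γ (a * A x₁ 0 + b * A x₂ 0) - K * (2 * ρ) := by rw [← add_mul, hab, one_mul]
        linarith
  have hc : IsPreconnected (segment ℝ x₁ (x₁ + s • e) ∪ (segment ℝ (x₁ + s • e) (x₂ + s • e) ∪
      segment ℝ x₂ (x₂ + s • e))) := by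
    refine (convex_segment _ _).isPreconnected.union (x₁ + s • e) (right_mem_segment _ _ _)
      (Or.inl (left_mem_segment _ _ _)) ?_
    exact (convex_segment _ _).isPreconnected.union (x₂ + s • e) (right_mem_segment _ _ _)
      (right_mem_segment _ _ _) (convex_segment _ _).isPreconnected
  refine hc.subset_connectedComponentIn (Or.inl (left_mem_segment _ _ _)) ?_
    (Or.inr (Or.inr (left_mem_segment _ _ _)))
  exact Set.union_subset (hseg _ hxb hx₁Ω) (Set.union_subset hacross (hseg _ hx₂ hx₂Ω))

/-! ### Interior points of a regular Dirichlet part -/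

theorem mem_closure_halfDisc {x : R2} (h1 : ‖x‖ ≤ 1) (h2 : x 1 ≤ 0) : x ∈ closure halfDisc₁ := by
  rw [Metric.mem_closure_iff]
  intro ε hε
  set t := min 1 (ε / 4)
  have ht0 : 0 < t := by positivity
  have ht1 : t ≤ 1 := min_le_left _ _
  have ht2 : t ≤ ε / 4 := min_le_right _ _
  have hc : ‖(-(1 / 2) : ℝ) • ee 1‖ = 1 / 2 := by
    rw [norm_smul]; simp
  refine ⟨(1 - t) • x + t • ((-(1 / 2) : ℝ) • ee 1), ⟨?_, ?_⟩, ?_⟩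
  · refine (norm_add_le _ _).trans_lt ?_
    rw [norm_smul, norm_smul, hc, Real.norm_of_nonneg ht0.le, Real.norm_of_nonneg (by linarith)]
    nlinarith
  · simp
    nlinarith
  · have : x - ((1 - t) • x + t • ((-(1 / 2) : ℝ) • ee 1)) = t • (x - (-(1 / 2) : ℝ) • ee 1) := by
      module
    rw [dist_eq_norm, this, norm_smul, Real.norm_of_nonneg ht0.le]
    have := norm_sub_le x ((-(1 / 2) : ℝ) • ee 1)
    rw [hc] at this
    nlinarith [norm_nonneg (x - (-(1 / 2) : ℝ) • ee 1)]

theorem closure_halfDisc₂_subset : closure halfDisc₂ ⊆ {x : R2 | ‖x‖ ≤ 1 ∧ x 1 ≤ 0} := by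
  have hc : IsClosed {x : R2 | ‖x‖ ≤ 1 ∧ x 1 ≤ 0} :=
    (isClosed_le continuous_norm continuous_const).inter
      (isClosed_le (EuclideanSpace.proj (1 : Fin 2) : R2 →L[ℝ] ℝ).continuous continuous_const)
  exact closure_minimal (fun x hx => ⟨hx.1.le, hx.2⟩) hc

theorem isOpen_halfDisc₁ : IsOpen halfDisc₁ :=
  (isOpen_lt continuous_norm continuous_const).inter (isOpen_coord_lt 1 0)

/-- Near a point of the boundary of a half disc lying on the unit circle there are boundary points
around which the half disc is open. -/
theorem exists_near_circle {H : Set R2} (hH : H ⊆ halfDisc₂) (hH' : halfDisc₁ ⊆ H) {q : R2}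
    (hq : ‖q‖ = 1) (hq1 : q 1 ≤ 0) {η : ℝ} (hη : 0 < η) :
    ∃ q' N, dist q' q < η ∧ q' ∈ closure H ∧ q' ∉ H ∧ IsOpen N ∧ q' ∈ N ∧ IsOpen (H ∩ N) := by
  set s := min (1 / 2) (η / 4)
  have hs0 : 0 < s := by positivity
  have hs1 : s ≤ 1 / 2 := min_le_left _ _
  have hs2 : s ≤ η / 4 := min_le_right _ _
  -- Pushing `q` down and projecting back to the circle gives a strictly negative second coordinate;
  -- near such a point the flat side plays no role and the set coincides with the open half disc.
  set v : R2 := q - s • ee 1 with hv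
  have hvq : ‖v - q‖ = s := by
    rw [hv, sub_sub_cancel_left, norm_neg, norm_smul, Real.norm_of_nonneg hs0.le]
    simp
  have hvn := abs_norm_sub_norm_le v q
  rw [hvq, hq, abs_le] at hvn
  have hv0 : 0 < ‖v‖ := by linarith
  have hq'n : ‖(‖v‖⁻¹ • v : R2)‖ = 1 := by
    rw [norm_smul, norm_inv, norm_norm, inv_mul_cancel₀ hv0.ne']
  have hq'1 : (‖v‖⁻¹ • v : R2) 1 < 0 := by
    have : v 1 < 0 := by simp [hv]; linarith
    simpa using mul_neg_of_pos_of_neg (inv_pos.2 hv0) this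
  refine ⟨‖v‖⁻¹ • v, {x | x 1 < 0}, ?_, ?_, ?_, isOpen_coord_lt 1 0, hq'1, ?_⟩
  · have h1 : ‖(‖v‖⁻¹ • v : R2) - v‖ ≤ s := by
      have : (‖v‖⁻¹ • v : R2) - v = (‖v‖⁻¹ - 1) • v := by module
      rw [this, norm_smul, Real.norm_eq_abs, ← abs_of_pos hv0, ← abs_mul, abs_of_pos hv0, sub_mul,
        inv_mul_cancel₀ hv0.ne', one_mul, abs_le]
      constructor <;> linarith
    have h2 := dist_triangle (‖v‖⁻¹ • v) v q
    rw [dist_eq_norm, dist_eq_norm, dist_eq_norm, hvq] at h2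
    rw [dist_eq_norm]
    linarith
  · exact closure_mono hH' (mem_closure_halfDisc hq'n.le hq'1.le)
  · intro h
    exact absurd (hH h).1 (by rw [hq'n]; exact lt_irrefl _)
  · convert isOpen_halfDisc₁ using 1
    ext x
    constructor
    · rintro ⟨h1, h2⟩
      exact ⟨(hH h1).1, h2⟩
    · intro h
      exact ⟨hH' h, h.2⟩

/-- The open half disc needs no displacement. Otherwise a missing closure point lies on the circle,
or, for the third model, on the removed half of the flat side. That half ends at the origin, where
the model is not locally open, so the point is moved slightly to the left. -/
theorem exists_near_halfDisc {H : Set R2} (hH : H = halfDisc₁ ∨ H = halfDisc₂ ∨ H = halfDisc₃)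
    {q : R2} (hq : q ∈ closure H) (hqH : q ∉ H) {η : ℝ} (hη : 0 < η) :
    ∃ q' N, dist q' q < η ∧ q' ∈ closure H ∧ q' ∉ H ∧ IsOpen N ∧ q' ∈ N ∧ IsOpen (H ∩ N) := by
  rcases hH with rfl | rfl | rfl
  · exact ⟨q, Set.univ, by simpa using hη, hq, hqH, isOpen_univ, Set.mem_univ _,
      by simpa using isOpen_halfDisc₁⟩
  · have h := closure_halfDisc₂_subset hq
    have hn : ‖q‖ = 1 := le_antisymm h.1 (not_lt.1 fun hlt => hqH ⟨hlt, h.2⟩)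
    exact exists_near_circle subset_rfl (fun x hx => ⟨hx.1, hx.2.le⟩) hn h.2 hη
  · have h := closure_halfDisc₂_subset (closure_mono (fun x hx => hx.1) hq)
    have hsub : halfDisc₁ ⊆ halfDisc₃ := fun x hx => ⟨⟨hx.1, hx.2.le⟩, Or.inl hx.2⟩
    rcases eq_or_lt_of_le h.1 with hn | hn
    · exact exists_near_circle (fun x hx => hx.1) hsub hn h.2 hη
    · have h3 : ¬ (q 1 < 0 ∨ 0 < q 0) := fun h' => hqH ⟨⟨hn, h.2⟩, h'⟩
      push Not at h3
      have hq1 : q 1 = 0 := le_antisymm h.2 h3.1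
      set s := min (1 - ‖q‖) η / 2 with hs
      have hs0 : 0 < s := half_pos (lt_min (by linarith) hη)
      have hs1 : s < 1 - ‖q‖ := by
        have := min_le_left (1 - ‖q‖) η
        have h' : 0 < 1 - ‖q‖ := by linarith
        rw [hs]; linarith
      have hs2 : s < η := by
        have := min_le_right (1 - ‖q‖) η
        rw [hs]; linarith
      have hsn : ‖s • ee 0‖ = s := by
        rw [norm_smul, Real.norm_of_nonneg hs0.le]; simp
      have hq'n : ‖q - s • ee 0‖ < 1 := by
        refine (norm_sub_le _ _).trans_lt ?_
        rw [hsn]; linarith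
      have hq'1 : (q - s • ee 0) 1 = 0 := by simp [hq1]
      have hq'0 : (q - s • ee 0) 0 < 0 := by
        simp only [PiLp.sub_apply, PiLp.smul_apply, PiLp.single_apply, smul_eq_mul]
        simp; linarith
      refine ⟨q - s • ee 0, {x | x 0 < 0}, ?_, ?_, ?_, isOpen_coord_lt 0 0, hq'0, ?_⟩
      · rw [dist_eq_norm, sub_sub_cancel_left, norm_neg, hsn]
        exact hs2
      · exact closure_mono hsub (mem_closure_halfDisc hq'n.le hq'1.le)
      · rintro ⟨-, h' | h'⟩
        · exact absurd h' (by rw [hq'1]; exact lt_irrefl _)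
        · exact lt_asymm h' hq'0
      · convert isOpen_halfDisc₁.inter (isOpen_coord_lt 0 0) using 1
        ext x
        constructor
        · rintro ⟨⟨h1, h2⟩, h3⟩
          exact ⟨⟨h1.1, h2.resolve_right fun h' => lt_asymm h' h3⟩, h3⟩
        · rintro ⟨h1, h2⟩
          exact ⟨hsub h1, h2⟩

/-- `y` itself may be an endpoint of the Dirichlet part, so it is replaced by a nearby point with a
full boundary neighbourhood in `D`. In the chart it corresponds to a missing closure point of a half
disc; `exists_near_halfDisc` supplies another one around which the model is open, and this openness
is pulled back to `G = Ω ∪ (∂Ω \ D)`. -/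
theorem exists_interior_point_of_dirichlet {Ω D : Set R2} (hΩ : IsOpen Ω)
    (hL : HasLipschitzBoundary Ω) (hD : D ⊆ frontier Ω) (hreg : IsGroegerRegular Ω D) {y : R2}
    (hy : y ∈ D) {ε : ℝ} (hε : 0 < ε) :
    ∃ y' ∈ D, dist y' y < ε ∧ ∃ ρ > 0, frontier Ω ∩ ball y' ρ ⊆ D := by
  obtain ⟨U, Φ, K, K', hU, hyU, hΦ, hΦ', hO, hH⟩ := hreg y (hD hy)
  set G := Ω ∪ (frontier Ω \ D) with hG
  set H := Φ '' (U ∩ G) with hHdef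
  have hfr : frontier Ω = closure Ω \ Ω := hΩ.frontier_eq
  have hanti : ∀ a ∈ U, ∀ b ∈ U, dist a b ≤ K' * dist (Φ a) (Φ b) := fun a ha b hb =>
    hΦ'.le_mul_dist ⟨a, ha⟩ ⟨b, hb⟩
  have hinj : ∀ a ∈ U, ∀ b ∈ U, Φ a = Φ b → a = b := fun a ha b hb hab => by
    have := hanti a ha b hb
    rw [hab, dist_self, mul_zero] at this
    exact dist_le_zero.1 this
  have hnotH : ∀ a ∈ U, a ∉ G → Φ a ∉ H := by
    rintro a ha haG ⟨b, ⟨hb, hbG⟩, hab⟩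
    rw [← hinj b hb a ha hab] at haG
    exact haG hbG
  have hyG : y ∉ G := by
    rintro (h | h)
    · have := hD hy
      rw [hfr] at this
      exact this.2 h
    · exact h.2 hy
  have hcl : Φ y ∈ closure H := by
    have h1 : y ∈ closure (U ∩ Ω) :=
      hU.inter_closure ⟨hyU, frontier_subset_closure (hD hy)⟩
    have h2 : ContinuousWithinAt Φ (U ∩ Ω) y :=
      (hΦ.continuousOn y hyU).mono Set.inter_subset_left
    refine closure_mono ?_ (h2.mem_closure_image h1)
    exact Set.image_mono fun x hx => ⟨hx.1, Or.inl hx.2⟩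
  obtain ⟨η, hη, hηO⟩ := Metric.isOpen_iff.1 hO (Φ y) ⟨y, hyU, rfl⟩
  -- The bound `η` keeps the new point in the image of the chart, and `ε / (K' + 1)` brings its
  -- preimage within `ε` by the antilipschitz estimate.
  obtain ⟨q', N, hq'd, hq'c, hq'H, hN, hq'N, hHN⟩ := exists_near_halfDisc hH hcl
    (hnotH y hyU hyG) (η := min η (ε / (K' + 1))) (lt_min hη (by positivity))
  obtain ⟨y', hy'U, rfl⟩ := hηO (mem_ball.2 (hq'd.trans_le (min_le_left _ _)))
  have hy'G : y' ∉ G := fun h => hq'H ⟨y', ⟨hy'U, h⟩, rfl⟩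
  have hGcl : G ⊆ closure Ω := Set.union_subset subset_closure
    (Set.sdiff_subset.trans frontier_subset_closure)
  have hy'cl : y' ∈ closure Ω := by
    refine closure_minimal hGcl isClosed_closure ?_
    rw [Metric.mem_closure_iff]
    intro θ hθ
    obtain ⟨_, ⟨g, ⟨hgU, hgG⟩, rfl⟩, hgd⟩ :=
      Metric.mem_closure_iff.1 hq'c (θ / (K' + 1)) (by positivity)
    refine ⟨g, hgG, ?_⟩
    have h1 := hanti y' hy'U g hgU
    rw [lt_div_iff₀ (by positivity)] at hgd
    nlinarith [dist_nonneg (x := Φ y') (y := Φ g)]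
  have hfd : ∀ x ∈ frontier Ω, x ∉ G → x ∈ D := fun x hx hxG => by
    by_contra h
    exact hxG (Or.inr ⟨hx, h⟩)
  have hy'fr : y' ∈ frontier Ω := by
    rw [hfr]
    exact ⟨hy'cl, fun h => hy'G (Or.inl h)⟩
  refine ⟨y', hfd y' hy'fr hy'G, ?_, ?_⟩
  · have h1 := hanti y' hy'U y hyU
    have h2 := hq'd.trans_le (min_le_right _ _)
    rw [lt_div_iff₀ (by positivity)] at h2
    nlinarith [dist_nonneg (x := Φ y') (y := Φ y)]
  have hN' : IsOpen (U ∩ Φ ⁻¹' N) := hΦ.continuousOn.isOpen_inter_preimage hU hN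
  have hGN : IsOpen (U ∩ Φ ⁻¹' (H ∩ N)) := hΦ.continuousOn.isOpen_inter_preimage hU hHN
  have hGsub : U ∩ Φ ⁻¹' (H ∩ N) ⊆ G := by
    rintro x ⟨hxU, hxH, -⟩
    by_contra h
    exact hnotH x hxU h hxH
  obtain ⟨ρ, hρ, hρN⟩ := Metric.isOpen_iff.1 hN' y' ⟨hy'U, hq'N⟩
  refine ⟨ρ, hρ, fun x ⟨hxfr, hxρ⟩ => ?_⟩
  -- A nearby boundary point outside `D` would have a whole neighbourhood in `G`, hence in the
  -- closure of `Ω`; but a Lipschitz boundary has an open set disjoint from `Ω` arbitrarily near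
  -- each of its points.
  by_contra hxD
  have hxN := hρN hxρ
  have hxG : x ∈ U ∩ Φ ⁻¹' (H ∩ N) :=
    ⟨hxN.1, ⟨x, ⟨hxN.1, Or.inr ⟨hxfr, hxD⟩⟩, rfl⟩, hxN.2⟩
  obtain ⟨σ, hσ, hσG⟩ := Metric.isOpen_iff.1 hGN x hxG
  obtain ⟨O, hOo, hOne, hOb, hOΩ⟩ := exists_open_disjoint_near_frontier hΩ hL hxfr hσ
  have hOfr : O ⊆ frontier Ω := fun z hz => by
    rw [hfr]
    exact ⟨hGcl (hGsub (hσG (hOb hz))), Set.disjoint_left.1 hOΩ hz⟩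
  obtain ⟨z, hz⟩ := hOne
  have hzcl := frontier_subset_closure (hOfr hz)
  obtain ⟨z', hz'O, hz'Ω⟩ := mem_closure_iff.1 hzcl O hOo hz
  exact Set.disjoint_left.1 hOΩ hz'O hz'Ω

/-! ### Fields with vanishing strain -/

theorem IsWeakPartial.restrict {Ω B : Set R2} {j : Fin 2} {v G : R2 → ℝ}
    (h : IsWeakPartial Ω j v G) (hB : B ⊆ Ω) : IsWeakPartial B j v G := by
  rw [isWeakPartial_iff] at *
  intro φ hφ
  have := h φ (hφ.mono hB)
  rwa [setIntegral_mul_of_tsupport (hφ.mono hB).2.2,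
    setIntegral_mul_of_tsupport ((hφ.mono hB).partialDeriv _).2.2,
    ← setIntegral_mul_of_tsupport hφ.2.2, ← setIntegral_mul_of_tsupport (hφ.partialDeriv _).2.2]
    at this

/-- Integration by parts over `Ω` for a smooth function whose support misses the boundary. -/
theorem setIntegral_fderiv_eq_zero {Ω : Set R2} (hΩ : IsOpen Ω) {F : R2 → ℝ}
    (hF : ContDiff ℝ ∞ F) (hc : HasCompactSupport F) (hd : Disjoint (tsupport F) (frontier Ω))
    (e : R2) : ∫ x in Ω, fderiv ℝ F x e = 0 := by
  have hK : IsCompact (tsupport F ∩ closure Ω) := hc.isCompact.inter_right isClosed_closure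
  have hKΩ : tsupport F ∩ closure Ω ⊆ Ω := by
    rintro x ⟨hx, hx'⟩
    by_contra h
    refine Set.disjoint_left.1 hd hx ?_
    rw [hΩ.frontier_eq]
    exact ⟨hx', h⟩
  -- A cutoff equal to 1 around the part of the support inside `Ω` may be inserted for free; after
  -- integration by parts its gradient meets only the zero set of `F`.
  obtain ⟨K₂, hK₂, hKK₂, hK₂Ω⟩ := exists_compact_between hK hΩ hKΩ
  obtain ⟨θ, hθ, -, hθ1⟩ := exists_cutoff hΩ hK₂ hK₂Ω
  have hFt : IsTest Set.univ F := ⟨hF, hc, Set.subset_univ _⟩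
  have h0 : ∀ x ∈ Ω, fderiv ℝ θ x e * F x = 0 := by
    intro x hx
    by_cases hxF : x ∈ tsupport F
    · have hxi := hKK₂ ⟨hxF, subset_closure hx⟩
      have : θ =ᶠ[𝓝 x] fun _ => 1 := by
        filter_upwards [mem_interior_iff_mem_nhds.1 hxi] with y hy using hθ1 y hy
      rw [this.fderiv_eq]
      simp
    · rw [image_eq_zero_of_notMem_tsupport hxF, mul_zero]
  have h1 : ∀ x ∈ Ω, fderiv ℝ F x e = θ x * fderiv ℝ F x e := by
    intro x hx
    by_cases hxF : x ∈ tsupport F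
    · rw [hθ1 x (interior_subset (hKK₂ ⟨hxF, subset_closure hx⟩)), one_mul]
    · rw [fderiv_of_notMem_tsupport (𝕜 := ℝ) hxF]
      simp
  rw [setIntegral_congr_fun hΩ.measurableSet h1, setIntegral_mul_of_tsupport hθ.2.2,
    integral_mul_fderiv_eq (hθ.1.of_le (by simp)) (hF.of_le (by simp)) hθ.2.1,
    ← setIntegral_mul_of_tsupport (hθ.partialDeriv e).2.2, neg_eq_zero]
  exact setIntegral_eq_zero_of_forall_eq_zero h0

section Kernel

variable {Ω D : Set R2}

theorem isWeakPartial_component (w : H1v Ω) (j a : Fin 2) :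
    IsWeakPartial Ω j (vL Ω a w) (dL Ω j a w) := isWeakPartial_pd (cmp a w) j

/-- The extension by zero of a field vanishing on `D` is weakly differentiable across `D`. -/
theorem isWeakPartial_extend (hΩ : IsOpen Ω) {B : Set R2}
    (hBD : frontier Ω ∩ B ⊆ D) {w : H1v Ω} (hw : w ∈ H1vZero Ω D) (j a : Fin 2) :
    IsWeakPartial B j (Ω.indicator (vL Ω a w)) (Ω.indicator (dL Ω j a w)) := by
  rw [isWeakPartial_iff]
  intro ψ hψ
  have e : ∀ (χ : R2 → ℝ) (_ : IsTest B χ) (f : R2 → ℝ),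
      ∫ x in B, χ x * Ω.indicator f x = ∫ x in Ω, χ x * f x := by
    intro χ hχ f
    rw [setIntegral_mul_of_tsupport hχ.2.2, integral_mul_ind hΩ]
  rw [e _ (hψ.partialDeriv _), e _ hψ]
  have m1 : MemLp (fun x => fderiv ℝ ψ x (ee j)) 2 (volume.restrict Ω) :=
    (hψ.partialDeriv _).memLp _
  have m2 : MemLp ψ 2 (volume.restrict Ω) := hψ.memLp _
  refine H1vZero_induction (P := fun w => ∫ x in Ω, fderiv ℝ ψ x (ee j) * vL Ω a w x =
    - ∫ x in Ω, ψ x * dL Ω j a w x) ?_ ?_ hw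
  · simp only [integral_mul_eq_inner m1, integral_mul_eq_inner m2]
    exact isClosed_eq (((innerSL ℝ (m1.toLp _)) ∘L vL Ω a).continuous)
      (((innerSL ℝ (m2.toLp _)) ∘L dL Ω j a).continuous).neg
  · rintro w ⟨φ, h1, h2, h3, h4⟩
    have hd := dL_of_contDiff hΩ h1 h2 h4 j a
    have hv : vL Ω a w =ᵐ[volume.restrict Ω] fun x => φ x a := by
      filter_upwards [vL_ae a w, h4] with x h h'
      rw [h, h']
    have hφs : ContDiff ℝ ∞ fun x => φ x a :=
      (EuclideanSpace.proj a : R2 →L[ℝ] ℝ).contDiff.comp h1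
    have hφc : HasCompactSupport fun x => φ x a := h2.comp_left (g := fun y : R2 => y a) rfl
    have hφt : IsTest Set.univ fun x => φ x a := ⟨hφs, hφc, Set.subset_univ _⟩
    rw [integral_congr_ae (g := fun x => fderiv ℝ ψ x (ee j) * φ x a)
      (hv.mono fun x hx => by simp only [hx]),
      integral_congr_ae (f := fun x => ψ x * dL Ω j a w x)
        (g := fun x => ψ x * fderiv ℝ (fun y => φ y a) x (ee j))
        (hd.mono fun x hx => by simp only [hx])]
    -- The product avoids the whole boundary: inside `B` the boundary lies in `D`, which the support
    -- of `φ` misses, and outside `B` the test function vanishes.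
    have hz := setIntegral_fderiv_eq_zero hΩ (F := fun x => ψ x * φ x a) (hψ.1.mul hφs)
      hψ.2.1.mul_right (by
        rw [Set.disjoint_left]
        intro x hx hxf
        have hx1 := hψ.2.2 (tsupport_mul_subset_left (g := fun x => φ x a) hx)
        have hx2 : x ∈ tsupport φ := by
          refine closure_mono ?_ (tsupport_mul_subset_right (f := ψ) hx)
          intro z hz hz'
          exact hz (by simp [hz'])
        exact Set.disjoint_left.1 h3 hx2 (hBD ⟨hxf, hx1⟩)) (ee j)
    have hf : ∀ x, fderiv ℝ (fun x => ψ x * φ x a) x (ee j) =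
        ψ x * fderiv ℝ (fun y => φ y a) x (ee j) + fderiv ℝ ψ x (ee j) * φ x a := fun x => by
      rw [fderiv_cutoff_mul hφs hψ.1]
      ring
    simp only [hf] at hz
    rw [integral_add] at hz
    · linarith
    · exact m2.integrable_mul ((hφt.partialDeriv _).memLp _)
    · exact m1.integrable_mul (hφt.memLp _)

theorem eq_zero_of_toLp_ae_zero (hΩ : IsOpen Ω) {w : H1v Ω}
    (h : ∀ᵐ x ∂(volume.restrict Ω), toLp w x = 0) : w = 0 := by
  have hv : ∀ a, vL Ω a w =ᵐ[volume.restrict Ω] fun _ => 0 := fun a => by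
    filter_upwards [vL_ae a w, h] with x h1 h2
    rw [h1, h2]
    rfl
  have hd : ∀ j a, dL Ω j a w =ᵐ[volume.restrict Ω] fun _ => 0 := fun j a =>
    IsWeakPartial.ae_eq hΩ
      (isWeakPartial_congr (isWeakPartial_component w j a) (hv a) EventuallyEq.rfl)
      (fun φ _ => by simp) (Lp.memLp _) MemLp.zero'
  have hz := Lp.coeFn_zero R2 2 (volume.restrict Ω)
  have ez : toLp w = 0 := Lp.ext (by
    filter_upwards [h, hz] with x h1 h2
    rw [h1, h2]
    rfl)
  have ep : ∀ j, pd j w = 0 := fun j => Lp.ext (by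
    filter_upwards [hz, hd j 0, hd j 1, dL_ae j 0 w, dL_ae j 1 w] with x h2 h3 h4 h5 h6
    rw [h2]
    ext a
    fin_cases a
    · exact h5.symm.trans h3
    · exact h6.symm.trans h4)
  exact sobolev_ext ez ep

theorem ae_strain_of_eq_zero {w : H1v Ω} (h1 : shDL Ω w = 0) (h2 : shOL Ω w = 0)
    (h3 : dvL Ω w = 0) : ∀ᵐ x ∂(volume.restrict Ω),
      dL Ω 0 0 w x = 0 ∧ dL Ω 1 1 w x = 0 ∧ dL Ω 1 0 w x = - dL Ω 0 1 w x := by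
  have e1 := shDL_ae w
  have e2 := shOL_ae w
  have e3 := dvL_ae w
  rw [h1] at e1
  rw [h2] at e2
  rw [h3] at e3
  filter_upwards [e1, e2, e3, Lp.coeFn_zero ℝ 2 (volume.restrict Ω), dL_ae 0 0 w, dL_ae 1 1 w,
    dL_ae 1 0 w, dL_ae 0 1 w] with x e1 e2 e3 z a b c d
  rw [z] at e1 e2 e3
  simp only [Pi.zero_apply] at e1 e2 e3
  rw [a, b, c, d]
  refine ⟨?_, ?_, ?_⟩ <;> linarith

/-- A field on a ball with vanishing strain that vanishes on an open subset vanishes. -/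
theorem ae_zero_of_strain_zero_of_open {c : R2} {r : ℝ} (hr : 0 < r) {v : Fin 2 → R2 → ℝ}
    {G : Fin 2 → Fin 2 → R2 → ℝ} (hv : ∀ a, MemLp (v a) 2 (volume.restrict (ball c r)))
    (hG : ∀ j a, MemLp (G j a) 2 (volume.restrict (ball c r)))
    (h : ∀ j a, IsWeakPartial (ball c r) j (v a) (G j a))
    (hs : ∀ᵐ x ∂(volume.restrict (ball c r)), G 0 0 x = 0 ∧ G 1 1 x = 0 ∧ G 1 0 x = - G 0 1 x)
    {O : Set R2} (hO : IsOpen O) (hne : O.Nonempty) (hOb : O ⊆ ball c r)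
    (hz : ∀ᵐ x ∂(volume.restrict O), v 0 x = 0 ∧ v 1 x = 0) :
    ∀ᵐ x ∂(volume.restrict (ball c r)), v 0 x = 0 ∧ v 1 x = 0 := by
  obtain ⟨α, β, γ, hrig⟩ := ae_rigid_of_strain_zero hr hv hG h (hs.mono fun _ h => h.1)
    (hs.mono fun _ h => h.2.1) (hs.mono fun _ h => h.2.2)
  have hrO := ae_restrict_of_ae_restrict_of_subset hOb hrig
  obtain ⟨rfl, rfl, rfl⟩ := rigid_eq_zero hO hne (α := α) (β := β) (γ := γ) (by
    filter_upwards [hrO, hz] with x h1 h2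
    exact ⟨h1.1.symm.trans h2.1, h1.2.symm.trans h2.2⟩)
  filter_upwards [hrig] with x hx
  simpa using hx

-- Unique continuation. The set `Z` of points near which `w` vanishes is open, and relatively closed
-- in `Ω` because a rigid displacement on a ball that vanishes on an open piece is zero. Every
-- component meets `Z`: it reaches `D`, near which the extension by zero is strain-free on a ball
-- containing an open piece of the exterior.
set_option maxHeartbeats 1000000 in
theorem eq_zero_of_strain_zero (hΩ : IsOpen Ω) (hL : HasLipschitzBoundary Ω)
    (hD : D ⊆ frontier Ω) (hreg : IsGroegerRegular Ω D)
    (hne : ∀ x ∈ Ω, (D ∩ closure (connectedComponentIn Ω x)).Nonempty) {w : H1v Ω}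
    (hw : w ∈ H1vZero Ω D) (h1 : shDL Ω w = 0) (h2 : shOL Ω w = 0) (h3 : dvL Ω w = 0) : w = 0 := by
  have hst := ae_strain_of_eq_zero h1 h2 h3
  set Z : Set R2 := {x | ∃ r > 0, ball x r ⊆ Ω ∧
    ∀ᵐ y ∂(volume.restrict (ball x r)), vL Ω 0 w y = 0 ∧ vL Ω 1 w y = 0} with hZ
  have hZball : ∀ x r, 0 < r → ball x r ⊆ Ω →
      (∀ᵐ y ∂(volume.restrict (ball x r)), vL Ω 0 w y = 0 ∧ vL Ω 1 w y = 0) → ball x r ⊆ Z := by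
    intro x r hr hrΩ hae y hy
    obtain ⟨s, hs, hsb⟩ := Metric.isOpen_iff.1 isOpen_ball y hy
    exact ⟨s, hs, hsb.trans hrΩ, ae_restrict_of_ae_restrict_of_subset hsb hae⟩
  have hZo : IsOpen Z := by
    rw [Metric.isOpen_iff]
    rintro x ⟨r, hr, hrΩ, hae⟩
    exact ⟨r, hr, hZball x r hr hrΩ hae⟩
  have hZae : ∀ O ⊆ Z, IsOpen O → O.Nonempty → ∃ O' ⊆ O, IsOpen O' ∧ O'.Nonempty ∧
      ∀ᵐ y ∂(volume.restrict O'), vL Ω 0 w y = 0 ∧ vL Ω 1 w y = 0 := by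
    rintro O hOZ hO ⟨x, hx⟩
    obtain ⟨r, hr, hrΩ, hae⟩ := hOZ hx
    exact ⟨O ∩ ball x r, Set.inter_subset_left, hO.inter isOpen_ball, ⟨x, hx, mem_ball_self hr⟩,
      ae_restrict_of_ae_restrict_of_subset Set.inter_subset_right hae⟩
  have hclop : ∀ x ∈ Ω, x ∈ closure Z → x ∈ Z := by
    intro x hx hxZ
    obtain ⟨r, hr, hrΩ⟩ := Metric.isOpen_iff.1 hΩ x hx
    obtain ⟨O, hOs, hO, hOne, hOz⟩ := hZae (ball x r ∩ Z) Set.inter_subset_right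
      (isOpen_ball.inter hZo) (mem_closure_iff.1 hxZ _ isOpen_ball (mem_ball_self hr))
    refine ⟨r, hr, hrΩ, ae_zero_of_strain_zero_of_open hr (v := fun a => vL Ω a w)
      (G := fun j a => dL Ω j a w) (fun a => (Lp.memLp _).mono_measure
        (Measure.restrict_mono hrΩ le_rfl)) (fun j a => (Lp.memLp _).mono_measure
        (Measure.restrict_mono hrΩ le_rfl)) (fun j a => (isWeakPartial_component w j a).restrict hrΩ)
      (ae_restrict_of_ae_restrict_of_subset hrΩ hst) hO hOne (hOs.trans Set.inter_subset_left) hOz⟩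
  have hΩZ : Ω ⊆ Z := by
    intro x hx
    obtain ⟨y, hyD, hyc⟩ := hne x hx
    obtain ⟨r, hr, hrC⟩ := exists_ball_inter_subset_component hL (hD hyD) hyc
    obtain ⟨y', hy'D, hy'd, ρ, hρ, hρD⟩ := exists_interior_point_of_dirichlet hΩ hL hD hreg hyD hr
    set σ := min ρ (r - dist y' y) with hσ
    -- The radius respects both constraints: the boundary in the ball belongs to `D`, and `Ω` in the
    -- ball belongs to the component of `x`.
    have hσ0 : 0 < σ := lt_min hρ (by linarith)
    have hσr : ball y' σ ⊆ ball y r := ball_subset_ball' (by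
      have := min_le_right ρ (r - dist y' y)
      linarith)
    have hσρ : ball y' σ ⊆ ball y' ρ := ball_subset_ball (min_le_left _ _)
    have hBD : frontier Ω ∩ ball y' σ ⊆ D := fun z hz => hρD ⟨hz.1, hσρ hz.2⟩
    obtain ⟨O, hO, hOne, hOb, hOΩ⟩ := exists_open_disjoint_near_frontier hΩ hL (hD hy'D) hσ0
    have hst' : ∀ᵐ x ∂(volume.restrict (ball y' σ)), Ω.indicator (dL Ω 0 0 w) x = 0 ∧
        Ω.indicator (dL Ω 1 1 w) x = 0 ∧
        Ω.indicator (dL Ω 1 0 w) x = - Ω.indicator (dL Ω 0 1 w) x := by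
      refine ae_restrict_of_ae ?_
      rw [ae_restrict_iff' hΩ.measurableSet] at hst
      filter_upwards [hst] with z hz
      by_cases hzΩ : z ∈ Ω
      · simpa [hzΩ] using hz hzΩ
      · simp [hzΩ]
    have hzero := ae_zero_of_strain_zero_of_open hσ0 (v := fun a => Ω.indicator (vL Ω a w))
      (G := fun j a => Ω.indicator (dL Ω j a w))
      (fun a => (memLp_ind hΩ (Lp.memLp _)).mono_measure Measure.restrict_le_self)
      (fun j a => (memLp_ind hΩ (Lp.memLp _)).mono_measure Measure.restrict_le_self)
      (fun j a => isWeakPartial_extend hΩ hBD hw j a) hst' hO hOne hOb (by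
        rw [ae_restrict_iff' hO.measurableSet]
        refine Eventually.of_forall fun z hz => ?_
        have : z ∉ Ω := Set.disjoint_left.1 hOΩ hz
        simp [this])
    have hsub : Ω ∩ ball y' σ ⊆ Z := by
      intro z hz
      obtain ⟨s, hs, hsb⟩ := Metric.isOpen_iff.1 (hΩ.inter isOpen_ball) z hz
      refine ⟨s, hs, fun x hx => (hsb hx).1, ?_⟩
      have := ae_restrict_of_ae_restrict_of_subset (fun x hx => (hsb hx).2) hzero
      rw [ae_restrict_iff' isOpen_ball.measurableSet] at this ⊢
      filter_upwards [this] with p hp hpb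
      simpa [(hsb hpb).1] using hp hpb
    have hne' : (connectedComponentIn Ω x ∩ Z).Nonempty := by
      obtain ⟨z, hzb, hzΩ⟩ := mem_closure_iff.1 (frontier_subset_closure (hD hy'D)) _ isOpen_ball
        (mem_ball_self hσ0)
      exact ⟨z, hrC ⟨hzΩ, hσr hzb⟩, hsub ⟨hzΩ, hzb⟩⟩
    refine isPreconnected_connectedComponentIn.subset_of_closure_inter_subset hZo hne'
      (fun z hz => hclop z (connectedComponentIn_subset _ _ hz.2) hz.1) (mem_connectedComponentIn hx)
  refine eq_zero_of_toLp_ae_zero hΩ ?_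
  have hnull : ∀ᵐ x ∂(volume.restrict Ω), vL Ω 0 w x = 0 ∧ vL Ω 1 w x = 0 := by
    rw [ae_restrict_iff' hΩ.measurableSet, ae_iff]
    refine measure_null_of_locally_null _ fun x hx => ?_
    simp only [Set.mem_ofPred_eq, Classical.not_imp] at hx
    obtain ⟨r, hr, hrΩ, hae⟩ := hΩZ hx.1
    refine ⟨_, inter_mem_nhdsWithin _ (ball_mem_nhds x hr), ?_⟩
    rw [ae_restrict_iff' isOpen_ball.measurableSet, ae_iff] at hae
    refine measure_mono_null ?_ hae
    rintro z ⟨hz, hzb⟩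
    simp only [Set.mem_ofPred_eq, Classical.not_imp] at hz ⊢
    exact ⟨hzb, hz.2⟩
  filter_upwards [hnull, vL_ae 0 w, vL_ae 1 w] with x h h0 h1
  ext i
  fin_cases i
  · exact h0.symm.trans h.1
  · exact h1.symm.trans h.2

end Kernel

/-! ### Korn's inequality -/

/-- The compactness argument that removes a compact perturbation from a coercivity estimate. -/
theorem exists_coercive_of_compact_perturbation {H F F' : Type*} [NormedAddCommGroup H]
    [InnerProductSpace ℝ H] [CompleteSpace H] [NormedAddCommGroup F] [NormedSpace ℝ F]
    [NormedAddCommGroup F'] [NormedSpace ℝ F'] {V : Submodule ℝ H} (hV : IsClosed (V : Set H))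
    {ι κ : Type*} [Fintype ι] [Fintype κ] (T : ι → H →L[ℝ] F) (R : κ → H →L[ℝ] F') {C : ℝ}
    (hC : ∀ w ∈ V, ‖w‖ ^ 2 ≤ C * ((∑ i, ‖T i w‖ ^ 2) + ∑ i, ‖R i w‖ ^ 2))
    (hker : ∀ w ∈ V, (∀ i, T i w = 0) → w = 0)
    (hR : ∀ w : ℕ → H, (∀ n, ‖w n‖ ≤ 1) →
      (∀ ψ : H →L[ℝ] ℝ, Tendsto (fun n => ψ (w n)) atTop (𝓝 0)) →
      ∀ i, Tendsto (fun n => ‖R i (w n)‖) atTop (𝓝 0)) :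
    ∃ C', 0 ≤ C' ∧ ∀ w ∈ V, ‖w‖ ^ 2 ≤ C' * ∑ i, ‖T i w‖ ^ 2 := by
  by_contra! hcon
  -- Failure for every constant `n + 1` gives, after normalisation, unit vectors on which all `T i`
  -- tend to zero; their weak limit lies in the common kernel and is therefore zero.
  choose w hwV hw using fun n : ℕ => hcon (n + 1 : ℝ) (by positivity)
  have hpos : ∀ n, 0 < ‖w n‖ := fun n => by
    have h1 : 0 < ‖w n‖ ^ 2 := (hw n).trans_le' (by positivity)
    rcases (norm_nonneg (w n)).eq_or_lt with h0 | h0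
    · rw [← h0] at h1
      norm_num at h1
    · exact h0
  set v : ℕ → H := fun n => ‖w n‖⁻¹ • w n with hv
  have hvn : ∀ n, ‖v n‖ = 1 := fun n => by
    rw [hv, norm_smul, norm_inv, norm_norm, inv_mul_cancel₀ (hpos n).ne']
  have hvV : ∀ n, v n ∈ V := fun n => V.smul_mem _ (hwV n)
  have hvT : ∀ n i, ‖T i (v n)‖ ^ 2 ≤ 1 / (n + 1 : ℝ) := fun n i => by
    have h1 : ‖T i (w n)‖ ^ 2 ≤ ∑ i, ‖T i (w n)‖ ^ 2 :=
      Finset.single_le_sum (f := fun i => ‖T i (w n)‖ ^ 2) (fun _ _ => sq_nonneg _)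
        (Finset.mem_univ i)
    have h2 := hw n
    have h3 : (n + 1 : ℝ) * ‖T i (w n)‖ ^ 2 ≤ ‖w n‖ ^ 2 :=
      (mul_le_mul_of_nonneg_left h1 (by positivity)).trans h2.le
    rw [hv, map_smul, norm_smul, norm_inv, norm_norm, mul_pow, inv_pow, inv_mul_eq_div,
      div_le_div_iff₀ (pow_pos (hpos n) 2) (by positivity)]
    linarith
  have hTn : ∀ i, Tendsto (fun n => T i (v n)) atTop (𝓝 0) := fun i => by
    rw [tendsto_zero_iff_norm_tendsto_zero]
    have h1 : Tendsto (fun n => ‖T i (v n)‖ ^ 2) atTop (𝓝 0) :=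
      squeeze_zero (fun n => sq_nonneg _) (fun n => hvT n i) tendsto_one_div_nat
    have h2 := h1.sqrt
    simpa using h2
  obtain ⟨x, ns, hns, hx⟩ := exists_weakly_convergent_subseq (fun n => (hvn n).le)
  have hxV : x ∈ V := mem_of_weak_limit hV (fun n => hvV (ns n)) hx
  have hx0 : x = 0 := hker x hxV fun i => by
    refine SeparatingDual.eq_zero_of_forall_dual_eq_zero (R := ℝ) fun ψ => ?_
    refine tendsto_nhds_unique (hx (ψ ∘L T i)) ?_
    have := (ψ.continuous.tendsto 0).comp ((hTn i).comp hns.tendsto_atTop)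
    simpa [Function.comp_def] using this
  have hR0 := hR (fun n => v (ns n)) (fun n => (hvn _).le) fun ψ => by
    simpa [hx0] using hx ψ
  have hlim : Tendsto (fun n => C * ((∑ i, ‖T i (v (ns n))‖ ^ 2) + ∑ i, ‖R i (v (ns n))‖ ^ 2))
      atTop (𝓝 (C * ((∑ _i : ι, 0 ^ 2) + ∑ _i : κ, 0 ^ 2))) := by
    refine (Tendsto.add (tendsto_finsetSum _ fun i _ => ?_)
      (tendsto_finsetSum _ fun i _ => (hR0 i).pow 2)).const_mul C
    exact (((hTn i).comp hns.tendsto_atTop).norm.pow 2).trans (by simp)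
  -- The remainders `R i` vanish along the weakly null sequence as well, so the assumed estimate for
  -- unit vectors would read `1 ≤ 0` in the limit.
  have h1 : (1 : ℝ) ≤ C * ((∑ _i : ι, 0 ^ 2) + ∑ _i : κ, 0 ^ 2) :=
    ge_of_tendsto' hlim fun n => by
      have := hC _ (hvV (ns n))
      rwa [hvn, one_pow] at this
  simp at h1
  linarith

section Korn

variable {Ω D : Set R2}

theorem tendsto_norm_resL (hΩ : IsOpen Ω) {K : Set R2} (hK : IsCompact K) (hKΩ : K ⊆ Ω)
    {w : ℕ → H1v Ω} (hw1 : ∀ n, ‖w n‖ ≤ 1)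
    (hw : ∀ ψ : H1v Ω →L[ℝ] ℝ, Tendsto (fun n => ψ (w n)) atTop (𝓝 0)) (a : Fin 2) :
    Tendsto (fun n => ‖resL Ω K (vL Ω a (w n))‖) atTop (𝓝 0) := by
  have h := tendsto_eLpNorm_of_weakly_null hΩ (w := fun n => cmp a (w n)) (C := 1)
    (fun n => (norm_cmp_le a _).trans (hw1 n)) (fun ψ => hw (ψ ∘L cmpL a)) hK hKΩ
  have e : (volume.restrict Ω).restrict K = volume.restrict K := by
    rw [Measure.restrict_restrict hK.measurableSet, Set.inter_eq_left.2 hKΩ]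
  have h2 := (ENNReal.tendsto_toReal ENNReal.zero_ne_top).comp h
  refine h2.congr fun n => ?_
  have hn := eLpNorm_congr_ae (p := 2) (LpToLpRestrictCLM_coeFn ℝ K (vL Ω a (w n)))
  rw [Lp.norm_def, resL, hn, e]
  rfl

-- Korn's second inequality has only a remainder on a compact set, compact by the interior Rellich
-- theorem, and the strain has trivial kernel; the remainder can thus be dropped.
set_option maxHeartbeats 1000000 in
theorem exists_korn (hΩ : IsOpen Ω) (hb : Bornology.IsBounded Ω) (hL : HasLipschitzBoundary Ω)
    (hD : D ⊆ frontier Ω) (hreg : IsGroegerRegular Ω D)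
    (hne : ∀ x ∈ Ω, (D ∩ closure (connectedComponentIn Ω x)).Nonempty) :
    ∃ C, 0 ≤ C ∧ ∀ w ∈ H1vZero Ω D,
      ‖w‖ ^ 2 ≤ C * (‖shDL Ω w‖ ^ 2 + ‖shOL Ω w‖ ^ 2 + ‖dvL Ω w‖ ^ 2) := by
  obtain ⟨K, C, hK, hKΩ, -, hk⟩ := exists_korn_second (D := D) hΩ hb hL
  let T : Fin 3 → H1v Ω →L[ℝ] Lp ℝ 2 (volume.restrict Ω) := ![shDL Ω, shOL Ω, dvL Ω]
  have hT : ∀ w, ∑ i, ‖T i w‖ ^ 2 = ‖shDL Ω w‖ ^ 2 + ‖shOL Ω w‖ ^ 2 + ‖dvL Ω w‖ ^ 2 := fun w =>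
    Fin.sum_univ_three _
  have hker : ∀ w ∈ (smoothVanishing Ω D).topologicalClosure, (∀ i, T i w = 0) → w = 0 :=
    fun w hw h => eq_zero_of_strain_zero hΩ hL hD hreg hne hw (h 0) (h 1) (h 2)
  have hk' : ∀ w ∈ (smoothVanishing Ω D).topologicalClosure, ‖w‖ ^ 2 ≤
      C * ((∑ i, ‖T i w‖ ^ 2) + ∑ a : Fin 2, ‖(resL Ω K ∘L vL Ω a) w‖ ^ 2) := fun w hw =>
    (hk w hw).trans_eq (congrArg (C * ·) (congrArg₂ (· + ·) (hT w).symm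
      (Fin.sum_univ_two fun a : Fin 2 => ‖(resL Ω K ∘L vL Ω a) w‖ ^ 2).symm))
  clear_value T
  obtain ⟨C', hC', h⟩ := exists_coercive_of_compact_perturbation
    (smoothVanishing Ω D).isClosed_topologicalClosure T (fun a : Fin 2 => resL Ω K ∘L vL Ω a)
    hk' hker (fun w hw1 hw a => tendsto_norm_resL hΩ hK hKΩ hw1 hw a)
  exact ⟨C', hC', fun w hw => hT w ▸ h w hw⟩

end Korn

/-! ### Alternate minimization of a separately strongly convex functional -/

/-- Minimality against the midpoint of `z` and `y`, combined with uniform midpoint convexity and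
multiplied by two. -/
theorem growth_of_midpoint {Y : Type*} [NormedAddCommGroup Y] [NormedSpace ℝ Y] {K : Set Y}
    {J : Y → ℝ} {c : ℝ} (hK : ∀ z ∈ K, ∀ z' ∈ K, (2⁻¹ : ℝ) • (z + z') ∈ K)
    (hJ : ∀ z ∈ K, ∀ z' ∈ K, J ((2⁻¹ : ℝ) • (z + z')) + c * ‖z - z'‖ ^ 2 ≤ (J z + J z') / 2)
    {z : Y} (hz : z ∈ K) (hmin : ∀ y ∈ K, J z ≤ J y) {y : Y} (hy : y ∈ K) :
    J z + 2 * c * ‖z - y‖ ^ 2 ≤ J y := by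
  have h1 := hmin _ (hK z hz y hy)
  have h2 := hJ z hz y hy
  linarith

theorem eq_of_midpoint {Y : Type*} [NormedAddCommGroup Y] [NormedSpace ℝ Y] {K : Set Y}
    {J : Y → ℝ} {c : ℝ} (hc : 0 < c) (hK : ∀ z ∈ K, ∀ z' ∈ K, (2⁻¹ : ℝ) • (z + z') ∈ K)
    (hJ : ∀ z ∈ K, ∀ z' ∈ K, J ((2⁻¹ : ℝ) • (z + z')) + c * ‖z - z'‖ ^ 2 ≤ (J z + J z') / 2)
    {z : Y} (hz : z ∈ K) (hmin : ∀ y ∈ K, J z ≤ J y) {y : Y} (hy : y ∈ K) (hy' : J y ≤ J z) :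
    y = z := by
  have h := growth_of_midpoint hK hJ hz hmin hy
  have h2 : ‖z - y‖ ^ 2 ≤ 0 := by
    by_contra hlt
    push Not at hlt
    have : 0 < 2 * c * ‖z - y‖ ^ 2 := by positivity
    linarith
  have h3 : ‖z - y‖ = 0 := pow_eq_zero_iff two_ne_zero |>.1 (le_antisymm h2 (sq_nonneg _))
  exact (sub_eq_zero.1 (norm_eq_zero.1 h3)).symm

/-- `E` plays the elastic energy, `Q` the part depending on the phase field only, `G` a lift of the
boundary datum. The hypothesis `hweak` packages a.e. convergence: along a subsequence of weakly
convergent phase fields, `E u` converges for each fixed `u`, and `E` is uniformly convex in `u`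
around a weak limit up to an error tending to zero. Strong convergence of `u` is obtained first,
from convexity in `u`; that of `z` follows from convexity in `z` and the Lipschitz bound `hcont`. -/
theorem exists_limit_of_alternate_minimization {X Y : Type*} [NormedAddCommGroup X]
    [InnerProductSpace ℝ X] [CompleteSpace X] [NormedAddCommGroup Y] [InnerProductSpace ℝ Y]
    [CompleteSpace Y] {V : Submodule ℝ X} (hV : IsClosed (V : Set X)) {K : Set Y}
    (hK : ∀ z ∈ K, ∀ z' ∈ K, (2⁻¹ : ℝ) • (z + z') ∈ K) {E : X → Y → ℝ} {Q : Y → ℝ} {G : X}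
    {c c' C C' R : ℝ} (hc : 0 < c) (hc' : 0 < c') (hC : 0 ≤ C) (hC' : 0 ≤ C')
    (hE0 : ∀ u, ∀ z ∈ K, 0 ≤ E u z) (hQ0 : ∀ z ∈ K, 0 ≤ Q z)
    (hub : ∀ u, ∀ z ∈ K, u - G ∈ V → E u z ≤ E G z → ‖u‖ ≤ R)
    (hzb : ∀ z ∈ K, ‖z‖ ^ 2 ≤ C' * (Q z + 1))
    (hmid : ∀ u, ∀ z ∈ K, ∀ z' ∈ K, E u ((2⁻¹ : ℝ) • (z + z')) + Q ((2⁻¹ : ℝ) • (z + z')) +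
      c * ‖z - z'‖ ^ 2 ≤ ((E u z + Q z) + (E u z' + Q z')) / 2)
    (hcont : ∀ u v, ∀ z ∈ K, |E u z - E v z| ≤ C * ‖u - v‖ * (‖u‖ + ‖v‖))
    (hweak : ∀ (z : ℕ → Y) (z' : Y) (B : ℝ), (∀ n, z n ∈ K) → (∀ n, ‖z n‖ ≤ B) →
      (∀ ψ : Y →L[ℝ] ℝ, Tendsto (fun n => ψ (z n)) atTop (𝓝 (ψ z'))) →
      ∃ ns : ℕ → ℕ, StrictMono ns ∧ z' ∈ K ∧
        (∀ u, Tendsto (fun n => E u (z (ns n))) atTop (𝓝 (E u z'))) ∧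
        ∀ (u : ℕ → X) (u' : X), (∀ n, u n - u' ∈ V) → (∀ n, ‖u n‖ ≤ R) →
          (∀ ψ : X →L[ℝ] ℝ, Tendsto (fun n => ψ (u n)) atTop (𝓝 (ψ u'))) →
          ∃ r : ℕ → ℝ, Tendsto r atTop (𝓝 0) ∧
            ∀ n, E u' (z (ns n)) + c' * ‖u n - u'‖ ^ 2 + r n ≤ E (u n) (z (ns n)))
    (hQc : ∀ (z : ℕ → Y) (z' : Y), (∀ n, z n ∈ K) → Tendsto z atTop (𝓝 z') →
      ∃ ns : ℕ → ℕ, StrictMono ns ∧ Tendsto (fun n => Q (z (ns n))) atTop (𝓝 (Q z')))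
    {u : ℕ → X} {z : ℕ → Y} (hz0 : z 0 ∈ K) (huV : ∀ j, u (j + 1) - G ∈ V)
    (hu : ∀ j v, v - G ∈ V → E (u (j + 1)) (z j) ≤ E v (z j)) (hzK : ∀ j, z (j + 1) ∈ K)
    (hz : ∀ j, ∀ y ∈ K, E (u (j + 1)) (z (j + 1)) + Q (z (j + 1)) ≤ E (u (j + 1)) y + Q y) :
    ∃ (u' : X) (z' : Y) (n : ℕ → ℕ), StrictMono n ∧ Tendsto (fun l => u (n l)) atTop (𝓝 u') ∧
      Tendsto (fun l => z (n l)) atTop (𝓝 z') ∧ u' - G ∈ V ∧ z' ∈ K ∧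
      (∀ v, v - G ∈ V → E u' z' ≤ E v z') ∧ ∀ y ∈ K, E u' z' + Q z' ≤ E u' y + Q y := by
  have hzK' : ∀ j, z j ∈ K := fun j => by
    cases j with
    | zero => exact hz0
    | succ j => exact hzK j
  have hgr : ∀ j, ∀ y ∈ K, E (u (j + 1)) (z (j + 1)) + Q (z (j + 1)) +
      2 * c * ‖z (j + 1) - y‖ ^ 2 ≤ E (u (j + 1)) y + Q y := fun j y hy =>
    growth_of_midpoint hK (J := fun y => E (u (j + 1)) y + Q y) (hmid _) (hzK j) (hz j) hy
  have hR : ∀ j, ‖u (j + 1)‖ ≤ R := fun j =>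
    hub _ (z j) (hzK' j) (huV j) (hu j G (by simp))
  have hR0 : 0 ≤ R := (norm_nonneg _).trans (hR 0)
  set F : ℕ → ℝ := fun j => E (u (j + 1)) (z (j + 1)) + Q (z (j + 1)) with hF
  have hF0 : ∀ j, 0 ≤ F j := fun j => add_nonneg (hE0 _ _ (hzK j)) (hQ0 _ (hzK j))
  -- The displacement step does not increase the functional, and the phase step decreases it by at
  -- least the squared increment, by `growth_of_midpoint`.
  have hstep : ∀ j, F (j + 1) + 2 * c * ‖z (j + 1 + 1) - z (j + 1)‖ ^ 2 ≤ F j := fun j =>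
    (hgr (j + 1) _ (hzK j)).trans (by
      have := hu (j + 1) (u (j + 1)) (huV j)
      simp only [hF]
      linarith)
  have hanti : Antitone F := antitone_nat_of_succ_le fun j => by
    have := hstep j
    have h2 : 0 ≤ 2 * c * ‖z (j + 1 + 1) - z (j + 1)‖ ^ 2 := by positivity
    linarith
  have hFl := tendsto_atTop_ciInf hanti ⟨0, by rintro _ ⟨j, rfl⟩; exact hF0 j⟩
  have hdiff : Tendsto (fun j => z (j + 1 + 1) - z (j + 1)) atTop (𝓝 0) := by
    rw [tendsto_zero_iff_norm_tendsto_zero]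
    have h1 : Tendsto (fun j => (F j - F (j + 1)) / (2 * c)) atTop (𝓝 0) := by
      have := (hFl.sub (hFl.comp (tendsto_add_atTop_nat 1))).div_const (2 * c)
      simpa using this
    have h2 : Tendsto (fun j => ‖z (j + 1 + 1) - z (j + 1)‖ ^ 2) atTop (𝓝 0) :=
      squeeze_zero (fun n => sq_nonneg _) (fun j => by
        rw [le_div_iff₀ (by positivity)]
        linarith [hstep j]) h1
    simpa using h2.sqrt
  have hzbd : ∀ j, ‖z (j + 1)‖ ≤ Real.sqrt (C' * (F 0 + 1)) := fun j => by
    refine Real.le_sqrt_of_sq_le ((hzb _ (hzK j)).trans (mul_le_mul_of_nonneg_left ?_ hC'))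
    have h1 := hanti (Nat.zero_le j)
    have h2 := hE0 (u (j + 1)) _ (hzK j)
    simp only [hF] at h1 ⊢
    linarith
  obtain ⟨z', n₁, hn₁, hz'⟩ := exists_weakly_convergent_subseq hzbd
  -- The index is shifted by one: the displacement `u (j + 1)` minimizes against the phase field `z
  -- j`, so `u (n₁ l + 2)` is paired with `z (n₁ l + 1)`.
  obtain ⟨u', n₂, hn₂, hu'⟩ := exists_weakly_convergent_subseq
    (w := fun l => u (n₁ l + 1 + 1)) (fun l => hR _)
  obtain ⟨n₃, hn₃, hz'K, hE1, hE2⟩ := hweak (fun l => z (n₁ (n₂ l) + 1)) z' _ (fun l => hzK _)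
    (fun l => hzbd _) (fun ψ => (hz' ψ).comp hn₂.tendsto_atTop)
  set φ : ℕ → ℕ := fun l => n₁ (n₂ (n₃ l)) with hφ
  have hφm : StrictMono φ := hn₁.comp (hn₂.comp hn₃)
  have hu'w : ∀ ψ : X →L[ℝ] ℝ, Tendsto (fun l => ψ (u (φ l + 1 + 1))) atTop (𝓝 (ψ u')) :=
    fun ψ => (hu' ψ).comp hn₃.tendsto_atTop
  have hu'V : u' - G ∈ V := mem_of_weak_limit hV (w := fun l => u (φ l + 1 + 1) - G)
    (fun l => huV _) fun ψ => by
      simp only [map_sub]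
      exact (hu'w ψ).sub_const _
  obtain ⟨r, hr, hrE⟩ := hE2 (fun l => u (φ l + 1 + 1)) u' (fun l => by
    have := V.sub_mem (huV (φ l + 1)) hu'V
    rwa [sub_sub_sub_cancel_right] at this) (fun l => hR _) hu'w
  -- The weak limit `u'` has the right boundary values and is a competitor for each `u (φ l + 2)`;
  -- the convexity gap is then bounded by the vanishing error `r`.
  have hb : Tendsto (fun l => u (φ l + 1 + 1)) atTop (𝓝 u') := by
    rw [tendsto_iff_norm_sub_tendsto_zero]
    have h1 : Tendsto (fun l => -r l / c') atTop (𝓝 0) := by simpa using hr.neg.div_const c'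
    have h2 : Tendsto (fun l => ‖u (φ l + 1 + 1) - u'‖ ^ 2) atTop (𝓝 0) :=
      squeeze_zero (fun n => sq_nonneg _) (fun l => by
        rw [le_div_iff₀ hc']
        have := hrE l
        have := hu (φ l + 1) u' hu'V
        linarith) h1
    simpa using h2.sqrt
  have hmin : ∀ v, v - G ∈ V → E u' z' ≤ E v z' := fun v hv => by
    have h1 : Tendsto (fun l => E u' (z (φ l + 1)) + r l) atTop (𝓝 (E u' z')) := by
      simpa using (hE1 u').add hr
    refine le_of_tendsto_of_tendsto' h1 (hE1 v) fun l => ?_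
    have := hrE l
    have := hu (φ l + 1) v hv
    have h3 : 0 ≤ c' * ‖u (φ l + 1 + 1) - u'‖ ^ 2 := by positivity
    linarith
  -- Each of two phase steps is tested with the solution of the other. Adding the two growth
  -- inequalities cancels `Q` and leaves differences of `E` in its first argument, small because `u`
  -- converges. The `+ 1` only keeps the denominator positive.
  have hd : CauchySeq fun l => z (φ l + 1 + 1) := by
    rw [Metric.cauchySeq_iff]
    intro ε hε
    obtain ⟨N, hN⟩ := Metric.cauchySeq_iff.1 hb.cauchySeq (c * ε ^ 2 / (C * (R + R) + 1))
      (by positivity)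
    refine ⟨N, fun l hl m hm => ?_⟩
    have h1 := hgr (φ l + 1) _ (hzK (φ m + 1))
    have h2 := hgr (φ m + 1) _ (hzK (φ l + 1))
    have h3 := le_abs_self _ |>.trans
      (hcont (u (φ l + 1 + 1)) (u (φ m + 1 + 1)) _ (hzK (φ m + 1)))
    have h4 := le_abs_self _ |>.trans
      (hcont (u (φ m + 1 + 1)) (u (φ l + 1 + 1)) _ (hzK (φ l + 1)))
    have h5 := hN l hl m hm
    rw [dist_eq_norm, lt_div_iff₀ (by positivity)] at h5
    rw [norm_sub_rev (u (φ m + 1 + 1))] at h4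
    rw [norm_sub_rev (z (φ m + 1 + 1))] at h2
    have h6 : ∀ s : ℝ, s ≤ R + R → C * ‖u (φ l + 1 + 1) - u (φ m + 1 + 1)‖ * s ≤
        C * ‖u (φ l + 1 + 1) - u (φ m + 1 + 1)‖ * (R + R) := fun s hs =>
      mul_le_mul_of_nonneg_left hs (by positivity)
    have h7 := h6 _ (add_le_add (hR (φ l + 1)) (hR (φ m + 1)))
    have h8 := h6 _ (add_le_add (hR (φ m + 1)) (hR (φ l + 1)))
    rw [dist_eq_norm]
    refine lt_of_pow_lt_pow_left₀ 2 hε.le ?_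
    have h9 : c * ‖z (φ l + 1 + 1) - z (φ m + 1 + 1)‖ ^ 2 < c * ε ^ 2 := by
      have := norm_nonneg (u (φ l + 1 + 1) - u (φ m + 1 + 1))
      have h0 : 0 ≤ c * ‖z (φ l + 1 + 1) - z (φ m + 1 + 1)‖ ^ 2 := by positivity
      linarith
    exact lt_of_mul_lt_mul_left h9 hc.le
  obtain ⟨z'', hz''⟩ := cauchySeq_tendsto_of_complete hd
  -- The increments vanish, so the phase fields before and after the step have the same limit, and
  -- the new displacement is paired with one phase field in both limit problems.
  have hzz : z'' = z' := by
    have h1 : Tendsto (fun l => z (φ l + 1)) atTop (𝓝 z'') := by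
      have := hz''.sub (hdiff.comp hφm.tendsto_atTop)
      simpa using this
    rw [← sub_eq_zero]
    refine SeparatingDual.eq_zero_of_forall_dual_eq_zero (R := ℝ) fun ψ => ?_
    rw [map_sub, sub_eq_zero]
    exact tendsto_nhds_unique ((ψ.continuous.tendsto _).comp h1)
      ((hz' ψ).comp (hn₂.comp hn₃).tendsto_atTop)
  rw [hzz] at hz''
  refine ⟨u', z', fun l => φ l + 1 + 1, fun a b hab => by
    have := hφm hab
    simp only
    omega, hb, hz'', hu'V, hz'K, hmin, fun y hy => ?_⟩
  -- Convergence of `Q` and of `E u'` is available only along further subsequences, which suffices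
  -- for passing to the limit in an inequality.
  obtain ⟨n₄, hn₄, hQ4⟩ := hQc _ z' (fun l => hzK (φ l + 1)) hz''
  obtain ⟨n₅, hn₅, -, hE5, -⟩ := hweak (fun l => z (φ (n₄ l) + 1 + 1)) z' _ (fun l => hzK _)
    (fun l => hzbd _) (fun ψ => (ψ.continuous.tendsto _).comp (hz''.comp hn₄.tendsto_atTop))
  set χ : ℕ → ℕ := fun l => n₄ (n₅ l) with hχ
  have hχm : StrictMono χ := hn₄.comp hn₅
  have hbχ : Tendsto (fun l => u (φ (χ l) + 1 + 1)) atTop (𝓝 u') := hb.comp hχm.tendsto_atTop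
  have hz1 : Tendsto (fun l => C * ‖u (φ (χ l) + 1 + 1) - u'‖ *
      (‖u (φ (χ l) + 1 + 1)‖ + ‖u'‖)) atTop (𝓝 0) := by
    have := ((hbχ.sub_const u').norm.const_mul C).mul (hbχ.norm.add_const ‖u'‖)
    simpa using this
  have hcv : ∀ y : ℕ → Y, (∀ l, y l ∈ K) →
      Tendsto (fun l => E (u (φ (χ l) + 1 + 1)) (y l) - E u' (y l)) atTop (𝓝 0) := fun y hy =>
    squeeze_zero_norm (fun l => by
      rw [Real.norm_eq_abs]
      exact hcont _ _ _ (hy l)) hz1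
  have l1 : Tendsto (fun l => E (u (φ (χ l) + 1 + 1)) (z (φ (χ l) + 1 + 1)) +
      Q (z (φ (χ l) + 1 + 1))) atTop (𝓝 (E u' z' + Q z')) := by
    have := ((hcv (fun l => z (φ (χ l) + 1 + 1)) fun l => hzK _).add (hE5 u')).add
      (hQ4.comp hn₅.tendsto_atTop)
    simp only [zero_add] at this
    refine this.congr fun l => ?_
    simp [hχ]
  have l2 : Tendsto (fun l => E (u (φ (χ l) + 1 + 1)) y + Q y) atTop (𝓝 (E u' y + Q y)) := by
    have := ((hcv (fun _ => y) fun _ => hy).add_const (E u' y)).add_const (Q y)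
    simpa using this
  exact le_of_tendsto_of_tendsto' l1 l2 fun l => hz _ y hy

/-! ### The elastic density in terms of the strain components -/

/-- The elastic density as a function of the degradation `A = h(z)` and of the components
`p = ∂₀u₀ - ∂₁u₁`, `q = ∂₁u₀ + ∂₀u₁`, `t = div u`. -/
noncomputable def dens (μ κ A p q t : ℝ) : ℝ :=
  A * (μ * (p ^ 2 + q ^ 2) / 2 + κ * max t 0 ^ 2 / 2) + κ * max (-t) 0 ^ 2 / 2

theorem density_strain {Ω : Set R2} (h : ℝ → ℝ) (μ κ s : ℝ) (u : H1v Ω) (x : R2) :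
    density h μ κ s (strain u x) = dens μ κ (h s) (pd 0 u x 0 - pd 1 u x 1)
      (pd 1 u x 0 + pd 0 u x 1) (pd 0 u x 0 + pd 1 u x 1) := by
  have ht : (strain u x).trace = pd 0 u x 0 + pd 1 u x 1 := by
    simp [Matrix.trace, strain]
  simp only [density, frobSq, devPart, volPart, volPos, volNeg, ht, dens, Fin.sum_univ_two]
  simp [strain]
  ring

section Pointwise

variable {μ κ A p q t p' q' t' : ℝ}

theorem max_sub_max_neg (t : ℝ) : max t 0 - max (-t) 0 = t := by
  rcases le_total t 0 with h | h
  · rw [max_eq_right h, max_eq_left (by linarith)]; ring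
  · rw [max_eq_left h, max_eq_right (by linarith)]; ring

theorem max_mul_max_neg (t : ℝ) : max t 0 * max (-t) 0 = 0 := by
  rcases le_total t 0 with h | h
  · rw [max_eq_right h]; ring
  · rw [max_eq_right (a := -t) (by linarith)]; ring

theorem dens_nonneg (hμ : 0 ≤ μ) (hκ : 0 ≤ κ) (hA : 0 ≤ A) : 0 ≤ dens μ κ A p q t := by
  unfold dens
  positivity

/-- Strong convexity in gradient form, with a modulus independent of the phase field because only `a
≤ A` is used. Splitting the trace into positive and negative parts, whose product is zero, makes
every piece quadratic; the cross terms between old and new parts have a favourable sign. -/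
theorem dens_lower {a c : ℝ} (ha : a ≤ A) (hμ : 2 * c ≤ a * μ)
    (hκ : 2 * c ≤ a * κ) (hκ' : 2 * c ≤ κ) (hμ0 : 0 ≤ μ) (hκ0 : 0 ≤ κ) :
    dens μ κ A p q t + (A * μ * p) * (p' - p) + (A * μ * q) * (q' - q) +
      (A * (κ * max t 0) - κ * max (-t) 0) * (t' - t) +
      c * ((p' - p) ^ 2 + (q' - q) ^ 2 + (t' - t) ^ 2) ≤ dens μ κ A p' q' t' := by
  have h1 : 2 * c ≤ A * μ := hμ.trans (mul_le_mul_of_nonneg_right ha hμ0)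
  have h2 : 2 * c ≤ A * κ := hκ.trans (mul_le_mul_of_nonneg_right ha hκ0)
  have e1 := max_sub_max_neg t
  have e2 := max_mul_max_neg t
  have e3 := max_sub_max_neg t'
  have e4 := max_mul_max_neg t'
  have n1 : 0 ≤ max t 0 := le_max_right _ _
  have n2 : 0 ≤ max (-t) 0 := le_max_right _ _
  have n3 : 0 ≤ max t' 0 := le_max_right _ _
  have n4 : 0 ≤ max (-t') 0 := le_max_right _ _
  unfold dens
  set x := max t 0
  set y := max (-t) 0
  set x' := max t' 0
  set y' := max (-t') 0
  rw [← e1, ← e3]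
  -- The four nonnegative remainders: two for the positive and negative parts of the trace, each
  -- with its cross term, and two for the shear components. The final combination also uses that
  -- both products of parts vanish.
  have f1 : 0 ≤ (A * κ / 2 - c) * ((x' - x) ^ 2 + 2 * (x * y')) :=
    mul_nonneg (by linarith) (by positivity)
  have f2 : 0 ≤ (κ / 2 - c) * ((y' - y) ^ 2 + 2 * (y * x')) :=
    mul_nonneg (by linarith) (by positivity)
  have f3 : 0 ≤ (A * μ / 2 - c) * (p' - p) ^ 2 := mul_nonneg (by linarith) (sq_nonneg _)
  have f4 : 0 ≤ (A * μ / 2 - c) * (q' - q) ^ 2 := mul_nonneg (by linarith) (sq_nonneg _)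
  linear_combination f1 + f2 + f3 + f4 + (A * κ + κ - 2 * c) * e2 - 2 * c * e4

theorem abs_sq_sub_sq_le (a b : ℝ) : |a ^ 2 - b ^ 2| ≤ |a - b| * (|a| + |b|) := by
  rw [show a ^ 2 - b ^ 2 = (a - b) * (a + b) by ring, abs_mul]
  exact mul_le_mul_of_nonneg_left (abs_add_le a b) (abs_nonneg _)

theorem abs_max_sq_sub_le (a b : ℝ) : |max a 0 ^ 2 - max b 0 ^ 2| ≤ |a - b| * (|a| + |b|) := by
  refine (abs_sq_sub_sq_le _ _).trans (mul_le_mul (abs_max_sub_max_le_abs a b 0) ?_ (by positivity)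
    (abs_nonneg _))
  have h : ∀ s : ℝ, |max s 0| ≤ |s| := fun s => by
    rw [abs_of_nonneg (le_max_right s 0)]
    exact max_le (le_abs_self s) (abs_nonneg s)
  exact add_le_add (h a) (h b)

theorem abs_dens_sub_le {M : ℝ} (hμ : 0 ≤ μ) (hκ : 0 ≤ κ) (hA : 0 ≤ A) (hM : A ≤ M) :
    |dens μ κ A p q t - dens μ κ A p' q' t'| ≤ (M + 1) * (μ + κ) *
      (|p - p'| * (|p| + |p'|) + |q - q'| * (|q| + |q'|) + |t - t'| * (|t| + |t'|)) := by
  have h1 := abs_sq_sub_sq_le p p'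
  have h2 := abs_sq_sub_sq_le q q'
  have h3 := abs_max_sq_sub_le t t'
  have h4 := abs_max_sq_sub_le (-t) (-t')
  rw [abs_neg, abs_neg, neg_sub_neg, abs_sub_comm t' t] at h4
  have e : dens μ κ A p q t - dens μ κ A p' q' t' = A * μ / 2 * (p ^ 2 - p' ^ 2) +
      A * μ / 2 * (q ^ 2 - q' ^ 2) + A * κ / 2 * (max t 0 ^ 2 - max t' 0 ^ 2) +
      κ / 2 * (max (-t) 0 ^ 2 - max (-t') 0 ^ 2) := by
    unfold dens; ring
  have b : ∀ c x y : ℝ, 0 ≤ c → |x| ≤ y → |c * x| ≤ c * y := fun c x y hc hxy => by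
    rw [abs_mul, abs_of_nonneg hc]
    exact mul_le_mul_of_nonneg_left hxy hc
  rw [e]
  have k1 := b (A * μ / 2) _ _ (by positivity) h1
  have k2 := b (A * μ / 2) _ _ (by positivity) h2
  have k3 := b (A * κ / 2) _ _ (by positivity) h3
  have k4 := b (κ / 2) _ _ (by positivity) h4
  have n1 : 0 ≤ |p - p'| * (|p| + |p'|) := by positivity
  have n2 : 0 ≤ |q - q'| * (|q| + |q'|) := by positivity
  have n3 : 0 ≤ |t - t'| * (|t| + |t'|) := by positivity
  set a := |p - p'| * (|p| + |p'|)
  set b := |q - q'| * (|q| + |q'|)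
  set d := |t - t'| * (|t| + |t'|)
  have m1 : A * μ ≤ M * μ := mul_le_mul_of_nonneg_right hM hμ
  have m2 : A * κ ≤ M * κ := mul_le_mul_of_nonneg_right hM hκ
  have m3 : 0 ≤ A * μ := by positivity
  have m4 : 0 ≤ A * κ := by positivity
  have c1 : A * μ / 2 ≤ (M + 1) * (μ + κ) := by linarith
  have c2 : A * κ / 2 + κ / 2 ≤ (M + 1) * (μ + κ) := by linarith
  have g1 := mul_le_mul_of_nonneg_right c1 n1
  have g2 := mul_le_mul_of_nonneg_right c1 n2
  have g3 := mul_le_mul_of_nonneg_right c2 n3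
  refine (abs_add_le _ _).trans ((add_le_add ((abs_add_le _ _).trans (add_le_add
    ((abs_add_le _ _).trans (add_le_add k1 k2)) k3)) k4).trans ?_)
  linarith

theorem dens_zero : dens μ κ A 0 0 0 = 0 := by simp [dens]

theorem dens_mono {A' : ℝ} (hμ : 0 ≤ μ) (hκ : 0 ≤ κ) (hA : A ≤ A') :
    dens μ κ A p q t ≤ dens μ κ A' p q t := by
  unfold dens
  gcongr

theorem dens_le_half {A₁ A₂ : ℝ} (hμ : 0 ≤ μ) (hκ : 0 ≤ κ) (hA : A ≤ (A₁ + A₂) / 2) :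
    dens μ κ A p q t ≤ (dens μ κ A₁ p q t + dens μ κ A₂ p q t) / 2 := by
  refine (dens_mono hμ hκ hA).trans_eq ?_
  unfold dens
  ring

end Pointwise

/-! ### The integrated elastic density -/

section Integrated

variable {α : Type*} [MeasurableSpace α] {ν : Measure α} {μ κ M : ℝ}

theorem integral_abs_mul_le (f g : Lp ℝ 2 ν) : ∫ x, |f x| * |g x| ∂ν ≤ ‖f‖ * ‖g‖ := by
  have hf : MemLp (fun x => |f x|) 2 ν := (Lp.memLp f).abs
  have hg : MemLp (fun x => |g x|) 2 ν := (Lp.memLp g).abs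
  have hn : ∀ (f : Lp ℝ 2 ν) (hf : MemLp (fun x => |f x|) 2 ν), ‖hf.toLp _‖ = ‖f‖ := by
    intro f hf
    rw [Lp.norm_toLp, Lp.norm_def]
    congr 1
    exact eLpNorm_congr_norm_ae (Eventually.of_forall fun x => by simp)
  rw [integral_mul_eq_inner_toLp hf hg, ← hn f hf, ← hn g hg]
  exact real_inner_le_norm _ _

theorem integrable_abs_sub_mul (f g : Lp ℝ 2 ν) :
    Integrable (fun x => |f x - g x| * (|f x| + |g x|)) ν :=
  MemLp.integrable_mul (p := 2) (q := 2) ((Lp.memLp f).sub (Lp.memLp g)).abs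
    ((Lp.memLp f).abs.add (Lp.memLp g).abs)

theorem integral_abs_sub_mul_le (f g : Lp ℝ 2 ν) :
    ∫ x, |f x - g x| * (|f x| + |g x|) ∂ν ≤ ‖f - g‖ * (‖f‖ + ‖g‖) := by
  have e : ∫ x, |f x - g x| * (|f x| + |g x|) ∂ν =
      (∫ x, |(f - g) x| * |f x| ∂ν) + ∫ x, |(f - g) x| * |g x| ∂ν := by
    rw [← integral_add]
    · refine integral_congr_ae ?_
      filter_upwards [Lp.coeFn_sub f g] with x hx
      rw [hx, Pi.sub_apply]
      ring
    · exact MemLp.integrable_mul (p := 2) (q := 2) (Lp.memLp _).abs (Lp.memLp _).abs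
    · exact MemLp.integrable_mul (p := 2) (q := 2) (Lp.memLp _).abs (Lp.memLp _).abs
  rw [e, mul_add]
  exact add_le_add (integral_abs_mul_le _ _) (integral_abs_mul_le _ _)

theorem continuous_dens : Continuous fun v : ℝ × ℝ × ℝ × ℝ => dens μ κ v.1 v.2.1 v.2.2.1 v.2.2.2 := by
  unfold dens
  fun_prop

theorem aestronglyMeasurable_dens {a : α → ℝ} (ha : AEStronglyMeasurable a ν) (p q t : Lp ℝ 2 ν) :
    AEStronglyMeasurable (fun x => dens μ κ (a x) (p x) (q x) (t x)) ν :=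
  continuous_dens.comp_aestronglyMeasurable (ha.prodMk ((Lp.aestronglyMeasurable p).prodMk
    ((Lp.aestronglyMeasurable q).prodMk (Lp.aestronglyMeasurable t))))

theorem abs_dens_le {A p q t : ℝ} (hμ : 0 ≤ μ) (hκ : 0 ≤ κ) (hA : A ∈ Set.Icc 0 M) :
    |dens μ κ A p q t| ≤ (M + 1) * (μ + κ) * (p ^ 2 + q ^ 2 + t ^ 2) := by
  have := abs_dens_sub_le (p := p) (q := q) (t := t) (p' := 0) (q' := 0) (t' := 0) hμ hκ hA.1 hA.2
  simpa [dens_zero, ← pow_two] using this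

theorem integrable_sq_sum (p q t : Lp ℝ 2 ν) :
    Integrable (fun x => p x ^ 2 + q x ^ 2 + t x ^ 2) ν :=
  ((Lp.memLp p).integrable_sq.add (Lp.memLp q).integrable_sq).add (Lp.memLp t).integrable_sq

theorem integrable_dens (hμ : 0 ≤ μ) (hκ : 0 ≤ κ) {a : α → ℝ} (ha : AEStronglyMeasurable a ν)
    (hM : ∀ᵐ x ∂ν, a x ∈ Set.Icc 0 M) (p q t : Lp ℝ 2 ν) :
    Integrable (fun x => dens μ κ (a x) (p x) (q x) (t x)) ν :=
  ((integrable_sq_sum p q t).const_mul ((M + 1) * (μ + κ))).mono'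
    (aestronglyMeasurable_dens ha p q t) (hM.mono fun _ hx => abs_dens_le hμ hκ hx)

theorem abs_integral_dens_sub_le (hμ : 0 ≤ μ) (hκ : 0 ≤ κ) (hM0 : 0 ≤ M) {a : α → ℝ}
    (ha : AEStronglyMeasurable a ν) (hM : ∀ᵐ x ∂ν, a x ∈ Set.Icc 0 M) (p q t p' q' t' : Lp ℝ 2 ν) :
    |(∫ x, dens μ κ (a x) (p x) (q x) (t x) ∂ν) - ∫ x, dens μ κ (a x) (p' x) (q' x) (t' x) ∂ν| ≤
      (M + 1) * (μ + κ) * (‖p - p'‖ * (‖p‖ + ‖p'‖) + ‖q - q'‖ * (‖q‖ + ‖q'‖) +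
        ‖t - t'‖ * (‖t‖ + ‖t'‖)) := by
  have i1 := integrable_abs_sub_mul p p'
  have i2 := integrable_abs_sub_mul q q'
  have i3 := integrable_abs_sub_mul t t'
  rw [← integral_sub (integrable_dens hμ hκ ha hM p q t) (integrable_dens hμ hκ ha hM p' q' t')]
  have h1 := norm_integral_le_of_norm_le (((i1.add i2).add i3).const_mul ((M + 1) * (μ + κ)))
    (f := fun x => dens μ κ (a x) (p x) (q x) (t x) - dens μ κ (a x) (p' x) (q' x) (t' x))
    (hM.mono fun x hx => abs_dens_sub_le hμ hκ hx.1 hx.2)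
  rw [Real.norm_eq_abs] at h1
  refine h1.trans ?_
  rw [integral_const_mul]
  refine mul_le_mul_of_nonneg_left ?_ (by positivity)
  rw [integral_add' (i1.add i2) i3, integral_add' i1 i2]
  exact add_le_add (add_le_add (integral_abs_sub_mul_le _ _) (integral_abs_sub_mul_le _ _))
    (integral_abs_sub_mul_le _ _)

theorem memLp_bdd_mul {a : α → ℝ} (ha : AEStronglyMeasurable a ν)
    (hM : ∀ᵐ x ∂ν, a x ∈ Set.Icc 0 M) {f : α → ℝ} (hf : MemLp f 2 ν) :
    MemLp (fun x => a x * f x) 2 ν := by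
  refine (hf.const_mul M).mono (ha.mul hf.1) (hM.mono fun x hx => ?_)
  rw [norm_mul, norm_mul, Real.norm_of_nonneg hx.1, Real.norm_of_nonneg (hx.1.trans hx.2)]
  exact mul_le_mul_of_nonneg_right hx.2 (norm_nonneg _)

theorem memLp_max (t : Lp ℝ 2 ν) : MemLp (fun x => max (t x) 0) 2 ν := (Lp.memLp t).pos_part

theorem memLp_max_neg (t : Lp ℝ 2 ν) : MemLp (fun x => max (-t x) 0) 2 ν := (Lp.memLp t).neg_part

theorem integral_dens_lower {a₀ c : ℝ} (hμ : 2 * c ≤ a₀ * μ)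
    (hκ : 2 * c ≤ a₀ * κ) (hκ' : 2 * c ≤ κ) (hμ0 : 0 ≤ μ) (hκ0 : 0 ≤ κ) {a : α → ℝ}
    (ha : AEStronglyMeasurable a ν) (ha₀ : ∀ᵐ x ∂ν, a₀ ≤ a x) (hM : ∀ᵐ x ∂ν, a x ∈ Set.Icc 0 M)
    (p q t p' q' t' : Lp ℝ 2 ν) :
    (∫ x, dens μ κ (a x) (p x) (q x) (t x) ∂ν) + (∫ x, a x * (μ * p x) * (p' - p) x ∂ν) +
      (∫ x, a x * (μ * q x) * (q' - q) x ∂ν) + (∫ x, a x * (κ * max (t x) 0) * (t' - t) x ∂ν) -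
      (∫ x, κ * max (-t x) 0 * (t' - t) x ∂ν) +
      c * (‖p' - p‖ ^ 2 + ‖q' - q‖ ^ 2 + ‖t' - t‖ ^ 2) ≤
    ∫ x, dens μ κ (a x) (p' x) (q' x) (t' x) ∂ν := by
  have m : ∀ {f : α → ℝ} (hf : MemLp f 2 ν) (w : Lp ℝ 2 ν), Integrable (fun x => f x * w x) ν :=
    fun hf w => MemLp.integrable_mul (p := 2) (q := 2) hf (Lp.memLp w)
  have i0 := integrable_dens hμ0 hκ0 ha hM p q t
  have i1 := m (memLp_bdd_mul ha hM ((Lp.memLp p).const_mul μ)) (p' - p)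
  have i2 := m (memLp_bdd_mul ha hM ((Lp.memLp q).const_mul μ)) (q' - q)
  have i3 := m (memLp_bdd_mul ha hM ((memLp_max t).const_mul κ)) (t' - t)
  have i4 := m ((memLp_max_neg t).const_mul κ) (t' - t)
  have i5 := (integrable_sq_sum (p' - p) (q' - q) (t' - t)).const_mul c
  have e5 : c * (‖p' - p‖ ^ 2 + ‖q' - q‖ ^ 2 + ‖t' - t‖ ^ 2) =
      ∫ x, c * ((p' - p) x ^ 2 + (q' - q) x ^ 2 + (t' - t) x ^ 2) ∂ν := by
    rw [integral_const_mul, norm_sq_lp, norm_sq_lp, norm_sq_lp, ← integral_add'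
      (Lp.memLp _).integrable_sq (Lp.memLp _).integrable_sq, ← integral_add'
      ((Lp.memLp _).integrable_sq.add (Lp.memLp _).integrable_sq) (Lp.memLp _).integrable_sq]
    rfl
  rw [e5, ← integral_add' i0 i1, ← integral_add' (i0.add i1) i2,
    ← integral_add' ((i0.add i1).add i2) i3, ← integral_sub' (((i0.add i1).add i2).add i3) i4,
    ← integral_add' ((((i0.add i1).add i2).add i3).sub i4) i5]
  refine integral_mono_ae (((((i0.add i1).add i2).add i3).sub i4).add i5)
    (integrable_dens hμ0 hκ0 ha hM p' q' t') ?_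
  filter_upwards [ha₀, Lp.coeFn_sub p' p, Lp.coeFn_sub q' q, Lp.coeFn_sub t' t] with x h0 h1 h2 h3
  simp only [Pi.add_apply, Pi.sub_apply, h1, h2, h3]
  have := dens_lower (p := p x) (q := q x) (t := t x) (p' := p' x) (q' := q' x) (t' := t' x)
    h0 hμ hκ hκ' hμ0 hκ0
  linarith

theorem tendsto_integral_dens (hμ : 0 ≤ μ) (hκ : 0 ≤ κ) {a : ℕ → α → ℝ} {a' : α → ℝ}
    (ha : ∀ n, AEStronglyMeasurable (a n) ν) (hM : ∀ n, ∀ᵐ x ∂ν, a n x ∈ Set.Icc 0 M)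
    (hl : ∀ᵐ x ∂ν, Tendsto (fun n => a n x) atTop (𝓝 (a' x))) (p q t : Lp ℝ 2 ν) :
    Tendsto (fun n => ∫ x, dens μ κ (a n x) (p x) (q x) (t x) ∂ν) atTop
      (𝓝 (∫ x, dens μ κ (a' x) (p x) (q x) (t x) ∂ν)) := by
  refine tendsto_integral_of_dominated_convergence
    (fun x => (M + 1) * (μ + κ) * (p x ^ 2 + q x ^ 2 + t x ^ 2))
    (fun n => aestronglyMeasurable_dens (ha n) p q t) ((integrable_sq_sum p q t).const_mul _)
    (fun n => (hM n).mono fun _ hx => abs_dens_le hμ hκ hx) ?_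
  filter_upwards [hl] with x hx
  have hc : Continuous fun A => dens μ κ A (p x) (q x) (t x) := by
    unfold dens
    fun_prop
  exact (hc.tendsto _).comp hx

/-- Bounded coefficients converging a.e. converge strongly in `L²` after multiplication by the fixed
`f`, and the pairing of a strongly convergent with a bounded weakly null sequence tends to zero. -/
theorem tendsto_integral_bdd_mul_weakly_null {a : ℕ → α → ℝ} {a' : α → ℝ}
    (ha : ∀ n, AEStronglyMeasurable (a n) ν) (hM : ∀ n, ∀ᵐ x ∂ν, a n x ∈ Set.Icc 0 M)
    (hl : ∀ᵐ x ∂ν, Tendsto (fun n => a n x) atTop (𝓝 (a' x))) {f : α → ℝ} (hf : MemLp f 2 ν)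
    {w : ℕ → Lp ℝ 2 ν} {C : ℝ} (hC : ∀ n, ‖w n‖ ≤ C)
    (hw : ∀ ψ : Lp ℝ 2 ν →L[ℝ] ℝ, Tendsto (fun n => ψ (w n)) atTop (𝓝 0)) :
    Tendsto (fun n => ∫ x, a n x * f x * w n x ∂ν) atTop (𝓝 0) := by
  have hM' : ∀ᵐ x ∂ν, a' x ∈ Set.Icc 0 M := by
    filter_upwards [hl, ae_all_iff.2 hM] with x hx hxM
    exact isClosed_Icc.mem_of_tendsto hx (Eventually.of_forall hxM)
  have ha' : AEStronglyMeasurable a' ν := aestronglyMeasurable_of_tendsto_ae atTop ha hl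
  have m := fun n => memLp_bdd_mul (ha n) (hM n) hf
  have m' := memLp_bdd_mul ha' hM' hf
  have hs : Tendsto (fun n => (m n).toLp _) atTop (𝓝 (m'.toLp _)) := by
    refine (Lp.tendsto_Lp_iff_tendsto_eLpNorm'' _ m _ m').2 ?_
    refine tendsto_eLpNorm_zero_of_dominated (g := fun x => M * |f x|)
      (fun n => (m n).1.sub m'.1) (hf.abs.const_mul M) (fun n => ?_) ?_
    · filter_upwards [hM n, hM'] with x h1 h2
      simp only [Pi.sub_apply]
      rw [← sub_mul, abs_mul]
      refine mul_le_mul_of_nonneg_right ?_ (abs_nonneg _)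
      rw [abs_le]
      constructor <;> linarith [h1.1, h1.2, h2.1, h2.2]
    · filter_upwards [hl] with x hx
      have := (hx.mul_const (f x)).sub_const (a' x * f x)
      simpa using this
  have h1 : Tendsto (fun n => inner ℝ ((m n).toLp _ - m'.toLp _) (w n)) atTop (𝓝 0) := by
    have h2 : Tendsto (fun n => ‖(m n).toLp _ - m'.toLp _‖ * C) atTop (𝓝 0) := by
      have := (tendsto_iff_norm_sub_tendsto_zero.1 hs).mul_const C
      simpa using this
    refine squeeze_zero_norm (fun n => ?_) h2
    exact (norm_inner_le_norm _ _).trans (mul_le_mul_of_nonneg_left (hC n) (norm_nonneg _))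
  have h3 := h1.add (hw (innerSL ℝ (m'.toLp _)))
  rw [add_zero] at h3
  refine h3.congr fun n => ?_
  rw [integral_mul_eq_inner (m n), innerSL_apply_apply, ← inner_add_left, sub_add_cancel]

end Integrated

/-! ### The energy on bounded phase fields -/

section Energy

variable {Ω : Set R2}

/-- Phase fields with values in `[-1, 1]`. -/
def IsBdd (z : H1 Ω) : Prop := ∀ᵐ x ∂(volume.restrict Ω), toLp z x ∈ Set.Icc (-1 : ℝ) 1

theorem exists_bound_Icc {h : ℝ → ℝ} (hc : Continuous h) :
    ∃ M : ℝ, 0 ≤ M ∧ ∀ s ∈ Set.Icc (-1 : ℝ) 1, h s ≤ M := by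
  obtain ⟨M, hM⟩ := isCompact_Icc.exists_bound_of_continuousOn (s := Set.Icc (-1 : ℝ) 1)
    hc.continuousOn
  refine ⟨M, (norm_nonneg _).trans (hM 0 (by norm_num)), fun s hs => ?_⟩
  exact (le_abs_self _).trans (hM s hs)

theorem aestronglyMeasurable_comp_toLp {h : ℝ → ℝ} (hc : Continuous h) (z : H1 Ω) :
    AEStronglyMeasurable (fun x => h (toLp z x)) (volume.restrict Ω) :=
  hc.comp_aestronglyMeasurable (Lp.aestronglyMeasurable _)

theorem ae_mem_Icc_comp {h : ℝ → ℝ} {M : ℝ} (h0 : ∀ s, 0 ≤ h s)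
    (hM : ∀ s ∈ Set.Icc (-1 : ℝ) 1, h s ≤ M) {z : H1 Ω} (hz : IsBdd z) :
    ∀ᵐ x ∂(volume.restrict Ω), h (toLp z x) ∈ Set.Icc 0 M :=
  hz.mono fun _ hx => ⟨h0 _, hM _ hx⟩

/-- The elastic energy, as a real number. -/
noncomputable def elR (h : ℝ → ℝ) (μ κ : ℝ) (u : H1v Ω) (z : H1 Ω) : ℝ :=
  1 / 2 * ∫ x in Ω, dens μ κ (h (toLp z x)) (shDL Ω u x) (shOL Ω u x) (dvL Ω u x)

/-- The dissipation potential, as a real number. -/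
noncomputable def diR (f : ℝ → ℝ) (z : H1 Ω) : ℝ :=
  1 / 2 * (‖pd 0 z‖ ^ 2 + ‖pd 1 z‖ ^ 2 + ∫ x in Ω, f (toLp z x))

theorem density_ae (h : ℝ → ℝ) (μ κ : ℝ) (u : H1v Ω) (z : H1 Ω) :
    (fun x => density h μ κ (toLp z x) (strain u x)) =ᵐ[volume.restrict Ω]
      fun x => dens μ κ (h (toLp z x)) (shDL Ω u x) (shOL Ω u x) (dvL Ω u x) := by
  filter_upwards [shDL_ae u, shOL_ae u, dvL_ae u] with x h1 h2 h3
  rw [density_strain, h1, h2, h3]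

theorem ofReal_half_mul {a : ℝ} : ENNReal.ofReal (1 / 2 * a) = 1 / 2 * ENNReal.ofReal a := by
  rw [ENNReal.ofReal_mul (by norm_num), ENNReal.ofReal_div_of_pos (by norm_num)]
  simp

theorem elastic_eq {h : ℝ → ℝ} (hc : Continuous h) (h0 : ∀ s, 0 ≤ h s) {μ κ : ℝ} (hμ : 0 ≤ μ)
    (hκ : 0 ≤ κ) (u : H1v Ω) {z : H1 Ω} (hz : IsBdd z) :
    elastic h μ κ u z = ENNReal.ofReal (elR h μ κ u z) := by
  obtain ⟨M, -, hM⟩ := exists_bound_Icc hc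
  have hi := integrable_dens hμ hκ (aestronglyMeasurable_comp_toLp hc z) (ae_mem_Icc_comp h0 hM hz)
    (shDL Ω u) (shOL Ω u) (dvL Ω u)
  rw [elR, ofReal_half_mul, elastic, ofReal_integral_eq_lintegral_ofReal hi
    (Eventually.of_forall fun x => dens_nonneg hμ hκ (h0 _))]
  congr 1
  exact lintegral_congr_ae ((density_ae h μ κ u z).mono fun x hx => by simp only [hx])

theorem integrable_comp_toLp [IsFiniteMeasure (volume.restrict Ω)] {f : ℝ → ℝ} (hc : Continuous f)
    (f0 : ∀ s, 0 ≤ f s) {z : H1 Ω} (hz : IsBdd z) :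
    Integrable (fun x => f (toLp z x)) (volume.restrict Ω) := by
  obtain ⟨M, -, hM⟩ := exists_bound_Icc hc
  refine (integrable_const M).mono' (aestronglyMeasurable_comp_toLp hc z)
    ((ae_mem_Icc_comp f0 hM hz).mono fun x hx => ?_)
  rw [Real.norm_of_nonneg hx.1]
  exact hx.2

theorem dissipation_eq [IsFiniteMeasure (volume.restrict Ω)] {f : ℝ → ℝ} (hc : Continuous f)
    (f0 : ∀ s, 0 ≤ f s) {z : H1 Ω} (hz : IsBdd z) :
    dissipation f z = ENNReal.ofReal (diR f z) := by
  have i0 := (Lp.memLp (pd 0 z)).integrable_sq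
  have i1 := (Lp.memLp (pd 1 z)).integrable_sq
  have i2 := integrable_comp_toLp hc f0 hz
  have e : ‖pd 0 z‖ ^ 2 + ‖pd 1 z‖ ^ 2 + ∫ x in Ω, f (toLp z x) =
      ∫ x in Ω, ((∑ j, pd j z x ^ 2) + f (toLp z x)) := by
    rw [norm_sq_lp, norm_sq_lp, ← integral_add' i0 i1, ← integral_add' (i0.add i1) i2]
    simp only [Fin.sum_univ_two]
    rfl
  rw [diR, e, ofReal_half_mul, dissipation, ofReal_integral_eq_lintegral_ofReal]
  · simp only [Fin.sum_univ_two]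
    exact (i0.add i1).add i2
  · exact Eventually.of_forall fun x => add_nonneg (Finset.sum_nonneg fun _ _ => sq_nonneg _) (f0 _)

theorem elR_nonneg {h : ℝ → ℝ} (h0 : ∀ s, 0 ≤ h s) {μ κ : ℝ} (hμ : 0 ≤ μ) (hκ : 0 ≤ κ) (u : H1v Ω)
    (z : H1 Ω) : 0 ≤ elR h μ κ u z :=
  mul_nonneg (by norm_num) (integral_nonneg fun _ => dens_nonneg hμ hκ (h0 _))

theorem diR_nonneg {f : ℝ → ℝ} (f0 : ∀ s, 0 ≤ f s) (z : H1 Ω) : 0 ≤ diR f z :=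
  mul_nonneg (by norm_num) (add_nonneg (by positivity) (integral_nonneg fun _ => f0 _))

theorem energy_eq [IsFiniteMeasure (volume.restrict Ω)] {h f : ℝ → ℝ} (hc : Continuous h)
    (h0 : ∀ s, 0 ≤ h s) {μ κ : ℝ} (hμ : 0 ≤ μ) (hκ : 0 ≤ κ) (fc : Continuous f)
    (f0 : ∀ s, 0 ≤ f s) (u : H1v Ω) {z : H1 Ω} (hz : IsBdd z) :
    energy h f μ κ u z = ENNReal.ofReal (elR h μ κ u z + diR f z) := by
  rw [energy, elastic_eq hc h0 hμ hκ u hz, dissipation_eq fc f0 hz,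
    ENNReal.ofReal_add (elR_nonneg h0 hμ hκ u z) (diR_nonneg f0 z)]

/-! ### Admissible phase fields -/

/-- The phase fields with values in `[-1, 1]` that lie below `z₀`. -/
def admissible (z₀ : H1 Ω) : Set (H1 Ω) :=
  {z | IsBdd z ∧ ∀ᵐ x ∂(volume.restrict Ω), toLp z x ≤ toLp z₀ x}

theorem toLp_mid_ae (z z' : H1 Ω) : ∀ᵐ x ∂(volume.restrict Ω),
    toLp ((2⁻¹ : ℝ) • (z + z')) x = (toLp z x + toLp z' x) / 2 := by
  filter_upwards [Lp.coeFn_smul (2⁻¹ : ℝ) (toLp z + toLp z'), Lp.coeFn_add (toLp z) (toLp z')]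
    with x h1 h2
  rw [toLp_smul, toLp_add, h1, Pi.smul_apply, h2, Pi.add_apply, smul_eq_mul]
  ring

theorem mid_mem_admissible (z₀ : H1 Ω) : ∀ z ∈ admissible z₀, ∀ z' ∈ admissible z₀,
    (2⁻¹ : ℝ) • (z + z') ∈ admissible z₀ := by
  rintro z ⟨h1, h2⟩ z' ⟨h3, h4⟩
  constructor
  · filter_upwards [toLp_mid_ae z z', h1, h3] with x hx h1 h3
    rw [hx]
    constructor <;> linarith [h1.1, h1.2, h3.1, h3.2]
  · filter_upwards [toLp_mid_ae z z', h2, h4] with x hx h2 h4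
    rw [hx]
    linarith

theorem half_add_of_convexOn {h : ℝ → ℝ} (hconv : ConvexOn ℝ Set.univ h) (s t : ℝ) :
    h ((s + t) / 2) ≤ (h s + h t) / 2 := by
  have := hconv.2 (Set.mem_univ s) (Set.mem_univ t)
    (by norm_num : (0 : ℝ) ≤ 2⁻¹) (by norm_num : (0 : ℝ) ≤ 2⁻¹) (by norm_num)
  simp only [smul_eq_mul] at this
  rw [show (s + t) / 2 = 2⁻¹ * s + 2⁻¹ * t by ring]
  linarith

theorem elR_le_half {h : ℝ → ℝ} (hconv : ConvexOn ℝ Set.univ h) (hc : Continuous h)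
    (h0 : ∀ s, 0 ≤ h s) {μ κ : ℝ} (hμ : 0 ≤ μ) (hκ : 0 ≤ κ) (u : H1v Ω) {z z' m : H1 Ω}
    (hz : IsBdd z) (hz' : IsBdd z') (hm : IsBdd m)
    (hmz : ∀ᵐ x ∂(volume.restrict Ω), toLp m x = (toLp z x + toLp z' x) / 2) :
    elR h μ κ u m ≤ (elR h μ κ u z + elR h μ κ u z') / 2 := by
  obtain ⟨M, -, hM⟩ := exists_bound_Icc hc
  have hi := fun (z : H1 Ω) (hz : IsBdd z) => integrable_dens hμ hκ
    (aestronglyMeasurable_comp_toLp hc z) (ae_mem_Icc_comp h0 hM hz)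
    (shDL Ω u) (shOL Ω u) (dvL Ω u)
  have := integral_mono_ae (hi m hm) (((hi z hz).add (hi z' hz')).div_const 2)
    (hmz.mono fun x hx => dens_le_half hμ hκ (by
      rw [hx]
      exact half_add_of_convexOn hconv _ _))
  rw [integral_div, integral_add' (hi z hz) (hi z' hz')] at this
  unfold elR
  linarith

theorem integral_comp_le_half [IsFiniteMeasure (volume.restrict Ω)] {f : ℝ → ℝ}
    (hconv : ConvexOn ℝ Set.univ f) (fc : Continuous f) (f0 : ∀ s, 0 ≤ f s) {z z' m : H1 Ω}
    (hz : IsBdd z) (hz' : IsBdd z') (hm : IsBdd m)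
    (hmz : ∀ᵐ x ∂(volume.restrict Ω), toLp m x = (toLp z x + toLp z' x) / 2) :
    ∫ x in Ω, f (toLp m x) ≤ ((∫ x in Ω, f (toLp z x)) + ∫ x in Ω, f (toLp z' x)) / 2 := by
  have hi := fun (z : H1 Ω) (hz : IsBdd z) => integrable_comp_toLp fc f0 hz
  have := integral_mono_ae (hi m hm) (((hi z hz).add (hi z' hz')).div_const 2)
    (hmz.mono fun x hx => by
      simp only [hx]
      exact half_add_of_convexOn hconv _ _)
  rwa [integral_div, integral_add' (hi z hz) (hi z' hz')] at this

theorem norm_sq_mid {H : Type*} [NormedAddCommGroup H] [InnerProductSpace ℝ H] (a b : H) :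
    ‖(2⁻¹ : ℝ) • (a + b)‖ ^ 2 = (‖a‖ ^ 2 + ‖b‖ ^ 2) / 2 - ‖a - b‖ ^ 2 / 4 := by
  have := parallelogram_law_with_norm ℝ a b
  rw [norm_smul, mul_pow, Real.norm_of_nonneg (by norm_num)]
  nlinarith

/-- The part of the phase-field functional that does not depend on the displacement. -/
noncomputable def quadR (f : ℝ → ℝ) (c₀ : ℝ) (z₀ z : H1 Ω) : ℝ :=
  diR f z + c₀ * ‖toLp z - toLp z₀‖ ^ 2

/-- The parallelogram identity leaves a quarter of the squared distance: for the gradients, weighted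
by one half, this gives `1 / 8`, and for the viscous term `c₀ / 4`. -/
theorem quadR_mid_le {f : ℝ → ℝ} {c₀ c : ℝ} (hc : c ≤ 1 / 8) (hc₀ : c ≤ c₀ / 4) {z₀ z z' : H1 Ω}
    (h1 : ∫ x in Ω, f (toLp ((2⁻¹ : ℝ) • (z + z')) x) ≤
      ((∫ x in Ω, f (toLp z x)) + ∫ x in Ω, f (toLp z' x)) / 2) :
    quadR f c₀ z₀ ((2⁻¹ : ℝ) • (z + z')) + c * ‖z - z'‖ ^ 2 ≤
      (quadR f c₀ z₀ z + quadR f c₀ z₀ z') / 2 := by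
  have h2 : ∀ j, ‖pd j ((2⁻¹ : ℝ) • (z + z'))‖ ^ 2 =
      (‖pd j z‖ ^ 2 + ‖pd j z'‖ ^ 2) / 2 - ‖pd j (z - z')‖ ^ 2 / 4 := fun j =>
    norm_sq_mid (pd j z) (pd j z')
  have h3 : ‖toLp ((2⁻¹ : ℝ) • (z + z')) - toLp z₀‖ ^ 2 =
      (‖toLp z - toLp z₀‖ ^ 2 + ‖toLp z' - toLp z₀‖ ^ 2) / 2 - ‖toLp (z - z')‖ ^ 2 / 4 := by
    have := norm_sq_mid (toLp z - toLp z₀) (toLp z' - toLp z₀)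
    rw [sub_sub_sub_cancel_right] at this
    rw [toLp_sub, ← this, toLp_smul, toLp_add]
    congr 2
    module
  have h4 := sobolev_norm_sq (z - z')
  have g1 := mul_le_mul_of_nonneg_right hc (sq_nonneg ‖pd 0 (z - z')‖)
  have g2 := mul_le_mul_of_nonneg_right hc (sq_nonneg ‖pd 1 (z - z')‖)
  have g3 := mul_le_mul_of_nonneg_right hc₀ (sq_nonneg ‖toLp (z - z')‖)
  have e1 := h2 0
  have e2 := h2 1
  have e3 := congrArg (c₀ * ·) h3
  have e4 := congrArg (c * ·) h4
  simp only [mul_add, mul_sub, mul_div_assoc'] at e3 e4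
  clear h2 h3 h4
  unfold quadR diR
  linarith

theorem quadR_nonneg {f : ℝ → ℝ} (f0 : ∀ s, 0 ≤ f s) {c₀ : ℝ} (hc₀ : 0 ≤ c₀) (z₀ z : H1 Ω) :
    0 ≤ quadR f c₀ z₀ z := add_nonneg (diR_nonneg f0 z) (by positivity)

theorem norm_sq_le_quadR [IsFiniteMeasure (volume.restrict Ω)] {f : ℝ → ℝ} (f0 : ∀ s, 0 ≤ f s)
    {c₀ : ℝ} (hc₀ : 0 ≤ c₀) {z₀ z : H1 Ω} (hz : IsBdd z) :
    ‖z‖ ^ 2 ≤ (2 + (volume.restrict Ω).real Set.univ) * (quadR f c₀ z₀ z + 1) := by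
  have h1 : ‖toLp z‖ ^ 2 ≤ (volume.restrict Ω).real Set.univ := by
    rw [norm_sq_lp]
    have := integral_mono_ae (Lp.memLp (toLp z)).integrable_sq
      (integrable_const (1 : ℝ)) (hz.mono fun x hx => by
        simp only
        nlinarith [hx.1, hx.2])
    simpa using this
  have h2 : ‖pd 0 z‖ ^ 2 + ‖pd 1 z‖ ^ 2 ≤ 2 * quadR f c₀ z₀ z := by
    have h3 : 0 ≤ ∫ x in Ω, f (toLp z x) := integral_nonneg fun _ => f0 _
    have h4 : 0 ≤ c₀ * ‖toLp z - toLp z₀‖ ^ 2 := by positivity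
    unfold quadR diR
    linarith
  have h5 : 0 ≤ (volume.restrict Ω).real Set.univ * quadR f c₀ z₀ z :=
    mul_nonneg measureReal_nonneg (quadR_nonneg f0 hc₀ z₀ z)
  rw [sobolev_norm_sq]
  linarith

end Energy

/-! ### Auxiliary facts on bounded operators -/

section Operators

variable {X Y : Type*} [NormedAddCommGroup X] [NormedSpace ℝ X] [NormedAddCommGroup Y]
  [NormedSpace ℝ Y]

theorem norm_map_sub_sq_le (T : X →L[ℝ] Y) (u v : X) :
    ‖T (u - v)‖ ^ 2 ≤ 2 * (‖T u‖ ^ 2 + ‖T v‖ ^ 2) := by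
  rw [map_sub]
  have h1 := pow_le_pow_left₀ (norm_nonneg _) (norm_sub_le (T u) (T v)) 2
  nlinarith [sq_nonneg (‖T u‖ - ‖T v‖)]

theorem norm_map_sub_mul_le (T : X →L[ℝ] Y) (u v : X) :
    ‖T u - T v‖ * (‖T u‖ + ‖T v‖) ≤ ‖T‖ ^ 2 * (‖u - v‖ * (‖u‖ + ‖v‖)) := by
  rw [← map_sub]
  have h1 := T.le_opNorm (u - v)
  have h2 := add_le_add (T.le_opNorm u) (T.le_opNorm v)
  refine (mul_le_mul h1 h2 (by positivity) (by positivity)).trans_eq ?_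
  ring

theorem norm_map_sub_le_of_norm_le (T : X →L[ℝ] Y) {u v : X} {R : ℝ} (hu : ‖u‖ ≤ R) :
    ‖T u - T v‖ ≤ ‖T‖ * (R + ‖v‖) := by
  rw [← map_sub]
  refine (T.le_opNorm _).trans (mul_le_mul_of_nonneg_left ?_ (norm_nonneg _))
  exact (norm_sub_le _ _).trans (by linarith)

theorem tendsto_apply_map_sub (T : X →L[ℝ] Y) {u : ℕ → X} {v : X}
    (hu : ∀ ψ : X →L[ℝ] ℝ, Tendsto (fun n => ψ (u n)) atTop (𝓝 (ψ v))) (ψ : Y →L[ℝ] ℝ) :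
    Tendsto (fun n => ψ (T (u n) - T v)) atTop (𝓝 0) := by
  have := (hu (ψ ∘L T)).sub_const (ψ (T v))
  simpa using this

theorem map_sub_map_mid (T : X →L[ℝ] Y) (u v : X) :
    T u - T ((2⁻¹ : ℝ) • (u + v)) = T ((2⁻¹ : ℝ) • (u - v)) := by
  rw [← map_sub]
  congr 1
  module

theorem map_sub_map_mid' (T : X →L[ℝ] Y) (u v : X) :
    T v - T ((2⁻¹ : ℝ) • (u + v)) = -T ((2⁻¹ : ℝ) • (u - v)) := by
  rw [← map_sub, ← map_neg]
  congr 1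
  module

theorem norm_sub_sq_eq_mid (u v : X) : ‖u - v‖ ^ 2 = 4 * ‖(2⁻¹ : ℝ) • (u - v)‖ ^ 2 := by
  rw [norm_smul, mul_pow, Real.norm_of_nonneg (by norm_num)]
  ring

theorem norm_le_sqrt_add {X : Type*} [NormedAddCommGroup X] {u v : X} {a : ℝ} (h : ‖u - v‖ ^ 2 ≤ a) : ‖u‖ ≤ Real.sqrt a + ‖v‖ := by
  have h5 := Real.le_sqrt_of_sq_le h
  have h6 := norm_le_norm_sub_add u v
  linarith

theorem norm_sq_add_lp {α : Type*} [MeasurableSpace α] {ν : Measure α} (p q t : Lp ℝ 2 ν) :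
    ‖p‖ ^ 2 + ‖q‖ ^ 2 + ‖t‖ ^ 2 = ∫ x, (p x ^ 2 + q x ^ 2 + t x ^ 2) ∂ν := by
  rw [norm_sq_lp, norm_sq_lp, norm_sq_lp, ← integral_add'
    (Lp.memLp _).integrable_sq (Lp.memLp _).integrable_sq, ← integral_add'
    ((Lp.memLp _).integrable_sq.add (Lp.memLp _).integrable_sq) (Lp.memLp _).integrable_sq]
  rfl

theorem integral_mul_neg_lp {α : Type*} [MeasurableSpace α] {ν : Measure α} (b : α → ℝ)
    (f : Lp ℝ 2 ν) : ∫ x, b x * (-f) x ∂ν = - ∫ x, b x * f x ∂ν := by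
  rw [← integral_neg]
  refine integral_congr_ae ?_
  filter_upwards [Lp.coeFn_neg f] with x hx
  rw [hx, Pi.neg_apply, mul_neg]

/-- Uniform midpoint convexity of the elastic energy in the strain. -/
theorem integral_dens_mid_le {α : Type*} [MeasurableSpace α] {ν : Measure α} {μ κ M a₀ c : ℝ}
    (hμ : 2 * c ≤ a₀ * μ) (hκ : 2 * c ≤ a₀ * κ) (hκ' : 2 * c ≤ κ) (hμ0 : 0 ≤ μ) (hκ0 : 0 ≤ κ)
    {a : α → ℝ} (ha : AEStronglyMeasurable a ν) (ha₀ : ∀ᵐ x ∂ν, a₀ ≤ a x)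
    (hM : ∀ᵐ x ∂ν, a x ∈ Set.Icc 0 M) {p q t p₁ q₁ t₁ p₂ q₂ t₂ p' q' t' : Lp ℝ 2 ν}
    (hp : p₁ - p = p') (hp' : p₂ - p = -p') (hq : q₁ - q = q') (hq' : q₂ - q = -q')
    (ht : t₁ - t = t') (ht' : t₂ - t = -t') :
    (∫ x, dens μ κ (a x) (p x) (q x) (t x) ∂ν) + c * (‖p'‖ ^ 2 + ‖q'‖ ^ 2 + ‖t'‖ ^ 2) ≤
      ((∫ x, dens μ κ (a x) (p₁ x) (q₁ x) (t₁ x) ∂ν) +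
        ∫ x, dens μ κ (a x) (p₂ x) (q₂ x) (t₂ x) ∂ν) / 2 := by
  have k1 := integral_dens_lower hμ hκ hκ' hμ0 hκ0 ha ha₀ hM p q t p₁ q₁ t₁
  have k2 := integral_dens_lower hμ hκ hκ' hμ0 hκ0 ha ha₀ hM p q t p₂ q₂ t₂
  rw [hp, hq, ht] at k1
  rw [hp', hq', ht', integral_mul_neg_lp, integral_mul_neg_lp, integral_mul_neg_lp,
    integral_mul_neg_lp, norm_neg, norm_neg, norm_neg] at k2
  linarith

end Operators

/-! ### The elastic energy as a function of the displacement -/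

section Displacement

variable {X : Type*} [NormedAddCommGroup X] [NormedSpace ℝ X] {α : Type*} [MeasurableSpace α]
  {ν : Measure α} {μ κ M a₀ c : ℝ} (P Q S : X →L[ℝ] Lp ℝ 2 ν)

theorem abs_half_integral_dens_sub_le (hμ : 0 ≤ μ) (hκ : 0 ≤ κ) (hM0 : 0 ≤ M) {a : α → ℝ}
    (ha : AEStronglyMeasurable a ν) (hM : ∀ᵐ x ∂ν, a x ∈ Set.Icc 0 M) (u v : X) :
    |(1 / 2 * ∫ x, dens μ κ (a x) (P u x) (Q u x) (S u x) ∂ν) -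
        1 / 2 * ∫ x, dens μ κ (a x) (P v x) (Q v x) (S v x) ∂ν| ≤
      (M + 1) * (μ + κ) / 2 * (‖P‖ ^ 2 + ‖Q‖ ^ 2 + ‖S‖ ^ 2) * ‖u - v‖ * (‖u‖ + ‖v‖) := by
  have h1 := abs_integral_dens_sub_le hμ hκ hM0 ha hM (P u) (Q u) (S u) (P v) (Q v) (S v)
  have k1 := norm_map_sub_mul_le P u v
  have k2 := norm_map_sub_mul_le Q u v
  have k3 := norm_map_sub_mul_le S u v
  have k4 := h1.trans (mul_le_mul_of_nonneg_left (add_le_add (add_le_add k1 k2) k3)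
    (show 0 ≤ (M + 1) * (μ + κ) by positivity))
  rw [← mul_sub, abs_mul, abs_of_pos (by norm_num)]
  linarith

/-- The density is expanded at the limit `u'` by `integral_dens_lower`. The linear terms form the
error `r`, null by weak convergence, and the quadratic term becomes the `H¹` distance through Korn's
inequality, hence the constant `c / (2 Ck)`. -/
theorem exists_half_integral_dens_lsc {Ck : ℝ} (hCk : 0 < Ck) (hμ : 2 * c ≤ a₀ * μ)
    (hκ : 2 * c ≤ a₀ * κ) (hκ' : 2 * c ≤ κ) (hc0 : 0 < c) (hμ0 : 0 ≤ μ) (hκ0 : 0 ≤ κ)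
    {a : ℕ → α → ℝ} {a' : α → ℝ} (ha : ∀ n, AEStronglyMeasurable (a n) ν)
    (ha₀ : ∀ n, ∀ᵐ x ∂ν, a₀ ≤ a n x) (hM : ∀ n, ∀ᵐ x ∂ν, a n x ∈ Set.Icc 0 M)
    (hl : ∀ᵐ x ∂ν, Tendsto (fun n => a n x) atTop (𝓝 (a' x)))
    {u : ℕ → X} {u' : X} {R : ℝ} (hR : ∀ n, ‖u n‖ ≤ R)
    (hkorn : ∀ n, ‖u n - u'‖ ^ 2 ≤
      Ck * (‖P (u n - u')‖ ^ 2 + ‖Q (u n - u')‖ ^ 2 + ‖S (u n - u')‖ ^ 2))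
    (hu : ∀ ψ : X →L[ℝ] ℝ, Tendsto (fun n => ψ (u n)) atTop (𝓝 (ψ u'))) :
    ∃ r : ℕ → ℝ, Tendsto r atTop (𝓝 0) ∧ ∀ n,
      (1 / 2 * ∫ x, dens μ κ (a n x) (P u' x) (Q u' x) (S u' x) ∂ν) +
          c / (2 * Ck) * ‖u n - u'‖ ^ 2 + r n ≤
        1 / 2 * ∫ x, dens μ κ (a n x) (P (u n) x) (Q (u n) x) (S (u n) x) ∂ν := by
  have l1 := tendsto_integral_bdd_mul_weakly_null ha hM hl
    ((Lp.memLp (P u')).const_mul μ) (fun n => norm_map_sub_le_of_norm_le P (hR n))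
    (tendsto_apply_map_sub P hu)
  have l2 := tendsto_integral_bdd_mul_weakly_null ha hM hl
    ((Lp.memLp (Q u')).const_mul μ) (fun n => norm_map_sub_le_of_norm_le Q (hR n))
    (tendsto_apply_map_sub Q hu)
  have l3 := tendsto_integral_bdd_mul_weakly_null ha hM hl
    ((memLp_max (S u')).const_mul κ) (fun n => norm_map_sub_le_of_norm_le S (hR n))
    (tendsto_apply_map_sub S hu)
  have l4 : Tendsto (fun n => ∫ x, κ * max (-S u' x) 0 * (S (u n) - S u') x ∂ν)
      atTop (𝓝 0) := by
    have m := (memLp_max_neg (S u')).const_mul κ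
    refine (tendsto_apply_map_sub S hu (innerSL ℝ (m.toLp _))).congr fun n => ?_
    rw [integral_mul_eq_inner m, innerSL_apply_apply]
  have l5 := (((l1.add l2).add l3).sub l4).const_mul (1 / 2)
  rw [add_zero, add_zero, sub_zero, mul_zero] at l5
  refine ⟨_, l5, fun n => ?_⟩
  have h1 := integral_dens_lower hμ hκ hκ' hμ0 hκ0 (ha n) (ha₀ n)
    (hM n) (P u') (Q u') (S u') (P (u n)) (Q (u n)) (S (u n))
  have h2 := mul_le_mul_of_nonneg_left (hkorn n) (show 0 ≤ c / (2 * Ck) by positivity)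
  have h3 : c / (2 * Ck) * (Ck * (‖P (u n - u')‖ ^ 2 + ‖Q (u n - u')‖ ^ 2 + ‖S (u n - u')‖ ^ 2)) =
      1 / 2 * (c * (‖P (u n - u')‖ ^ 2 + ‖Q (u n - u')‖ ^ 2 + ‖S (u n - u')‖ ^ 2)) := by
    field_simp
  rw [h3, map_sub, map_sub, map_sub] at h2
  linarith

/-- Both endpoints are compared with the midpoint, where the linear terms cancel. The distance to
the midpoint is half of `‖u - v‖`, which divides the constant `c / (2 Ck)` by four. -/
theorem half_integral_dens_mid_le {Ck : ℝ} (hCk : 0 < Ck) (hμ : 2 * c ≤ a₀ * μ)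
    (hκ : 2 * c ≤ a₀ * κ) (hκ' : 2 * c ≤ κ) (hc0 : 0 < c) (hμ0 : 0 ≤ μ) (hκ0 : 0 ≤ κ)
    {a : α → ℝ} (ha : AEStronglyMeasurable a ν) (ha₀ : ∀ᵐ x ∂ν, a₀ ≤ a x)
    (hM : ∀ᵐ x ∂ν, a x ∈ Set.Icc 0 M) {u v : X}
    (hkorn : ‖(2⁻¹ : ℝ) • (u - v)‖ ^ 2 ≤ Ck * (‖P ((2⁻¹ : ℝ) • (u - v))‖ ^ 2 +
      ‖Q ((2⁻¹ : ℝ) • (u - v))‖ ^ 2 + ‖S ((2⁻¹ : ℝ) • (u - v))‖ ^ 2)) :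
    (1 / 2 * ∫ x, dens μ κ (a x) (P ((2⁻¹ : ℝ) • (u + v)) x) (Q ((2⁻¹ : ℝ) • (u + v)) x)
        (S ((2⁻¹ : ℝ) • (u + v)) x) ∂ν) + c / (8 * Ck) * ‖u - v‖ ^ 2 ≤
      ((1 / 2 * ∫ x, dens μ κ (a x) (P u x) (Q u x) (S u x) ∂ν) +
        1 / 2 * ∫ x, dens μ κ (a x) (P v x) (Q v x) (S v x) ∂ν) / 2 := by
  have k := integral_dens_mid_le hμ hκ hκ' hμ0 hκ0 ha ha₀ hM
    (map_sub_map_mid P u v) (map_sub_map_mid' P u v) (map_sub_map_mid Q u v)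
    (map_sub_map_mid' Q u v) (map_sub_map_mid S u v) (map_sub_map_mid' S u v)
  have h2 := mul_le_mul_of_nonneg_left hkorn (show 0 ≤ c / (2 * Ck) by positivity)
  generalize ‖P ((2⁻¹ : ℝ) • (u - v))‖ ^ 2 + ‖Q ((2⁻¹ : ℝ) • (u - v))‖ ^ 2 +
    ‖S ((2⁻¹ : ℝ) • (u - v))‖ ^ 2 = N at k h2
  have h3 := norm_sub_sq_eq_mid u v
  have h4 : c / (2 * Ck) * (Ck * N) = 1 / 2 * (c * N) := by field_simp
  have h5 : c / (8 * Ck) = c / (2 * Ck) / 4 := by field_simp; norm_num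
  rw [h4] at h2
  rw [h5, h3]
  linarith

end Displacement

/-! ### Coercivity, continuity and lower semicontinuity of the energy -/

section Coercive

variable {Ω : Set R2} {h : ℝ → ℝ} {μ κ M c : ℝ}

/-- The squared norm of the strain components. -/
noncomputable def strainSq (u : H1v Ω) : ℝ :=
  ‖shDL Ω u‖ ^ 2 + ‖shOL Ω u‖ ^ 2 + ‖dvL Ω u‖ ^ 2

theorem strainSq_nonneg (u : H1v Ω) : 0 ≤ strainSq u := by
  unfold strainSq
  positivity

theorem strainSq_eq (u : H1v Ω) :
    strainSq u = ∫ x in Ω, (shDL Ω u x ^ 2 + shOL Ω u x ^ 2 + dvL Ω u x ^ 2) :=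
  norm_sq_add_lp _ _ _

theorem strainSq_sub_le (u v : H1v Ω) : strainSq (u - v) ≤ 2 * (strainSq u + strainSq v) := by
  have h1 := norm_map_sub_sq_le (shDL Ω) u v
  have h2 := norm_map_sub_sq_le (shOL Ω) u v
  have h3 := norm_map_sub_sq_le (dvL Ω) u v
  unfold strainSq
  linarith

theorem strainSq_le_elR (hc : Continuous h) (h0 : ∀ s, 0 ≤ h s) {a : ℝ} (ha : ∀ s, a ≤ h s)
    (hμ : 2 * c ≤ a * μ) (hκ : 2 * c ≤ a * κ) (hκ' : 2 * c ≤ κ) (hμ0 : 0 ≤ μ) (hκ0 : 0 ≤ κ)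
    (u : H1v Ω) {z : H1 Ω} (hz : IsBdd z) : c * strainSq u ≤ 2 * elR h μ κ u z := by
  obtain ⟨M, -, hM⟩ := exists_bound_Icc hc
  have hi := integrable_dens hμ0 hκ0 (aestronglyMeasurable_comp_toLp hc z)
    (ae_mem_Icc_comp h0 hM hz) (shDL Ω u) (shOL Ω u) (dvL Ω u)
  have := integral_mono ((integrable_sq_sum (shDL Ω u) (shOL Ω u) (dvL Ω u)).const_mul c) hi
    (fun x => by
      have := dens_lower (p := 0) (q := 0) (t := 0) (p' := shDL Ω u x) (q' := shOL Ω u x)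
        (t' := dvL Ω u x) (ha (toLp z x)) hμ hκ hκ' hμ0 hκ0
      simpa [dens_zero] using this)
  rw [integral_const_mul, ← strainSq_eq] at this
  unfold elR
  linarith

theorem elR_le_strainSq (hc : Continuous h) (h0 : ∀ s, 0 ≤ h s)
    (hM : ∀ s ∈ Set.Icc (-1 : ℝ) 1, h s ≤ M) (hμ0 : 0 ≤ μ) (hκ0 : 0 ≤ κ)
    (u : H1v Ω) {z : H1 Ω} (hz : IsBdd z) :
    2 * elR h μ κ u z ≤ (M + 1) * (μ + κ) * strainSq u := by
  have hi := integrable_dens hμ0 hκ0 (aestronglyMeasurable_comp_toLp hc z)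
    (ae_mem_Icc_comp h0 hM hz) (shDL Ω u) (shOL Ω u) (dvL Ω u)
  have := integral_mono_ae hi ((integrable_sq_sum (shDL Ω u) (shOL Ω u) (dvL Ω u)).const_mul
    ((M + 1) * (μ + κ))) ((ae_mem_Icc_comp h0 hM hz).mono fun x hx =>
      (le_abs_self _).trans (abs_dens_le hμ0 hκ0 hx))
  rw [integral_const_mul, ← strainSq_eq] at this
  unfold elR
  linarith

theorem exists_elR_lipschitz (Ω : Set R2) (hc : Continuous h) (h0 : ∀ s, 0 ≤ h s) (hμ0 : 0 ≤ μ)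
    (hκ0 : 0 ≤ κ) : ∃ C, 0 ≤ C ∧ ∀ u v : H1v Ω, ∀ z : H1 Ω, IsBdd z →
      |elR h μ κ u z - elR h μ κ v z| ≤ C * ‖u - v‖ * (‖u‖ + ‖v‖) := by
  obtain ⟨M, hM0, hM⟩ := exists_bound_Icc hc
  refine ⟨(M + 1) * (μ + κ) / 2 * (‖shDL Ω‖ ^ 2 + ‖shOL Ω‖ ^ 2 + ‖dvL Ω‖ ^ 2), by positivity,
    fun u v z hz => ?_⟩
  exact abs_half_integral_dens_sub_le (shDL Ω) (shOL Ω) (dvL Ω) hμ0 hκ0 hM0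
    (aestronglyMeasurable_comp_toLp hc z) (ae_mem_Icc_comp h0 hM hz) u v

/-- The energy of the lift `G` is bounded independently of the phase field, so it bounds the strain
of `u`; Korn's inequality is then applied to `u - G`. -/
theorem exists_norm_bound_of_korn {V : Submodule ℝ (H1v Ω)} {Ck : ℝ} (hCk : 0 ≤ Ck)
    (hkorn : ∀ w ∈ V, ‖w‖ ^ 2 ≤ Ck * strainSq w) (hc : Continuous h) (h0 : ∀ s, 0 ≤ h s) {a : ℝ}
    (ha : ∀ s, a ≤ h s) (hc0 : 0 < c) (hμ : 2 * c ≤ a * μ) (hκ : 2 * c ≤ a * κ) (hκ' : 2 * c ≤ κ)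
    (hμ0 : 0 ≤ μ) (hκ0 : 0 ≤ κ) (G : H1v Ω) :
    ∃ R, ∀ u : H1v Ω, ∀ z : H1 Ω, IsBdd z → u - G ∈ V → elR h μ κ u z ≤ elR h μ κ G z →
      ‖u‖ ≤ R := by
  obtain ⟨M, hM0, hM⟩ := exists_bound_Icc hc
  set B := (M + 1) * (μ + κ) * strainSq G / c with hB
  refine ⟨Real.sqrt (Ck * (2 * (B + strainSq G))) + ‖G‖, fun u z hz hu hE => ?_⟩
  have h1 := strainSq_le_elR hc h0 ha hμ hκ hκ' hμ0 hκ0 u hz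
  have h2 := elR_le_strainSq hc h0 hM hμ0 hκ0 G hz
  have h3 : strainSq u ≤ B := by
    rw [hB, le_div_iff₀ hc0]
    linarith
  have h4 : strainSq (u - G) ≤ 2 * (B + strainSq G) :=
    (strainSq_sub_le u G).trans (by linarith)
  exact norm_le_sqrt_add ((hkorn _ hu).trans (mul_le_mul_of_nonneg_left h4 hCk))

theorem elR_lsc {V : Submodule ℝ (H1v Ω)} {Ck : ℝ} (hCk : 0 < Ck)
    (hkorn : ∀ w ∈ V, ‖w‖ ^ 2 ≤ Ck * strainSq w) (hc : Continuous h) (h0 : ∀ s, 0 ≤ h s) {a : ℝ}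
    (ha : ∀ s, a ≤ h s) (hc0 : 0 < c) (hμ : 2 * c ≤ a * μ) (hκ : 2 * c ≤ a * κ) (hκ' : 2 * c ≤ κ)
    (hμ0 : 0 ≤ μ) (hκ0 : 0 ≤ κ) {z : ℕ → H1 Ω} {z' : H1 Ω} (hz : ∀ n, IsBdd (z n))
    (hzl : ∀ᵐ x ∂(volume.restrict Ω), Tendsto (fun n => toLp (z n) x) atTop (𝓝 (toLp z' x)))
    {u : ℕ → H1v Ω} {u' : H1v Ω} {R : ℝ} (huV : ∀ n, u n - u' ∈ V) (hR : ∀ n, ‖u n‖ ≤ R)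
    (hu : ∀ ψ : H1v Ω →L[ℝ] ℝ, Tendsto (fun n => ψ (u n)) atTop (𝓝 (ψ u'))) :
    ∃ r : ℕ → ℝ, Tendsto r atTop (𝓝 0) ∧ ∀ n,
      elR h μ κ u' (z n) + c / (2 * Ck) * ‖u n - u'‖ ^ 2 + r n ≤ elR h μ κ (u n) (z n) := by
  obtain ⟨M, hM0, hM⟩ := exists_bound_Icc hc
  exact exists_half_integral_dens_lsc (shDL Ω) (shOL Ω) (dvL Ω) hCk hμ hκ hκ' hc0 hμ0 hκ0
    (fun n => aestronglyMeasurable_comp_toLp hc (z n))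
    (fun n => Eventually.of_forall fun x => ha _) (fun n => ae_mem_Icc_comp h0 hM (hz n))
    (hzl.mono fun x hx => (hc.tendsto _).comp hx) hR (fun n => hkorn _ (huV n)) hu

theorem elR_mid_u {V : Submodule ℝ (H1v Ω)} {Ck : ℝ} (hCk : 0 < Ck)
    (hkorn : ∀ w ∈ V, ‖w‖ ^ 2 ≤ Ck * strainSq w) (hc : Continuous h) (h0 : ∀ s, 0 ≤ h s) {a : ℝ}
    (ha : ∀ s, a ≤ h s) (hc0 : 0 < c) (hμ : 2 * c ≤ a * μ) (hκ : 2 * c ≤ a * κ) (hκ' : 2 * c ≤ κ)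
    (hμ0 : 0 ≤ μ) (hκ0 : 0 ≤ κ) {z : H1 Ω} (hz : IsBdd z) {u v : H1v Ω} (huv : u - v ∈ V) :
    elR h μ κ ((2⁻¹ : ℝ) • (u + v)) z + c / (8 * Ck) * ‖u - v‖ ^ 2 ≤
      (elR h μ κ u z + elR h μ κ v z) / 2 := by
  obtain ⟨M, hM0, hM⟩ := exists_bound_Icc hc
  exact half_integral_dens_mid_le (shDL Ω) (shOL Ω) (dvL Ω) hCk hμ hκ hκ' hc0 hμ0 hκ0
    (aestronglyMeasurable_comp_toLp hc z) (Eventually.of_forall fun x => ha _)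
    (ae_mem_Icc_comp h0 hM hz) (hkorn _ (V.smul_mem (2⁻¹ : ℝ) huv))

/-- The norm terms are continuous; only the integral of `f` asks for a.e. convergence, hence the
subsequence. -/
theorem quadR_continuous_subseq (hΩ : IsOpen Ω) (hb : Bornology.IsBounded Ω)
    [IsFiniteMeasure (volume.restrict Ω)] {f : ℝ → ℝ} (fc : Continuous f) (f0 : ∀ s, 0 ≤ f s)
    (c₀ : ℝ) (z₀ : H1 Ω) {z : ℕ → H1 Ω} {z' : H1 Ω} (hz : ∀ n, IsBdd (z n))
    (hl : Tendsto z atTop (𝓝 z')) :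
    ∃ ns : ℕ → ℕ, StrictMono ns ∧
      Tendsto (fun n => quadR f c₀ z₀ (z (ns n))) atTop (𝓝 (quadR f c₀ z₀ z')) := by
  obtain ⟨B, hB⟩ := hl.norm.bddAbove_range
  obtain ⟨ns, hns, hae⟩ := exists_subseq_ae_of_weakly_convergent hΩ hb (w := z) (w₀ := z') (C := B)
    (fun n => hB ⟨n, rfl⟩) (fun ψ => (ψ.continuous.tendsto _).comp hl)
  refine ⟨ns, hns, ?_⟩
  obtain ⟨M, -, hM⟩ := exists_bound_Icc fc
  have h1 : Tendsto (fun n => ∫ x in Ω, f (toLp (z (ns n)) x)) atTop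
      (𝓝 (∫ x in Ω, f (toLp z' x))) := by
    refine tendsto_integral_of_dominated_convergence (fun _ => M)
      (fun n => aestronglyMeasurable_comp_toLp fc _) (integrable_const M) (fun n => ?_) ?_
    · filter_upwards [ae_mem_Icc_comp f0 hM (hz (ns n))] with x hx
      rw [Real.norm_of_nonneg hx.1]
      exact hx.2
    · exact hae.mono fun x hx => (fc.tendsto _).comp hx
  have hl' := hl.comp hns.tendsto_atTop
  have h2 : ∀ o, Tendsto (fun n => coord o (z (ns n))) atTop (𝓝 (coord o z')) := fun o =>
    ((coord o).continuous.tendsto z').comp hl'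
  have h3 := (((((h2 (some 0)).norm.pow 2).add ((h2 (some 1)).norm.pow 2)).add h1).const_mul
    (1 / 2)).add ((((h2 none).sub_const (toLp z₀)).norm.pow 2).const_mul c₀)
  exact h3

end Coercive

/-! ### A smooth truncation from below -/

section Truncation

/-- The `C¹` truncation with `trunc s = s` for `s ≥ 0` and `trunc s = exp s - 1` for `s ≤ 0`. -/
noncomputable def trunc (s : ℝ) : ℝ := ∫ t in (0 : ℝ)..s, Real.exp (min t 0)

theorem hasDerivAt_trunc (s : ℝ) : HasDerivAt trunc (Real.exp (min s 0)) s := by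
  have hc : Continuous fun t : ℝ => Real.exp (min t 0) := by fun_prop
  exact intervalIntegral.integral_hasDerivAt_right (hc.intervalIntegrable _ _)
    (hc.stronglyMeasurableAtFilter _ _) hc.continuousAt

theorem deriv_trunc : deriv trunc = fun s => Real.exp (min s 0) :=
  funext fun s => (hasDerivAt_trunc s).deriv

theorem contDiff_trunc : ContDiff ℝ 1 trunc := by
  rw [contDiff_one_iff_deriv, deriv_trunc]
  exact ⟨fun s => (hasDerivAt_trunc s).differentiableAt, by fun_prop⟩

theorem abs_deriv_trunc_le (s : ℝ) : |deriv trunc s| ≤ (1 : ℝ≥0) := by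
  rw [deriv_trunc, abs_of_pos (Real.exp_pos _)]
  simp

theorem trunc_of_nonneg {s : ℝ} (hs : 0 ≤ s) : trunc s = s := by
  rw [trunc, intervalIntegral.integral_congr (g := fun _ => (1 : ℝ))]
  · simp
  · intro t ht
    rw [Set.uIcc_of_le hs] at ht
    simp [min_eq_right ht.1]

theorem trunc_of_nonpos {s : ℝ} (hs : s ≤ 0) : trunc s = Real.exp s - 1 := by
  rw [trunc, intervalIntegral.integral_congr (g := Real.exp)]
  · simp
  · intro t ht
    rw [Set.uIcc_of_ge hs] at ht
    simp [min_eq_left ht.2]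

theorem trunc_nonpos {s : ℝ} (hs : s ≤ 0) : trunc s ≤ 0 := by
  rw [trunc_of_nonpos hs]
  have := Real.exp_le_one_iff.2 hs
  linarith

theorem neg_one_le_trunc (s : ℝ) : -1 ≤ trunc s := by
  rcases le_total 0 s with hs | hs
  · rw [trunc_of_nonneg hs]
    linarith
  · rw [trunc_of_nonpos hs]
    linarith [Real.exp_pos s]

theorem lt_trunc {s : ℝ} (hs : s < 0) : s < trunc s := by
  rw [trunc_of_nonpos hs.le]
  linarith [Real.add_one_lt_exp hs.ne]

theorem trunc_le {s a : ℝ} (hsa : s ≤ a) (ha : 0 ≤ a) : trunc s ≤ a := by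
  rcases le_total 0 s with hs | hs
  · rwa [trunc_of_nonneg hs]
  · exact (trunc_nonpos hs).trans ha

theorem ConvexOn.antitone_left {h : ℝ → ℝ} (hconv : ConvexOn ℝ Set.univ h) {m : ℝ}
    (hmin : ∀ s, h m ≤ h s) {a b : ℝ} (hab : a ≤ b) (hbm : b ≤ m) : h b ≤ h a := by
  have := hconv.le_max_of_mem_Icc (Set.mem_univ a) (Set.mem_univ m) ⟨hab, hbm⟩
  rwa [max_eq_left (hmin a)] at this

theorem comp_trunc_le {h : ℝ → ℝ} (hconv : ConvexOn ℝ Set.univ h) {m : ℝ} (hm : 0 ≤ m)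
    (hmin : ∀ s, h m ≤ h s) (s : ℝ) : h (trunc s) ≤ h s := by
  rcases le_or_gt 0 s with hs | hs
  · rw [trunc_of_nonneg hs]
  · exact ConvexOn.antitone_left hconv hmin (lt_trunc hs).le ((trunc_nonpos hs.le).trans hm)

variable {Ω : Set R2}

/-- `trunc` is `C¹` with slope at most 1, so the classical chain rule `exists_comp` applies, without
a chain rule for the positive part, and the gradient does not grow. -/
theorem exists_trunc (hΩ : IsOpen Ω) (z : H1 Ω) : ∃ w : H1 Ω,
    (∀ᵐ x ∂(volume.restrict Ω), toLp w x = trunc (toLp z x)) ∧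
    ∀ᵐ x ∂(volume.restrict Ω), ∑ j, pd j w x ^ 2 ≤ ∑ j, pd j z x ^ 2 := by
  obtain ⟨w, h1, h2⟩ := exists_comp hΩ z contDiff_trunc (trunc_of_nonneg le_rfl) abs_deriv_trunc_le
  refine ⟨w, h1, ?_⟩
  filter_upwards [ae_all_iff.2 h2] with x hx
  refine Finset.sum_le_sum fun j _ => ?_
  rw [hx j, mul_pow]
  have h3 := abs_deriv_trunc_le (toLp z x)
  rw [NNReal.coe_one, ← sq_le_one_iff_abs_le_one] at h3
  exact mul_le_of_le_one_left (sq_nonneg _) h3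

/-- Truncation moves negative values up towards zero, where `h` and `f` are nonincreasing, being
convex with minima at 0 and 1. -/
theorem energy_trunc_le {h f : ℝ → ℝ} (hconv : ConvexOn ℝ Set.univ h) (hmin : ∀ s, h 0 ≤ h s)
    (fconv : ConvexOn ℝ Set.univ f) (fmin : ∀ s, f 1 ≤ f s) {μ κ : ℝ} (hμ : 0 ≤ μ) (hκ : 0 ≤ κ)
    (u : H1v Ω) {z w : H1 Ω} (hw : ∀ᵐ x ∂(volume.restrict Ω), toLp w x = trunc (toLp z x))
    (hw' : ∀ᵐ x ∂(volume.restrict Ω), ∑ j, pd j w x ^ 2 ≤ ∑ j, pd j z x ^ 2) :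
    energy h f μ κ u w ≤ energy h f μ κ u z := by
  refine add_le_add (mul_le_mul_right (lintegral_mono_ae ?_) _)
    (mul_le_mul_right (lintegral_mono_ae ?_) _)
  · filter_upwards [hw] with x hx
    refine ENNReal.ofReal_le_ofReal ?_
    rw [density_strain, density_strain, hx]
    exact dens_mono hμ hκ (comp_trunc_le hconv le_rfl hmin _)
  · filter_upwards [hw, hw'] with x hx hx'
    refine ENNReal.ofReal_le_ofReal (add_le_add hx' ?_)
    rw [hx]
    exact comp_trunc_le fconv zero_le_one fmin _

theorem norm_sub_sq_lp {α : Type*} [MeasurableSpace α] {ν : Measure α} (p q : Lp ℝ 2 ν) :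
    ‖p - q‖ ^ 2 = ∫ x, (p x - q x) ^ 2 ∂ν := by
  rw [norm_sq_lp]
  refine integral_congr_ae ?_
  filter_upwards [Lp.coeFn_sub p q] with x hx
  rw [hx, Pi.sub_apply]

theorem sq_trunc_sub_le {s a : ℝ} (ha : 0 ≤ a) : (trunc s - a) ^ 2 ≤ (s - a) ^ 2 := by
  rcases le_or_gt 0 s with hs | hs
  · rw [trunc_of_nonneg hs]
  · nlinarith [lt_trunc hs, trunc_nonpos hs.le]

theorem norm_trunc_sub_le {z₀ z w : H1 Ω} (hz₀ : ∀ᵐ x ∂(volume.restrict Ω), 0 ≤ toLp z₀ x)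
    (hw : ∀ᵐ x ∂(volume.restrict Ω), toLp w x = trunc (toLp z x)) :
    ‖toLp w - toLp z₀‖ ^ 2 ≤ ‖toLp z - toLp z₀‖ ^ 2 := by
  rw [norm_sub_sq_lp, norm_sub_sq_lp]
  refine integral_mono_ae ((Lp.memLp _).sub (Lp.memLp _)).integrable_sq
    ((Lp.memLp _).sub (Lp.memLp _)).integrable_sq ?_
  filter_upwards [hz₀, hw] with x h0 h1
  simp only [h1]
  exact sq_trunc_sub_le h0

/-- As `z₀ ≥ 0`, truncation brings negative values strictly closer to `z₀`; if the distance does not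
decrease, the set where `z < 0` is null. -/
theorem nonneg_of_norm_sub_le_trunc {z₀ z w : H1 Ω}
    (hz₀ : ∀ᵐ x ∂(volume.restrict Ω), 0 ≤ toLp z₀ x)
    (hw : ∀ᵐ x ∂(volume.restrict Ω), toLp w x = trunc (toLp z x))
    (hle : ‖toLp z - toLp z₀‖ ^ 2 ≤ ‖toLp w - toLp z₀‖ ^ 2) :
    ∀ᵐ x ∂(volume.restrict Ω), 0 ≤ toLp z x := by
  have i1 := ((Lp.memLp (toLp z)).sub (Lp.memLp (toLp z₀))).integrable_sq
  have i2 := ((Lp.memLp (toLp w)).sub (Lp.memLp (toLp z₀))).integrable_sq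
  have hn : 0 ≤ᵐ[volume.restrict Ω] (fun x => (toLp z x - toLp z₀ x) ^ 2 -
      (toLp w x - toLp z₀ x) ^ 2) := by
    filter_upwards [hz₀, hw] with x h0 h1
    rw [h1]
    exact sub_nonneg.2 (sq_trunc_sub_le h0)
  rw [norm_sub_sq_lp, norm_sub_sq_lp] at hle
  have h0 : ∫ x in Ω, ((toLp z x - toLp z₀ x) ^ 2 - (toLp w x - toLp z₀ x) ^ 2) = 0 :=
    le_antisymm ((integral_sub i1 i2).trans_le (sub_nonpos.2 hle)) (integral_nonneg_of_ae hn)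
  rw [integral_eq_zero_iff_of_nonneg_ae hn (i1.sub i2)] at h0
  filter_upwards [h0, hz₀, hw] with x h1 h2 h3
  by_contra! h4
  simp only [Pi.zero_apply, h3] at h1
  nlinarith [lt_trunc h4, trunc_nonpos h4.le]

/-- Every solution of the phase-field step takes its values in `[0, 1]`. -/
theorem mem_Icc_of_mem_argminZ [IsFiniteMeasure (volume.restrict Ω)] (hΩ : IsOpen Ω) {h f : ℝ → ℝ}
    (hc : Continuous h) (hconv : ConvexOn ℝ Set.univ h) (h0 : ∀ s, 0 ≤ h s)
    (hmin : ∀ s, h 0 ≤ h s) (fc : Continuous f)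
    (fconv : ConvexOn ℝ Set.univ f) (f0 : ∀ s, 0 ≤ f s) (fmin : ∀ s, f 1 ≤ f s)
    {μ κ : ℝ} (hμ : 0 ≤ μ) (hκ : 0 ≤ κ) {δ τ : ℝ} (hδ : 0 < δ / (2 * τ)) {z₀ : H1 Ω}
    (hz₀ : ∀ᵐ x ∂(volume.restrict Ω), toLp z₀ x ∈ Set.Icc (0 : ℝ) 1) {u : H1v Ω} {z : H1 Ω}
    (hz : z ∈ argminZ h f μ κ δ τ z₀ u) :
    ∀ᵐ x ∂(volume.restrict Ω), toLp z x ∈ Set.Icc (0 : ℝ) 1 := by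
  have hzm' : ∀ᵐ x ∂(volume.restrict Ω), toLp z x ≤ toLp z₀ x := hz.1
  have hzmin : ∀ y : H1 Ω, (∀ᵐ x ∂(volume.restrict Ω), toLp y x ≤ toLp z₀ x) →
      energy h f μ κ u z + ENNReal.ofReal (δ / (2 * τ) * ‖toLp z - toLp z₀‖ ^ 2) ≤
      energy h f μ κ u y + ENNReal.ofReal (δ / (2 * τ) * ‖toLp y - toLp z₀‖ ^ 2) := hz.2
  have hz₀b : IsBdd z₀ := hz₀.mono fun x hx => ⟨by linarith [hx.1], hx.2⟩
  have hz₀p : ∀ᵐ x ∂(volume.restrict Ω), 0 ≤ toLp z₀ x := hz₀.mono fun x hx => hx.1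
  obtain ⟨w, hw, hw'⟩ := exists_trunc hΩ z
  have hwm : ∀ᵐ x ∂(volume.restrict Ω), toLp w x ≤ toLp z₀ x := by
    filter_upwards [hw, hzm', hz₀p] with x h1 h2 h3
    rw [h1]
    exact trunc_le h2 h3
  -- Energies take values in `[0, ∞]`, so cancelling the energy of `z` below requires finiteness,
  -- obtained by comparison with the bounded competitor `z₀`.
  have hfin : energy h f μ κ u z ≠ ⊤ := by
    have h1 := hzmin z₀ (ae_of_all _ fun x => le_rfl)
    refine ne_top_of_le_ne_top ?_ (le_self_add.trans h1)
    rw [energy_eq hc h0 hμ hκ fc f0 u hz₀b]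
    exact ENNReal.add_ne_top.2 ⟨ENNReal.ofReal_ne_top, ENNReal.ofReal_ne_top⟩
  have h1 := (hzmin w hwm).trans
    (add_le_add_left (energy_trunc_le hconv hmin fconv fmin hμ hκ u hw hw') _)
  rw [ENNReal.add_le_add_iff_left hfin, ENNReal.ofReal_le_ofReal_iff (by positivity)] at h1
  have h2 := nonneg_of_norm_sub_le_trunc hz₀p hw (le_of_mul_le_mul_left h1 hδ)
  filter_upwards [h2, hzm', hz₀] with x a b c
  exact ⟨a, b.trans c.2⟩

end Truncation

/-! ### The two partial minimization problems -/

/-- The standing assumptions on the constitutive functions and moduli. -/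
structure IsEnergyData (h f : ℝ → ℝ) (μ κ : ℝ) : Prop where
  μ_pos : 0 < μ
  κ_pos : 0 < κ
  continuous_h : Continuous h
  convex_h : ConvexOn ℝ Set.univ h
  h_pos : 0 < h 0
  h_min : ∀ s, h 0 ≤ h s
  continuous_f : Continuous f
  convex_f : ConvexOn ℝ Set.univ f
  f_one : 0 ≤ f 1
  f_min : ∀ s, f 1 ≤ f s

section Partial

variable {Ω D : Set R2} {h f : ℝ → ℝ} {μ κ : ℝ}

namespace IsEnergyData

variable (H : IsEnergyData h f μ κ)

include H

theorem h_nonneg (s : ℝ) : 0 ≤ h s := H.h_pos.le.trans (H.h_min s)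

theorem f_nonneg (s : ℝ) : 0 ≤ f s := H.f_one.trans (H.f_min s)

theorem exists_const : ∃ c, 0 < c ∧ 2 * c ≤ h 0 * μ ∧ 2 * c ≤ h 0 * κ ∧ 2 * c ≤ κ := by
  have h1 := mul_pos H.h_pos H.μ_pos
  have h2 := mul_pos H.h_pos H.κ_pos
  have h3 := H.κ_pos
  refine ⟨min (h 0 * μ) (min (h 0 * κ) κ) / 2, by positivity, ?_, ?_, ?_⟩ <;>
    rw [mul_div_cancel₀ _ (two_ne_zero' ℝ)]
  · exact min_le_left _ _
  · exact (min_le_right _ _).trans (min_le_left _ _)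
  · exact (min_le_right _ _).trans (min_le_right _ _)

variable [IsFiniteMeasure (volume.restrict Ω)]

theorem energy_le_iff (u v : H1v Ω) {z : H1 Ω} (hz : IsBdd z) :
    energy h f μ κ u z ≤ energy h f μ κ v z ↔ elR h μ κ u z ≤ elR h μ κ v z := by
  have e := fun u : H1v Ω => energy_eq H.continuous_h H.h_nonneg H.μ_pos.le H.κ_pos.le
    H.continuous_f H.f_nonneg u hz
  rw [e u, e v, ENNReal.ofReal_le_ofReal_iff (add_nonneg
    (elR_nonneg H.h_nonneg H.μ_pos.le H.κ_pos.le _ _) (diR_nonneg H.f_nonneg _)),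
    add_le_add_iff_right]

theorem energy_add_eq {c₀ : ℝ} (hc₀ : 0 ≤ c₀) (u : H1v Ω) (z₀ : H1 Ω) {z : H1 Ω} (hz : IsBdd z) :
    energy h f μ κ u z + ENNReal.ofReal (c₀ * ‖toLp z - toLp z₀‖ ^ 2) =
      ENNReal.ofReal (elR h μ κ u z + quadR f c₀ z₀ z) := by
  rw [energy_eq H.continuous_h H.h_nonneg H.μ_pos.le H.κ_pos.le
    H.continuous_f H.f_nonneg u hz, ← ENNReal.ofReal_add (add_nonneg
    (elR_nonneg H.h_nonneg H.μ_pos.le H.κ_pos.le _ _) (diR_nonneg H.f_nonneg _)) (by positivity),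
    quadR, add_assoc]

theorem mem_argminU_iff {p : ℝ≥0∞} [Fact (1 ≤ p)] {b : Sobolev R2 Ω p} {P : H1v Ω → Prop}
    (hP : ∀ u, EqOnBdry D u b ↔ P u) {z : H1 Ω} (hz : IsBdd z) {u : H1v Ω} :
    u ∈ argminU D h f μ κ b z ↔ P u ∧ ∀ v, P v → elR h μ κ u z ≤ elR h μ κ v z := by
  refine and_congr (hP u) (forall_congr' fun v => imp_congr (hP v) ?_)
  exact H.energy_le_iff u v hz

/-- The constrained problem over all of `H¹` is equivalent to a real-valued problem over bounded
phase fields: minimizers are bounded by `mem_Icc_of_mem_argminZ`, and any competitor can be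
truncated into the admissible set at no cost. The range `[-1, 1]` appears because `trunc` is bounded
below by -1 rather than 0. -/
theorem mem_argminZ_iff (hΩ : IsOpen Ω) {δ τ : ℝ} (hδ : 0 < δ / (2 * τ)) {z₀ : H1 Ω}
    (hz₀ : ∀ᵐ x ∂(volume.restrict Ω), toLp z₀ x ∈ Set.Icc (0 : ℝ) 1) {u : H1v Ω} {z : H1 Ω} :
    z ∈ argminZ h f μ κ δ τ z₀ u ↔ z ∈ admissible z₀ ∧ ∀ y ∈ admissible z₀,
      elR h μ κ u z + quadR f (δ / (2 * τ)) z₀ z ≤ elR h μ κ u y + quadR f (δ / (2 * τ)) z₀ y := by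
  have hle : ∀ {z y : H1 Ω}, IsBdd z → IsBdd y →
      (energy h f μ κ u z + ENNReal.ofReal (δ / (2 * τ) * ‖toLp z - toLp z₀‖ ^ 2) ≤
        energy h f μ κ u y + ENNReal.ofReal (δ / (2 * τ) * ‖toLp y - toLp z₀‖ ^ 2) ↔
      elR h μ κ u z + quadR f (δ / (2 * τ)) z₀ z ≤
        elR h μ κ u y + quadR f (δ / (2 * τ)) z₀ y) := fun hz hy => by
    rw [H.energy_add_eq hδ.le u z₀ hz, H.energy_add_eq hδ.le u z₀ hy,
      ENNReal.ofReal_le_ofReal_iff (add_nonneg (elR_nonneg H.h_nonneg H.μ_pos.le H.κ_pos.le _ _)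
      (quadR_nonneg H.f_nonneg hδ.le _ _))]
  constructor
  · intro hz
    have h1 := mem_Icc_of_mem_argminZ hΩ H.continuous_h H.convex_h H.h_nonneg H.h_min
      H.continuous_f H.convex_f H.f_nonneg H.f_min H.μ_pos.le H.κ_pos.le hδ hz₀ hz
    have hb : IsBdd z := h1.mono fun x hx => ⟨by linarith [hx.1], hx.2⟩
    exact ⟨⟨hb, hz.1⟩, fun y hy => (hle hb hy.1).1 (hz.2 y hy.2)⟩
  · rintro ⟨hz, hmin⟩
    refine ⟨hz.2, fun y hy => ?_⟩
    have hy' : ∀ᵐ x ∂(volume.restrict Ω), toLp y x ≤ toLp z₀ x := hy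
    obtain ⟨w, hw, hw'⟩ := exists_trunc hΩ y
    have hwa : w ∈ admissible z₀ := by
      constructor
      · filter_upwards [hw, hy', hz₀] with x h1 h2 h3
        rw [h1]
        exact ⟨neg_one_le_trunc _, trunc_le (h2.trans h3.2) zero_le_one⟩
      · filter_upwards [hw, hy', hz₀] with x h1 h2 h3
        rw [h1]
        exact trunc_le h2 h3.1
    refine ((hle hz.1 hwa.1).2 (hmin w hwa)).trans (add_le_add
      (energy_trunc_le H.convex_h H.h_min H.convex_f H.f_min H.μ_pos.le H.κ_pos.le u hw hw')
      (ENNReal.ofReal_le_ofReal (mul_le_mul_of_nonneg_left ?_ hδ.le)))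
    exact norm_trunc_sub_le (hz₀.mono fun x hx => hx.1) hw

theorem midpoint_convex_phase {c₀ c : ℝ} (hc : c ≤ 1 / 8) (hc₀ : c ≤ c₀ / 4) {z₀ : H1 Ω}
    (u : H1v Ω) : ∀ z ∈ admissible z₀, ∀ z' ∈ admissible z₀,
      elR h μ κ u ((2⁻¹ : ℝ) • (z + z')) + quadR f c₀ z₀ ((2⁻¹ : ℝ) • (z + z')) +
        c * ‖z - z'‖ ^ 2 ≤
      ((elR h μ κ u z + quadR f c₀ z₀ z) + (elR h μ κ u z' + quadR f c₀ z₀ z')) / 2 := by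
  intro z hz z' hz'
  have hm := (mid_mem_admissible z₀ z hz z' hz').1
  have h1 := elR_le_half H.convex_h H.continuous_h H.h_nonneg H.μ_pos.le H.κ_pos.le u hz.1 hz'.1
    hm (toLp_mid_ae z z')
  have h2 := quadR_mid_le (z₀ := z₀) hc hc₀ (integral_comp_le_half H.convex_f H.continuous_f
    H.f_nonneg hz.1 hz'.1 hm (toLp_mid_ae z z'))
  linarith

end IsEnergyData

theorem admissible_of_ae_tendsto {z₀ z' : H1 Ω} {z : ℕ → H1 Ω} (hz : ∀ n, z n ∈ admissible z₀)
    (hl : ∀ᵐ x ∂(volume.restrict Ω), Tendsto (fun n => toLp (z n) x) atTop (𝓝 (toLp z' x))) :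
    z' ∈ admissible z₀ := by
  constructor
  · filter_upwards [hl, ae_all_iff.2 fun n => (hz n).1] with x h1 h2
    exact isClosed_Icc.mem_of_tendsto h1 (Eventually.of_forall h2)
  · filter_upwards [hl, ae_all_iff.2 fun n => (hz n).2] with x h1 h2
    exact le_of_tendsto h1 (Eventually.of_forall h2)

theorem exists_sobolev_two_of_le {E : Type*} [NormedAddCommGroup E] [NormedSpace ℝ E]
    [IsFiniteMeasure (volume.restrict Ω)] {p : ℝ≥0∞} [Fact (1 ≤ p)] (hp : 2 ≤ p)
    (b : Sobolev E Ω p) :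
    ∃ G : Sobolev E Ω 2, ∀ᵐ x ∂(volume.restrict Ω), toLp G x = toLp b x :=
  ⟨mkSob (toLp b) (fun j => pd j b) ((Lp.memLp _).mono_exponent hp)
    (fun _ => (Lp.memLp _).mono_exponent hp) b.2, toLp_mkSob _ _ _⟩

/-- An `H¹` element is determined by its function a.e., so agreement of the functions in the
boundary condition is agreement in `H¹`. The boundary condition thus becomes membership in an affine
subspace directed by a closed one. -/
theorem eqOnBdry_iff (hΩ : IsOpen Ω) {p : ℝ≥0∞} [Fact (1 ≤ p)] {b : Sobolev R2 Ω p} {G : H1v Ω}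
    (hG : ∀ᵐ x ∂(volume.restrict Ω), toLp G x = toLp b x) (u : H1v Ω) : EqOnBdry D u b ↔
      u - G ∈ (smoothVanishing Ω D).topologicalClosure := by
  have hs : ∀ᵐ x ∂(volume.restrict Ω), toLp (u - G) x = toLp u x - toLp b x := by
    filter_upwards [hG, Lp.coeFn_sub (toLp u) (toLp G)] with x h1 h2
    rw [toLp_sub, h2, Pi.sub_apply, h1]
  constructor
  · rintro ⟨w, hw, hw'⟩
    have h0 : u - G - w = 0 := by
      refine eq_zero_of_toLp_ae_zero hΩ ?_
      filter_upwards [hs, hw', Lp.coeFn_sub (toLp (u - G)) (toLp w)] with x h1 h2 h3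
      rw [toLp_sub, h3, Pi.sub_apply, h1, h2, sub_self]
    rw [sub_eq_zero.1 h0]
    exact hw
  · intro hu
    exact ⟨u - G, hu, hs.mono fun x hx => hx.symm⟩

end Partial

/-! ### Convergence of the alternate minimization -/

section Affine

variable {X : Type*} [AddCommGroup X] [Module ℝ X] {V : Submodule ℝ X} {G x y : X}

theorem mid_sub_mem (hx : x - G ∈ V) (hy : y - G ∈ V) : (2⁻¹ : ℝ) • (x + y) - G ∈ V := by
  have e : (2⁻¹ : ℝ) • (x + y) - G = (2⁻¹ : ℝ) • ((x - G) + (y - G)) := by module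
  rw [e]
  exact V.smul_mem _ (V.add_mem hx hy)

theorem sub_mem_of_sub_mem (hx : x - G ∈ V) (hy : y - G ∈ V) : x - y ∈ V := by
  have := V.sub_mem hx hy
  rwa [sub_sub_sub_cancel_right] at this

end Affine

section Convergence

variable {Ω D : Set R2} {h f : ℝ → ℝ} {μ κ : ℝ}

/-- The displacement problem has a unique solution. -/
theorem IsEnergyData.argminU_eq_singleton [IsFiniteMeasure (volume.restrict Ω)]
    (H : IsEnergyData h f μ κ) {V : Submodule ℝ (H1v Ω)} {Ck : ℝ} (hCk : 0 < Ck)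
    (hkorn : ∀ w ∈ V, ‖w‖ ^ 2 ≤ Ck * strainSq w) {p : ℝ≥0∞} [Fact (1 ≤ p)] {b : Sobolev R2 Ω p}
    {G : H1v Ω} (hG : ∀ u, EqOnBdry D u b ↔ u - G ∈ V) {z : H1 Ω} (hz : IsBdd z) {u : H1v Ω}
    (hu : u - G ∈ V) (hmin : ∀ v, v - G ∈ V → elR h μ κ u z ≤ elR h μ κ v z) :
    argminU D h f μ κ b z = {u} := by
  obtain ⟨c, hc, hc1, hc2, hc3⟩ := H.exists_const
  refine Set.eq_singleton_iff_unique_mem.2 ⟨(H.mem_argminU_iff hG hz).2 ⟨hu, hmin⟩,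
    fun v hv => ?_⟩
  obtain ⟨hv, hvmin⟩ := (H.mem_argminU_iff hG hz).1 hv
  refine eq_of_midpoint (K := {w | w - G ∈ V}) (J := fun w => elR h μ κ w z)
    (c := c / (8 * Ck)) (by positivity) (fun x hx y hy => ?_) (fun x hx y hy => ?_) hu hmin hv
    (hvmin u hu)
  · exact mid_sub_mem hx hy
  · exact elR_mid_u hCk hkorn H.continuous_h H.h_nonneg H.h_min hc hc1 hc2 hc3 H.μ_pos.le
      H.κ_pos.le hz (sub_mem_of_sub_mem hx hy)

/-- The phase-field problem has a unique solution. -/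
theorem IsEnergyData.argminZ_eq_singleton [IsFiniteMeasure (volume.restrict Ω)]
    (H : IsEnergyData h f μ κ) (hΩ : IsOpen Ω) {δ τ : ℝ} (hδ : 0 < δ / (2 * τ)) {z₀ : H1 Ω}
    (hz₀ : ∀ᵐ x ∂(volume.restrict Ω), toLp z₀ x ∈ Set.Icc (0 : ℝ) 1) {u : H1v Ω} {z : H1 Ω}
    (hz : z ∈ argminZ h f μ κ δ τ z₀ u) : argminZ h f μ κ δ τ z₀ u = {z} := by
  refine Set.eq_singleton_iff_unique_mem.2 ⟨hz, fun y hy => ?_⟩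
  rw [H.mem_argminZ_iff hΩ hδ hz₀] at hz hy
  exact eq_of_midpoint (J := fun y => elR h μ κ u y + quadR f (δ / (2 * τ)) z₀ y)
    (c := min (1 / 8) (δ / (2 * τ) / 4)) (by positivity) (mid_mem_admissible z₀)
    (H.midpoint_convex_phase (min_le_left _ _) (min_le_right _ _) u) hz.1 hz.2 hy.1 (hy.2 z hz.1)

theorem IsEnergyData.exists_limit [IsFiniteMeasure (volume.restrict Ω)]
    (H : IsEnergyData h f μ κ) (hΩ : IsOpen Ω) (hb : Bornology.IsBounded Ω)
    {V : Submodule ℝ (H1v Ω)} (hV : IsClosed (V : Set (H1v Ω))) {Ck : ℝ} (hCk : 0 < Ck)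
    (hkorn : ∀ w ∈ V, ‖w‖ ^ 2 ≤ Ck * strainSq w) {G : H1v Ω} {c₀ : ℝ} (hc₀ : 0 < c₀) {z₀ : H1 Ω}
    {u : ℕ → H1v Ω} {z : ℕ → H1 Ω} (hz0 : z 0 ∈ admissible z₀)
    (huV : ∀ j, u (j + 1) - G ∈ V)
    (hu : ∀ j v, v - G ∈ V → elR h μ κ (u (j + 1)) (z j) ≤ elR h μ κ v (z j))
    (hzK : ∀ j, z (j + 1) ∈ admissible z₀)
    (hz : ∀ j, ∀ y ∈ admissible z₀, elR h μ κ (u (j + 1)) (z (j + 1)) +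
      quadR f c₀ z₀ (z (j + 1)) ≤ elR h μ κ (u (j + 1)) y + quadR f c₀ z₀ y) :
    ∃ (u' : H1v Ω) (z' : H1 Ω) (n : ℕ → ℕ), StrictMono n ∧
      Tendsto (fun l => u (n l)) atTop (𝓝 u') ∧ Tendsto (fun l => z (n l)) atTop (𝓝 z') ∧
      u' - G ∈ V ∧ z' ∈ admissible z₀ ∧
      (∀ v, v - G ∈ V → elR h μ κ u' z' ≤ elR h μ κ v z') ∧
      ∀ y ∈ admissible z₀, elR h μ κ u' z' + quadR f c₀ z₀ z' ≤
        elR h μ κ u' y + quadR f c₀ z₀ y := by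
  refine H.exists_const.elim fun c hcs => ?_
  have hc := hcs.1
  have hc1 := hcs.2.1
  have hc2 := hcs.2.2.1
  have hc3 := hcs.2.2.2
  refine (exists_elR_lipschitz Ω H.continuous_h H.h_nonneg H.μ_pos.le H.κ_pos.le).elim
    fun C hlip => ?_
  refine (exists_norm_bound_of_korn hCk.le hkorn H.continuous_h H.h_nonneg H.h_min hc
    hc1 hc2 hc3 H.μ_pos.le H.κ_pos.le G).elim fun R hR => ?_
  refine (exists_bound_Icc H.continuous_h).elim fun M hM => ?_
  refine exists_limit_of_alternate_minimization (X := H1v Ω) (Y := H1 Ω) (V := V)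
    (K := admissible z₀) (E := elR h μ κ) (Q := quadR f c₀ z₀) (G := G) (c := min (1 / 8) (c₀ / 4))
    (c' := c / (2 * Ck)) (C := C) (C' := 2 + (volume.restrict Ω).real Set.univ) (R := R)
    hV (mid_mem_admissible z₀) (by positivity) (by positivity) hlip.1
    (add_nonneg zero_le_two measureReal_nonneg)
    (fun u z _ => elR_nonneg H.h_nonneg H.μ_pos.le H.κ_pos.le u z)
    (fun z _ => quadR_nonneg H.f_nonneg hc₀.le z₀ z) (fun u z hz => hR u z hz.1)
    (fun z hz => norm_sq_le_quadR H.f_nonneg hc₀.le hz.1)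
    (H.midpoint_convex_phase (min_le_left _ _) (min_le_right _ _))
    (fun u v z hz => hlip.2 u v z hz.1) ?_
    (fun z z' hz hl => quadR_continuous_subseq hΩ hb H.continuous_f H.f_nonneg c₀ z₀
      (fun n => (hz n).1) hl) hz0 huV hu hzK hz
  intro z z' B hzK hB hw
  -- One a.e. convergent subsequence serves the constraint, the convergence of the energy at fixed
  -- displacement, and the lower semicontinuity estimate.
  refine (exists_subseq_ae_of_weakly_convergent hΩ hb hB hw).elim fun ns hns => ?_
  have hae := hns.2
  refine ⟨ns, hns.1, admissible_of_ae_tendsto (fun n => hzK (ns n)) hae, fun u => ?_,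
    fun u u' huV hR hu => elR_lsc hCk hkorn H.continuous_h H.h_nonneg H.h_min hc hc1 hc2 hc3
      H.μ_pos.le H.κ_pos.le (fun n => (hzK (ns n)).1) hae huV hR hu⟩
  exact (tendsto_integral_dens H.μ_pos.le H.κ_pos.le
    (fun n => aestronglyMeasurable_comp_toLp H.continuous_h _)
    (fun n => ae_mem_Icc_comp H.h_nonneg hM.2 (hzK (ns n)).1)
    (hae.mono fun x hx => (H.continuous_h.tendsto _).comp hx) _ _ _).const_mul _

end Convergence

end PhaseField

/-! ### The proposition -/

theorem proposition3p1
    (Ω D : Set PhaseField.R2) (hΩo : IsOpen Ω) (hΩb : Bornology.IsBounded Ω)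
    (hΩL : PhaseField.HasLipschitzBoundary Ω)
    (hD : D ⊆ frontier Ω) (hDreg : PhaseField.IsGroegerRegular Ω D)
    -- every connected component of the domain touches the Dirichlet part
    (hDne : ∀ x ∈ Ω, (D ∩ closure (connectedComponentIn Ω x)).Nonempty)
    (μ κ : ℝ) (hμ : 0 < μ) (hκ : 0 < κ)
    (h : ℝ → ℝ) (hreg : PhaseField.IsC11Loc h) (hconv : ConvexOn ℝ Set.univ h)
    (h0 : 0 < h 0) (hmin : ∀ s, h 0 ≤ h s)
    (f : ℝ → ℝ) (freg : PhaseField.IsC11Loc f)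
    (fconv : ∃ m : ℝ, 0 < m ∧ StrongConvexOn Set.univ m f)
    (f1 : 0 ≤ f 1) (fmin : ∀ s, f 1 ≤ f s)
    (T : ℝ) (hT : 0 < T) (p : ℝ≥0∞) [Fact (1 ≤ p)] (hp : 2 < p) (hp' : p < ⊤)
    (g : ℝ → PhaseField.Sobolev PhaseField.R2 Ω p) (hg : PhaseField.IsH1InTime T g)
    (δ : ℝ) (hδ : 0 < δ) (k i : ℕ) (hi : 1 ≤ i) (hik : i ≤ k)
    (τ t : ℝ) (hτ : τ = T / k) (ht : t = i * τ)
    -- the configuration at the previous time node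
    (u₀ : PhaseField.H1v Ω) (z₀ : PhaseField.H1 Ω)
    (hz₀ : ∀ᵐ x ∂(volume.restrict Ω), PhaseField.toLp z₀ x ∈ Set.Icc (0 : ℝ) 1)
    -- the alternate minimization iterates
    (u : ℕ → PhaseField.H1v Ω) (z : ℕ → PhaseField.H1 Ω) (hu0 : u 0 = u₀) (hz0 : z 0 = z₀)
    (hu : ∀ j, u (j + 1) ∈ PhaseField.argminU D h f μ κ (g t) (z j))
    (hz : ∀ j, z (j + 1) ∈ PhaseField.argminZ h f μ κ δ τ z₀ (u (j + 1))) :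
    ∃ (ubar : PhaseField.H1v Ω) (zbar : PhaseField.H1 Ω) (n : ℕ → ℕ),
      (∀ᵐ x ∂(volume.restrict Ω), PhaseField.toLp zbar x ∈ Set.Icc (0 : ℝ) 1) ∧
      StrictMono n ∧
      Tendsto (fun l => u (n l)) atTop (𝓝 ubar) ∧
      (∀ ψ : PhaseField.H1 Ω →L[ℝ] ℝ, Tendsto (fun l => ψ (z (n l))) atTop (𝓝 (ψ zbar))) ∧
      PhaseField.EqOnBdry D ubar (g t) ∧
      PhaseField.argminU D h f μ κ (g t) zbar = {ubar} ∧
      PhaseField.argminZ h f μ κ δ τ z₀ ubar = {zbar} := by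
  have hτ0 : 0 < τ := by
    rw [hτ]
    exact div_pos hT (Nat.cast_pos.2 (hi.trans hik))
  have hδτ : 0 < δ / (2 * τ) := by positivity
  have : IsFiniteMeasure (volume.restrict Ω) :=
    isFiniteMeasure_restrict.2 hΩb.measure_lt_top.ne
  have H : PhaseField.IsEnergyData h f μ κ :=
    ⟨hμ, hκ, hreg.1.continuous, hconv, h0, hmin, freg.1.continuous,
      fconv.elim fun _ hm => (hm.2.strictConvexOn hm.1).convexOn, f1, fmin⟩
  refine (PhaseField.exists_sobolev_two_of_le hp.le (g t)).elim fun G hG => ?_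
  have hGD := PhaseField.eqOnBdry_iff (D := D) hΩo hG
  refine (PhaseField.exists_korn hΩo hΩb hΩL hD hDreg hDne).elim fun C hkorn => ?_
  have hC := hkorn.1
  -- Korn's constant is only known to be nonnegative; `C + 1` is strictly positive and can be
  -- divided by.
  have hkorn' : ∀ w ∈ (PhaseField.smoothVanishing Ω D).topologicalClosure,
      ‖w‖ ^ 2 ≤ (C + 1) * PhaseField.strainSq w := fun w hw =>
    (hkorn.2 w hw).trans (mul_le_mul_of_nonneg_right (by linarith) (PhaseField.strainSq_nonneg w))
  have hz' := fun j => (H.mem_argminZ_iff hΩo hδτ hz₀).1 (hz j)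
  have hz0K : z 0 ∈ PhaseField.admissible z₀ := by
    rw [hz0]
    exact ⟨hz₀.mono fun x hx => ⟨by linarith [hx.1], hx.2⟩, ae_of_all _ fun x => le_rfl⟩
  have hzK : ∀ j, z j ∈ PhaseField.admissible z₀ := fun j => by
    cases j with
    | zero => exact hz0K
    | succ j => exact (hz' j).1
  have hu' := fun j => (H.mem_argminU_iff hGD (hzK j).1).1 (hu j)
  refine (H.exists_limit hΩo hΩb (PhaseField.smoothVanishing Ω D).isClosed_topologicalClosure
      (by linarith : 0 < C + 1) hkorn' hδτ hz0K (fun j => (hu' j).1) (fun j => (hu' j).2)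
      (fun j => (hz' j).1) (fun j => (hz' j).2)).elim fun ubar h1 => h1.elim fun zbar h2 => h2.elim fun n h3 => ?_
  have hn := h3.1
  have hnu := h3.2.1
  have hnz := h3.2.2.1
  have hub := h3.2.2.2.1
  have hzb := h3.2.2.2.2.1
  have humin := h3.2.2.2.2.2.1
  have hzmin := h3.2.2.2.2.2.2
  have hzarg := (H.mem_argminZ_iff hΩo hδτ hz₀).2 ⟨hzb, hzmin⟩
  exact ⟨ubar, zbar, n, PhaseField.mem_Icc_of_mem_argminZ hΩo H.continuous_h H.convex_h H.h_nonneg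
    H.h_min H.continuous_f H.convex_f H.f_nonneg H.f_min H.μ_pos.le H.κ_pos.le hδτ hz₀ hzarg,
    hn, hnu, fun ψ => (ψ.continuous.tendsto _).comp hnz, (hGD ubar).2 hub,
    H.argminU_eq_singleton (by linarith : 0 < C + 1) hkorn' hGD hzb.1 hub humin,
    H.argminZ_eq_singleton hΩo hδτ hz₀ hzarg⟩
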